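/- Let $(B,g_B)$ and $(F,g_F)$ be connected Riemannian manifolds with $m=\dim F\ge 1$. Let $G$ be a Lie group acting smoothly and isometrically on $(F,g_F)$, let $G\to P\to B$ be a smooth principal bundle, and let $M=(P\times F)/G$ be the associated bundle over $B$, with projection $\pi\colon M\to B$. Given an integrable horizontal distribution (a flat principal connection) $\mathcal H$ on $P$ and a smooth function $f>0$ on $B$, the induced splitting $TM=\mathcal H\oplus\mathcal V$, with $\mathcal V=\ker d\pi$, defines the warped metric $g_f$ on $M$: $\mathcal H\perp\mathcal V$, $g_f=\pi^*g_B$ on $\mathcal H$, and $g_f=(f\circ\pi)^2g_F$ on each fiber, which is identified with $F$ by means of any point of $P$ over the corresponding point of $B$. If $\psi\in C^\infty(M)$ satisfies $$\mathrm{Ric}_{g_f}+\nabla^2\psi=\lambda g_f$$ for a constant $\lambda\in\mathbb R$ and $g_f$ is complete, then $M(f,\psi)=(M,g_f,\psi)$ is called a gradient Ricci soliton warped flat bundle with constant $\lambda$. Consider the following equations for smooth functions $f>0$ and $\varphi$ on $B$ and constants $\lambda,c,\mu\in\mathbb R$ (all geometric quantities being those of $g_B$): $$\mathrm{Ric}+\nabla^2\varphi=\lambda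 g_B+\frac mf\nabla^2f,\tag{1}$$ $$2\lambda\varphi-|\nabla\varphi|^2+\Delta\varphi+\frac mf\nabla\varphi(f)=c,\tag{2}$$ $$\lambda f^2+f\Delta f+(m-1)|\nabla f|^2-f\,\nabla\varphi(f)=\mu.\tag{3}$$ Theorem 1. (a) Suppose that $M(f,\psi)=(P\times F)/G$ is a gradient Ricci soliton warped flat bundle with constant $\lambda$ and that the warping function $f$ is not constant. Then $\psi=\varphi\circ\pi$ for a smooth function $\varphi$ on $B$, and $f$ and $\varphi$ satisfy (1) and (2), with the same $\lambda$ and with some constant $c$. Moreover, $\mathrm{Ric}_F=\mu g_F$ for a constant $\mu$ for which (3) holds. (b) Conversely, suppose that smooth functions $f>0$ and $\varphi$ on $B$ satisfy (1) and (2) for some constants $\lambda$ and $c$, and that $\mathrm{Ric}_F=\mu g_F$, where $\mu$ is a constant for which (3) holds. Let $P=\tilde B$ be the universal covering of $B$, a principal bundle with discrete group $G=\pi_1(B)$ and $\mathcal H=TP$, and let $\pi_1(B)$ act on $(F,g_F)$ by any homomorphism $\pi_1(B)\to\mathrm{Iso}(F,g_F)$. Then the warped metric $g_f$ exists on the manifold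 $M=(\tilde B\times F)/\pi_1(B)$, and $\mathrm{Ric}_{g_f}+\nabla^2\psi=\lambda g_f$ with $\psi=\varphi\circ\pi$. If, in addition, $g_B$ and $g_F$ are complete, then $g_f$ is complete, so that $M(f,\psi)$ is a gradient Ricci soliton warped flat bundle with base $B$ and fiber $F$. -/

import Mathlib

open Set Filter Topology Manifold Bundle
open scoped ContDiff ENNReal

noncomputable section

/-! ### Riemannian geometry in charts

Manifolds are modelled on a finite-dimensional real vector space `E` without boundary; the tangent
space at `x` is identified with `E` by means of the preferred chart at `x`. -/

section Coordinates

variable {E : Type*} [NormedAddCommGroup E] [NormedSpace ℝ E]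

/-- Christoffel symbols `Γ(u, v)` at `y` of a metric `G` given on (an open part of) `E`, that is
`G (Γ(u, v), w) = (1/2) (D_u G (v, w) + D_v G (u, w) - D_w G (u, v))` for all `w`. -/
def christoffel (G : E → E →L[ℝ] E →L[ℝ] ℝ) (y u v : E) : E :=
  (G y).inverse ((1 / 2 : ℝ) •
    (fderiv ℝ G y u v + fderiv ℝ G y v u - ((fderiv ℝ G y).flip u).flip v))

/-- Curvature `R(u, v)w = ∇_u ∇_v w - ∇_v ∇_u w` at `y`, for constant vector fields `u, v, w`. -/
def coordCurvature (G : E → E →L[ℝ] E →L[ℝ] ℝ) (y u v w : E) : E :=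
  fderiv ℝ (fun z => christoffel G z v w) y u - fderiv ℝ (fun z => christoffel G z u w) y v
    + christoffel G y u (christoffel G y v w) - christoffel G y v (christoffel G y u w)

/-- Ricci tensor at `y`: `Ric(v, w)` is the trace of `u ↦ R(u, v)w`. -/
def coordRicci [FiniteDimensional ℝ E] (G : E → E →L[ℝ] E →L[ℝ] ℝ) (y v w : E) : ℝ :=
  ∑ i, (Module.finBasis ℝ E).coord i (coordCurvature G y (Module.finBasis ℝ E i) v w)

/-- Hessian at `y` of a function: `D²φ(u, v) - Dφ(Γ(u, v))`. -/
def coordHessian (G : E → E →L[ℝ] E →L[ℝ] ℝ) (φ : E → ℝ) (y u v : E) : ℝ :=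
  fderiv ℝ (fderiv ℝ φ) y u v - fderiv ℝ φ y (christoffel G y u v)

end Coordinates

section Riemannian

variable {E : Type*} [NormedAddCommGroup E] [NormedSpace ℝ E]

/-- Smooth Riemannian metrics on a manifold `M` modelled on `E`. -/
abbrev SmoothMetric (E : Type*) [NormedAddCommGroup E] [NormedSpace ℝ E]
    (M : Type*) [TopologicalSpace M] [ChartedSpace E M] [IsManifold 𝓘(ℝ, E) ∞ M] :=
  ContMDiffRiemannianMetric 𝓘(ℝ, E) ∞ E (fun x : M => TangentSpace 𝓘(ℝ, E) x)

variable {M : Type*} [TopologicalSpace M] [ChartedSpace E M] [IsManifold 𝓘(ℝ, E) ∞ M]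

namespace SmoothMetric

/-- The metric in the coordinates given by the preferred chart at `x`. -/
def inChart (g : SmoothMetric E M) (x : M) (y : E) : E →L[ℝ] E →L[ℝ] ℝ :=
  let D : E →L[ℝ] E := mfderiv 𝓘(ℝ, E) 𝓘(ℝ, E) (extChartAt 𝓘(ℝ, E) x).symm y
  let G : E →L[ℝ] E →L[ℝ] ℝ := g.inner ((extChartAt 𝓘(ℝ, E) x).symm y)
  G.bilinearComp D D

/-- The Ricci tensor. -/
def ricci [FiniteDimensional ℝ E] (g : SmoothMetric E M) (x : M)
    (v w : TangentSpace 𝓘(ℝ, E) x) : ℝ :=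
  coordRicci (g.inChart x) (extChartAt 𝓘(ℝ, E) x x) v w

/-- The Hessian `∇²φ`. -/
def hessian (g : SmoothMetric E M) (φ : M → ℝ) (x : M) (v w : TangentSpace 𝓘(ℝ, E) x) : ℝ :=
  coordHessian (g.inChart x) (φ ∘ (extChartAt 𝓘(ℝ, E) x).symm) (extChartAt 𝓘(ℝ, E) x x) v w

/-- The tangent vector dual to a covector: `g (g.sharp x α, v) = α v` for all `v`. -/
def sharp (g : SmoothMetric E M) (x : M) (α : E →L[ℝ] ℝ) : TangentSpace 𝓘(ℝ, E) x :=
  let G : E →L[ℝ] E →L[ℝ] ℝ := g.inner x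
  G.inverse α

/-- The gradient: `g (∇φ, v) = dφ(v)` for all `v`. -/
def gradient (g : SmoothMetric E M) (φ : M → ℝ) (x : M) : TangentSpace 𝓘(ℝ, E) x :=
  g.sharp x (mfderiv 𝓘(ℝ, E) 𝓘(ℝ, ℝ) φ x)

/-- The derivative `∇φ(f) = g (∇φ, ∇f)` of `f` along the gradient of `φ`. In particular
`g.gradInner φ φ = |∇φ|²`. -/
def gradInner (g : SmoothMetric E M) (φ f : M → ℝ) (x : M) : ℝ :=
  g.inner x (g.gradient φ x) (g.gradient f x)

/-- The Laplacian `Δφ`, the trace of the Hessian with respect to the metric. -/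
def laplacian [FiniteDimensional ℝ E] (g : SmoothMetric E M) (φ : M → ℝ) (x : M) : ℝ :=
  ∑ i, g.hessian φ x (Module.finBasis ℝ E i)
    (g.sharp x (LinearMap.toContinuousLinearMap ((Module.finBasis ℝ E).coord i)))

/-- The distance: the infimum of the lengths of `C¹` paths (`∞` if there is no such path). -/
def edist (g : SmoothMetric E M) (x y : M) : ℝ≥0∞ :=
  letI : RiemannianBundle (fun x : M => TangentSpace 𝓘(ℝ, E) x) := ⟨g.toRiemannianMetric⟩
  riemannianEDist 𝓘(ℝ, E) x y

/-- A metric is complete if every Cauchy sequence for its distance converges. -/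
def IsComplete (g : SmoothMetric E M) : Prop :=
  ∀ u : ℕ → M, (∀ ε : ℝ≥0∞, 0 < ε → ∃ N, ∀ m ≥ N, ∀ n ≥ N, g.edist (u m) (u n) < ε) →
    ∃ x, Tendsto u atTop (𝓝 x)

/-- `(M, g, ψ)` is a gradient Ricci soliton with constant `lam`: `Ric + ∇²ψ = lam g`. -/
def IsGradientRicciSoliton [FiniteDimensional ℝ E] (g : SmoothMetric E M) (ψ : M → ℝ)
    (lam : ℝ) : Prop :=
  ContMDiff 𝓘(ℝ, E) 𝓘(ℝ, ℝ) ∞ ψ ∧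
    ∀ (x : M) (v w : TangentSpace 𝓘(ℝ, E) x),
      g.ricci x v w + g.hessian ψ x v w = lam * g.inner x v w

/-- `Ric = μ g` for the constant `μ`. -/
def IsEinstein [FiniteDimensional ℝ E] (g : SmoothMetric E M) (μ : ℝ) : Prop :=
  ∀ (x : M) (v w : TangentSpace 𝓘(ℝ, E) x), g.ricci x v w = μ * g.inner x v w

/-- `Ric + ∇²φ = lam g + (m / f) ∇²f`. -/
def BaseTensorEq [FiniteDimensional ℝ E] (g : SmoothMetric E M) (f φ : M → ℝ)
    (lam m : ℝ) : Prop :=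
  ∀ (x : M) (v w : TangentSpace 𝓘(ℝ, E) x),
    g.ricci x v w + g.hessian φ x v w = lam * g.inner x v w + m / f x * g.hessian f x v w

/-- `2 lam φ - |∇φ|² + Δφ + (m / f) ∇φ(f) = c`. -/
def BaseScalarEq [FiniteDimensional ℝ E] (g : SmoothMetric E M) (f φ : M → ℝ)
    (lam m c : ℝ) : Prop :=
  ∀ x : M, 2 * lam * φ x - g.gradInner φ φ x + g.laplacian φ x
    + m / f x * g.gradInner φ f x = c

/-- `lam f² + f Δf + (m - 1) |∇f|² - f ∇φ(f) = μ`. -/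
def FiberConstantEq [FiniteDimensional ℝ E] (g : SmoothMetric E M) (f φ : M → ℝ)
    (lam m μ : ℝ) : Prop :=
  ∀ x : M, lam * f x ^ 2 + f x * g.laplacian f x + (m - 1) * g.gradInner f f x
    - f x * g.gradInner φ f x = μ

end SmoothMetric

/-- The group `G` acts by isometries of `g`. -/
def ActsIsometrically (G : Type*) [SMul G M] (g : SmoothMetric E M) : Prop :=
  ∀ (a : G) (x : M) (v w : TangentSpace 𝓘(ℝ, E) x),
    g.inner (a • x) (mfderiv 𝓘(ℝ, E) 𝓘(ℝ, E) (fun x' : M => a • x') x v)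
      (mfderiv 𝓘(ℝ, E) 𝓘(ℝ, E) (fun x' : M => a • x') x w) = g.inner x v w

end Riemannian

/-! ### Principal bundles, flat connections, associated bundles -/

section Principal

variable (EB EG EP : Type*) [NormedAddCommGroup EB] [NormedSpace ℝ EB]
  [NormedAddCommGroup EG] [NormedSpace ℝ EG] [NormedAddCommGroup EP] [NormedSpace ℝ EP]
  {B : Type*} [TopologicalSpace B] [ChartedSpace EB B]
  (G : Type*) [TopologicalSpace G] [ChartedSpace EG G] [Group G]
  {P : Type*} [TopologicalSpace P] [ChartedSpace EP P] [MulAction G P]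

/-- `pr : P → B` is a smooth principal `G`-bundle. The action is written on the left (a right
action is turned into a left one by `a • p = p a⁻¹`). -/
structure IsPrincipalBundle (pr : P → B) : Prop where
  contMDiff : ContMDiff 𝓘(ℝ, EP) 𝓘(ℝ, EB) ∞ pr
  map_smul : ∀ (a : G) (p : P), pr (a • p) = pr p
  exists_trivialization : ∀ b : B, ∃ (U : Set B) (Φ : OpenPartialHomeomorph P (B × G)),
    IsOpen U ∧ b ∈ U ∧ Φ.source = pr ⁻¹' U ∧ Φ.target = U ×ˢ univ ∧
    ContMDiffOn 𝓘(ℝ, EP) (𝓘(ℝ, EB).prod 𝓘(ℝ, EG)) ∞ Φ Φ.source ∧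
    ContMDiffOn (𝓘(ℝ, EB).prod 𝓘(ℝ, EG)) 𝓘(ℝ, EP) ∞ Φ.symm Φ.target ∧
    ∀ p ∈ Φ.source, (Φ p).1 = pr p ∧ ∀ a : G, Φ (a • p) = (pr p, a * (Φ p).2)

/-- `H` is an integrable horizontal distribution (a flat principal connection) on `pr : P → B`:
it is complementary to the vertical distribution, `G`-invariant, and through every point there is
a local section of `pr` that is an integral manifold of `H`. (Smoothness of `H` follows, as `H` is
tangent to the translates of a smooth local section.) -/
structure IsFlatConnection (pr : P → B)
    (H : ∀ p : P, Submodule ℝ (TangentSpace 𝓘(ℝ, EP) p)) : Prop where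
  isCompl : ∀ p : P, IsCompl (H p) (LinearMap.ker (mfderiv 𝓘(ℝ, EP) 𝓘(ℝ, EB) pr p).toLinearMap)
  map_smul : ∀ (a : G) (p : P),
    (H p).map (mfderiv 𝓘(ℝ, EP) 𝓘(ℝ, EP) (fun p' : P => a • p') p).toLinearMap = H (a • p)
  integrable : ∀ p : P, ∃ (U : Set B) (s : B → P), IsOpen U ∧ pr p ∈ U ∧ s (pr p) = p ∧
    ContMDiffOn 𝓘(ℝ, EB) 𝓘(ℝ, EP) ∞ s U ∧
    ∀ b ∈ U, pr (s b) = b ∧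
      LinearMap.range (mfderiv 𝓘(ℝ, EB) 𝓘(ℝ, EP) s b).toLinearMap = H (s b)

end Principal

section Associated

/-- The associated bundle `(P × F) / G`, the orbit space of `a • (p, x) = (a • p, a • x)`. -/
def AssociatedBundle (G P F : Type*) [Group G] [MulAction G P] [MulAction G F] :=
  Quotient (MulAction.orbitRel G (P × F))

namespace AssociatedBundle

variable {G P F : Type*} [Group G] [MulAction G P] [MulAction G F]

/-- The quotient topology. -/
instance [TopologicalSpace P] [TopologicalSpace F] :
    TopologicalSpace (AssociatedBundle G P F) :=
  inferInstanceAs (TopologicalSpace (Quotient (MulAction.orbitRel G (P × F))))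

variable (G) in
/-- The class of `(p, x)`. -/
def mk (p : P) (x : F) : AssociatedBundle G P F :=
  Quotient.mk (MulAction.orbitRel G (P × F)) (p, x)

/-- The projection `(P × F) / G → B` induced by a `G`-invariant map `P → B`. -/
def proj {B : Type*} (pr : P → B) (h : ∀ (a : G) (p : P), pr (a • p) = pr p) :
    AssociatedBundle G P F → B :=
  Quotient.lift (s := MulAction.orbitRel G (P × F)) (fun z => pr z.1) (by
    rintro z z' ⟨a, rfl⟩
    exact h a z'.1)

end AssociatedBundle

variable {EB EF EG EP EM : Type*} [NormedAddCommGroup EB] [NormedSpace ℝ EB]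
  [NormedAddCommGroup EF] [NormedSpace ℝ EF] [NormedAddCommGroup EG] [NormedSpace ℝ EG]
  [NormedAddCommGroup EP] [NormedSpace ℝ EP] [NormedAddCommGroup EM] [NormedSpace ℝ EM]
  {B : Type*} [TopologicalSpace B] [ChartedSpace EB B] [IsManifold 𝓘(ℝ, EB) ∞ B]
  {F : Type*} [TopologicalSpace F] [ChartedSpace EF F] [IsManifold 𝓘(ℝ, EF) ∞ F]
  {G : Type*} [TopologicalSpace G] [ChartedSpace EG G] [Group G]
  {P : Type*} [TopologicalSpace P] [ChartedSpace EP P] [MulAction G P] [MulAction G F]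
  [ChartedSpace EM (AssociatedBundle G P F)]

variable (EF EP EM G P F) in
/-- The smooth structure of `(P × F) / G` is the quotient one: the quotient map is a smooth
submersion. (There is at most one such structure on the orbit space.) -/
def IsQuotientSmoothStructure : Prop :=
  ContMDiff (𝓘(ℝ, EP).prod 𝓘(ℝ, EF)) 𝓘(ℝ, EM) ∞
      (fun z : P × F => AssociatedBundle.mk G z.1 z.2) ∧
    ∀ z : P × F, Function.Surjective (mfderiv (𝓘(ℝ, EP).prod 𝓘(ℝ, EF)) 𝓘(ℝ, EM)
      (fun z : P × F => AssociatedBundle.mk G z.1 z.2) z)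

variable [IsManifold 𝓘(ℝ, EM) ∞ (AssociatedBundle G P F)]

/-- `g` is the warped metric on `M = (P × F) / G`. At the class of `(p, x)` the horizontal space is
the image of `H p`, the vertical space (tangent to the fiber) is the image of the tangent space of
`F`, the two are orthogonal, and `g` is the pullback of `gB` on the first and `f²` times `gF` on
the second. -/
def IsWarpedBundleMetric (pr : P → B) (H : ∀ p : P, Submodule ℝ (TangentSpace 𝓘(ℝ, EP) p))
    (gB : SmoothMetric EB B) (gF : SmoothMetric EF F) (f : B → ℝ)
    (g : SmoothMetric EM (AssociatedBundle G P F)) : Prop :=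
  ∀ (p : P) (x : F), ∀ u ∈ H p, ∀ v ∈ H p, ∀ ξ η : TangentSpace 𝓘(ℝ, EF) x,
    g.inner (AssociatedBundle.mk G p x)
      (mfderiv 𝓘(ℝ, EP) 𝓘(ℝ, EM) (fun p' => AssociatedBundle.mk G p' x) p u
        + mfderiv 𝓘(ℝ, EF) 𝓘(ℝ, EM) (fun x' => AssociatedBundle.mk G p x') x ξ)
      (mfderiv 𝓘(ℝ, EP) 𝓘(ℝ, EM) (fun p' => AssociatedBundle.mk G p' x) p v
        + mfderiv 𝓘(ℝ, EF) 𝓘(ℝ, EM) (fun x' => AssociatedBundle.mk G p x') x η)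
    = gB.inner (pr p) (mfderiv 𝓘(ℝ, EP) 𝓘(ℝ, EB) pr p u) (mfderiv 𝓘(ℝ, EP) 𝓘(ℝ, EB) pr p v)
      + f (pr p) ^ 2 * gF.inner x ξ η

/-- `M = (P × F) / G`, with metric `g` and potential `ψ`, is a gradient Ricci soliton (with
constant `lam`) that is a warped flat bundle with warping function `f`, obtained from the principal
bundle `pr : P → B` with integrable horizontal distribution `H`. Completeness of `g` is a separate
condition, `g.IsComplete`. -/
structure IsSolitonWarpedFlatBundle [FiniteDimensional ℝ EM] (pr : P → B)
    (H : ∀ p : P, Submodule ℝ (TangentSpace 𝓘(ℝ, EP) p))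
    (gB : SmoothMetric EB B) (gF : SmoothMetric EF F) (f : B → ℝ)
    (g : SmoothMetric EM (AssociatedBundle G P F)) (ψ : AssociatedBundle G P F → ℝ)
    (lam : ℝ) : Prop where
  flat : IsFlatConnection EB EP G pr H
  smooth_quotient : IsQuotientSmoothStructure EF EP EM F G P
  smooth_warping : ContMDiff 𝓘(ℝ, EB) 𝓘(ℝ, ℝ) ∞ f
  warping_pos : ∀ b, 0 < f b
  warped : IsWarpedBundleMetric pr H gB gF f g
  soliton : g.IsGradientRicciSoliton ψ lam

end Associated

end

noncomputable section

set_option maxSynthPendingDepth 3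
set_option linter.unusedSectionVars false

/-! ### Metrics in coordinates -/

section CoordMetric

variable {E : Type*} [NormedAddCommGroup E] [NormedSpace ℝ E]

/-! A warped flat bundle is locally a warped product. A local section `s` of `P` tangent to the flat
connection gives coordinates `(b, x) ↦ [s b, x]` on `M`, in which the metric is `g_B + f² g_F`
(`IsWarpedFlatBundle.pull_eq`). Ricci tensor and Hessian are invariant under changes of coordinates
(`IsCoordIsometry`), so they may be computed in a warped product of coordinate domains
(`IsCoordWarping.ricci_eq`, `IsCoordWarping.hessian_eq`). The soliton equation then splits into a
horizontal, a mixed and a vertical part.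

Necessity. The mixed part says `∂_u ∂_η ψ = (∂_u f / f) ∂_η ψ`, that is, `∂_u (∂_η ψ / f) = 0`.
Hence over a small set of the base `ψ / f` is a function on the base plus a function on the fiber
(`exists_rectangle`). Along two points of the fiber `ψ` therefore differs by `k f` with a constant
`k`, and constancy of `ψ` on the fiber over `b` is a locally constant property of `b`. If it fails
somewhere, it fails everywhere, and subtracting the horizontal equations at two fiber points gives
`k ∇²f = 0` with `k ≠ 0`. Then `∇²f = 0` on all of `B`, so `|∇f|` is constant, and positive as `f`
is not constant. This contradicts completeness: descending along the gradient, the positive function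
`f ∘ π` would become negative within finite distance. In place of the gradient flow, a
Caristi-Ekeland argument is used (`false_of_gradInner_eq`).

So `ψ = φ ∘ π`. The horizontal part becomes the tensor equation on `B`. The vertical part says that
`Ric_F` is `g_F` times a function of `b`; as `Ric_F` does not involve `b`, this function is a
constant `μ`. The scalar equation is Hamilton's identity on `M`, the constancy of `Δψ - |∇ψ|² + 2
lam ψ`, rewritten on `B` by `Δψ = Δφ + (m / f) ∇φ(f)`. Hamilton's identity follows from the soliton
equation, the contracted Bianchi identity and the commutation of covariant derivatives, all verified
at a point where the Christoffel symbols vanish.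

Sufficiency. If `G` is discrete, the maps comparing local trivializations are locally constant, so
the trivializations glue to a smooth structure on `M`; as `G` acts by isometries, the local warped
metrics agree and define `g_f`. The Ricci and Hessian formulas turn the equations on `B` and `F`
into the soliton equation. For completeness, a Cauchy sequence projects to a Cauchy sequence of `B`;
near its limit `f` is bounded away from zero, so the fiber coordinates are Cauchy in `F` as well. -/

theorem fderiv_clm_apply_apply {E₁ E₂ E₃ : Type*} [NormedAddCommGroup E₁] [NormedSpace ℝ E₁]
    [NormedAddCommGroup E₂] [NormedSpace ℝ E₂] [NormedAddCommGroup E₃] [NormedSpace ℝ E₃]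
    {c : E₁ → E₂ →L[ℝ] E₃} {d : E₁ → E₂} {y : E₁} (hc : DifferentiableAt ℝ c y)
    (hd : DifferentiableAt ℝ d y) (u : E₁) :
    fderiv ℝ (fun z => c z (d z)) y u = fderiv ℝ c y u (d y) + c y (fderiv ℝ d y u) := by
  rw [fderiv_clm_apply hc hd]
  simp [add_comm]

theorem fderiv_clm_apply_const {E₁ E₂ E₃ : Type*} [NormedAddCommGroup E₁] [NormedSpace ℝ E₁]
    [NormedAddCommGroup E₂] [NormedSpace ℝ E₂] [NormedAddCommGroup E₃] [NormedSpace ℝ E₃]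
    {c : E₁ → E₂ →L[ℝ] E₃} {y : E₁} (hc : DifferentiableAt ℝ c y) (d : E₂) (u : E₁) :
    fderiv ℝ (fun z => c z d) y u = fderiv ℝ c y u d := by
  rw [fderiv_clm_apply_apply hc (differentiableAt_const d)]
  simp

/-- The second derivative of a `C²` map is symmetric. -/
theorem fderiv_fderiv_comm {E₁ E₂ : Type*} [NormedAddCommGroup E₁] [NormedSpace ℝ E₁]
    [NormedAddCommGroup E₂] [NormedSpace ℝ E₂] {φ : E₁ → E₂} {y : E₁}
    (h : ContDiffAt ℝ 2 φ y) (u v : E₁) :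
    fderiv ℝ (fderiv ℝ φ) y u v = fderiv ℝ (fderiv ℝ φ) y v u :=
  (h.isSymmSndFDerivAt (by simp)).eq u v

/-- `G` is a smooth Riemannian metric on the open set `U`. -/
structure IsCoordMetric (G : E → E →L[ℝ] E →L[ℝ] ℝ) (U : Set E) : Prop where
  isOpen : IsOpen U
  contDiffOn : ContDiffOn ℝ ∞ G U
  symm : ∀ y ∈ U, ∀ v w, G y v w = G y w v
  pos : ∀ y ∈ U, ∀ v, v ≠ 0 → 0 < G y v v

/-- The Christoffel symbols as a bilinear map. -/
def christoffelCLM (G : E → E →L[ℝ] E →L[ℝ] ℝ) (y : E) : E →L[ℝ] E →L[ℝ] E :=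
  (ContinuousLinearMap.compL ℝ E (E →L[ℝ] ℝ) E (G y).inverse).comp
    ((1 / 2 : ℝ) • (fderiv ℝ G y + (fderiv ℝ G y).flip
      - (ContinuousLinearMap.flipₗᵢ ℝ E E ℝ :
          (E →L[ℝ] E →L[ℝ] ℝ) →L[ℝ] (E →L[ℝ] E →L[ℝ] ℝ)).comp (fderiv ℝ G y).flip))

theorem christoffelCLM_apply (G : E → E →L[ℝ] E →L[ℝ] ℝ) (y u v : E) :
    christoffelCLM G y u v = christoffel G y u v := by
  simp [christoffelCLM, christoffel]

/-- The gradient in coordinates. -/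
def coordGrad (G : E → E →L[ℝ] E →L[ℝ] ℝ) (φ : E → ℝ) (y : E) : E :=
  (G y).inverse (fderiv ℝ φ y)

/-- The Hessian in coordinates, as a bilinear map. -/
def coordHessianCLM (G : E → E →L[ℝ] E →L[ℝ] ℝ) (φ : E → ℝ) (y : E) : E →L[ℝ] E →L[ℝ] ℝ :=
  fderiv ℝ (fderiv ℝ φ) y
    - (ContinuousLinearMap.compL ℝ E E ℝ (fderiv ℝ φ y)).comp (christoffelCLM G y)

theorem coordHessianCLM_apply (G : E → E →L[ℝ] E →L[ℝ] ℝ) (φ : E → ℝ) (y u v : E) :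
    coordHessianCLM G φ y u v = coordHessian G φ y u v := by
  simp [coordHessianCLM, coordHessian, christoffelCLM_apply]

/-- The Laplacian in coordinates. -/
def coordLaplacian (G : E → E →L[ℝ] E →L[ℝ] ℝ) (φ : E → ℝ) (y : E) : ℝ :=
  LinearMap.trace ℝ E ((G y).inverse.comp (coordHessianCLM G φ y) : E →L[ℝ] E).toLinearMap

/-- The inner product of two gradients in coordinates. -/
def coordGradInner (G : E → E →L[ℝ] E →L[ℝ] ℝ) (φ f : E → ℝ) (y : E) : ℝ :=
  G y (coordGrad G φ y) (coordGrad G f y)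

/-- The curvature as a linear map `u ↦ R(u, v)w`. -/
def coordCurvatureCLM (G : E → E →L[ℝ] E →L[ℝ] ℝ) (y v w : E) : E →L[ℝ] E :=
  ((fderiv ℝ (christoffelCLM G) y).flip v).flip w - (fderiv ℝ (christoffelCLM G) y v).flip w
    + (christoffelCLM G y).flip (christoffelCLM G y v w)
    - (christoffelCLM G y v).comp ((christoffelCLM G y).flip w)

namespace IsCoordMetric

variable [FiniteDimensional ℝ E]
  {G : E → E →L[ℝ] E →L[ℝ] ℝ} {U : Set E} {y : E}

/-- Nondegeneracy. Identities between vectors are proved below by pairing both sides with an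
arbitrary `w`. -/
theorem eq_of_forall (hG : IsCoordMetric G U) (hy : y ∈ U) {a b : E}
    (h : ∀ w, G y a w = G y b w) : a = b := by
  by_contra hne
  have := hG.pos y hy (a - b) (sub_ne_zero.2 hne)
  simp [h] at this

/-- Positivity makes `G y` injective, and `E` and its dual have the same dimension. Thus `inverse`,
in the Christoffel symbols and gradients, is a genuine inverse and not the default value. -/
theorem isInvertible (hG : IsCoordMetric G U) (hy : y ∈ U) : (G y).IsInvertible := by
  have hinj : Function.Injective (G y) := fun a b hab => hG.eq_of_forall hy (by simp [hab])
  have hdim : Module.finrank ℝ E = Module.finrank ℝ (E →L[ℝ] ℝ) := by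
    rw [(LinearMap.toContinuousLinearMap (𝕜 := ℝ) (E := E) (F' := ℝ)).symm.finrank_eq]
    exact (Subspace.dual_finrank_eq (K := ℝ) (V := E)).symm
  exact ⟨(LinearEquiv.ofInjectiveOfFinrankEq (G y).toLinearMap hinj hdim).toContinuousLinearEquiv,
    by ext; rfl⟩

theorem contDiffAt (hG : IsCoordMetric G U) (hy : y ∈ U) : ContDiffAt ℝ ∞ G y :=
  hG.contDiffOn.contDiffAt (hG.isOpen.mem_nhds hy)

theorem differentiableAt (hG : IsCoordMetric G U) (hy : y ∈ U) : DifferentiableAt ℝ G y :=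
  (hG.contDiffAt hy).differentiableAt (by simp)

theorem contDiffAt_fderiv (hG : IsCoordMetric G U) (hy : y ∈ U) :
    ContDiffAt ℝ ∞ (fderiv ℝ G) y :=
  (hG.contDiffAt hy).fderiv_right (by simp)

theorem contDiffAt_inverse (hG : IsCoordMetric G U) (hy : y ∈ U) :
    ContDiffAt ℝ ∞ (fun z => (G z).inverse) y :=
  ContDiffAt.comp (g := ContinuousLinearMap.inverse) y
    (hG.isInvertible hy).contDiffAt_map_inverse (hG.contDiffAt hy)

theorem contDiffAt_christoffelCLM (hG : IsCoordMetric G U) (hy : y ∈ U) :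
    ContDiffAt ℝ ∞ (christoffelCLM G) y := by
  have h1 := hG.contDiffAt_fderiv hy
  have h2 : ContDiffAt ℝ ∞ (fun z => (fderiv ℝ G z).flip) y :=
    (ContinuousLinearMap.flipₗᵢ ℝ E E (E →L[ℝ] ℝ)).contDiff.contDiffAt.comp y h1
  have h3 := hG.contDiffAt_inverse hy
  have h4 : ContDiffAt ℝ ∞ (fun z => ContinuousLinearMap.compL ℝ E (E →L[ℝ] ℝ) E (G z).inverse) y :=
    (ContinuousLinearMap.contDiff _).contDiffAt.comp y h3
  exact h4.clm_comp (((h1.add h2).sub (contDiffAt_const.clm_comp h2)).const_smul (1 / 2 : ℝ))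

theorem differentiableAt_christoffelCLM (hG : IsCoordMetric G U) (hy : y ∈ U) :
    DifferentiableAt ℝ (christoffelCLM G) y :=
  (hG.contDiffAt_christoffelCLM hy).differentiableAt (by simp)

theorem inverse_spec (hG : IsCoordMetric G U) (hy : y ∈ U) (α : E →L[ℝ] ℝ) :
    G y ((G y).inverse α) = α :=
  (hG.isInvertible hy).self_apply_inverse α

theorem fderiv_symm (hG : IsCoordMetric G U) (hy : y ∈ U) (u v w : E) :
    fderiv ℝ G y u v w = fderiv ℝ G y u w v := by
  have h1 : ∀ a b, fderiv ℝ G y u a b = fderiv ℝ (fun z => G z a b) y u := by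
    intro a b
    rw [fderiv_clm_apply_const (c := fun z => G z a)
      ((hG.differentiableAt hy).clm_apply (differentiableAt_const a)),
      fderiv_clm_apply_const (hG.differentiableAt hy)]
  rw [h1, h1]
  congr 1
  apply Filter.EventuallyEq.fderiv_eq
  filter_upwards [hG.isOpen.mem_nhds hy] with z hz using hG.symm z hz v w

theorem christoffel_spec (hG : IsCoordMetric G U) (hy : y ∈ U) (u v w : E) :
    G y (christoffelCLM G y u v) w =
      1 / 2 * (fderiv ℝ G y u v w + fderiv ℝ G y v u w - fderiv ℝ G y w u v) := by
  rw [christoffelCLM_apply, christoffel, hG.inverse_spec hy]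
  simp

/-- The Koszul formula determines the Christoffel symbols; this is how they are identified after a
change of coordinates and in a warped product. -/
theorem christoffel_unique (hG : IsCoordMetric G U) (hy : y ∈ U) {u v a : E}
    (h : ∀ w, G y a w =
      1 / 2 * (fderiv ℝ G y u v w + fderiv ℝ G y v u w - fderiv ℝ G y w u v)) :
    christoffelCLM G y u v = a :=
  hG.eq_of_forall hy fun w => by rw [h, hG.christoffel_spec hy]

theorem christoffel_symm (hG : IsCoordMetric G U) (hy : y ∈ U) (u v : E) :
    christoffelCLM G y u v = christoffelCLM G y v u :=
  hG.christoffel_unique hy fun w => by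
    rw [hG.christoffel_spec hy, hG.fderiv_symm hy w u v]; ring

/-- Metric compatibility of the Levi-Civita connection. -/
theorem fderiv_eq (hG : IsCoordMetric G U) (hy : y ∈ U) (u v w : E) :
    fderiv ℝ G y u v w = G y (christoffelCLM G y u v) w + G y v (christoffelCLM G y u w) := by
  rw [hG.symm y hy v, hG.christoffel_spec hy, hG.christoffel_spec hy, hG.fderiv_symm hy u w v,
    hG.fderiv_symm hy w u v, hG.fderiv_symm hy v u w]
  ring

theorem coordCurvatureCLM_apply (hG : IsCoordMetric G U) (hy : y ∈ U) (u v w : E) :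
    coordCurvatureCLM G y v w u = coordCurvature G y u v w := by
  have h : ∀ a b c, fderiv ℝ (fun z => christoffel G z a b) y c
      = fderiv ℝ (christoffelCLM G) y c a b := by
    intro a b c
    have hd := hG.differentiableAt_christoffelCLM hy
    simp only [← christoffelCLM_apply]
    rw [fderiv_clm_apply_const (c := fun z => christoffelCLM G z a)
      (hd.clm_apply (differentiableAt_const a)), fderiv_clm_apply_const hd]
  simp [coordCurvatureCLM, coordCurvature, h, christoffelCLM_apply]

/-- The form without a basis is the one that behaves well under isometries and splits on products.
-/
theorem coordRicci_eq_trace (hG : IsCoordMetric G U) (hy : y ∈ U) (v w : E) :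
    coordRicci G y v w = LinearMap.trace ℝ E (coordCurvatureCLM G y v w).toLinearMap := by
  rw [LinearMap.trace_eq_matrix_trace ℝ (Module.finBasis ℝ E), Matrix.trace, coordRicci]
  refine Finset.sum_congr rfl fun i _ => ?_
  simp [LinearMap.toMatrix_apply, hG.coordCurvatureCLM_apply hy]

theorem coordGrad_spec (hG : IsCoordMetric G U) (hy : y ∈ U) (φ : E → ℝ) (v : E) :
    G y (coordGrad G φ y) v = fderiv ℝ φ y v := by
  rw [coordGrad, hG.inverse_spec hy]

theorem coordGradInner_eq (hG : IsCoordMetric G U) (hy : y ∈ U) (φ f : E → ℝ) :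
    coordGradInner G φ f y = fderiv ℝ φ y (coordGrad G f y) :=
  hG.coordGrad_spec hy _ _

theorem contDiffAt_coordGrad (hG : IsCoordMetric G U) (hy : y ∈ U) {φ : E → ℝ}
    (hφ : ContDiffAt ℝ ∞ φ y) : ContDiffAt ℝ ∞ (coordGrad G φ) y :=
  (hG.contDiffAt_inverse hy).clm_apply (hφ.fderiv_right (by simp))

theorem contDiffAt_coordHessianCLM (hG : IsCoordMetric G U) (hy : y ∈ U) {φ : E → ℝ}
    (hφ : ContDiffAt ℝ ∞ φ y) : ContDiffAt ℝ ∞ (coordHessianCLM G φ) y := by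
  have h1 : ContDiffAt ℝ ∞ (fderiv ℝ φ) y := hφ.fderiv_right (by simp)
  have h2 : ContDiffAt ℝ ∞ (fderiv ℝ (fderiv ℝ φ)) y := h1.fderiv_right (by simp)
  have h4 : ContDiffAt ℝ ∞ (fun z => ContinuousLinearMap.compL ℝ E E ℝ (fderiv ℝ φ z)) y :=
    (ContinuousLinearMap.contDiff _).contDiffAt.comp y h1
  exact h2.sub (h4.clm_comp (hG.contDiffAt_christoffelCLM hy))

/-- The Laplacian is the sum over a basis of the Hessian paired with the dual vectors. -/
theorem coordLaplacian_eq_sum (hG : IsCoordMetric G U) (hy : y ∈ U) (φ : E → ℝ) :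
    coordLaplacian G φ y = ∑ i, coordHessian G φ y (Module.finBasis ℝ E i)
      ((G y).inverse (LinearMap.toContinuousLinearMap ((Module.finBasis ℝ E).coord i))) := by
  rw [coordLaplacian, LinearMap.trace_eq_matrix_trace ℝ (Module.finBasis ℝ E), Matrix.trace]
  refine Finset.sum_congr rfl fun i _ => ?_
  rw [Matrix.diag_apply, LinearMap.toMatrix_apply, ← coordHessianCLM_apply]
  conv_rhs => rw [← hG.inverse_spec hy (coordHessianCLM G φ y (Module.finBasis ℝ E i)),
    hG.symm y hy, hG.inverse_spec hy]
  rfl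

end IsCoordMetric

end CoordMetric

/-! ### Behaviour under coordinate changes -/

section CoordChange

variable {E E' : Type*} [NormedAddCommGroup E] [NormedSpace ℝ E] [FiniteDimensional ℝ E]
  [NormedAddCommGroup E'] [NormedSpace ℝ E'] [FiniteDimensional ℝ E']

theorem trace_eq_of_semiconj {S : E →ₗ[ℝ] E} {T : E' →ₗ[ℝ] E'} (A : E' ≃L[ℝ] E)
    (h : ∀ u, A (T u) = S (A u)) : LinearMap.trace ℝ E' T = LinearMap.trace ℝ E S := by
  rw [← LinearMap.trace_conj' T A.toLinearEquiv]
  congr 1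
  ext u
  simp [LinearEquiv.conj_apply, h]

/-- The map `Φ` is a local isometry from the metric `G'` on `U'` to the metric `G` on `U`. -/
structure IsCoordIsometry (G' : E' → E' →L[ℝ] E' →L[ℝ] ℝ) (U' : Set E')
    (G : E → E →L[ℝ] E →L[ℝ] ℝ) (U : Set E) (Φ : E' → E) : Prop where
  metric' : IsCoordMetric G' U'
  metric : IsCoordMetric G U
  contDiffOn : ContDiffOn ℝ ∞ Φ U'
  mapsTo : MapsTo Φ U' U
  invertible : ∀ y ∈ U', (fderiv ℝ Φ y).IsInvertible
  pullback : ∀ y ∈ U', ∀ u v, G' y u v = G (Φ y) (fderiv ℝ Φ y u) (fderiv ℝ Φ y v)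

/-- Smoothness, symmetry and positivity of the pullback are inherited, so a local isometry is
obtained from the map and the formula for the pullback alone. -/
theorem IsCoordMetric.pullback {G : E → E →L[ℝ] E →L[ℝ] ℝ} {U : Set E} (hG : IsCoordMetric G U)
    {G' : E' → E' →L[ℝ] E' →L[ℝ] ℝ} {U' : Set E'} {Φ : E' → E} (hU' : IsOpen U')
    (hΦ : ContDiffOn ℝ ∞ Φ U') (hm : MapsTo Φ U' U)
    (hinv : ∀ y ∈ U', (fderiv ℝ Φ y).IsInvertible)
    (hpb : ∀ y ∈ U', ∀ u v, G' y u v = G (Φ y) (fderiv ℝ Φ y u) (fderiv ℝ Φ y v)) :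
    IsCoordIsometry G' U' G U Φ := by
  refine ⟨⟨hU', ?_, ?_, ?_⟩, hG, hΦ, hm, hinv, hpb⟩
  · have h1 : ContDiffOn ℝ ∞ (fderiv ℝ Φ) U' := hΦ.fderiv_of_isOpen hU' (by simp)
    have h2 : ContDiffOn ℝ ∞ (fun y => G (Φ y)) U' := hG.contDiffOn.comp hΦ hm
    refine contDiffOn_clm_apply.2 fun u => contDiffOn_clm_apply.2 fun v => ?_
    refine ContDiffOn.congr (f := fun y => G (Φ y) (fderiv ℝ Φ y u) (fderiv ℝ Φ y v)) ?_
      fun y hy => hpb y hy u v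
    exact (h2.clm_apply (h1.clm_apply contDiffOn_const)).clm_apply (h1.clm_apply contDiffOn_const)
  · intro y hy v w
    rw [hpb y hy, hpb y hy, hG.symm _ (hm hy)]
  · intro y hy v hv
    rw [hpb y hy]
    refine hG.pos _ (hm hy) _ fun h => hv ?_
    exact (hinv y hy).injective (by simp [h])

namespace IsCoordIsometry

variable {G' : E' → E' →L[ℝ] E' →L[ℝ] ℝ} {U' : Set E'}
    {G : E → E →L[ℝ] E →L[ℝ] ℝ} {U : Set E} {Φ : E' → E} {y : E'}

theorem contDiffAt (h : IsCoordIsometry G' U' G U Φ) (hy : y ∈ U') : ContDiffAt ℝ ∞ Φ y :=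
  h.contDiffOn.contDiffAt (h.metric'.isOpen.mem_nhds hy)

theorem differentiableAt (h : IsCoordIsometry G' U' G U Φ) (hy : y ∈ U') :
    DifferentiableAt ℝ Φ y :=
  (h.contDiffAt hy).differentiableAt (by simp)

theorem contDiffAt_fderiv (h : IsCoordIsometry G' U' G U Φ) (hy : y ∈ U') :
    ContDiffAt ℝ ∞ (fderiv ℝ Φ) y :=
  (h.contDiffAt hy).fderiv_right (by simp)

theorem differentiableAt_fderiv (h : IsCoordIsometry G' U' G U Φ) (hy : y ∈ U') :
    DifferentiableAt ℝ (fderiv ℝ Φ) y :=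
  (h.contDiffAt_fderiv hy).differentiableAt (by simp)

theorem fderiv_fderiv_symm (h : IsCoordIsometry G' U' G U Φ) (hy : y ∈ U') (u v : E') :
    fderiv ℝ (fderiv ℝ Φ) y u v = fderiv ℝ (fderiv ℝ Φ) y v u :=
  fderiv_fderiv_comm ((h.contDiffAt hy).of_le ENat.LEInfty.out) u v

theorem fderiv_metric (h : IsCoordIsometry G' U' G U Φ) (hy : y ∈ U') (u v w : E') :
    fderiv ℝ G' y u v w =
      fderiv ℝ G (Φ y) (fderiv ℝ Φ y u) (fderiv ℝ Φ y v) (fderiv ℝ Φ y w)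
      + G (Φ y) (fderiv ℝ (fderiv ℝ Φ) y u v) (fderiv ℝ Φ y w)
      + G (Φ y) (fderiv ℝ Φ y v) (fderiv ℝ (fderiv ℝ Φ) y u w) := by
  have dG := h.metric.differentiableAt (h.mapsTo hy)
  have dG' := h.metric'.differentiableAt hy
  have dΦ := h.differentiableAt hy
  have ddΦ := h.differentiableAt_fderiv hy
  have dGΦ : DifferentiableAt ℝ (fun z => G (Φ z)) y := dG.comp y dΦ
  have e1 : fderiv ℝ G' y u v w = fderiv ℝ (fun z => G' z v w) y u := by
    rw [fderiv_clm_apply_const (c := fun z => G' z v)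
      (dG'.clm_apply (differentiableAt_const v)), fderiv_clm_apply_const dG']
  have e2 : fderiv ℝ (fun z => G' z v w) y
      = fderiv ℝ (fun z => G (Φ z) (fderiv ℝ Φ z v) (fderiv ℝ Φ z w)) y := by
    apply Filter.EventuallyEq.fderiv_eq
    filter_upwards [h.metric'.isOpen.mem_nhds hy] with z hz using h.pullback z hz v w
  have dv : ∀ v, DifferentiableAt ℝ (fun z => fderiv ℝ Φ z v) y :=
    fun v => ddΦ.clm_apply (differentiableAt_const v)
  rw [e1, e2, fderiv_clm_apply_apply (c := fun z => G (Φ z) (fderiv ℝ Φ z v))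
    (dGΦ.clm_apply (dv v)) (dv w), fderiv_clm_apply_apply dGΦ (dv v),
    fderiv_clm_apply_const ddΦ, fderiv_clm_apply_const ddΦ,
    show (fun z => G (Φ z)) = G ∘ Φ from rfl, fderiv_comp y dG dΦ]
  simp

/-- Transformation law of the Christoffel symbols. -/
theorem map_christoffel (h : IsCoordIsometry G' U' G U Φ) (hy : y ∈ U') (u v : E') :
    fderiv ℝ Φ y (christoffelCLM G' y u v) =
      fderiv ℝ (fderiv ℝ Φ) y u v
        + christoffelCLM G (Φ y) (fderiv ℝ Φ y u) (fderiv ℝ Φ y v) := by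
  -- The right-hand side is the image of some `a`, and `a` satisfies the Koszul formula of `G'`.
  obtain ⟨a, ha⟩ := (h.invertible y hy).surjective (fderiv ℝ (fderiv ℝ Φ) y u v
        + christoffelCLM G (Φ y) (fderiv ℝ Φ y u) (fderiv ℝ Φ y v))
  rw [← ha]
  congr 1
  refine h.metric'.christoffel_unique hy fun w => ?_
  rw [h.pullback y hy, ha, h.fderiv_metric hy, h.fderiv_metric hy, h.fderiv_metric hy, map_add,
    add_apply, h.metric.christoffel_spec (h.mapsTo hy),
    h.fderiv_fderiv_symm hy v u, h.fderiv_fderiv_symm hy w u, h.fderiv_fderiv_symm hy w v,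
    h.metric.symm _ (h.mapsTo hy) (fderiv ℝ Φ y v), h.metric.symm _ (h.mapsTo hy) (fderiv ℝ Φ y u)]
  ring

/-- The derivative of the transformation law `map_christoffel`. Antisymmetrized in `u` and `v` it
gives the invariance of the curvature. -/
theorem map_fderiv_christoffel (h : IsCoordIsometry G' U' G U Φ) (hy : y ∈ U') (u v w : E') :
    fderiv ℝ (fderiv ℝ Φ) y u (christoffelCLM G' y v w)
      + fderiv ℝ Φ y (fderiv ℝ (christoffelCLM G') y u v w) =
    fderiv ℝ (fderiv ℝ (fderiv ℝ Φ)) y u v w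
      + (fderiv ℝ (christoffelCLM G) (Φ y) (fderiv ℝ Φ y u) (fderiv ℝ Φ y v) (fderiv ℝ Φ y w)
      + christoffelCLM G (Φ y) (fderiv ℝ (fderiv ℝ Φ) y u v) (fderiv ℝ Φ y w)
      + christoffelCLM G (Φ y) (fderiv ℝ Φ y v) (fderiv ℝ (fderiv ℝ Φ) y u w)) := by
  have dΓ := h.metric.differentiableAt_christoffelCLM (h.mapsTo hy)
  have dΓ' := h.metric'.differentiableAt_christoffelCLM hy
  have dΦ := h.differentiableAt hy
  have ddΦ := h.differentiableAt_fderiv hy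
  have dddΦ : DifferentiableAt ℝ (fderiv ℝ (fderiv ℝ Φ)) y :=
    ((h.contDiffAt_fderiv hy).fderiv_right (m := ∞) (by simp)).differentiableAt (by simp)
  have dΓΦ : DifferentiableAt ℝ (fun z => christoffelCLM G (Φ z)) y := dΓ.comp y dΦ
  have dv : ∀ v, DifferentiableAt ℝ (fun z => fderiv ℝ Φ z v) y :=
    fun v => ddΦ.clm_apply (differentiableAt_const v)
  have ddv : DifferentiableAt ℝ (fun z => fderiv ℝ (fderiv ℝ Φ) z v) y :=
    dddΦ.clm_apply (differentiableAt_const v)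
  have dΓ'v : DifferentiableAt ℝ (fun z => christoffelCLM G' z v) y :=
    dΓ'.clm_apply (differentiableAt_const v)
  have e : fderiv ℝ (fun z => fderiv ℝ Φ z (christoffelCLM G' z v w)) y
      = fderiv ℝ (fun z => fderiv ℝ (fderiv ℝ Φ) z v w
        + christoffelCLM G (Φ z) (fderiv ℝ Φ z v) (fderiv ℝ Φ z w)) y := by
    apply Filter.EventuallyEq.fderiv_eq
    filter_upwards [h.metric'.isOpen.mem_nhds hy] with z hz using h.map_christoffel hz v w
  have e' := congrArg (fun L => L u) e

  rw [fderiv_clm_apply_apply ddΦ (dΓ'v.clm_apply (differentiableAt_const w)),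
    fderiv_clm_apply_const dΓ'v, fderiv_clm_apply_const dΓ',
    fderiv_fun_add (ddv.clm_apply (differentiableAt_const w))
      ((dΓΦ.clm_apply (dv v)).clm_apply (dv w)),
    add_apply, fderiv_clm_apply_const ddv, fderiv_clm_apply_const dddΦ,
    fderiv_clm_apply_apply (c := fun z => christoffelCLM G (Φ z) (fderiv ℝ Φ z v))
      (dΓΦ.clm_apply (dv v)) (dv w), fderiv_clm_apply_apply dΓΦ (dv v),
    fderiv_clm_apply_const ddΦ, fderiv_clm_apply_const ddΦ,
    show (fun z => christoffelCLM G (Φ z)) = christoffelCLM G ∘ Φ from rfl,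
    fderiv_comp y dΓ dΦ] at e'
  simpa using e'

/-- The curvature tensor is invariant under local isometries. -/
theorem map_curvature (h : IsCoordIsometry G' U' G U Φ) (hy : y ∈ U') (u v w : E') :
    fderiv ℝ Φ y (coordCurvatureCLM G' y v w u) =
      coordCurvatureCLM G (Φ y) (fderiv ℝ Φ y v) (fderiv ℝ Φ y w) (fderiv ℝ Φ y u) := by
  have e1 := h.map_fderiv_christoffel hy u v w
  have e2 := h.map_fderiv_christoffel hy v u w
  -- Symmetry of the higher derivatives of `Φ`: after antisymmetrization no term without Christoffel
  -- symbols is left.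
  have e3 : fderiv ℝ (fderiv ℝ (fderiv ℝ Φ)) y u v w = fderiv ℝ (fderiv ℝ (fderiv ℝ Φ)) y v u w := by
    rw [fderiv_fderiv_comm ((h.contDiffAt_fderiv hy).of_le ENat.LEInfty.out) u v]
  have e4 := h.fderiv_fderiv_symm hy u v
  simp only [coordCurvatureCLM, add_apply, sub_apply,
    ContinuousLinearMap.flip_apply, ContinuousLinearMap.comp_apply, map_add, map_sub,
    h.map_christoffel hy]
  rw [← eq_sub_iff_add_eq'] at e1 e2
  rw [e1, e2, e3, e4]
  abel

theorem map_ricci (h : IsCoordIsometry G' U' G U Φ) (hy : y ∈ U') (v w : E') :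
    coordRicci G' y v w = coordRicci G (Φ y) (fderiv ℝ Φ y v) (fderiv ℝ Φ y w) := by
  rw [h.metric'.coordRicci_eq_trace hy, h.metric.coordRicci_eq_trace (h.mapsTo hy)]
  obtain ⟨A, hA⟩ := h.invertible y hy
  refine trace_eq_of_semiconj A fun u => ?_
  have := h.map_curvature hy u v w
  rw [← hA] at this
  simpa [← hA] using this

theorem fderiv_comp_apply (h : IsCoordIsometry G' U' G U Φ) (hy : y ∈ U') {φ : E → ℝ}
    (hφ : DifferentiableAt ℝ φ (Φ y)) (u : E') :
    fderiv ℝ (φ ∘ Φ) y u = fderiv ℝ φ (Φ y) (fderiv ℝ Φ y u) := by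
  rw [fderiv_comp y hφ (h.differentiableAt hy)]; rfl

/-- The term with the second derivative of `Φ` in the chain rule cancels against the inhomogeneous
term in the transformation law of the Christoffel symbols. -/
theorem map_hessian (h : IsCoordIsometry G' U' G U Φ) (hy : y ∈ U') {φ : E → ℝ}
    (hφ : ContDiffAt ℝ 2 φ (Φ y)) (u v : E') :
    coordHessian G' (φ ∘ Φ) y u v =
      coordHessian G φ (Φ y) (fderiv ℝ Φ y u) (fderiv ℝ Φ y v) := by
  have dΦ := h.differentiableAt hy
  have ddΦ := h.differentiableAt_fderiv hy
  have dφ : DifferentiableAt ℝ φ (Φ y) := hφ.differentiableAt (by simp)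
  have ddφ : DifferentiableAt ℝ (fderiv ℝ φ) (Φ y) :=
    (hφ.fderiv_right (m := 1) (by norm_num)).differentiableAt (by simp)
  have ddφΦ : DifferentiableAt ℝ (fun z => fderiv ℝ φ (Φ z)) y := ddφ.comp y dΦ
  have hev : ∀ᶠ z in 𝓝 y, DifferentiableAt ℝ φ (Φ z) := by
    have : ∀ᶠ x in 𝓝 (Φ y), ContDiffAt ℝ 2 φ x := hφ.eventually (by simp)
    filter_upwards [dΦ.continuousAt.eventually this] with z hz using hz.differentiableAt (by simp)
  have dd : DifferentiableAt ℝ (fderiv ℝ (φ ∘ Φ)) y := by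
    have : ContDiffAt ℝ 2 (φ ∘ Φ) y :=
      hφ.comp y ((h.contDiffAt hy).of_le ENat.LEInfty.out)
    exact (this.fderiv_right (m := 1) (by norm_num)).differentiableAt (by simp)
  have e1 : fderiv ℝ (fderiv ℝ (φ ∘ Φ)) y u v
      = fderiv ℝ (fderiv ℝ φ) (Φ y) (fderiv ℝ Φ y u) (fderiv ℝ Φ y v)
        + fderiv ℝ φ (Φ y) (fderiv ℝ (fderiv ℝ Φ) y u v) := by
    rw [← fderiv_clm_apply_const dd]
    have : fderiv ℝ (fun z => fderiv ℝ (φ ∘ Φ) z v) y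
        = fderiv ℝ (fun z => fderiv ℝ φ (Φ z) (fderiv ℝ Φ z v)) y := by
      apply Filter.EventuallyEq.fderiv_eq
      filter_upwards [h.metric'.isOpen.mem_nhds hy, hev] with z hz hz'
        using h.fderiv_comp_apply hz hz' v
    rw [this, fderiv_clm_apply_apply ddφΦ (ddΦ.clm_apply (differentiableAt_const v)),
      fderiv_clm_apply_const ddΦ, show (fun z => fderiv ℝ φ (Φ z)) = fderiv ℝ φ ∘ Φ from rfl,
      fderiv_comp y ddφ dΦ]
    rfl
  rw [coordHessian, coordHessian, e1, h.fderiv_comp_apply hy dφ, ← christoffelCLM_apply,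
    ← christoffelCLM_apply, h.map_christoffel hy, map_add]
  ring

theorem map_coordGrad (h : IsCoordIsometry G' U' G U Φ) (hy : y ∈ U') {φ : E → ℝ}
    (hφ : DifferentiableAt ℝ φ (Φ y)) :
    fderiv ℝ Φ y (coordGrad G' (φ ∘ Φ) y) = coordGrad G φ (Φ y) := by
  refine h.metric.eq_of_forall (h.mapsTo hy) fun w => ?_
  obtain ⟨a, rfl⟩ := (h.invertible y hy).surjective w
  rw [← h.pullback y hy, h.metric'.coordGrad_spec hy, h.metric.coordGrad_spec (h.mapsTo hy),
    h.fderiv_comp_apply hy hφ]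

theorem map_coordGradInner (h : IsCoordIsometry G' U' G U Φ) (hy : y ∈ U') {φ f : E → ℝ}
    (hφ : DifferentiableAt ℝ φ (Φ y)) (hf : DifferentiableAt ℝ f (Φ y)) :
    coordGradInner G' (φ ∘ Φ) (f ∘ Φ) y = coordGradInner G φ f (Φ y) := by
  rw [coordGradInner, coordGradInner, h.pullback y hy, h.map_coordGrad hy hφ,
    h.map_coordGrad hy hf]

theorem map_coordLaplacian (h : IsCoordIsometry G' U' G U Φ) (hy : y ∈ U') {φ : E → ℝ}
    (hφ : ContDiffAt ℝ 2 φ (Φ y)) :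
    coordLaplacian G' (φ ∘ Φ) y = coordLaplacian G φ (Φ y) := by
  obtain ⟨A, hA⟩ := h.invertible y hy
  refine trace_eq_of_semiconj A fun u => ?_
  refine h.metric.eq_of_forall (h.mapsTo hy) fun w => ?_
  obtain ⟨a, rfl⟩ := (h.invertible y hy).surjective w
  have hA' : ∀ z, A z = fderiv ℝ Φ y z := fun z => by rw [← hA]; rfl
  rw [hA', hA', ← h.pullback y hy]
  simp only [ContinuousLinearMap.coe_coe, ContinuousLinearMap.comp_apply]
  rw [h.metric'.inverse_spec hy, h.metric.inverse_spec (h.mapsTo hy), coordHessianCLM_apply,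
    coordHessianCLM_apply, h.map_hessian hy hφ]

end IsCoordIsometry

end CoordChange

/-! ### Warped products in coordinates -/

section Warped

variable {EB EF : Type*} [NormedAddCommGroup EB] [NormedSpace ℝ EB] [FiniteDimensional ℝ EB]
  [NormedAddCommGroup EF] [NormedSpace ℝ EF] [FiniteDimensional ℝ EF]

/-- Only the diagonal blocks enter, so the mixed components of the curvature and of the Hessian
endomorphism need not be computed. -/
theorem trace_prod_eq (T : (EB × EF) →ₗ[ℝ] (EB × EF)) (A : EB →ₗ[ℝ] EB) (D : EF →ₗ[ℝ] EF)
    (hA : ∀ u, (T (u, 0)).1 = A u) (hD : ∀ ξ, (T (0, ξ)).2 = D ξ) :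
    LinearMap.trace ℝ (EB × EF) T = LinearMap.trace ℝ EB A + LinearMap.trace ℝ EF D := by
  have hid : T = (LinearMap.inl ℝ EB EF) ∘ₗ (LinearMap.fst ℝ EB EF ∘ₗ T)
      + (LinearMap.inr ℝ EB EF) ∘ₗ (LinearMap.snd ℝ EB EF ∘ₗ T) := by
    ext <;> simp
  have h1 : (LinearMap.fst ℝ EB EF ∘ₗ T) ∘ₗ LinearMap.inl ℝ EB EF = A :=
    LinearMap.ext fun u => by simp [hA]
  have h2 : (LinearMap.snd ℝ EB EF ∘ₗ T) ∘ₗ LinearMap.inr ℝ EB EF = D :=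
    LinearMap.ext fun u => by simp [hD]
  have := congrArg (LinearMap.trace ℝ (EB × EF)) hid
  rwa [map_add, LinearMap.trace_comp_comm' (LinearMap.fst ℝ EB EF ∘ₗ T),
    LinearMap.trace_comp_comm' (LinearMap.snd ℝ EB EF ∘ₗ T), h1, h2] at this

theorem DifferentiableAt.comp_prod_fst {E₃ : Type*} [NormedAddCommGroup E₃] [NormedSpace ℝ E₃]
    {h : EB → E₃} {y : EB × EF} (hh : DifferentiableAt ℝ h y.1) :
    DifferentiableAt ℝ (fun z : EB × EF => h z.1) y :=
  hh.comp y differentiableAt_fst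

theorem DifferentiableAt.comp_prod_snd {E₃ : Type*} [NormedAddCommGroup E₃] [NormedSpace ℝ E₃]
    {h : EF → E₃} {y : EB × EF} (hh : DifferentiableAt ℝ h y.2) :
    DifferentiableAt ℝ (fun z : EB × EF => h z.2) y :=
  hh.comp y differentiableAt_snd

theorem fderiv_comp_fst_apply {E₃ : Type*} [NormedAddCommGroup E₃] [NormedSpace ℝ E₃]
    {h : EB → E₃} {y : EB × EF} (hh : DifferentiableAt ℝ h y.1) (U : EB × EF) :
    fderiv ℝ (fun z : EB × EF => h z.1) y U = fderiv ℝ h y.1 U.1 := by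
  rw [show (fun z : EB × EF => h z.1) = h ∘ Prod.fst from rfl, fderiv_comp y hh differentiableAt_fst,
    fderiv_fst]; rfl

theorem fderiv_comp_snd_apply {E₃ : Type*} [NormedAddCommGroup E₃] [NormedSpace ℝ E₃]
    {h : EF → E₃} {y : EB × EF} (hh : DifferentiableAt ℝ h y.2) (U : EB × EF) :
    fderiv ℝ (fun z : EB × EF => h z.2) y U = fderiv ℝ h y.2 U.2 := by
  rw [show (fun z : EB × EF => h z.2) = h ∘ Prod.snd from rfl, fderiv_comp y hh differentiableAt_snd,
    fderiv_snd]; rfl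

/-- The covariant derivative of the gradient is the Hessian. -/
theorem IsCoordMetric.fderiv_coordGrad {G : EB → EB →L[ℝ] EB →L[ℝ] ℝ} {U : Set EB}
    (hG : IsCoordMetric G U) {y : EB} (hy : y ∈ U) {φ : EB → ℝ} (hφ : ContDiffAt ℝ ∞ φ y) (u : EB) :
    fderiv ℝ (coordGrad G φ) y u + christoffelCLM G y u (coordGrad G φ y)
      = (G y).inverse (coordHessianCLM G φ y u) := by
  refine hG.eq_of_forall hy fun w => ?_
  rw [hG.inverse_spec hy, coordHessianCLM_apply, coordHessian, ← christoffelCLM_apply,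
    ← hG.coordGrad_spec hy]
  have dG := hG.differentiableAt hy
  have dgr := (hG.contDiffAt_coordGrad hy hφ).differentiableAt (by simp)
  have ddφ : DifferentiableAt ℝ (fderiv ℝ φ) y :=
    (hφ.fderiv_right (m := ∞) (by simp)).differentiableAt (by simp)
  have e : fderiv ℝ (fun z => G z (coordGrad G φ z) w) y = fderiv ℝ (fun z => fderiv ℝ φ z w) y := by
    apply Filter.EventuallyEq.fderiv_eq
    filter_upwards [hG.isOpen.mem_nhds hy] with z hz using hG.coordGrad_spec hz φ w
  have e' := congrArg (fun L => L u) e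
  rw [fderiv_clm_apply_const (c := fun z => G z (coordGrad G φ z)) (dG.clm_apply dgr),
    fderiv_clm_apply_apply dG dgr, fderiv_clm_apply_const ddφ, add_apply, hG.fderiv_eq hy] at e'
  rw [map_add, add_apply]
  linarith

/-- The warped product metric `G + f² K` in coordinates. -/
def warpedMetric (G : EB → EB →L[ℝ] EB →L[ℝ] ℝ) (K : EF → EF →L[ℝ] EF →L[ℝ] ℝ) (f : EB → ℝ)
    (y : EB × EF) : (EB × EF) →L[ℝ] (EB × EF) →L[ℝ] ℝ :=
  (G y.1).bilinearComp (.fst ℝ EB EF) (.fst ℝ EB EF)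
    + f y.1 ^ 2 • (K y.2).bilinearComp (.snd ℝ EB EF) (.snd ℝ EB EF)

@[simp]
theorem warpedMetric_apply (G : EB → EB →L[ℝ] EB →L[ℝ] ℝ) (K : EF → EF →L[ℝ] EF →L[ℝ] ℝ)
    (f : EB → ℝ) (y U V : EB × EF) :
    warpedMetric G K f y U V = G y.1 U.1 V.1 + f y.1 ^ 2 * K y.2 U.2 V.2 := by
  simp [warpedMetric]

/-- The data of a warped product in coordinates. -/
structure IsCoordWarping (G : EB → EB →L[ℝ] EB →L[ℝ] ℝ) (UB : Set EB)
    (K : EF → EF →L[ℝ] EF →L[ℝ] ℝ) (UF : Set EF) (f : EB → ℝ) : Prop where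
  base : IsCoordMetric G UB
  fiber : IsCoordMetric K UF
  contDiffOn : ContDiffOn ℝ ∞ f UB
  pos : ∀ y ∈ UB, 0 < f y

namespace IsCoordWarping

variable {G : EB → EB →L[ℝ] EB →L[ℝ] ℝ} {UB : Set EB} {K : EF → EF →L[ℝ] EF →L[ℝ] ℝ}
  {UF : Set EF} {f : EB → ℝ} {y : EB × EF}

theorem contDiffAt (h : IsCoordWarping G UB K UF f) (hy : y ∈ UB ×ˢ UF) : ContDiffAt ℝ ∞ f y.1 :=
  h.contDiffOn.contDiffAt (h.base.isOpen.mem_nhds hy.1)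

theorem differentiableAt (h : IsCoordWarping G UB K UF f) (hy : y ∈ UB ×ˢ UF) :
    DifferentiableAt ℝ f y.1 :=
  (h.contDiffAt hy).differentiableAt (by simp)

theorem metric (h : IsCoordWarping G UB K UF f) :
    IsCoordMetric (warpedMetric G K f) (UB ×ˢ UF) := by
  refine ⟨h.base.isOpen.prod h.fiber.isOpen, ?_, ?_, ?_⟩
  · refine contDiffOn_clm_apply.2 fun U => contDiffOn_clm_apply.2 fun V => ?_
    simp only [warpedMetric_apply]
    have h1 : ContDiffOn ℝ ∞ (fun y : EB × EF => y.1) (UB ×ˢ UF) := contDiff_fst.contDiffOn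
    have h2 : ContDiffOn ℝ ∞ (fun y : EB × EF => y.2) (UB ×ˢ UF) := contDiff_snd.contDiffOn
    have hG := (((h.base.contDiffOn.comp h1 fun y hy => hy.1).clm_apply
      (contDiffOn_const (c := U.1))).clm_apply (contDiffOn_const (c := V.1)))
    have hK := (((h.fiber.contDiffOn.comp h2 fun y hy => hy.2).clm_apply
      (contDiffOn_const (c := U.2))).clm_apply (contDiffOn_const (c := V.2)))
    exact hG.add (((h.contDiffOn.comp h1 fun y hy => hy.1).pow 2).mul hK)
  · intro y hy v w
    simp [h.base.symm _ hy.1 v.1, h.fiber.symm _ hy.2 v.2]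
  · rintro y hy ⟨v, ξ⟩ hv
    have hf := pow_pos (h.pos _ hy.1) 2
    simp only [warpedMetric_apply]
    by_cases h1 : v = 0
    · have h2 : ξ ≠ 0 := fun h2 => hv (by simp [h1, h2])
      simpa [h1] using mul_pos hf (h.fiber.pos _ hy.2 ξ h2)
    · have h3 := h.base.pos _ hy.1 v h1
      by_cases h2 : ξ = 0
      · simpa [h2] using h3
      · exact add_pos h3 (mul_pos hf (h.fiber.pos _ hy.2 ξ h2))

theorem fderiv_metric (h : IsCoordWarping G UB K UF f) (hy : y ∈ UB ×ˢ UF) (U V W : EB × EF) :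
    fderiv ℝ (warpedMetric G K f) y U V W =
      fderiv ℝ G y.1 U.1 V.1 W.1 + (2 * f y.1 * fderiv ℝ f y.1 U.1 * K y.2 V.2 W.2
        + f y.1 ^ 2 * fderiv ℝ K y.2 U.2 V.2 W.2) := by
  have dW := h.metric.differentiableAt hy
  have dG := h.base.differentiableAt hy.1
  have dK := h.fiber.differentiableAt hy.2
  have df := h.differentiableAt hy
  have dGv : DifferentiableAt ℝ (fun z => G z V.1) y.1 := dG.clm_apply (differentiableAt_const _)
  have dGvw : DifferentiableAt ℝ (fun z => G z V.1 W.1) y.1 :=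
    dGv.clm_apply (differentiableAt_const _)
  have dKv : DifferentiableAt ℝ (fun z => K z V.2) y.2 := dK.clm_apply (differentiableAt_const _)
  have dKvw : DifferentiableAt ℝ (fun z => K z V.2 W.2) y.2 :=
    dKv.clm_apply (differentiableAt_const _)
  have df2 : DifferentiableAt ℝ (fun z => f z ^ 2) y.1 := df.pow 2
  rw [← fderiv_clm_apply_const dW, ← fderiv_clm_apply_const (c := fun z => warpedMetric G K f z V)
    (dW.clm_apply (differentiableAt_const _))]
  simp only [warpedMetric_apply]
  rw [fderiv_fun_add (f := fun z : EB × EF => G z.1 V.1 W.1)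
      (g := fun z : EB × EF => f z.1 ^ 2 * K z.2 V.2 W.2) (dGvw.comp y differentiableAt_fst)
      ((df2.comp y differentiableAt_fst).mul (dKvw.comp y differentiableAt_snd)),
    fderiv_fun_mul (c := fun z : EB × EF => f z.1 ^ 2) (d := fun z : EB × EF => K z.2 V.2 W.2)
      (df2.comp y differentiableAt_fst) (dKvw.comp y differentiableAt_snd)]
  simp only [add_apply, smul_apply, smul_eq_mul]
  rw [fderiv_comp_fst_apply dGvw, fderiv_comp_fst_apply df2, fderiv_comp_snd_apply dKvw,
    fderiv_clm_apply_const dGv, fderiv_clm_apply_const dG, fderiv_clm_apply_const dKv,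
    fderiv_clm_apply_const dK, fderiv_fun_pow 2 df]
  simp
  ring

/-- The fibers are umbilic, which gives the horizontal term `-f K(U, V) ∇f`, and a fiber vector is
scaled by `∂_u f / f` when moved horizontally. Both are read off from the Koszul formula. -/
theorem christoffel_eq (h : IsCoordWarping G UB K UF f) (hy : y ∈ UB ×ˢ UF) (U V : EB × EF) :
    christoffelCLM (warpedMetric G K f) y U V =
      (christoffelCLM G y.1 U.1 V.1 - K y.2 U.2 V.2 • (f y.1 • coordGrad G f y.1),
        christoffelCLM K y.2 U.2 V.2 + ((f y.1)⁻¹ * fderiv ℝ f y.1 U.1) • V.2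
          + ((f y.1)⁻¹ * fderiv ℝ f y.1 V.1) • U.2) := by
  refine h.metric.christoffel_unique hy fun W => ?_
  have hf : f y.1 ≠ 0 := (h.pos _ hy.1).ne'
  simp only [h.fderiv_metric hy, warpedMetric_apply, map_sub, map_add, map_smul, sub_apply,
    add_apply, smul_apply, smul_eq_mul, h.base.christoffel_spec hy.1,
    h.fiber.christoffel_spec hy.2, h.base.coordGrad_spec hy.1]
  field_simp
  ring

theorem fderiv_logDeriv (h : IsCoordWarping G UB K UF f) (hy : y ∈ UB ×ˢ UF) (u v : EB) :
    fderiv ℝ (fun z => (f z)⁻¹ * fderiv ℝ f z v) y.1 u =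
      (f y.1)⁻¹ * fderiv ℝ (fderiv ℝ f) y.1 u v
        - (f y.1)⁻¹ ^ 2 * fderiv ℝ f y.1 u * fderiv ℝ f y.1 v := by
  have hf : f y.1 ≠ 0 := (h.pos _ hy.1).ne'
  have df := h.differentiableAt hy
  have ddf : DifferentiableAt ℝ (fderiv ℝ f) y.1 :=
    ((h.contDiffAt hy).fderiv_right (m := ∞) (by simp)).differentiableAt (by simp)
  have h1 : HasFDerivAt (fun z => (f z)⁻¹) (-(f y.1 ^ 2)⁻¹ • fderiv ℝ f y.1) y.1 :=
    (hasDerivAt_inv hf).comp_hasFDerivAt y.1 df.hasFDerivAt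
  rw [fderiv_fun_mul (c := fun z => (f z)⁻¹) (d := fun z => fderiv ℝ f z v) h1.differentiableAt
    (ddf.clm_apply (differentiableAt_const _)), h1.fderiv]
  simp only [add_apply, smul_apply, smul_eq_mul]
  rw [fderiv_clm_apply_const ddf]
  ring

theorem fderiv_christoffel (h : IsCoordWarping G UB K UF f) (hy : y ∈ UB ×ˢ UF)
    (U V W : EB × EF) :
    fderiv ℝ (christoffelCLM (warpedMetric G K f)) y U V W =
      (fderiv ℝ (christoffelCLM G) y.1 U.1 V.1 W.1
        - (K y.2 V.2 W.2 • (f y.1 • fderiv ℝ (coordGrad G f) y.1 U.1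
            + fderiv ℝ f y.1 U.1 • coordGrad G f y.1)
          + fderiv ℝ K y.2 U.2 V.2 W.2 • (f y.1 • coordGrad G f y.1)),
        fderiv ℝ (christoffelCLM K) y.2 U.2 V.2 W.2
          + ((f y.1)⁻¹ * fderiv ℝ (fderiv ℝ f) y.1 U.1 V.1
            - (f y.1)⁻¹ ^ 2 * fderiv ℝ f y.1 U.1 * fderiv ℝ f y.1 V.1) • W.2
          + ((f y.1)⁻¹ * fderiv ℝ (fderiv ℝ f) y.1 U.1 W.1
            - (f y.1)⁻¹ ^ 2 * fderiv ℝ f y.1 U.1 * fderiv ℝ f y.1 W.1) • V.2) := by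
  have hf : f y.1 ≠ 0 := (h.pos _ hy.1).ne'
  have dΓ := h.metric.differentiableAt_christoffelCLM hy
  have dG := h.base.differentiableAt_christoffelCLM hy.1
  have dK := h.fiber.differentiableAt_christoffelCLM hy.2
  have dM := h.fiber.differentiableAt hy.2
  have df := h.differentiableAt hy
  have ddf : DifferentiableAt ℝ (fderiv ℝ f) y.1 :=
    ((h.contDiffAt hy).fderiv_right (m := ∞) (by simp)).differentiableAt (by simp)
  have dgr := (h.base.contDiffAt_coordGrad hy.1 (h.contDiffAt hy)).differentiableAt (by simp)
  have dGv : DifferentiableAt ℝ (fun z => christoffelCLM G z V.1) y.1 :=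
    dG.clm_apply (differentiableAt_const _)
  have dGvw : DifferentiableAt ℝ (fun z => christoffelCLM G z V.1 W.1) y.1 :=
    dGv.clm_apply (differentiableAt_const _)
  have dKv : DifferentiableAt ℝ (fun z => christoffelCLM K z V.2) y.2 :=
    dK.clm_apply (differentiableAt_const _)
  have dKvw : DifferentiableAt ℝ (fun z => christoffelCLM K z V.2 W.2) y.2 :=
    dKv.clm_apply (differentiableAt_const _)
  have dMv : DifferentiableAt ℝ (fun z => K z V.2) y.2 := dM.clm_apply (differentiableAt_const _)
  have dMvw : DifferentiableAt ℝ (fun z => K z V.2 W.2) y.2 :=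
    dMv.clm_apply (differentiableAt_const _)
  have dP : DifferentiableAt ℝ (fun z => f z • coordGrad G f z) y.1 := df.smul dgr
  have dp : ∀ v, DifferentiableAt ℝ (fun z => (f z)⁻¹ * fderiv ℝ f z v) y.1 := fun v =>
    (df.inv hf).mul (ddf.clm_apply (differentiableAt_const _))
  have a1 := dGvw.comp_prod_fst (EF := EF)
  have a2 := dMvw.comp_prod_snd (EB := EB)
  have a3 := dP.comp_prod_fst (EF := EF)
  have a4 := dKvw.comp_prod_snd (EB := EB)
  have a5 := (dp V.1).comp_prod_fst (EF := EF)
  have a6 := (dp W.1).comp_prod_fst (EF := EF)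
  have e : fderiv ℝ (fun z => christoffelCLM (warpedMetric G K f) z V W) y =
      fderiv ℝ (fun z : EB × EF =>
        (christoffelCLM G z.1 V.1 W.1 - K z.2 V.2 W.2 • (f z.1 • coordGrad G f z.1),
        christoffelCLM K z.2 V.2 W.2 + ((f z.1)⁻¹ * fderiv ℝ f z.1 V.1) • W.2
          + ((f z.1)⁻¹ * fderiv ℝ f z.1 W.1) • V.2)) y := by
    apply Filter.EventuallyEq.fderiv_eq
    filter_upwards [h.metric.isOpen.mem_nhds hy] with z hz using h.christoffel_eq hz V W
  rw [← fderiv_clm_apply_const dΓ, ← fderiv_clm_apply_const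
    (c := fun z => christoffelCLM (warpedMetric G K f) z V)
    (dΓ.clm_apply (differentiableAt_const _)), e,
    DifferentiableAt.fderiv_prodMk (a1.fun_sub (a2.fun_smul a3))
      ((a4.fun_add (a5.fun_smul (differentiableAt_const _))).fun_add
        (a6.fun_smul (differentiableAt_const _))),
    fderiv_fun_sub a1 (a2.fun_smul a3), fderiv_fun_smul a2 a3,
    fderiv_fun_add (a4.fun_add (a5.fun_smul (differentiableAt_const _)))
      (a6.fun_smul (differentiableAt_const _)),
    fderiv_fun_add a4 (a5.fun_smul (differentiableAt_const _)),
    fderiv_fun_smul a5 (differentiableAt_const _),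
    fderiv_fun_smul a6 (differentiableAt_const _)]
  simp only [ContinuousLinearMap.prod_apply, add_apply, sub_apply, smul_apply,
    ContinuousLinearMap.smulRight_apply]
  rw [fderiv_comp_fst_apply dGvw, fderiv_comp_snd_apply dMvw, fderiv_comp_fst_apply dP,
    fderiv_comp_snd_apply dKvw, fderiv_comp_fst_apply (dp V.1), fderiv_comp_fst_apply (dp W.1),
    h.fderiv_logDeriv hy, h.fderiv_logDeriv hy, fderiv_clm_apply_const dGv,
    fderiv_clm_apply_const dG, fderiv_clm_apply_const dKv, fderiv_clm_apply_const dK,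
    fderiv_clm_apply_const dMv, fderiv_clm_apply_const dM, fderiv_fun_smul df dgr]
  simp

/-- The two diagonal blocks of `u ↦ R(u, V)W`. In the fiber block the rank-one term has trace `|∇f|²
K(V, W)` and the identity has trace `m`; this is the origin of the factor `m - 1` in the Ricci
tensor. -/
theorem trace_curvature (h : IsCoordWarping G UB K UF f) (hy : y ∈ UB ×ˢ UF) (V W : EB × EF) :
    LinearMap.trace ℝ (EB × EF)
        (coordCurvatureCLM (warpedMetric G K f) y V W).toLinearMap =
      LinearMap.trace ℝ EB ((coordCurvatureCLM G y.1 V.1 W.1).toLinearMap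
        - (K y.2 V.2 W.2 * f y.1) •
          ((G y.1).inverse.comp (coordHessianCLM G f y.1) : EB →L[ℝ] EB).toLinearMap)
      + LinearMap.trace ℝ EF ((coordCurvatureCLM K y.2 V.2 W.2).toLinearMap
        + (coordGradInner G f f y.1) • ((K y.2 W.2).toLinearMap.smulRight V.2)
        - ((f y.1)⁻¹ * coordHessian G f y.1 V.1 W.1
            + coordGradInner G f f y.1 * K y.2 V.2 W.2) • LinearMap.id) := by
  have hf : f y.1 ≠ 0 := (h.pos _ hy.1).ne'
  refine trace_prod_eq _ _ _ (fun u => ?_) fun ξ => ?_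
  · simp only [ContinuousLinearMap.coe_coe, coordCurvatureCLM, add_apply, sub_apply,
      ContinuousLinearMap.flip_apply, ContinuousLinearMap.comp_apply, h.fderiv_christoffel hy,
      h.christoffel_eq hy, Prod.fst_add, Prod.fst_sub, LinearMap.sub_apply, LinearMap.smul_apply,
      ← h.base.fderiv_coordGrad hy.1 (h.contDiffAt hy)]
    simp only [map_zero, zero_apply, map_smul, smul_zero, add_zero, zero_add, smul_eq_mul,
      map_sub, smul_add, sub_zero, zero_smul]
    match_scalars <;> field_simp <;> ring
  · simp only [ContinuousLinearMap.coe_coe, coordCurvatureCLM, add_apply, sub_apply,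
      ContinuousLinearMap.flip_apply, ContinuousLinearMap.comp_apply, h.fderiv_christoffel hy,
      h.christoffel_eq hy, Prod.snd_add, Prod.snd_sub, LinearMap.sub_apply, LinearMap.smul_apply,
      LinearMap.add_apply, LinearMap.smulRight_apply, LinearMap.id_apply, coordHessian,
      ← christoffelCLM_apply, h.base.coordGradInner_eq hy.1]
    rw [h.fiber.symm _ hy.2 W.2 ξ,
      fderiv_fderiv_comm ((h.contDiffAt hy).of_le ENat.LEInfty.out) V.1 W.1]
    simp only [map_zero, zero_apply, mul_zero, zero_mul, map_smul, add_zero, smul_eq_mul, map_sub,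
      map_add, smul_add, zero_smul, sub_self, map_neg, zero_sub, mul_neg, mul_sub, add_smul,
      sub_smul]
    rw [h.fiber.christoffel_symm hy.2 V.2 ξ]
    match_scalars <;> field_simp <;> ring

/-- The Ricci tensor of a warped product. -/
theorem ricci_eq (h : IsCoordWarping G UB K UF f) (hy : y ∈ UB ×ˢ UF) (V W : EB × EF) :
    coordRicci (warpedMetric G K f) y V W =
      coordRicci G y.1 V.1 W.1
        - Module.finrank ℝ EF / f y.1 * coordHessian G f y.1 V.1 W.1
      + (coordRicci K y.2 V.2 W.2 - (f y.1 * coordLaplacian G f y.1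
        + (Module.finrank ℝ EF - 1) * coordGradInner G f f y.1) * K y.2 V.2 W.2) := by
  rw [h.metric.coordRicci_eq_trace hy, h.base.coordRicci_eq_trace hy.1,
    h.fiber.coordRicci_eq_trace hy.2, h.trace_curvature hy, map_sub, map_smul, map_sub, map_add,
    map_smul, map_smul, LinearMap.trace_smulRight, LinearMap.trace_id, coordLaplacian]
  simp only [smul_eq_mul, ContinuousLinearMap.coe_coe, h.fiber.symm _ hy.2 W.2 V.2]
  ring

end IsCoordWarping

/-- The mixed part of the Hessian on a warped product. -/
def mixedHessian (f : EB → ℝ) (ψ : EB × EF → ℝ) (y : EB × EF) (u : EB) (η : EF) : ℝ :=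
  fderiv ℝ (fderiv ℝ ψ) y (u, 0) (0, η) - (f y.1)⁻¹ * fderiv ℝ f y.1 u * fderiv ℝ ψ y (0, η)

theorem fderiv_partial_fst {ψ : EB × EF → ℝ} {y : EB × EF} (hψ : DifferentiableAt ℝ ψ y) (u : EB) :
    fderiv ℝ (fun z => ψ (z, y.2)) y.1 u = fderiv ℝ ψ y (u, 0) := by
  have h : HasFDerivAt (fun z : EB => (z, y.2)) (.inl ℝ EB EF) y.1 := hasFDerivAt_prodMk_left _ _
  have h' : HasFDerivAt (fun z => ψ (z, y.2)) ((fderiv ℝ ψ y).comp (.inl ℝ EB EF)) y.1 :=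
    HasFDerivAt.comp (g := ψ) y.1 hψ.hasFDerivAt h
  rw [h'.fderiv]; simp

theorem fderiv_partial_snd {ψ : EB × EF → ℝ} {y : EB × EF} (hψ : DifferentiableAt ℝ ψ y) (η : EF) :
    fderiv ℝ (fun z => ψ (y.1, z)) y.2 η = fderiv ℝ ψ y (0, η) := by
  have h : HasFDerivAt (fun z : EF => (y.1, z)) (.inr ℝ EB EF) y.2 := hasFDerivAt_prodMk_right _ _
  have h' : HasFDerivAt (fun z => ψ (y.1, z)) ((fderiv ℝ ψ y).comp (.inr ℝ EB EF)) y.2 :=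
    HasFDerivAt.comp (g := ψ) y.2 hψ.hasFDerivAt h
  rw [h'.fderiv]; simp

theorem fderiv_fderiv_partial_fst {ψ : EB × EF → ℝ} {y : EB × EF} (hψ : ContDiffAt ℝ 2 ψ y)
    (u v : EB) : fderiv ℝ (fderiv ℝ (fun z => ψ (z, y.2))) y.1 u v
      = fderiv ℝ (fderiv ℝ ψ) y (u, 0) (v, 0) := by
  have h : HasFDerivAt (fun z : EB => (z, y.2)) (.inl ℝ EB EF) y.1 := hasFDerivAt_prodMk_left _ _
  have dd : DifferentiableAt ℝ (fderiv ℝ ψ) y :=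
    (hψ.fderiv_right (m := 1) (by norm_num)).differentiableAt (by simp)
  have h' : HasFDerivAt (fun z => (fderiv ℝ ψ (z, y.2)).comp (.inl ℝ EB EF))
      (((ContinuousLinearMap.compL ℝ EB (EB × EF) ℝ).flip (.inl ℝ EB EF)).comp
        ((fderiv ℝ (fderiv ℝ ψ) y).comp (.inl ℝ EB EF))) y.1 :=
    ((ContinuousLinearMap.compL ℝ EB (EB × EF) ℝ).flip (.inl ℝ EB EF)).hasFDerivAt.comp y.1
      (HasFDerivAt.comp (g := fderiv ℝ ψ) y.1 dd.hasFDerivAt h)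
  have e : fderiv ℝ (fun z => ψ (z, y.2))
      =ᶠ[𝓝 y.1] fun z => (fderiv ℝ ψ (z, y.2)).comp (.inl ℝ EB EF) := by
    have hev : ∀ᶠ z in 𝓝 y.1, ContDiffAt ℝ 2 ψ (z, y.2) :=
      h.continuousAt.eventually (hψ.eventually (by simp))
    filter_upwards [hev] with z hz
    ext v
    simpa using fderiv_partial_fst (y := (z, y.2)) (hz.differentiableAt (by simp)) v
  rw [e.fderiv_eq, h'.fderiv]
  simp

theorem fderiv_fderiv_partial_snd {ψ : EB × EF → ℝ} {y : EB × EF} (hψ : ContDiffAt ℝ 2 ψ y)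
    (u v : EF) : fderiv ℝ (fderiv ℝ (fun z => ψ (y.1, z))) y.2 u v
      = fderiv ℝ (fderiv ℝ ψ) y (0, u) (0, v) := by
  have h : HasFDerivAt (fun z : EF => (y.1, z)) (.inr ℝ EB EF) y.2 := hasFDerivAt_prodMk_right _ _
  have dd : DifferentiableAt ℝ (fderiv ℝ ψ) y :=
    (hψ.fderiv_right (m := 1) (by norm_num)).differentiableAt (by simp)
  have h' : HasFDerivAt (fun z => (fderiv ℝ ψ (y.1, z)).comp (.inr ℝ EB EF))
      (((ContinuousLinearMap.compL ℝ EF (EB × EF) ℝ).flip (.inr ℝ EB EF)).comp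
        ((fderiv ℝ (fderiv ℝ ψ) y).comp (.inr ℝ EB EF))) y.2 :=
    ((ContinuousLinearMap.compL ℝ EF (EB × EF) ℝ).flip (.inr ℝ EB EF)).hasFDerivAt.comp y.2
      (HasFDerivAt.comp (g := fderiv ℝ ψ) y.2 dd.hasFDerivAt h)
  have e : fderiv ℝ (fun z => ψ (y.1, z))
      =ᶠ[𝓝 y.2] fun z => (fderiv ℝ ψ (y.1, z)).comp (.inr ℝ EB EF) := by
    have hev : ∀ᶠ z in 𝓝 y.2, ContDiffAt ℝ 2 ψ (y.1, z) :=
      h.continuousAt.eventually (hψ.eventually (by simp))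
    filter_upwards [hev] with z hz
    ext v
    simpa using fderiv_partial_snd (y := (y.1, z)) (hz.differentiableAt (by simp)) v
  rw [e.fderiv_eq, h'.fderiv]
  simp

namespace IsCoordWarping

variable {G : EB → EB →L[ℝ] EB →L[ℝ] ℝ} {UB : Set EB} {K : EF → EF →L[ℝ] EF →L[ℝ] ℝ}
  {UF : Set EF} {f : EB → ℝ} {y : EB × EF}

/-- The Hessian of a function on a warped product. -/
theorem hessian_eq (h : IsCoordWarping G UB K UF f) (hy : y ∈ UB ×ˢ UF) {ψ : EB × EF → ℝ}
    (hψ : ContDiffAt ℝ 2 ψ y) (V W : EB × EF) :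
    coordHessian (warpedMetric G K f) ψ y V W =
      coordHessian G (fun z => ψ (z, y.2)) y.1 V.1 W.1
      + (coordHessian K (fun z => ψ (y.1, z)) y.2 V.2 W.2
        + f y.1 * coordGradInner G (fun z => ψ (z, y.2)) f y.1 * K y.2 V.2 W.2)
      + mixedHessian f ψ y V.1 W.2 + mixedHessian f ψ y W.1 V.2 := by
  have d : DifferentiableAt ℝ ψ y := hψ.differentiableAt (by simp)
  have split : ∀ (α : EB × EF →L[ℝ] ℝ) (U : EB × EF), α U = α (U.1, 0) + α (0, U.2) := by
    intro α U; rw [← map_add]; simp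
  simp only [coordHessian, ← christoffelCLM_apply, mixedHessian, h.base.coordGradInner_eq hy.1,
    fderiv_partial_fst d, fderiv_partial_snd d, fderiv_fderiv_partial_fst hψ,
    fderiv_fderiv_partial_snd hψ, h.christoffel_eq hy]
  -- Both arguments of the second derivative are split into base and fiber components, and its
  -- symmetry brings the two mixed terms into the order used by `mixedHessian`.
  rw [split (fderiv ℝ (fderiv ℝ ψ) y V) W, fderiv_fderiv_comm hψ V (W.1, 0),
    fderiv_fderiv_comm hψ V (0, W.2), split (fderiv ℝ (fderiv ℝ ψ) y (W.1, 0)) V,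
    split (fderiv ℝ (fderiv ℝ ψ) y (0, W.2)) V, split (fderiv ℝ ψ y) (_, _),
    fderiv_fderiv_comm hψ (0, W.2) (V.1, 0), fderiv_fderiv_comm hψ (W.1, 0) (V.1, 0),
    fderiv_fderiv_comm hψ (0, W.2) (0, V.2)]
  have e1 : fderiv ℝ ψ y (christoffelCLM G y.1 V.1 W.1
        - K y.2 V.2 W.2 • (f y.1 • coordGrad G f y.1), 0)
      = fderiv ℝ ψ y (christoffelCLM G y.1 V.1 W.1, 0)
        - K y.2 V.2 W.2 * (f y.1 * fderiv ℝ ψ y (coordGrad G f y.1, 0)) := by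
    rw [← smul_eq_mul, ← smul_eq_mul (f y.1), ← map_smul, ← map_smul, ← map_sub]; simp
  have e2 : ∀ (a b : EF) (s t : ℝ), fderiv ℝ ψ y (0, christoffelCLM K y.2 V.2 W.2 + s • a + t • b)
      = fderiv ℝ ψ y (0, christoffelCLM K y.2 V.2 W.2) + s * fderiv ℝ ψ y (0, a)
        + t * fderiv ℝ ψ y (0, b) := by
    intro a b s t
    rw [← smul_eq_mul, ← smul_eq_mul t, ← map_smul, ← map_smul, ← map_add, ← map_add]; simp
  rw [e1, e2]
  ring

/-- The gradient of a function of the base variable is horizontal, and on horizontal vectors the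
warped metric is `G`. -/
theorem gradInner_fst (h : IsCoordWarping G UB K UF f) (hy : y ∈ UB ×ˢ UF) {φ k : EB → ℝ}
    (hφ : DifferentiableAt ℝ φ y.1) (hk : DifferentiableAt ℝ k y.1) :
    coordGradInner (warpedMetric G K f) (fun z => φ z.1) (fun z => k z.1) y
      = coordGradInner G φ k y.1 := by
  have e : coordGrad (warpedMetric G K f) (fun z => k z.1) y = (coordGrad G k y.1, 0) := by
    refine h.metric.eq_of_forall hy fun w => ?_
    rw [h.metric.coordGrad_spec hy, fderiv_comp_fst_apply hk]
    simp [h.base.coordGrad_spec hy.1]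
  rw [h.metric.coordGradInner_eq hy, h.base.coordGradInner_eq hy.1, e, fderiv_comp_fst_apply hφ]

/-- The mixed part vanishes with the fiber derivatives. The vertical part does not, because the
Christoffel symbol of two fiber vectors has a component along `∇f`. -/
theorem hessian_fst (h : IsCoordWarping G UB K UF f) (hy : y ∈ UB ×ˢ UF) {φ : EB → ℝ}
    (hφ : ContDiffAt ℝ 2 φ y.1) (V W : EB × EF) :
    coordHessian (warpedMetric G K f) (fun z => φ z.1) y V W =
      coordHessian G φ y.1 V.1 W.1 + f y.1 * coordGradInner G φ f y.1 * K y.2 V.2 W.2 := by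
  have hψ : ContDiffAt ℝ 2 (fun z : EB × EF => φ z.1) y := hφ.comp y contDiffAt_fst
  have hm : ∀ (u : EB) (η : EF), mixedHessian f (fun z : EB × EF => φ z.1) y u η = 0 := by
    intro u η
    have dd : DifferentiableAt ℝ (fderiv ℝ (fun z : EB × EF => φ z.1)) y :=
      (hψ.fderiv_right (m := 1) (by norm_num)).differentiableAt (by simp)
    have e : (fun z => fderiv ℝ (fun z : EB × EF => φ z.1) z (0, η)) =ᶠ[𝓝 y] fun _ => (0 : ℝ) := by
      filter_upwards [continuousAt_fst.eventually (hφ.eventually (by simp))] with z hz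
      rw [fderiv_comp_fst_apply (hz.differentiableAt (by simp))]; simp
    rw [mixedHessian, ← fderiv_clm_apply_const dd, e.fderiv_eq,
      fderiv_comp_fst_apply (hφ.differentiableAt (by simp))]
    simp
  rw [h.hessian_eq hy hψ, hm, hm]
  have : coordHessian K (fun _ => φ y.1) y.2 V.2 W.2 = 0 := by simp [coordHessian]
  rw [this]
  ring

/-- The Hessian endomorphism preserves the splitting, and on the fiber it is `∇φ(f) / f` times the
identity, of trace `(m / f) ∇φ(f)`. -/
theorem laplacian_fst (h : IsCoordWarping G UB K UF f) (hy : y ∈ UB ×ˢ UF) {φ : EB → ℝ}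
    (hφ : ContDiffAt ℝ 2 φ y.1) :
    coordLaplacian (warpedMetric G K f) (fun z => φ z.1) y =
      coordLaplacian G φ y.1 + Module.finrank ℝ EF / f y.1 * coordGradInner G φ f y.1 := by
  have hf : f y.1 ≠ 0 := (h.pos _ hy.1).ne'
  have key : ∀ V, (warpedMetric G K f y).inverse
      (coordHessianCLM (warpedMetric G K f) (fun z => φ z.1) y V)
      = ((G y.1).inverse (coordHessianCLM G φ y.1 V.1),
          ((f y.1)⁻¹ * coordGradInner G φ f y.1) • V.2) := by
    intro V
    refine h.metric.eq_of_forall hy fun W => ?_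
    rw [h.metric.inverse_spec hy, coordHessianCLM_apply, h.hessian_fst hy hφ, warpedMetric_apply,
      h.base.inverse_spec hy.1, coordHessianCLM_apply, map_smul, smul_apply, smul_eq_mul]
    field_simp
  rw [coordLaplacian, trace_prod_eq _
    ((G y.1).inverse.comp (coordHessianCLM G φ y.1) : EB →L[ℝ] EB).toLinearMap
    (((f y.1)⁻¹ * coordGradInner G φ f y.1) • LinearMap.id), map_smul, LinearMap.trace_id,
    coordLaplacian, smul_eq_mul]
  · ring
  · intro u; simp [key]
  · intro ξ; simp [key]

end IsCoordWarping

end Warped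

/-! ### Hamilton's identity for gradient solitons in coordinates -/

section Hamilton

variable {E : Type*} [NormedAddCommGroup E] [NormedSpace ℝ E]

theorem fderiv_half_combination {P Q R : E → ℝ} {y : E} (hP : DifferentiableAt ℝ P y)
    (hQ : DifferentiableAt ℝ Q y) (hR : DifferentiableAt ℝ R y) (a : E) :
    fderiv ℝ (fun z => 1 / 2 * (P z + Q z - R z)) y a
      = 1 / 2 * (fderiv ℝ P y a + fderiv ℝ Q y a - fderiv ℝ R y a) := by
  rw [fderiv_const_mul ((hP.fun_add hQ).fun_sub hR), fderiv_fun_sub (hP.fun_add hQ) hR,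
    fderiv_fun_add hP hQ]
  simp

theorem fderiv_fderiv_apply {g : E → ℝ} {y : E} (hg : ContDiffAt ℝ ∞ g y) (u a : E) :
    fderiv ℝ (fun z => fderiv ℝ g z a) y u = fderiv ℝ (fderiv ℝ g) y u a :=
  fderiv_clm_apply_const
    ((hg.fderiv_right (m := ∞) (by simp)).differentiableAt (by simp)) _ _

theorem contDiffAt_fderiv_apply {E₂ : Type*} [NormedAddCommGroup E₂] [NormedSpace ℝ E₂]
    {g : E → E₂} {y : E} (hg : ContDiffAt ℝ ∞ g y) (a : E) :
    ContDiffAt ℝ ∞ (fun z => fderiv ℝ g z a) y :=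
  (hg.fderiv_right (m := ∞) (by simp)).clm_apply contDiffAt_const

theorem fderiv_fderiv_fderiv_apply {g : E → ℝ} {y : E}
    (hg : ContDiffAt ℝ ∞ g y) (u a b : E) :
    fderiv ℝ (fun z => fderiv ℝ (fderiv ℝ g) z a b) y u
      = fderiv ℝ (fderiv ℝ (fderiv ℝ g)) y u a b := by
  have h1 : ContDiffAt ℝ ∞ (fderiv ℝ g) y := hg.fderiv_right (by simp)
  have h2 : DifferentiableAt ℝ (fderiv ℝ (fderiv ℝ g)) y :=
    (h1.fderiv_right (m := ∞) (by simp)).differentiableAt (by simp)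
  rw [fderiv_clm_apply_const (c := fun z => fderiv ℝ (fderiv ℝ g) z a)
    (h2.clm_apply (differentiableAt_const _)), fderiv_clm_apply_const h2]

theorem fderiv_three_comm_left {g : E → ℝ} {y : E} (hg : ContDiffAt ℝ ∞ g y) (u a b : E) :
    fderiv ℝ (fderiv ℝ (fderiv ℝ g)) y u a b = fderiv ℝ (fderiv ℝ (fderiv ℝ g)) y a u b := by
  have h1 : ContDiffAt ℝ ∞ (fderiv ℝ g) y := hg.fderiv_right (by simp)
  rw [fderiv_fderiv_comm (h1.of_le ENat.LEInfty.out)]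

theorem fderiv_three_comm_right {g : E → ℝ} {U : Set E} {y : E} (hU : IsOpen U) (hy : y ∈ U)
    (hg : ∀ z ∈ U, ContDiffAt ℝ ∞ g z) (u a b : E) :
    fderiv ℝ (fderiv ℝ (fderiv ℝ g)) y u a b = fderiv ℝ (fderiv ℝ (fderiv ℝ g)) y u b a := by
  rw [← fderiv_fderiv_fderiv_apply (hg y hy), ← fderiv_fderiv_fderiv_apply (hg y hy)]
  congr 1
  apply Filter.EventuallyEq.fderiv_eq
  filter_upwards [hU.mem_nhds hy] with z hz
    using fderiv_fderiv_comm ((hg z hz).of_le ENat.LEInfty.out) a b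

namespace IsCoordMetric

variable [FiniteDimensional ℝ E]
  {G : E → E →L[ℝ] E →L[ℝ] ℝ} {U : Set E} {y : E}

theorem exists_orthonormal (hG : IsCoordMetric G U) (hy : y ∈ U) :
    ∃ e : Module.Basis (Fin (Module.finrank ℝ E)) ℝ E,
      ∀ i j, G y (e i) (e j) = if i = j then 1 else 0 := by
  let β : LinearMap.BilinForm ℝ E := LinearMap.mk₂ ℝ (fun v w => G y v w) (by simp) (by simp)
    (by simp) (by simp)
  have hβ : LinearMap.IsSymm β := ⟨fun v w => hG.symm y hy v w⟩
  obtain ⟨v, hv⟩ := LinearMap.BilinForm.exists_orthogonal_basis (K := ℝ) (B := β) hβ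
  have hpos : ∀ i, 0 < G y (v i) (v i) := fun i => hG.pos y hy _ (v.ne_zero i)
  have hw : ∀ i, IsUnit (Real.sqrt (G y (v i) (v i)))⁻¹ := fun i =>
    isUnit_iff_ne_zero.2 (inv_ne_zero (Real.sqrt_pos.2 (hpos i)).ne')
  refine ⟨v.isUnitSMul hw, fun i j => ?_⟩
  rw [Module.Basis.isUnitSMul_apply, Module.Basis.isUnitSMul_apply]
  split_ifs with hij
  · subst hij
    simp only [map_smul, smul_apply, smul_eq_mul]
    have h1 := Real.mul_self_sqrt (hpos i).le
    have h2 := (Real.sqrt_pos.2 (hpos i)).ne'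
    field_simp
    rw [sq]
    exact h1.symm
  · have : G y (v i) (v j) = 0 := hv hij
    simp [this]

/-- The form and the frame stay frozen at `y`. The formula can then be used for the endomorphisms at
nearby points, and only these have to be differentiated. -/
theorem trace_eq_sum_orthonormal
    {e : Module.Basis (Fin (Module.finrank ℝ E)) ℝ E}
    (he : ∀ i j, G y (e i) (e j) = if i = j then 1 else 0) (A : E →ₗ[ℝ] E) :
    LinearMap.trace ℝ E A = ∑ i, G y (A (e i)) (e i) := by
  rw [LinearMap.trace_eq_matrix_trace ℝ e, Matrix.trace]
  refine Finset.sum_congr rfl fun i _ => ?_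
  rw [Matrix.diag_apply, LinearMap.toMatrix_apply]
  conv_rhs => rw [← e.sum_repr (A (e i))]
  simp only [map_sum, map_smul, sum_apply, smul_apply, he, smul_eq_mul, mul_ite, mul_one, mul_zero]
  simp

theorem contDiffAt_apply (hG : IsCoordMetric G U) (w x : E) :
    ∀ z ∈ U, ContDiffAt ℝ ∞ (fun z => G z w x) z := fun _ hz =>
  ((hG.contDiffAt hz).clm_apply contDiffAt_const).clm_apply contDiffAt_const

theorem contDiffAt_christoffel_apply (hG : IsCoordMetric G U) (v w : E) :
    ∀ z ∈ U, ContDiffAt ℝ ∞ (fun z => christoffelCLM G z v w) z := fun _ hz =>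
  ((hG.contDiffAt_christoffelCLM hz).clm_apply contDiffAt_const).clm_apply contDiffAt_const

theorem fderiv_apply_apply (hG : IsCoordMetric G U) (hy : y ∈ U) (u w x : E) :
    fderiv ℝ (fun z => G z w x) y u = fderiv ℝ G y u w x := by
  have dG := hG.differentiableAt hy
  rw [fderiv_clm_apply_const (c := fun z => G z w) (dG.clm_apply (differentiableAt_const _)),
    fderiv_clm_apply_const dG]

theorem fderiv_christoffel_apply (hG : IsCoordMetric G U) (hy : y ∈ U) (u v w : E) :
    fderiv ℝ (fun z => christoffelCLM G z v w) y u = fderiv ℝ (christoffelCLM G) y u v w := by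
  have dΓ := hG.differentiableAt_christoffelCLM hy
  rw [fderiv_clm_apply_const (c := fun z => christoffelCLM G z v)
    (dΓ.clm_apply (differentiableAt_const _)), fderiv_clm_apply_const dΓ]

theorem lower_christoffel (hG : IsCoordMetric G U) (hy : y ∈ U) (v w x : E) :
    G y (christoffelCLM G y v w) x = 1 / 2 * (fderiv ℝ (fun z => G z w x) y v
      + fderiv ℝ (fun z => G z v x) y w - fderiv ℝ (fun z => G z v w) y x) := by
  rw [hG.christoffel_spec hy, hG.fderiv_apply_apply hy, hG.fderiv_apply_apply hy,
    hG.fderiv_apply_apply hy]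

/-- The lowered symbols are a linear expression in first derivatives of the metric, hence their
derivatives involve no products. Together with the next lemma this gives the curvature and its
derivative as linear expressions at a point where the symbols vanish. -/
theorem fderiv_lower_christoffel (hG : IsCoordMetric G U) (hy : y ∈ U) (u v w x : E) :
    fderiv ℝ (fun z => G z (christoffelCLM G z v w) x) y u =
      1 / 2 * (fderiv ℝ (fderiv ℝ (fun z => G z w x)) y u v
        + fderiv ℝ (fderiv ℝ (fun z => G z v x)) y u w
        - fderiv ℝ (fderiv ℝ (fun z => G z v w)) y u x) := by
  have e : (fun z => G z (christoffelCLM G z v w) x) =ᶠ[𝓝 y]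
      fun z => 1 / 2 * (fderiv ℝ (fun z => G z w x) z v
      + fderiv ℝ (fun z => G z v x) z w - fderiv ℝ (fun z => G z v w) z x) := by
    filter_upwards [hG.isOpen.mem_nhds hy] with z hz using hG.lower_christoffel hz v w x
  have d : ∀ a b c, DifferentiableAt ℝ (fun z => fderiv ℝ (fun z => G z a b) z c) y :=
    fun a b c => (contDiffAt_fderiv_apply (hG.contDiffAt_apply a b y hy) c).differentiableAt
      (by simp)
  rw [e.fderiv_eq, fderiv_half_combination (d _ _ _) (d _ _ _) (d _ _ _),
    fderiv_fderiv_apply (hG.contDiffAt_apply _ _ y hy),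
    fderiv_fderiv_apply (hG.contDiffAt_apply _ _ y hy),
    fderiv_fderiv_apply (hG.contDiffAt_apply _ _ y hy)]

theorem fderiv_fderiv_lower_christoffel (hG : IsCoordMetric G U) (hy : y ∈ U) (u a v w x : E) :
    fderiv ℝ (fun z => fderiv ℝ (fun z => G z (christoffelCLM G z v w) x) z a) y u =
      1 / 2 * (fderiv ℝ (fderiv ℝ (fderiv ℝ (fun z => G z w x))) y u a v
        + fderiv ℝ (fderiv ℝ (fderiv ℝ (fun z => G z v x))) y u a w
        - fderiv ℝ (fderiv ℝ (fderiv ℝ (fun z => G z v w))) y u a x) := by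
  have e : (fun z => fderiv ℝ (fun z => G z (christoffelCLM G z v w) x) z a) =ᶠ[𝓝 y]
      fun z => 1 / 2 * (fderiv ℝ (fderiv ℝ (fun z => G z w x)) z a v
        + fderiv ℝ (fderiv ℝ (fun z => G z v x)) z a w
        - fderiv ℝ (fderiv ℝ (fun z => G z v w)) z a x) := by
    filter_upwards [hG.isOpen.mem_nhds hy] with z hz using hG.fderiv_lower_christoffel hz a v w x
  have d : ∀ b c p q,
      DifferentiableAt ℝ (fun z => fderiv ℝ (fderiv ℝ (fun z => G z b c)) z p q) y := by
    intro b c p q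
    have h1 : ContDiffAt ℝ ∞ (fderiv ℝ (fun z => G z b c)) y :=
      (hG.contDiffAt_apply b c y hy).fderiv_right (by simp)
    exact ((contDiffAt_fderiv_apply h1 p).differentiableAt (by simp)).clm_apply
      (differentiableAt_const _)
  rw [e.fderiv_eq, fderiv_half_combination (d _ _ _ _) (d _ _ _ _) (d _ _ _ _),
    fderiv_fderiv_fderiv_apply (hG.contDiffAt_apply _ _ y hy),
    fderiv_fderiv_fderiv_apply (hG.contDiffAt_apply _ _ y hy),
    fderiv_fderiv_fderiv_apply (hG.contDiffAt_apply _ _ y hy)]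

section Normal

variable (hG : IsCoordMetric G U) (hy : y ∈ U) (hΓ : christoffelCLM G y = 0)

include hG hy hΓ

theorem fderiv_eq_zero_of_christoffel : fderiv ℝ G y = 0 := by
  ext u v w
  simp [hG.fderiv_eq hy, hΓ]

/-- As `dG` vanishes at `y`, lowering an index commutes with differentiation there. -/
theorem lower_fderiv_christoffel (u v w x : E) :
    G y (fderiv ℝ (christoffelCLM G) y u v w) x =
      1 / 2 * (fderiv ℝ (fderiv ℝ (fun z => G z w x)) y u v
        + fderiv ℝ (fderiv ℝ (fun z => G z v x)) y u w
        - fderiv ℝ (fderiv ℝ (fun z => G z v w)) y u x) := by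
  have dG := hG.differentiableAt hy
  have dX := (hG.contDiffAt_christoffel_apply v w y hy).differentiableAt (by simp)
  rw [← hG.fderiv_lower_christoffel hy,
    fderiv_clm_apply_const (c := fun z => G z (christoffelCLM G z v w)) (dG.clm_apply dX),
    fderiv_clm_apply_apply dG dX, hG.fderiv_eq_zero_of_christoffel hy hΓ,
    hG.fderiv_christoffel_apply hy]
  simp

/-- In the second derivative of `G(Γ(v, w), x)` every other term contains a factor `Γ` or `dG`
evaluated at `y`, which is zero; in particular the term with the second derivative of `G` is
multiplied by `Γ`. -/
theorem lower_fderiv_fderiv_christoffel (u a v w x : E) :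
    G y (fderiv ℝ (fun z => fderiv ℝ (christoffelCLM G) z a v w) y u) x =
      1 / 2 * (fderiv ℝ (fderiv ℝ (fderiv ℝ (fun z => G z w x))) y u a v
        + fderiv ℝ (fderiv ℝ (fderiv ℝ (fun z => G z v x))) y u a w
        - fderiv ℝ (fderiv ℝ (fderiv ℝ (fun z => G z v w))) y u a x) := by
  rw [← hG.fderiv_fderiv_lower_christoffel hy]
  have dG := hG.differentiableAt hy
  have dX := (hG.contDiffAt_christoffel_apply v w y hy).differentiableAt (by simp)
  have dΓa : DifferentiableAt ℝ (fun z => fderiv ℝ (christoffelCLM G) z a v w) y :=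
    (((contDiffAt_fderiv_apply (hG.contDiffAt_christoffelCLM hy) a).clm_apply
      contDiffAt_const).clm_apply contDiffAt_const).differentiableAt (by simp)
  have dGa : DifferentiableAt ℝ (fun z => fderiv ℝ G z a) y :=
    (contDiffAt_fderiv_apply (hG.contDiffAt hy) a).differentiableAt (by simp)
  have e : (fun z => fderiv ℝ (fun z => G z (christoffelCLM G z v w) x) z a) =ᶠ[𝓝 y]
      fun z => fderiv ℝ G z a (christoffelCLM G z v w) x
        + G z (fderiv ℝ (christoffelCLM G) z a v w) x := by
    filter_upwards [hG.isOpen.mem_nhds hy] with z hz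
    have dG := hG.differentiableAt hz
    have dX := (hG.contDiffAt_christoffel_apply v w z hz).differentiableAt (by simp)
    rw [fderiv_clm_apply_const (c := fun z => G z (christoffelCLM G z v w)) (dG.clm_apply dX),
      fderiv_clm_apply_apply dG dX, hG.fderiv_christoffel_apply hz]
    simp
  rw [e.fderiv_eq, fderiv_fun_add ((dGa.clm_apply dX).clm_apply (differentiableAt_const _))
    ((dG.clm_apply dΓa).clm_apply (differentiableAt_const _)), add_apply,
    fderiv_clm_apply_const (c := fun z => G z (fderiv ℝ (christoffelCLM G) z a v w))
      (dG.clm_apply dΓa), fderiv_clm_apply_apply dG dΓa,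
    fderiv_clm_apply_const (c := fun z => fderiv ℝ G z a (christoffelCLM G z v w))
      (dGa.clm_apply dX), fderiv_clm_apply_apply dGa dX,
    hG.fderiv_eq_zero_of_christoffel hy hΓ, hΓ]
  simp

theorem curvature_of_christoffel_eq_zero (u v b : E) :
    coordCurvatureCLM G y v b u =
      fderiv ℝ (christoffelCLM G) y u v b - fderiv ℝ (christoffelCLM G) y v u b := by
  simp [coordCurvatureCLM, hΓ]

/-- In the lowered curvature, a combination of second derivatives of the metric, the antisymmetry is
visible once derivatives are commuted. -/
theorem curvature_skew (u v b x : E) :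
    G y (coordCurvatureCLM G y v b u) x = - G y (coordCurvatureCLM G y v x u) b := by
  rw [hG.curvature_of_christoffel_eq_zero hy hΓ, hG.curvature_of_christoffel_eq_zero hy hΓ]
  simp only [map_sub, sub_apply, hG.lower_fderiv_christoffel hy hΓ]
  have c : ∀ p q u v, fderiv ℝ (fderiv ℝ (fun z => G z p q)) y u v
      = fderiv ℝ (fderiv ℝ (fun z => G z p q)) y v u := fun p q u v =>
    fderiv_fderiv_comm ((hG.contDiffAt_apply p q y hy).of_le ENat.LEInfty.out) u v
  have s : fderiv ℝ (fderiv ℝ (fun z => G z x b)) y = fderiv ℝ (fderiv ℝ (fun z => G z b x)) y := by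
    have : (fun z => G z x b) =ᶠ[𝓝 y] fun z => G z b x := by
      filter_upwards [hG.isOpen.mem_nhds hy] with z hz using hG.symm z hz x b
    exact this.fderiv.fderiv_eq
  rw [s, c b x u v]
  ring

/-- The terms of the curvature quadratic in `Γ` vanish to second order at `y`. -/
theorem fderiv_curvature (u v w a : E) :
    fderiv ℝ (fun z => coordCurvatureCLM G z v w a) y u =
      fderiv ℝ (fun z => fderiv ℝ (christoffelCLM G) z a v w) y u
        - fderiv ℝ (fun z => fderiv ℝ (christoffelCLM G) z v a w) y u := by
  have dΓ := hG.differentiableAt_christoffelCLM hy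
  have dΓa : ∀ a v w, DifferentiableAt ℝ (fun z => fderiv ℝ (christoffelCLM G) z a v w) y :=
    fun a v w => (((contDiffAt_fderiv_apply (hG.contDiffAt_christoffelCLM hy) a).clm_apply
      contDiffAt_const).clm_apply contDiffAt_const).differentiableAt (by simp)
  have dX : ∀ v w, DifferentiableAt ℝ (fun z => christoffelCLM G z v w) y := fun v w =>
    (hG.contDiffAt_christoffel_apply v w y hy).differentiableAt (by simp)
  have dv : ∀ v, DifferentiableAt ℝ (fun z => christoffelCLM G z v) y := fun v =>
    dΓ.clm_apply (differentiableAt_const _)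
  have e : (fun z => coordCurvatureCLM G z v w a) = fun z =>
      fderiv ℝ (christoffelCLM G) z a v w - fderiv ℝ (christoffelCLM G) z v a w
        + christoffelCLM G z a (christoffelCLM G z v w)
        - christoffelCLM G z v (christoffelCLM G z a w) := by
    ext z; simp [coordCurvatureCLM]
  have z1 : ∀ a v w, fderiv ℝ (fun z => christoffelCLM G z a (christoffelCLM G z v w)) y u = 0 := by
    intro a v w
    rw [fderiv_clm_apply_apply (dv a) (dX v w), hΓ]
    simp
  rw [e, fderiv_fun_sub (((dΓa _ _ _).fun_sub (dΓa _ _ _)).fun_add ((dv _).clm_apply (dX _ _)))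
    ((dv _).clm_apply (dX _ _)), fderiv_fun_add ((dΓa _ _ _).fun_sub (dΓa _ _ _))
    ((dv _).clm_apply (dX _ _)), fderiv_fun_sub (dΓa _ _ _) (dΓa _ _ _), sub_apply, add_apply,
    sub_apply, z1, z1]
  simp

/-- The derivative of the Ricci tensor, expressed by third derivatives of the metric. -/
theorem fderiv_ricci {e : Module.Basis (Fin (Module.finrank ℝ E)) ℝ E}
    (he : ∀ i j, G y (e i) (e j) = if i = j then 1 else 0) (u v w : E) :
    fderiv ℝ (fun z => coordRicci G z v w) y u =
      1 / 2 * ∑ i, (fderiv ℝ (fderiv ℝ (fderiv ℝ (fun z => G z v (e i)))) y u (e i) w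
        - fderiv ℝ (fderiv ℝ (fderiv ℝ (fun z => G z v w))) y u (e i) (e i)
        - fderiv ℝ (fderiv ℝ (fderiv ℝ (fun z => G z (e i) (e i)))) y u v w
        + fderiv ℝ (fderiv ℝ (fderiv ℝ (fun z => G z (e i) w))) y u v (e i)) := by
  have hd : ∀ a, DifferentiableAt ℝ (fun z => coordCurvatureCLM G z v w a) y := by
    intro a
    have h1 : ∀ a v w, DifferentiableAt ℝ (fun z => fderiv ℝ (christoffelCLM G) z a v w) y :=
      fun a v w => (((contDiffAt_fderiv_apply (hG.contDiffAt_christoffelCLM hy) a).clm_apply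
        contDiffAt_const).clm_apply contDiffAt_const).differentiableAt (by simp)
    have h2 : ∀ v w, DifferentiableAt ℝ (fun z => christoffelCLM G z v w) y := fun v w =>
      (hG.contDiffAt_christoffel_apply v w y hy).differentiableAt (by simp)
    have h3 : ∀ v, DifferentiableAt ℝ (fun z => christoffelCLM G z v) y := fun v =>
      (hG.differentiableAt_christoffelCLM hy).clm_apply (differentiableAt_const _)
    have := (((h1 a v w).fun_sub (h1 v a w)).fun_add ((h3 a).clm_apply (h2 v w))).fun_sub
      ((h3 v).clm_apply (h2 a w))
    simpa [coordCurvatureCLM] using this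
  have e1 : (fun z => coordRicci G z v w) =ᶠ[𝓝 y]
      fun z => ∑ i, G y (coordCurvatureCLM G z v w (e i)) (e i) := by
    filter_upwards [hG.isOpen.mem_nhds hy] with z hz
    rw [hG.coordRicci_eq_trace hz, trace_eq_sum_orthonormal he]
    rfl
  have e2 : ∀ i, fderiv ℝ (fun z => G y (coordCurvatureCLM G z v w (e i)) (e i)) y u
      = G y (fderiv ℝ (fun z => coordCurvatureCLM G z v w (e i)) y u) (e i) := by
    intro i
    have h1 : DifferentiableAt ℝ (fun z => G y (coordCurvatureCLM G z v w (e i))) y :=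
      (differentiableAt_const (G y)).clm_apply (hd _)
    rw [fderiv_clm_apply_const h1, fderiv_clm_apply_apply (differentiableAt_const (G y)) (hd _)]
    simp
  have c : ∀ p q a b, fderiv ℝ (fderiv ℝ (fderiv ℝ (fun z => G z p q))) y u a b
      = fderiv ℝ (fderiv ℝ (fderiv ℝ (fun z => G z p q))) y u b a := fun p q a b =>
    fderiv_three_comm_right hG.isOpen hy (hG.contDiffAt_apply p q) u a b
  have dsum : ∀ i ∈ (Finset.univ : Finset (Fin (Module.finrank ℝ E))), DifferentiableAt ℝ
      (fun z => G y (coordCurvatureCLM G z v w (e i)) (e i)) y := fun i _ =>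
    ((differentiableAt_const (G y)).clm_apply (hd _)).clm_apply (differentiableAt_const _)
  rw [e1.fderiv_eq, fderiv_fun_sum dsum, sum_apply, Finset.mul_sum]
  refine Finset.sum_congr rfl fun i _ => ?_
  rw [e2, hG.fderiv_curvature hy hΓ, map_sub, sub_apply,
    hG.lower_fderiv_fderiv_christoffel hy hΓ, hG.lower_fderiv_fderiv_christoffel hy hΓ,
    c w (e i) v (e i)]
  ring

/-- The contracted second Bianchi identity. -/
theorem contracted_bianchi {e : Module.Basis (Fin (Module.finrank ℝ E)) ℝ E}
    (he : ∀ i j, G y (e i) (e j) = if i = j then 1 else 0) (v : E) :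
    ∑ j, fderiv ℝ (fun z => coordRicci G z (e j) (e j)) y v =
      2 * ∑ j, fderiv ℝ (fun z => coordRicci G z v (e j)) y (e j) := by
  simp only [hG.fderiv_ricci hy hΓ he, ← Finset.mul_sum]
  have cl : ∀ p q a b c, fderiv ℝ (fderiv ℝ (fderiv ℝ (fun z => G z p q))) y a b c
      = fderiv ℝ (fderiv ℝ (fderiv ℝ (fun z => G z p q))) y b a c := fun p q a b c =>
    fderiv_three_comm_left (hG.contDiffAt_apply p q y hy) a b c
  have cr : ∀ p q a b c, fderiv ℝ (fderiv ℝ (fderiv ℝ (fun z => G z p q))) y a b c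
      = fderiv ℝ (fderiv ℝ (fderiv ℝ (fun z => G z p q))) y a c b := fun p q a b c =>
    fderiv_three_comm_right hG.isOpen hy (hG.contDiffAt_apply p q) a b c
  have s : ∀ p q, fderiv ℝ (fderiv ℝ (fderiv ℝ (fun z => G z p q))) y
      = fderiv ℝ (fderiv ℝ (fderiv ℝ (fun z => G z q p))) y := by
    intro p q
    have : (fun z => G z p q) =ᶠ[𝓝 y] fun z => G z q p := by
      filter_upwards [hG.isOpen.mem_nhds hy] with z hz using hG.symm z hz p q
    exact this.fderiv.fderiv.fderiv_eq
  simp only [Finset.sum_add_distrib, Finset.sum_sub_distrib]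
  -- `T a b c p q` is the third derivative along `a`, `b`, `c` of the metric component `p`, `q`. The
  -- double sums are matched by exchanging the summation indices, permuting the derivatives and
  -- using the symmetry of the metric.
  set T : E → E → E → E → E → ℝ := fun a b c p q =>
    fderiv ℝ (fderiv ℝ (fderiv ℝ (fun z => G z p q))) y a b c with hT
  have h1 : ∑ j, ∑ i, T v (e i) (e j) (e j) (e i) = ∑ j, ∑ i, T v (e j) (e i) (e i) (e j) := by
    rw [Finset.sum_comm]
  have h2 : ∑ j, ∑ i, T v (e j) (e j) (e i) (e i) = ∑ j, ∑ i, T v (e i) (e i) (e j) (e j) := by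
    rw [Finset.sum_comm]
  have h3 : ∑ j, ∑ i, T (e j) (e i) (e j) v (e i) = ∑ j, ∑ i, T (e j) (e i) (e i) v (e j) := by
    rw [Finset.sum_comm]
    refine Finset.sum_congr rfl fun i _ => Finset.sum_congr rfl fun j _ => ?_
    exact cl _ _ _ _ _
  have h4 : ∑ j, ∑ i, T (e j) v (e j) (e i) (e i) = ∑ j, ∑ i, T v (e i) (e i) (e j) (e j) := by
    rw [Finset.sum_comm]
    refine Finset.sum_congr rfl fun i _ => Finset.sum_congr rfl fun j _ => ?_
    exact cl _ _ _ _ _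
  have h5 : ∑ j, ∑ i, T (e j) v (e i) (e i) (e j) = ∑ j, ∑ i, T v (e j) (e i) (e i) (e j) := by
    refine Finset.sum_congr rfl fun i _ => Finset.sum_congr rfl fun j _ => ?_
    exact cl _ _ _ _ _
  simp only [hT] at h1 h2 h3 h4 h5
  rw [h1, h2, h3, h4, h5]
  ring

end Normal

end IsCoordMetric

/-- The quantity `Δψ - |∇ψ|² + 2 lam ψ` in coordinates. -/
def coordHamilton (G : E → E →L[ℝ] E →L[ℝ] ℝ) (ψ : E → ℝ) (lam : ℝ) (y : E) : ℝ :=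
  coordLaplacian G ψ y - coordGradInner G ψ ψ y + 2 * lam * ψ y

namespace IsCoordMetric

variable [FiniteDimensional ℝ E]
  {G : E → E →L[ℝ] E →L[ℝ] ℝ} {U : Set E} {y : E}

section Normal

variable (hG : IsCoordMetric G U) (hy : y ∈ U) (hΓ : christoffelCLM G y = 0)

include hG hy hΓ

/-- The metric is stationary at `y`, hence so is its inverse; gradients and traces can be
differentiated as if the metric were constant. -/
theorem hasFDerivAt_inverse_zero :
    HasFDerivAt (fun z => (G z).inverse) (0 : E →L[ℝ] (E →L[ℝ] ℝ) →L[ℝ] E) y := by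
  have h1 : DifferentiableAt ℝ ContinuousLinearMap.inverse (G y) :=
    ((hG.isInvertible hy).contDiffAt_map_inverse (n := 1)).differentiableAt (by simp)
  have h2 := h1.hasFDerivAt.comp y (hG.differentiableAt hy).hasFDerivAt
  rw [hG.fderiv_eq_zero_of_christoffel hy hΓ, ContinuousLinearMap.comp_zero] at h2
  exact h2

theorem fderiv_coordGradInner_self {ψ : E → ℝ} (hψ : ContDiffAt ℝ ∞ ψ y) (v : E) :
    fderiv ℝ (coordGradInner G ψ ψ) y v = 2 * coordHessian G ψ y v (coordGrad G ψ y) := by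
  have dψ : DifferentiableAt ℝ (fderiv ℝ ψ) y :=
    (hψ.fderiv_right (m := ∞) (by simp)).differentiableAt (by simp)
  have dI := hG.hasFDerivAt_inverse_zero hy hΓ
  have e : coordGradInner G ψ ψ =ᶠ[𝓝 y] fun z => fderiv ℝ ψ z ((G z).inverse (fderiv ℝ ψ z)) := by
    filter_upwards [hG.isOpen.mem_nhds hy] with z hz using hG.coordGradInner_eq hz ψ ψ
  rw [e.fderiv_eq, fderiv_clm_apply_apply dψ (dI.differentiableAt.clm_apply dψ),
    fderiv_clm_apply_apply dI.differentiableAt dψ, dI.fderiv, ← hG.coordGrad_spec hy ψ,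
    hG.symm y hy, zero_apply, zero_apply, zero_add, hG.inverse_spec hy, coordHessian,
    ← christoffelCLM_apply, hΓ]
  simp [coordGrad]
  ring

theorem fderiv_coordHessian {ψ : E → ℝ} (hψ : ∀ z ∈ U, ContDiffAt ℝ ∞ ψ z) (u v w : E) :
    fderiv ℝ (fun z => coordHessian G ψ z v w) y u =
      fderiv ℝ (fderiv ℝ (fderiv ℝ ψ)) y u v w
        - fderiv ℝ ψ y (fderiv ℝ (christoffelCLM G) y u v w) := by
  have dψ : DifferentiableAt ℝ (fderiv ℝ ψ) y :=
    ((hψ y hy).fderiv_right (m := ∞) (by simp)).differentiableAt (by simp)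
  have ddψ : DifferentiableAt ℝ (fun z => fderiv ℝ (fderiv ℝ ψ) z v w) y :=
    ((contDiffAt_fderiv_apply ((hψ y hy).fderiv_right (m := ∞) (by simp)) v).clm_apply
      contDiffAt_const).differentiableAt (by simp)
  have dX : DifferentiableAt ℝ (fun z => christoffelCLM G z v w) y :=
    (hG.contDiffAt_christoffel_apply v w y hy).differentiableAt (by simp)
  simp only [coordHessian, ← christoffelCLM_apply]
  rw [fderiv_fun_sub ddψ (dψ.clm_apply dX), sub_apply, fderiv_clm_apply_apply dψ dX,
    fderiv_fderiv_fderiv_apply (hψ y hy), hG.fderiv_christoffel_apply hy, hΓ]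
  simp

theorem fderiv_coordLaplacian {e : Module.Basis (Fin (Module.finrank ℝ E)) ℝ E}
    (he : ∀ i j, G y (e i) (e j) = if i = j then 1 else 0) {ψ : E → ℝ}
    (hψ : ContDiffAt ℝ ∞ ψ y) (v : E) :
    fderiv ℝ (coordLaplacian G ψ) y v =
      ∑ j, fderiv ℝ (fun z => coordHessian G ψ z (e j) (e j)) y v := by
  have dI := hG.hasFDerivAt_inverse_zero hy hΓ
  have dH : DifferentiableAt ℝ (coordHessianCLM G ψ) y :=
    (hG.contDiffAt_coordHessianCLM hy hψ).differentiableAt (by simp)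
  have dHa : ∀ a, DifferentiableAt ℝ (fun z => coordHessianCLM G ψ z a) y := fun a =>
    dH.clm_apply (differentiableAt_const _)
  have dIH : ∀ a, DifferentiableAt ℝ (fun z => (G z).inverse (coordHessianCLM G ψ z a)) y :=
    fun a => dI.differentiableAt.clm_apply (dHa a)
  have e1 : coordLaplacian G ψ =
      fun z => ∑ j, G y ((G z).inverse (coordHessianCLM G ψ z (e j))) (e j) := by
    ext z
    rw [coordLaplacian, trace_eq_sum_orthonormal he]
    rfl
  have dG : ∀ a, DifferentiableAt ℝ
      (fun z => G y ((G z).inverse (coordHessianCLM G ψ z a))) y := fun a =>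
    (differentiableAt_const (G y)).clm_apply (dIH a)
  rw [e1, fderiv_fun_sum fun i _ => (dG (e i)).clm_apply (differentiableAt_const _), sum_apply]
  refine Finset.sum_congr rfl fun j _ => ?_
  rw [fderiv_clm_apply_const (dG _), fderiv_clm_apply_apply (differentiableAt_const (G y)) (dIH _),
    fderiv_clm_apply_apply dI.differentiableAt (dHa _), dI.fderiv]
  simp only [← coordHessianCLM_apply]
  rw [fderiv_clm_apply_const (dHa _)]
  simp [hG.inverse_spec hy]

/-- Let `A = d(Δψ)(v)` and let `D` be the divergence of `∇²ψ` applied to `v`. The soliton equation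
and the Bianchi identity give `A = 2D`, commuting derivatives gives `D - A = Ric(v, ∇ψ)`, hence `A =
-2 Ric(v, ∇ψ)`. The derivative of Hamilton's quantity is `A - 2 ∇²ψ(v, ∇ψ) + 2 lam dψ(v)`, which is
zero by the soliton equation. -/
theorem fderiv_coordHamilton_normal {ψ : E → ℝ} (hψ : ∀ z ∈ U, ContDiffAt ℝ ∞ ψ z) {lam : ℝ}
    (hsol : ∀ z ∈ U, ∀ v w, coordRicci G z v w + coordHessian G ψ z v w = lam * G z v w) :
    fderiv ℝ (coordHamilton G ψ lam) y = 0 := by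
  obtain ⟨e, he⟩ := hG.exists_orthonormal hy
  ext v
  have dG := hG.differentiableAt hy
  have dψ : DifferentiableAt ℝ ψ y := (hψ y hy).differentiableAt (by simp)
  have dH : ∀ v w, DifferentiableAt ℝ (fun z => coordHessian G ψ z v w) y := by
    intro v w
    simp only [← coordHessianCLM_apply]
    exact (((hG.contDiffAt_coordHessianCLM hy (hψ y hy)).clm_apply contDiffAt_const).clm_apply
      contDiffAt_const).differentiableAt (by simp)
  have dL : DifferentiableAt ℝ (coordLaplacian G ψ) y := by
    have e1 : coordLaplacian G ψ =
        fun z => ∑ j, G y ((G z).inverse (coordHessianCLM G ψ z (e j))) (e j) := by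
      ext z
      rw [coordLaplacian, trace_eq_sum_orthonormal he]
      rfl
    rw [e1]
    refine DifferentiableAt.fun_sum fun j _ => ?_
    exact ((contDiffAt_const.clm_apply ((hG.contDiffAt_inverse hy).clm_apply
      ((hG.contDiffAt_coordHessianCLM hy (hψ y hy)).clm_apply contDiffAt_const))).clm_apply
      contDiffAt_const).differentiableAt (by simp)
  have dN : DifferentiableAt ℝ (coordGradInner G ψ ψ) y :=
    (((hG.contDiffAt hy).clm_apply (hG.contDiffAt_coordGrad hy (hψ y hy))).clm_apply
      (hG.contDiffAt_coordGrad hy (hψ y hy))).differentiableAt (by simp)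
  -- The metric term `lam G` has zero derivative at `y`.
  have hR : ∀ u v w, fderiv ℝ (fun z => coordRicci G z v w) y u
      = - fderiv ℝ (fun z => coordHessian G ψ z v w) y u := by
    intro u v w
    have e1 : (fun z => coordRicci G z v w) =ᶠ[𝓝 y]
        fun z => lam * G z v w - coordHessian G ψ z v w := by
      filter_upwards [hG.isOpen.mem_nhds hy] with z hz
      linarith [hsol z hz v w]
    have dGv : DifferentiableAt ℝ (fun z => G z v w) y :=
      (hG.contDiffAt_apply v w y hy).differentiableAt (by simp)
    rw [e1.fderiv_eq, fderiv_fun_sub (dGv.const_mul lam) (dH v w), fderiv_const_mul dGv, sub_apply,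
      smul_apply, hG.fderiv_apply_apply hy, hG.fderiv_eq_zero_of_christoffel hy hΓ]
    simp
  -- The Ricci identity: the third covariant derivatives of `ψ` commute up to curvature.
  have hcomm : ∀ u b, fderiv ℝ (fun z => coordHessian G ψ z v b) y u
      - fderiv ℝ (fun z => coordHessian G ψ z u b) y v
      = - G y (coordCurvatureCLM G y v b u) (coordGrad G ψ y) := by
    intro u b
    rw [hG.fderiv_coordHessian hy hΓ hψ, hG.fderiv_coordHessian hy hΓ hψ,
      fderiv_three_comm_left (hψ y hy) v u, hG.curvature_of_christoffel_eq_zero hy hΓ,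
      hG.symm y hy, hG.coordGrad_spec hy, map_sub]
    ring
  -- The trace of the Ricci identity; skew-symmetry of the curvature moves `∇ψ` into the slot over
  -- which the Ricci tensor is not traced.
  have hric : ∑ j, (fderiv ℝ (fun z => coordHessian G ψ z v (e j)) y (e j)
      - fderiv ℝ (fun z => coordHessian G ψ z (e j) (e j)) y v)
      = coordRicci G y v (coordGrad G ψ y) := by
    rw [hG.coordRicci_eq_trace hy, trace_eq_sum_orthonormal he]
    refine Finset.sum_congr rfl fun j _ => ?_
    rw [hcomm, hG.curvature_skew hy hΓ, neg_neg]
    rfl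
  have hB := hG.contracted_bianchi hy hΓ he v
  simp only [hR, Finset.sum_neg_distrib] at hB
  rw [Finset.sum_sub_distrib] at hric
  have hs := hsol y hy v (coordGrad G ψ y)
  rw [hG.symm y hy, hG.coordGrad_spec hy] at hs
  have : coordHamilton G ψ lam = fun z =>
    coordLaplacian G ψ z - coordGradInner G ψ ψ z + 2 * lam * ψ z := rfl
  rw [this, fderiv_fun_add (dL.fun_sub dN) (dψ.const_mul _), fderiv_fun_sub dL dN,
    fderiv_const_mul dψ, add_apply, sub_apply, smul_apply, smul_eq_mul,
    hG.fderiv_coordLaplacian hy hΓ he (hψ y hy), hG.fderiv_coordGradInner_self hy hΓ (hψ y hy)]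
  simp only [zero_apply]
  linarith

end Normal

/-- Quadratic normal coordinates: a change of coordinates killing the Christoffel symbols. -/
theorem exists_normal (hG : IsCoordMetric G U) (hy : y ∈ U) :
    ∃ (G' : E → E →L[ℝ] E →L[ℝ] ℝ) (U' : Set E) (Φ : E → E), IsCoordIsometry G' U' G U Φ ∧
      0 ∈ U' ∧ Φ 0 = y ∧ christoffelCLM G' 0 = 0 := by
  set Γ := christoffelCLM G y with hΓdef
  have hsymm : ∀ u v, Γ u v = Γ v u := hG.christoffel_symm hy
  -- At `0` the derivative of `Φ` is the identity and the second derivative is `-Γ`, so the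
  -- transformation law makes the new Christoffel symbols equal to `-Γ + Γ = 0`.
  let Φ : E → E := fun z => y + z - (1 / 2 : ℝ) • Γ z z
  have hder : ∀ z, HasFDerivAt Φ (ContinuousLinearMap.id ℝ E - Γ z) z := by
    intro z
    have h1 : HasFDerivAt (fun z => Γ z z) ((Γ z).comp (.id ℝ E) + Γ.flip z) z :=
      (Γ.hasFDerivAt (x := z)).clm_apply (hasFDerivAt_id z)
    have h2 := ((hasFDerivAt_id z).const_add y).sub (h1.const_smul (1 / 2 : ℝ))
    refine h2.congr_fderiv ?_
    ext u
    simp only [sub_apply, smul_apply, add_apply, ContinuousLinearMap.comp_apply,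
      ContinuousLinearMap.flip_apply, ContinuousLinearMap.id_apply, hsymm u z]
    rw [← two_smul ℝ, smul_smul]
    norm_num
  have hfd : fderiv ℝ Φ = fun z => ContinuousLinearMap.id ℝ E - Γ z :=
    funext fun z => (hder z).fderiv
  have hsmooth : ContDiff ℝ ∞ Φ :=
    (contDiff_const.add contDiff_id).sub ((Γ.contDiff.clm_apply contDiff_id).const_smul _)
  have hcont : Continuous (fderiv ℝ Φ) := hsmooth.continuous_fderiv (by simp)
  -- The quadratic map is a local diffeomorphism only near `0`; the set where its derivative is
  -- invertible is open and contains `0`.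
  let U' : Set E := Φ ⁻¹' U ∩ (fderiv ℝ Φ) ⁻¹' (range ((↑) : (E ≃L[ℝ] E) → E →L[ℝ] E))
  have hU' : IsOpen U' :=
    (hG.isOpen.preimage hsmooth.continuous).inter (ContinuousLinearEquiv.isOpen.preimage hcont)
  let G' : E → E →L[ℝ] E →L[ℝ] ℝ :=
    fun z => (G (Φ z)).bilinearComp (fderiv ℝ Φ z) (fderiv ℝ Φ z)
  have h0 : Φ 0 = y := by simp [Φ]
  have hfd0 : fderiv ℝ Φ 0 = ContinuousLinearMap.id ℝ E := by simp [hfd]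
  have h0U : (0 : E) ∈ U' := by
    refine ⟨by simpa [h0] using hy, ?_⟩
    rw [mem_preimage, hfd0]
    exact ⟨ContinuousLinearEquiv.refl ℝ E, rfl⟩
  have hiso : IsCoordIsometry G' U' G U Φ :=
    hG.pullback hU' hsmooth.contDiffOn (fun z hz => hz.1) (fun z hz => hz.2)
      fun z _ u v => by simp [G']
  refine ⟨G', U', Φ, hiso, h0U, h0, ?_⟩
  ext u v
  have := hiso.map_christoffel h0U u v
  have h2 : fderiv ℝ (fderiv ℝ Φ) 0 = -Γ := by
    rw [hfd, fderiv_const_sub]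
    simp
  rw [hfd0, h2, h0, ← hΓdef] at this
  simpa using this

/-- Hamilton's identity: `Δψ - |∇ψ|² + 2 lam ψ` has zero derivative on a gradient soliton. -/
theorem fderiv_coordHamilton (hG : IsCoordMetric G U) (hy : y ∈ U) {ψ : E → ℝ}
    (hψ : ContDiffOn ℝ ∞ ψ U) {lam : ℝ}
    (hsol : ∀ z ∈ U, ∀ v w, coordRicci G z v w + coordHessian G ψ z v w = lam * G z v w) :
    fderiv ℝ (coordHamilton G ψ lam) y = 0 := by
  have hψ' : ∀ z ∈ U, ContDiffAt ℝ ∞ ψ z := fun z hz => hψ.contDiffAt (hG.isOpen.mem_nhds hz)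
  obtain ⟨G', U', Φ, h, h0, hΦ0, hΓ⟩ := hG.exists_normal hy
  have hψΦ : ∀ z ∈ U', ContDiffAt ℝ ∞ (ψ ∘ Φ) z := fun z hz =>
    (hψ' _ (h.mapsTo hz)).comp z (h.contDiffAt hz)
  have key := h.metric'.fderiv_coordHamilton_normal h0 hΓ hψΦ (lam := lam) fun z hz v w => by
    rw [h.map_ricci hz, h.map_hessian hz ((hψ' _ (h.mapsTo hz)).of_le ENat.LEInfty.out),
      h.pullback z hz, hsol _ (h.mapsTo hz)]
  have e : coordHamilton G' (ψ ∘ Φ) lam =ᶠ[𝓝 0] coordHamilton G ψ lam ∘ Φ := by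
    filter_upwards [h.metric'.isOpen.mem_nhds h0] with z hz
    have h1 := hψ' _ (h.mapsTo hz)
    have h2 : DifferentiableAt ℝ ψ (Φ z) := h1.differentiableAt (by simp)
    simp only [coordHamilton, Function.comp_apply]
    rw [h.map_coordLaplacian hz (h1.of_le ENat.LEInfty.out), h.map_coordGradInner hz h2 h2]
  -- At a point of nondifferentiability the derivative is zero by convention, so smoothness of
  -- Hamilton's quantity is not needed here.
  by_cases hd : DifferentiableAt ℝ (coordHamilton G ψ lam) y
  · rw [e.fderiv_eq, fderiv_comp 0 (by rwa [hΦ0]) (h.differentiableAt h0), hΦ0] at key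
    ext w
    obtain ⟨a, rfl⟩ := (h.invertible 0 h0).surjective w
    simpa using congrArg (fun L => L a) key
  · exact fderiv_zero_of_not_differentiableAt hd

end IsCoordMetric

end Hamilton

/-! ### Metrics on manifolds in arbitrary parametrizations -/

section Param

theorem coordHessian_congr {E : Type*} [NormedAddCommGroup E] [NormedSpace ℝ E]
    (G : E → E →L[ℝ] E →L[ℝ] ℝ) {φ φ' : E → ℝ} {y : E} (h : φ =ᶠ[𝓝 y] φ') (u v : E) :
    coordHessian G φ y u v = coordHessian G φ' y u v := by
  rw [coordHessian, coordHessian, h.fderiv.fderiv_eq, h.fderiv_eq]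

theorem coordGradInner_congr {E : Type*} [NormedAddCommGroup E] [NormedSpace ℝ E]
    (G : E → E →L[ℝ] E →L[ℝ] ℝ) {φ φ' f f' : E → ℝ} {y : E} (h : φ =ᶠ[𝓝 y] φ')
    (h' : f =ᶠ[𝓝 y] f') : coordGradInner G φ f y = coordGradInner G φ' f' y := by
  rw [coordGradInner, coordGradInner, coordGrad, coordGrad, coordGrad, coordGrad, h.fderiv_eq,
    h'.fderiv_eq]

theorem coordLaplacian_congr {E : Type*} [NormedAddCommGroup E] [NormedSpace ℝ E]
    (G : E → E →L[ℝ] E →L[ℝ] ℝ) {φ φ' : E → ℝ} {y : E} (h : φ =ᶠ[𝓝 y] φ') :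
    coordLaplacian G φ y = coordLaplacian G φ' y := by
  have : coordHessianCLM G φ y = coordHessianCLM G φ' y := by
    ext u v
    rw [coordHessianCLM_apply, coordHessianCLM_apply, coordHessian_congr G h]
  rw [coordLaplacian, coordLaplacian, this]

variable {E : Type*} [NormedAddCommGroup E] [NormedSpace ℝ E]
  {M : Type*} [TopologicalSpace M] [ChartedSpace E M] [IsManifold 𝓘(ℝ, E) ∞ M]
  {E' : Type*} [NormedAddCommGroup E'] [NormedSpace ℝ E']

/-- The derivative of a parametrization, as a map between the model spaces. -/
def paramDeriv (E : Type*) [NormedAddCommGroup E] [NormedSpace ℝ E]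
    {M : Type*} [TopologicalSpace M] [ChartedSpace E M]
    {E' : Type*} [NormedAddCommGroup E'] [NormedSpace ℝ E'] (Ψ : E' → M) (y : E') : E' →L[ℝ] E :=
  mfderiv 𝓘(ℝ, E') 𝓘(ℝ, E) Ψ y

namespace SmoothMetric

/-- The metric at a point, as a bilinear form on the model space. -/
def form (g : SmoothMetric E M) (x : M) : E →L[ℝ] E →L[ℝ] ℝ := g.inner x

/-- The pullback of the metric by a parametrization. -/
def pull (g : SmoothMetric E M) (Ψ : E' → M) (y : E') : E' →L[ℝ] E' →L[ℝ] ℝ :=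
  (g.form (Ψ y)).bilinearComp (paramDeriv E Ψ y) (paramDeriv E Ψ y)

theorem pull_apply (g : SmoothMetric E M) (Ψ : E' → M) (y u v : E') :
    g.pull Ψ y u v = g.form (Ψ y) (paramDeriv E Ψ y u) (paramDeriv E Ψ y v) := rfl

theorem inChart_eq_pull (g : SmoothMetric E M) (x : M) :
    g.inChart x = g.pull (extChartAt 𝓘(ℝ, E) x).symm := rfl

end SmoothMetric

/-- `Ψ` is a smooth local parametrization of `M` on the open set `W`. -/
structure IsParam (E : Type*) [NormedAddCommGroup E] [NormedSpace ℝ E]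
    {M : Type*} [TopologicalSpace M] [ChartedSpace E M]
    {E' : Type*} [NormedAddCommGroup E'] [NormedSpace ℝ E'] (Ψ : E' → M) (W : Set E') : Prop where
  isOpen : IsOpen W
  contMDiffOn : ContMDiffOn 𝓘(ℝ, E') 𝓘(ℝ, E) ∞ Ψ W
  invertible : ∀ y ∈ W, (paramDeriv E Ψ y).IsInvertible

theorem IsParam.mdifferentiableAt {Ψ : E' → M} {W : Set E'} (h : IsParam E Ψ W) {y : E'}
    (hy : y ∈ W) : MDifferentiableAt 𝓘(ℝ, E') 𝓘(ℝ, E) Ψ y :=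
  (h.contMDiffOn.contMDiffAt (h.isOpen.mem_nhds hy)).mdifferentiableAt (by simp)

/-- The tangent map turns the constant fields `u`, `v` into smooth fields along `Ψ`, to which the
smooth bundle metric is applied. `Ψ` need not be an immersion: the statement also serves for the
base and fiber coordinates of the associated bundle. -/
theorem contDiffOn_pull_apply (g : SmoothMetric E M) {Ψ : E' → M} {W : Set E'} (hW : IsOpen W)
    (hΨ : ContMDiffOn 𝓘(ℝ, E') 𝓘(ℝ, E) ∞ Ψ W) (u v : E') :
    ContDiffOn ℝ ∞ (fun y => g.pull Ψ y u v) W := by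
  have hT := hΨ.contMDiffOn_tangentMapWithin (m := ∞) (by simp) hW.uniqueMDiffOn
  have hsec : ∀ u : E', ContMDiffOn 𝓘(ℝ, E') 𝓘(ℝ, E).tangent ∞
      (fun y => (⟨Ψ y, mfderiv 𝓘(ℝ, E') 𝓘(ℝ, E) Ψ y u⟩ : TangentBundle 𝓘(ℝ, E) M)) W := by
    intro u
    have hc : ContMDiffOn 𝓘(ℝ, E') 𝓘(ℝ, E').tangent ∞
        (fun y => (⟨y, u⟩ : TangentBundle 𝓘(ℝ, E') E')) W :=
      contMDiffOn_vectorSpace_iff_contDiffOn.2 contDiffOn_const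
    refine (hT.comp hc fun y hy => hy).congr fun y hy => ?_
    simp [tangentMapWithin, mfderivWithin_of_mem_nhds (hW.mem_nhds hy)]
  have hg : ContMDiffOn 𝓘(ℝ, E') (𝓘(ℝ, E).prod 𝓘(ℝ, E →L[ℝ] E →L[ℝ] ℝ)) ∞
      (fun y => TotalSpace.mk' (E →L[ℝ] E →L[ℝ] ℝ)
        (E := fun x : M => TangentSpace 𝓘(ℝ, E) x →L[ℝ] TangentSpace 𝓘(ℝ, E) x →L[ℝ] ℝ)
        (Ψ y) (g.inner (Ψ y))) W := g.contMDiff.comp_contMDiffOn hΨ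
  have key : ContMDiffOn 𝓘(ℝ, E') (𝓘(ℝ, E).prod 𝓘(ℝ, ℝ)) ∞
      (fun y => TotalSpace.mk' ℝ (E := Bundle.Trivial M ℝ) (Ψ y)
        (g.inner (Ψ y) (mfderiv 𝓘(ℝ, E') 𝓘(ℝ, E) Ψ y u) (mfderiv 𝓘(ℝ, E') 𝓘(ℝ, E) Ψ y v))) W := by
    intro y hy
    exact ContMDiffWithinAt.clm_bundle_apply₂ (F₁ := E) (F₂ := E)
      (E₁ := fun x : M => TangentSpace 𝓘(ℝ, E) x) (E₂ := fun x : M => TangentSpace 𝓘(ℝ, E) x)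
      (hg y hy) (hsec u y hy) (hsec v y hy)
  intro y hy
  have := key y hy
  simp only [contMDiffWithinAt_totalSpace] at this
  exact this.2.contDiffWithinAt

theorem IsParam.isCoordMetric [FiniteDimensional ℝ E'] (g : SmoothMetric E M) {Ψ : E' → M}
    {W : Set E'} (h : IsParam E Ψ W) : IsCoordMetric (g.pull Ψ) W := by
  refine ⟨h.isOpen, contDiffOn_clm_apply.2 fun u => contDiffOn_clm_apply.2 fun v =>
    contDiffOn_pull_apply g h.isOpen h.contMDiffOn u v, ?_, ?_⟩
  · intro y _ v w
    exact g.symm (Ψ y) _ _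
  · intro y hy v hv
    exact g.pos (Ψ y) _ fun h0 => hv ((h.invertible y hy).injective (h0.trans (map_zero _).symm))

theorem isParam_extChartAt_symm (x : M) :
    IsParam E (extChartAt 𝓘(ℝ, E) x).symm (extChartAt 𝓘(ℝ, E) x).target := by
  refine ⟨isOpen_extChartAt_target x, contMDiffOn_extChartAt_symm x, fun y hy => ?_⟩
  have := isInvertible_mfderivWithin_extChartAt_symm (I := 𝓘(ℝ, E)) hy
  have e : mfderivWithin 𝓘(ℝ, E) 𝓘(ℝ, E) (extChartAt 𝓘(ℝ, E) x).symm
      (range 𝓘(ℝ, E)) y = mfderiv 𝓘(ℝ, E) 𝓘(ℝ, E) (extChartAt 𝓘(ℝ, E) x).symm y := by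
    rw [modelWithCornersSelf_coe, range_id, mfderivWithin_univ]
  rw [e] at this
  exact this

theorem isCoordMetric_inChart [FiniteDimensional ℝ E] (g : SmoothMetric E M) (x : M) :
    IsCoordMetric (g.inChart x) (extChartAt 𝓘(ℝ, E) x).target :=
  (isParam_extChartAt_symm x).isCoordMetric g

theorem paramDeriv_symm_comp {Ψ : E' → M} {W : Set E'} (h : IsParam E Ψ W) {y : E'} (hy : y ∈ W)
    {x : M} (hx : Ψ y ∈ (chartAt E x).source) (v : E') :
    paramDeriv E (extChartAt 𝓘(ℝ, E) x).symm (extChartAt 𝓘(ℝ, E) x (Ψ y))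
      (fderiv ℝ (extChartAt 𝓘(ℝ, E) x ∘ Ψ) y v) = paramDeriv E Ψ y v := by
  have hx' : Ψ y ∈ (extChartAt 𝓘(ℝ, E) x).source := by rwa [extChartAt_source]
  have d1 : MDifferentiableAt 𝓘(ℝ, E) 𝓘(ℝ, E) (extChartAt 𝓘(ℝ, E) x) (Ψ y) :=
    (contMDiffAt_extChartAt' (n := 1) hx).mdifferentiableAt (by simp)
  have dΨ := h.mdifferentiableAt hy
  have d2 : MDifferentiableAt 𝓘(ℝ, E) 𝓘(ℝ, E) (extChartAt 𝓘(ℝ, E) x).symm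
      ((extChartAt 𝓘(ℝ, E) x ∘ Ψ) y) :=
    (isParam_extChartAt_symm x).mdifferentiableAt ((extChartAt 𝓘(ℝ, E) x).map_source hx')
  have e : (extChartAt 𝓘(ℝ, E) x).symm ∘ (extChartAt 𝓘(ℝ, E) x ∘ Ψ) =ᶠ[𝓝 y] Ψ := by
    have : ∀ᶠ z in 𝓝 y, Ψ z ∈ (extChartAt 𝓘(ℝ, E) x).source :=
      dΨ.continuousAt.eventually ((isOpen_extChartAt_source x).mem_nhds hx')
    filter_upwards [this] with z hz using (extChartAt 𝓘(ℝ, E) x).left_inv hz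
  have hc := mfderiv_comp y d2 (d1.comp y dΨ)
  rw [e.mfderiv_eq, mfderiv_eq_fderiv (f := extChartAt 𝓘(ℝ, E) x ∘ Ψ)] at hc
  exact (congrArg (fun L : E' →L[ℝ] E => L v) hc).symm

/-- The passage from the preferred charts, in which the geometric quantities are defined, to
arbitrary parametrizations: the change of coordinates is a local isometry, so the invariance results
apply. -/
theorem isCoordIsometry_param [FiniteDimensional ℝ E] [FiniteDimensional ℝ E']
    (g : SmoothMetric E M) {Ψ : E' → M} {W : Set E'} (h : IsParam E Ψ W) (x : M) :
    IsCoordIsometry (g.pull Ψ) (W ∩ Ψ ⁻¹' (chartAt E x).source) (g.inChart x)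
      (extChartAt 𝓘(ℝ, E) x).target (extChartAt 𝓘(ℝ, E) x ∘ Ψ) := by
  have hopen : IsOpen (W ∩ Ψ ⁻¹' (chartAt E x).source) :=
    h.contMDiffOn.continuousOn.isOpen_inter_preimage h.isOpen (chartAt E x).open_source
  refine (isCoordMetric_inChart g x).pullback hopen ?_ ?_ ?_ ?_
  · rw [← contMDiffOn_iff_contDiffOn]
    exact contMDiffOn_extChartAt.comp (h.contMDiffOn.mono inter_subset_left) fun y hy => hy.2
  · intro y hy
    exact (extChartAt 𝓘(ℝ, E) x).map_source (by rw [extChartAt_source]; exact hy.2)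
  · intro y hy
    have d1 : MDifferentiableAt 𝓘(ℝ, E) 𝓘(ℝ, E) (extChartAt 𝓘(ℝ, E) x) (Ψ y) :=
      (contMDiffAt_extChartAt' (n := 1) hy.2).mdifferentiableAt (by simp)
    rw [← mfderiv_eq_fderiv, mfderiv_comp y d1 (h.mdifferentiableAt hy.1)]
    exact (isInvertible_mfderiv_extChartAt (by rw [extChartAt_source]; exact hy.2)).comp
      (h.invertible y hy.1)
  · intro y hy u v
    have hl : (extChartAt 𝓘(ℝ, E) x).symm ((extChartAt 𝓘(ℝ, E) x ∘ Ψ) y) = Ψ y :=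
      (extChartAt 𝓘(ℝ, E) x).left_inv (by rw [extChartAt_source]; exact hy.2)
    rw [SmoothMetric.inChart_eq_pull, SmoothMetric.pull_apply, SmoothMetric.pull_apply, hl]
    erw [paramDeriv_symm_comp h hy.1 hy.2, paramDeriv_symm_comp h hy.1 hy.2]

variable [FiniteDimensional ℝ E] [FiniteDimensional ℝ E'] {Ψ : E' → M} {W : Set E'} {y : E'}

/-- The tangent space at a point is identified with `E` through the preferred chart there, so that
chart has identity derivative at its own center. -/
theorem fderiv_extChartAt_comp_self (h : IsParam E Ψ W) (hy : y ∈ W) :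
    fderiv ℝ (extChartAt 𝓘(ℝ, E) (Ψ y) ∘ Ψ) y = paramDeriv E Ψ y := by
  have d1 : MDifferentiableAt 𝓘(ℝ, E) 𝓘(ℝ, E) (extChartAt 𝓘(ℝ, E) (Ψ y)) (Ψ y) :=
    (contMDiffAt_extChartAt (n := 1)).mdifferentiableAt (by simp)
  rw [← mfderiv_eq_fderiv, mfderiv_comp y d1 (h.mdifferentiableAt hy), mfderiv_extChartAt_self]
  rfl

theorem IsParam.mem_inter (hy : y ∈ W) :
    y ∈ W ∩ Ψ ⁻¹' (chartAt E (Ψ y)).source := ⟨hy, mem_chart_source E (Ψ y)⟩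

/-- The Ricci tensor may be computed in any parametrization. -/
theorem IsParam.ricci_eq (h : IsParam E Ψ W) (g : SmoothMetric E M) (hy : y ∈ W) (v w : E') :
    g.ricci (Ψ y) (paramDeriv E Ψ y v) (paramDeriv E Ψ y w) = coordRicci (g.pull Ψ) y v w := by
  rw [(isCoordIsometry_param g h (Ψ y)).map_ricci (IsParam.mem_inter hy),
    fderiv_extChartAt_comp_self h hy]
  rfl

theorem contDiffAt_comp_extChartAt_symm {φ : M → ℝ} {x : M}
    (hφ : ContMDiffAt 𝓘(ℝ, E) 𝓘(ℝ, ℝ) ∞ φ x) :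
    ContDiffAt ℝ ∞ (φ ∘ (extChartAt 𝓘(ℝ, E) x).symm) (extChartAt 𝓘(ℝ, E) x x) := by
  rw [← contMDiffAt_iff_contDiffAt]
  refine ContMDiffAt.comp_of_eq (x := extChartAt 𝓘(ℝ, E) x x) (y := x) hφ ?_
    (extChartAt_to_inv x)
  exact (contMDiffOn_extChartAt_symm x).contMDiffAt (extChartAt_target_mem_nhds x)

theorem IsParam.comp_eventuallyEq (h : IsParam E Ψ W) (hy : y ∈ W) (φ : M → ℝ) :
    (φ ∘ (extChartAt 𝓘(ℝ, E) (Ψ y)).symm) ∘ (extChartAt 𝓘(ℝ, E) (Ψ y) ∘ Ψ) =ᶠ[𝓝 y] φ ∘ Ψ := by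
  have : ∀ᶠ z in 𝓝 y, Ψ z ∈ (extChartAt 𝓘(ℝ, E) (Ψ y)).source :=
    (h.mdifferentiableAt hy).continuousAt.eventually (extChartAt_source_mem_nhds (Ψ y))
  filter_upwards [this] with z hz
  simp only [Function.comp_apply]
  rw [(extChartAt 𝓘(ℝ, E) (Ψ y)).left_inv hz]

/-- The Hessian may be computed in any parametrization. -/
theorem IsParam.hessian_eq (h : IsParam E Ψ W) (g : SmoothMetric E M) (hy : y ∈ W) {φ : M → ℝ}
    (hφ : ContMDiffAt 𝓘(ℝ, E) 𝓘(ℝ, ℝ) ∞ φ (Ψ y)) (v w : E') :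
    g.hessian φ (Ψ y) (paramDeriv E Ψ y v) (paramDeriv E Ψ y w)
      = coordHessian (g.pull Ψ) (φ ∘ Ψ) y v w := by
  have := (isCoordIsometry_param g h (Ψ y)).map_hessian (IsParam.mem_inter hy)
    ((contDiffAt_comp_extChartAt_symm hφ).of_le ENat.LEInfty.out) v w
  rw [coordHessian_congr _ (h.comp_eventuallyEq hy φ), fderiv_extChartAt_comp_self h hy] at this
  rw [this]
  rfl

theorem paramDeriv_extChartAt_symm_self (x : M) :
    paramDeriv E (extChartAt 𝓘(ℝ, E) x).symm (extChartAt 𝓘(ℝ, E) x x)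
      = ContinuousLinearMap.id ℝ E := by
  have d1 : MDifferentiableAt 𝓘(ℝ, E) 𝓘(ℝ, E) (extChartAt 𝓘(ℝ, E) x) x :=
    (contMDiffAt_extChartAt (n := 1)).mdifferentiableAt (by simp)
  have d2 : MDifferentiableAt 𝓘(ℝ, E) 𝓘(ℝ, E) (extChartAt 𝓘(ℝ, E) x).symm
      (extChartAt 𝓘(ℝ, E) x x) :=
    (isParam_extChartAt_symm x).mdifferentiableAt (mem_extChartAt_target x)
  have e : (extChartAt 𝓘(ℝ, E) x).symm ∘ extChartAt 𝓘(ℝ, E) x =ᶠ[𝓝 x] id := by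
    filter_upwards [extChartAt_source_mem_nhds (I := 𝓘(ℝ, E)) x] with z hz
      using (extChartAt 𝓘(ℝ, E) x).left_inv hz
  have hc := mfderiv_comp x d2 d1
  rw [e.mfderiv_eq, mfderiv_id, mfderiv_extChartAt_self] at hc
  exact hc.symm

theorem inChart_self (g : SmoothMetric E M) (x : M) :
    g.inChart x (extChartAt 𝓘(ℝ, E) x x) = g.form x := by
  ext u v
  rw [SmoothMetric.inChart_eq_pull, SmoothMetric.pull_apply, paramDeriv_extChartAt_symm_self,
    extChartAt_to_inv]
  rfl

theorem mfderiv_eq_fderiv_comp_symm {φ : M → ℝ} {x : M}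
    (hφ : MDifferentiableAt 𝓘(ℝ, E) 𝓘(ℝ, ℝ) φ x) :
    mfderiv 𝓘(ℝ, E) 𝓘(ℝ, ℝ) φ x
      = fderiv ℝ (φ ∘ (extChartAt 𝓘(ℝ, E) x).symm) (extChartAt 𝓘(ℝ, E) x x) := by
  rw [hφ.mfderiv, modelWithCornersSelf_coe, range_id, fderivWithin_univ]
  rfl

theorem SmoothMetric.gradient_eq_inChart (g : SmoothMetric E M) {φ : M → ℝ} {x : M}
    (hφ : MDifferentiableAt 𝓘(ℝ, E) 𝓘(ℝ, ℝ) φ x) :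
    g.gradient φ x = coordGrad (g.inChart x) (φ ∘ (extChartAt 𝓘(ℝ, E) x).symm)
      (extChartAt 𝓘(ℝ, E) x x) := by
  rw [coordGrad, inChart_self, ← mfderiv_eq_fderiv_comp_symm hφ]
  rfl

theorem gradInner_eq_inChart (g : SmoothMetric E M) {φ f : M → ℝ} {x : M}
    (hφ : MDifferentiableAt 𝓘(ℝ, E) 𝓘(ℝ, ℝ) φ x) (hf : MDifferentiableAt 𝓘(ℝ, E) 𝓘(ℝ, ℝ) f x) :
    g.gradInner φ f x = coordGradInner (g.inChart x) (φ ∘ (extChartAt 𝓘(ℝ, E) x).symm)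
      (f ∘ (extChartAt 𝓘(ℝ, E) x).symm) (extChartAt 𝓘(ℝ, E) x x) := by
  rw [coordGradInner, ← g.gradient_eq_inChart hφ, ← g.gradient_eq_inChart hf, inChart_self]
  rfl

theorem laplacian_eq_inChart (g : SmoothMetric E M) (φ : M → ℝ) (x : M) :
    g.laplacian φ x = coordLaplacian (g.inChart x) (φ ∘ (extChartAt 𝓘(ℝ, E) x).symm)
      (extChartAt 𝓘(ℝ, E) x x) := by
  rw [(isCoordMetric_inChart g x).coordLaplacian_eq_sum (mem_extChartAt_target x), inChart_self]
  rfl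

theorem IsParam.gradInner_eq (h : IsParam E Ψ W) (g : SmoothMetric E M) (hy : y ∈ W)
    {φ f : M → ℝ} (hφ : ContMDiffAt 𝓘(ℝ, E) 𝓘(ℝ, ℝ) ∞ φ (Ψ y))
    (hf : ContMDiffAt 𝓘(ℝ, E) 𝓘(ℝ, ℝ) ∞ f (Ψ y)) :
    g.gradInner φ f (Ψ y) = coordGradInner (g.pull Ψ) (φ ∘ Ψ) (f ∘ Ψ) y := by
  rw [gradInner_eq_inChart g (hφ.mdifferentiableAt (by simp)) (hf.mdifferentiableAt (by simp)),
    ← coordGradInner_congr _ (h.comp_eventuallyEq hy φ) (h.comp_eventuallyEq hy f),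
    (isCoordIsometry_param g h (Ψ y)).map_coordGradInner (IsParam.mem_inter hy)
      ((contDiffAt_comp_extChartAt_symm hφ).differentiableAt (by simp))
      ((contDiffAt_comp_extChartAt_symm hf).differentiableAt (by simp))]
  rfl

theorem IsParam.laplacian_eq (h : IsParam E Ψ W) (g : SmoothMetric E M) (hy : y ∈ W)
    {φ : M → ℝ} (hφ : ContMDiffAt 𝓘(ℝ, E) 𝓘(ℝ, ℝ) ∞ φ (Ψ y)) :
    g.laplacian φ (Ψ y) = coordLaplacian (g.pull Ψ) (φ ∘ Ψ) y := by
  rw [laplacian_eq_inChart, ← coordLaplacian_congr _ (h.comp_eventuallyEq hy φ),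
    (isCoordIsometry_param g h (Ψ y)).map_coordLaplacian (IsParam.mem_inter hy)
      ((contDiffAt_comp_extChartAt_symm hφ).of_le ENat.LEInfty.out)]
  rfl

end Param

/-! ### Derivatives as maps between model spaces -/

section ModelDeriv

variable {E₁ E₂ E₃ : Type*} [NormedAddCommGroup E₁] [NormedSpace ℝ E₁]
  [NormedAddCommGroup E₂] [NormedSpace ℝ E₂] [NormedAddCommGroup E₃] [NormedSpace ℝ E₃]
  {M₁ M₂ M₃ : Type*} [TopologicalSpace M₁] [ChartedSpace E₁ M₁] [TopologicalSpace M₂]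
  [ChartedSpace E₂ M₂] [TopologicalSpace M₃] [ChartedSpace E₃ M₃]

variable (E₁ E₂) in
/-- The derivative of a map between manifolds, as a map between the model spaces. -/
def modelDeriv (f : M₁ → M₂) (x : M₁) : E₁ →L[ℝ] E₂ := mfderiv 𝓘(ℝ, E₁) 𝓘(ℝ, E₂) f x

theorem modelDeriv_comp {g : M₂ → M₃} {f : M₁ → M₂} {x : M₁}
    (hg : MDifferentiableAt 𝓘(ℝ, E₂) 𝓘(ℝ, E₃) g (f x))
    (hf : MDifferentiableAt 𝓘(ℝ, E₁) 𝓘(ℝ, E₂) f x) (v : E₁) :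
    modelDeriv E₁ E₃ (g ∘ f) x v = modelDeriv E₂ E₃ g (f x) (modelDeriv E₁ E₂ f x v) :=
  mfderiv_comp_apply x hg hf v

theorem modelDeriv_congr {f f' : M₁ → M₂} {x : M₁} (h : f =ᶠ[𝓝 x] f') :
    modelDeriv E₁ E₂ f x = modelDeriv E₁ E₂ f' x :=
  h.mfderiv_eq

theorem modelDeriv_id (x : M₁) (v : E₁) : modelDeriv E₁ E₁ (id : M₁ → M₁) x v = v := by
  rw [modelDeriv, mfderiv_id]; rfl

theorem modelDeriv_const (c : M₂) (x : M₁) : modelDeriv E₁ E₂ (fun _ => c) x = 0 :=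
  mfderiv_const

end ModelDeriv

/-! ### The local structure of a warped flat bundle -/

section Local

theorem AssociatedBundle.mk_smul_left {G P F : Type*} [Group G] [MulAction G P] [MulAction G F]
    (a : G) (p : P) (x : F) : mk G (a • p) x = mk G p (a⁻¹ • x) := by
  refine Quotient.sound ⟨a, ?_⟩
  simp [Prod.smul_def]

@[simp]
theorem AssociatedBundle.proj_mk {G P F B : Type*} [Group G] [MulAction G P] [MulAction G F]
    (pr : P → B) (h : ∀ (a : G) (p : P), pr (a • p) = pr p) (p : P) (x : F) :
    proj pr h (mk G p x) = pr p := rfl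

theorem AssociatedBundle.exists_rep {G P F : Type*} [Group G] [MulAction G P] [MulAction G F]
    (z : AssociatedBundle G P F) : ∃ p x, z = mk G p x := by
  obtain ⟨⟨p, x⟩, rfl⟩ := Quotient.exists_rep z
  exact ⟨p, x, rfl⟩

variable {EB EF EG EP EM : Type*} [NormedAddCommGroup EB] [NormedSpace ℝ EB]
  [NormedAddCommGroup EF] [NormedSpace ℝ EF] [NormedAddCommGroup EG] [NormedSpace ℝ EG]
  [NormedAddCommGroup EP] [NormedSpace ℝ EP] [NormedAddCommGroup EM] [NormedSpace ℝ EM]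
  {B : Type*} [TopologicalSpace B] [ChartedSpace EB B] [IsManifold 𝓘(ℝ, EB) ∞ B]
  {F : Type*} [TopologicalSpace F] [ChartedSpace EF F] [IsManifold 𝓘(ℝ, EF) ∞ F]
  {G : Type*} [TopologicalSpace G] [ChartedSpace EG G] [Group G]
  {P : Type*} [TopologicalSpace P] [ChartedSpace EP P] [MulAction G P] [MulAction G F]
  [ChartedSpace EM (AssociatedBundle G P F)]

/-- `s` is a smooth section on `U` of `pr : P → B`, tangent to the distribution `H`. -/
structure IsFlatSection (EB EP : Type*) [NormedAddCommGroup EB] [NormedSpace ℝ EB]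
    [NormedAddCommGroup EP] [NormedSpace ℝ EP]
    {B : Type*} [TopologicalSpace B] [ChartedSpace EB B]
    {P : Type*} [TopologicalSpace P] [ChartedSpace EP P]
    (pr : P → B) (H : ∀ p : P, Submodule ℝ (TangentSpace 𝓘(ℝ, EP) p)) (s : B → P) (U : Set B) :
    Prop where
  isOpen : IsOpen U
  contMDiffOn : ContMDiffOn 𝓘(ℝ, EB) 𝓘(ℝ, EP) ∞ s U
  section_eq : ∀ b ∈ U, pr (s b) = b
  range_eq : ∀ b ∈ U, LinearMap.range (mfderiv 𝓘(ℝ, EB) 𝓘(ℝ, EP) s b).toLinearMap = H (s b)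

theorem IsFlatConnection.exists_section {pr : P → B}
    {H : ∀ p : P, Submodule ℝ (TangentSpace 𝓘(ℝ, EP) p)} (h : IsFlatConnection EB EP G pr H)
    (p : P) : ∃ s U, IsFlatSection EB EP pr H s U ∧ pr p ∈ U ∧ s (pr p) = p := by
  obtain ⟨U, s, hU, hp, hsp, hs, h'⟩ := h.integrable p
  exact ⟨s, U, ⟨hU, hs, fun b hb => (h' b hb).1, fun b hb => (h' b hb).2⟩, hp, hsp⟩

section Section

variable {pr : P → B} {H : ∀ p : P, Submodule ℝ (TangentSpace 𝓘(ℝ, EP) p)} {s : B → P} {U : Set B}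

theorem IsFlatSection.mdifferentiableAt (h : IsFlatSection EB EP pr H s U) {b : B} (hb : b ∈ U) :
    MDifferentiableAt 𝓘(ℝ, EB) 𝓘(ℝ, EP) s b :=
  (h.contMDiffOn.contMDiffAt (h.isOpen.mem_nhds hb)).mdifferentiableAt (by simp)

theorem IsFlatSection.modelDeriv_mem (h : IsFlatSection EB EP pr H s U) {b : B} (hb : b ∈ U)
    (v : EB) : modelDeriv EB EP s b v ∈ H (s b) := by
  rw [← h.range_eq b hb]
  exact ⟨v, rfl⟩

theorem IsFlatSection.exists_of_mem (h : IsFlatSection EB EP pr H s U) {b : B} (hb : b ∈ U)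
    {w : EP} (hw : w ∈ H (s b)) : ∃ v : EB, modelDeriv EB EP s b v = w := by
  rw [← h.range_eq b hb] at hw
  exact hw

theorem IsFlatSection.modelDeriv_proj (h : IsFlatSection EB EP pr H s U)
    (hpr : ContMDiff 𝓘(ℝ, EP) 𝓘(ℝ, EB) ∞ pr) {b : B} (hb : b ∈ U) (v : EB) :
    modelDeriv EP EB pr (s b) (modelDeriv EB EP s b v) = v := by
  rw [← modelDeriv_comp (hpr.mdifferentiableAt (by simp)) (h.mdifferentiableAt hb)]
  have : pr ∘ s =ᶠ[𝓝 b] id := by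
    filter_upwards [h.isOpen.mem_nhds hb] with z hz using h.section_eq z hz
  rw [modelDeriv_congr this, modelDeriv_id]

end Section

theorem contMDiff_mk_left
    (hq : ContMDiff (𝓘(ℝ, EP).prod 𝓘(ℝ, EF)) 𝓘(ℝ, EM) ∞
      (fun z : P × F => AssociatedBundle.mk G z.1 z.2)) (x : F) :
    ContMDiff 𝓘(ℝ, EP) 𝓘(ℝ, EM) ∞ (fun p : P => AssociatedBundle.mk G p x) :=
  hq.comp (contMDiff_id.prodMk contMDiff_const)

theorem contMDiff_mk_right
    (hq : ContMDiff (𝓘(ℝ, EP).prod 𝓘(ℝ, EF)) 𝓘(ℝ, EM) ∞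
      (fun z : P × F => AssociatedBundle.mk G z.1 z.2)) (p : P) :
    ContMDiff 𝓘(ℝ, EF) 𝓘(ℝ, EM) ∞ (fun x : F => AssociatedBundle.mk G p x) :=
  hq.comp (contMDiff_const.prodMk contMDiff_id)

theorem mfderiv_mk_apply
    (hq : ContMDiff (𝓘(ℝ, EP).prod 𝓘(ℝ, EF)) 𝓘(ℝ, EM) ∞
      (fun z : P × F => AssociatedBundle.mk G z.1 z.2)) (p : P) (x : F) (v : EP) (ξ : EF) :
    mfderiv (𝓘(ℝ, EP).prod 𝓘(ℝ, EF)) 𝓘(ℝ, EM)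
      (fun z : P × F => AssociatedBundle.mk G z.1 z.2) (p, x) (v, ξ)
    = modelDeriv EP EM (fun p' => AssociatedBundle.mk G p' x) p v
      + modelDeriv EF EM (fun x' => AssociatedBundle.mk G p x') x ξ :=
  mfderiv_prod_eq_add_apply (f := fun z : P × F => AssociatedBundle.mk G z.1 z.2) (p := (p, x))
    (v := (v, ξ)) (hq.mdifferentiableAt (by simp))

/-- The image in the associated bundle of a vertical vector of the principal bundle is tangent to
the fiber. -/
theorem exists_fiber_of_vertical [LieGroup 𝓘(ℝ, EG) ∞ G]
    [ContMDiffSMul 𝓘(ℝ, EG) 𝓘(ℝ, EF) ∞ G F] {pr : P → B} (hpr : IsPrincipalBundle EB EG EP G pr)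
    (hq : ContMDiff (𝓘(ℝ, EP).prod 𝓘(ℝ, EF)) 𝓘(ℝ, EM) ∞
      (fun z : P × F => AssociatedBundle.mk G z.1 z.2)) (p : P) (x : F) (v : EP)
    (hv : modelDeriv EP EB pr p v = 0) :
    ∃ ξ : EF, modelDeriv EP EM (fun p' => AssociatedBundle.mk G p' x) p v
      = modelDeriv EF EM (fun x' => AssociatedBundle.mk G p x') x ξ := by
  obtain ⟨U, Φ, hU, hpU, hsrc, htgt, hΦ, hΦs, hΦ'⟩ := hpr.exists_trivialization (pr p)
  have hp : p ∈ Φ.source := by rw [hsrc]; exact hpU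
  set g₀ := (Φ p).2 with hg₀
  have hΦp : Φ p = (pr p, g₀) := Prod.ext (hΦ' p hp).1 rfl
  have hmem : ∀ a : G, (pr p, a) ∈ Φ.target := fun a => by rw [htgt]; exact ⟨hpU, trivial⟩
  -- the fiber coordinate and the inclusion of the fiber
  let γ : P → G := fun p' => (Φ p').2
  let κ : G → P := fun a => Φ.symm (pr p, a)
  have hγ : MDifferentiableAt 𝓘(ℝ, EP) 𝓘(ℝ, EG) γ p :=
    (contMDiff_snd.contMDiffAt.comp p
      (hΦ.contMDiffAt (Φ.open_source.mem_nhds hp))).mdifferentiableAt (by simp)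
  have hprd : MDifferentiableAt 𝓘(ℝ, EP) 𝓘(ℝ, EB) pr p := hpr.contMDiff.mdifferentiableAt (by simp)
  have hR : MDifferentiableAt (𝓘(ℝ, EB).prod 𝓘(ℝ, EG)) 𝓘(ℝ, EP) Φ.symm (pr p, g₀) :=
    (hΦs.contMDiffAt (Φ.open_target.mem_nhds (hmem g₀))).mdifferentiableAt (by simp)
  have hκ : MDifferentiableAt 𝓘(ℝ, EG) 𝓘(ℝ, EP) κ g₀ :=
    hR.comp g₀ (mdifferentiableAt_const.prodMk mdifferentiableAt_id)
  have hκ0 : κ g₀ = p := by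
    change Φ.symm (pr p, g₀) = p
    rw [← hΦp]; exact Φ.left_inv hp
  -- `v` is the image of a tangent vector of `G`
  have hvκ : v = modelDeriv EG EP κ g₀ (modelDeriv EP EG γ p v) := by
    have e : (Φ.symm ∘ fun p' => (pr p', γ p')) =ᶠ[𝓝 p] id := by
      filter_upwards [Φ.open_source.mem_nhds hp] with z hz
      have : Φ z = (pr z, γ z) := Prod.ext (hΦ' z hz).1 rfl
      simp only [Function.comp_apply, id, ← this]
      exact Φ.left_inv hz
    have h1 := mfderiv_comp_apply (I := 𝓘(ℝ, EP)) (I' := 𝓘(ℝ, EB).prod 𝓘(ℝ, EG))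
      (I'' := 𝓘(ℝ, EP)) (g := Φ.symm) (f := fun p' => (pr p', γ p')) p hR (hprd.prodMk hγ) v
    rw [e.mfderiv_eq, mfderiv_id, hprd.mfderiv_prod hγ] at h1
    have h2 := mfderiv_prod_eq_add_apply (f := Φ.symm) (p := (pr p, g₀))
      (v := ((0 : EB), modelDeriv EP EG γ p v)) hR
    have h3 : ((mfderiv 𝓘(ℝ, EP) 𝓘(ℝ, EB) pr p).prod (mfderiv 𝓘(ℝ, EP) 𝓘(ℝ, EG) γ p)) v
        = ((0 : EB), modelDeriv EP EG γ p v) := Prod.ext hv rfl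
    let L : EB × EG →L[ℝ] EP := mfderiv (𝓘(ℝ, EB).prod 𝓘(ℝ, EG)) 𝓘(ℝ, EP) Φ.symm (pr p, g₀)
    have h1' : v = L ((0 : EB), modelDeriv EP EG γ p v) := Eq.trans h1 (congrArg L h3)
    have h2' : L ((0 : EB), modelDeriv EP EG γ p v)
        = modelDeriv EB EP (fun b => Φ.symm (b, g₀)) (pr p) 0
          + modelDeriv EG EP κ g₀ (modelDeriv EP EG γ p v) := h2
    rw [map_zero, zero_add] at h2'
    exact h1'.trans h2'
  -- on the fiber, moving in `P` amounts to moving in `F`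
  let ρ : G → F := fun a => (g₀ * a⁻¹) • x
  have hρ : MDifferentiableAt 𝓘(ℝ, EG) 𝓘(ℝ, EF) ρ g₀ := by
    have h1 : ContMDiff 𝓘(ℝ, EG) 𝓘(ℝ, EG) ∞ fun a : G => g₀ * a⁻¹ :=
      contMDiff_const.mul (contMDiff_id.inv)
    have h2 : ContMDiff 𝓘(ℝ, EG) 𝓘(ℝ, EF) ∞ ρ := h1.smul contMDiff_const
    exact h2.mdifferentiableAt (by simp)
  have hρ0 : ρ g₀ = x := by simp [ρ]
  have hκa : ∀ a, κ a = (a * g₀⁻¹) • p := by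
    intro a
    have h1 : (a * g₀⁻¹) • p ∈ Φ.source := by
      rw [hsrc, mem_preimage, hpr.map_smul]; exact hpU
    have h2 : Φ ((a * g₀⁻¹) • p) = (pr p, a) := by
      rw [(hΦ' p hp).2 (a * g₀⁻¹), ← hg₀]; simp
    change Φ.symm (pr p, a) = _
    rw [← h2]; exact Φ.left_inv h1
  have hcomm : (fun p' => AssociatedBundle.mk G p' x) ∘ κ
      = (fun x' => AssociatedBundle.mk G p x') ∘ ρ := by
    ext a
    simp only [Function.comp_apply, hκa, ρ]
    rw [AssociatedBundle.mk_smul_left]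
    simp
  have hml := contMDiff_mk_left hq x
  have hmr := contMDiff_mk_right hq p
  refine ⟨modelDeriv EG EF ρ g₀ (modelDeriv EP EG γ p v), ?_⟩
  have k1 := modelDeriv_comp (E₁ := EG) (g := fun p' => AssociatedBundle.mk G p' x) (f := κ)
    (hml.mdifferentiableAt (by simp)) hκ (modelDeriv EP EG γ p v)
  have k2 := modelDeriv_comp (E₁ := EG) (g := fun x' => AssociatedBundle.mk G p x') (f := ρ)
    (hmr.mdifferentiableAt (by simp)) hρ (modelDeriv EP EG γ p v)
  rw [← hvκ, hκ0, hcomm, k2, hρ0] at k1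
  exact k1.symm

end Local

/-! ### Dependence on the germ of the metric -/

section CongrMetric

variable {E : Type*} [NormedAddCommGroup E] [NormedSpace ℝ E] {G G' : E → E →L[ℝ] E →L[ℝ] ℝ} {y : E}

theorem christoffel_congr_metric (h : G =ᶠ[𝓝 y] G') (u v : E) :
    (fun z => christoffel G z u v) =ᶠ[𝓝 y] fun z => christoffel G' z u v := by
  filter_upwards [h, h.fderiv (𝕜 := ℝ)] with z h1 h2
  rw [christoffel, christoffel, h1, h2]

theorem coordCurvature_congr_metric (h : G =ᶠ[𝓝 y] G') (u v w : E) :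
    coordCurvature G y u v w = coordCurvature G' y u v w := by
  have e : ∀ u v, christoffel G y u v = christoffel G' y u v := fun u v =>
    (christoffel_congr_metric h u v).eq_of_nhds
  rw [coordCurvature, coordCurvature, (christoffel_congr_metric h v w).fderiv_eq,
    (christoffel_congr_metric h u w).fderiv_eq, e, e, e, e]

theorem coordRicci_congr_metric [FiniteDimensional ℝ E] (h : G =ᶠ[𝓝 y] G') (v w : E) :
    coordRicci G y v w = coordRicci G' y v w := by
  simp only [coordRicci, coordCurvature_congr_metric h]

theorem coordHessian_congr_metric (h : G =ᶠ[𝓝 y] G') (φ : E → ℝ) (v w : E) :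
    coordHessian G φ y v w = coordHessian G' φ y v w := by
  rw [coordHessian, coordHessian, (christoffel_congr_metric h v w).eq_of_nhds]

theorem coordLaplacian_congr_metric (h : G =ᶠ[𝓝 y] G') (φ : E → ℝ) :
    coordLaplacian G φ y = coordLaplacian G' φ y := by
  have : coordHessianCLM G φ y = coordHessianCLM G' φ y := by
    ext v w
    rw [coordHessianCLM_apply, coordHessianCLM_apply, coordHessian_congr_metric h]
  rw [coordLaplacian, coordLaplacian, this, h.eq_of_nhds]

theorem coordGradInner_congr_metric (h : G =ᶠ[𝓝 y] G') (φ f : E → ℝ) :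
    coordGradInner G φ f y = coordGradInner G' φ f y := by
  rw [coordGradInner, coordGradInner, coordGrad, coordGrad, coordGrad, coordGrad, h.eq_of_nhds]

end CongrMetric

/-! ### Warped flat bundles in the coordinates of a flat section -/

section Warped

variable {EB EF EG EP EM : Type*} [NormedAddCommGroup EB] [NormedSpace ℝ EB]
  [NormedAddCommGroup EF] [NormedSpace ℝ EF] [NormedAddCommGroup EG] [NormedSpace ℝ EG]
  [NormedAddCommGroup EP] [NormedSpace ℝ EP] [NormedAddCommGroup EM] [NormedSpace ℝ EM]
  {B : Type*} [TopologicalSpace B] [ChartedSpace EB B] [IsManifold 𝓘(ℝ, EB) ∞ B]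
  {F : Type*} [TopologicalSpace F] [ChartedSpace EF F] [IsManifold 𝓘(ℝ, EF) ∞ F]
  {G : Type*} [TopologicalSpace G] [ChartedSpace EG G] [Group G]
  {P : Type*} [TopologicalSpace P] [ChartedSpace EP P] [MulAction G P] [MulAction G F]
  [ChartedSpace EM (AssociatedBundle G P F)] [IsManifold 𝓘(ℝ, EM) ∞ (AssociatedBundle G P F)]

/-- A warped flat bundle: the associated bundle of a flat principal bundle, with a warped metric. -/
structure IsWarpedFlatBundle (EG : Type*) [NormedAddCommGroup EG] [NormedSpace ℝ EG]
    [ChartedSpace EG G] (pr : P → B)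
    (H : ∀ p : P, Submodule ℝ (TangentSpace 𝓘(ℝ, EP) p))
    (gB : SmoothMetric EB B) (gF : SmoothMetric EF F) (f : B → ℝ)
    (g : SmoothMetric EM (AssociatedBundle G P F)) : Prop where
  principal : IsPrincipalBundle EB EG EP G pr
  flat : IsFlatConnection EB EP G pr H
  smooth_quotient : IsQuotientSmoothStructure EF EP EM F G P
  smooth_warping : ContMDiff 𝓘(ℝ, EB) 𝓘(ℝ, ℝ) ∞ f
  warping_pos : ∀ b, 0 < f b
  warped : IsWarpedBundleMetric pr H gB gF f g

variable {pr : P → B} {H : ∀ p : P, Submodule ℝ (TangentSpace 𝓘(ℝ, EP) p)}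
  {gB : SmoothMetric EB B} {gF : SmoothMetric EF F} {f : B → ℝ}
  {g : SmoothMetric EM (AssociatedBundle G P F)} {s : B → P} {U : Set B}
  {α : EB → B} {β : EF → F} {WB : Set EB} {WF : Set EF} {y : EB × EF}

variable (G) in
/-- The parametrization of the associated bundle given by a section of the principal bundle and
parametrizations of the base and of the fiber. -/
def bundleParam (s : B → P) (α : EB → B) (β : EF → F) (y : EB × EF) : AssociatedBundle G P F :=
  AssociatedBundle.mk G (s (α y.1)) (β y.2)

/-- A flat section together with parametrizations of the base and of the fiber. -/
structure IsBundleParam (EB EF EP : Type*) [NormedAddCommGroup EB] [NormedSpace ℝ EB]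
    [NormedAddCommGroup EF] [NormedSpace ℝ EF]
    [NormedAddCommGroup EP] [NormedSpace ℝ EP]
    {B : Type*} [TopologicalSpace B] [ChartedSpace EB B]
    {F : Type*} [TopologicalSpace F] [ChartedSpace EF F]
    {P : Type*} [TopologicalSpace P] [ChartedSpace EP P]
    (pr : P → B) (H : ∀ p : P, Submodule ℝ (TangentSpace 𝓘(ℝ, EP) p)) (s : B → P) (U : Set B)
    (α : EB → B) (WB : Set EB) (β : EF → F) (WF : Set EF) : Prop where
  flatSection : IsFlatSection EB EP pr H s U
  base : IsParam EB α WB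
  fiber : IsParam EF β WF
  mapsTo : MapsTo α WB U

theorem modelDeriv_eq_fderiv {E₁ E₂ : Type*} [NormedAddCommGroup E₁] [NormedSpace ℝ E₁]
    [NormedAddCommGroup E₂] [NormedSpace ℝ E₂] (f : E₁ → E₂) (x : E₁) :
    modelDeriv E₁ E₂ f x = fderiv ℝ f x := mfderiv_eq_fderiv

namespace IsBundleParam

theorem contMDiffOn_left (h : IsBundleParam EB EF EP pr H s U α WB β WF) :
    ContMDiffOn 𝓘(ℝ, EB × EF) 𝓘(ℝ, EP) ∞ (fun y : EB × EF => s (α y.1)) (WB ×ˢ WF) :=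
  (h.flatSection.contMDiffOn.comp h.base.contMDiffOn h.mapsTo).comp
    (contDiff_fst (E := EB) (F := EF)).contMDiff.contMDiffOn fun _ hy => hy.1

theorem contMDiffOn_right (h : IsBundleParam EB EF EP pr H s U α WB β WF) :
    ContMDiffOn 𝓘(ℝ, EB × EF) 𝓘(ℝ, EF) ∞ (fun y : EB × EF => β y.2) (WB ×ˢ WF) :=
  h.fiber.contMDiffOn.comp (contDiff_snd (E := EB) (F := EF)).contMDiff.contMDiffOn
    fun _ hy => hy.2

theorem isOpen_prod (h : IsBundleParam EB EF EP pr H s U α WB β WF) : IsOpen (WB ×ˢ WF) :=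
  h.base.isOpen.prod h.fiber.isOpen

theorem modelDeriv_left (h : IsBundleParam EB EF EP pr H s U α WB β WF) (hy : y ∈ WB ×ˢ WF)
    (V : EB × EF) : modelDeriv (EB × EF) EP (fun y : EB × EF => s (α y.1)) y V
      = modelDeriv EB EP s (α y.1) (paramDeriv EB α y.1 V.1) := by
  have hα := h.base.mdifferentiableAt hy.1
  have hs := h.flatSection.mdifferentiableAt (h.mapsTo hy.1)
  have hf : MDifferentiableAt 𝓘(ℝ, EB × EF) 𝓘(ℝ, EB) (Prod.fst : EB × EF → EB) y :=
    differentiableAt_fst.mdifferentiableAt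
  have := modelDeriv_comp (E₁ := EB × EF) (E₂ := EB) (E₃ := EP) (g := s ∘ α)
    (f := (Prod.fst : EB × EF → EB)) (x := y) (hs.comp _ hα) hf V
  rw [modelDeriv_comp (E₂ := EB) hs hα, modelDeriv_eq_fderiv, fderiv_fst] at this
  exact this

theorem modelDeriv_right (h : IsBundleParam EB EF EP pr H s U α WB β WF) (hy : y ∈ WB ×ˢ WF)
    (V : EB × EF) : modelDeriv (EB × EF) EF (fun y : EB × EF => β y.2) y V
      = paramDeriv EF β y.2 V.2 := by
  have hβ := h.fiber.mdifferentiableAt hy.2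
  have hf : MDifferentiableAt 𝓘(ℝ, EB × EF) 𝓘(ℝ, EF) (Prod.snd : EB × EF → EF) y :=
    differentiableAt_snd.mdifferentiableAt
  have := modelDeriv_comp (E₁ := EB × EF) (E₂ := EF) (E₃ := EF) (g := β)
    (f := (Prod.snd : EB × EF → EF)) (x := y) hβ hf V
  rw [modelDeriv_eq_fderiv, fderiv_snd] at this
  exact this

end IsBundleParam

namespace IsWarpedFlatBundle

theorem contMDiffOn_bundleParam (hM : IsWarpedFlatBundle EG pr H gB gF f g)
    (h : IsBundleParam EB EF EP pr H s U α WB β WF) :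
    ContMDiffOn 𝓘(ℝ, EB × EF) 𝓘(ℝ, EM) ∞ (bundleParam G s α β) (WB ×ˢ WF) :=
  hM.smooth_quotient.1.comp_contMDiffOn (h.contMDiffOn_left.prodMk h.contMDiffOn_right)

theorem paramDeriv_bundleParam (hM : IsWarpedFlatBundle EG pr H gB gF f g)
    (h : IsBundleParam EB EF EP pr H s U α WB β WF) (hy : y ∈ WB ×ˢ WF) (V : EB × EF) :
    paramDeriv EM (bundleParam G s α β) y V
      = modelDeriv EP EM (fun p => AssociatedBundle.mk G p (β y.2)) (s (α y.1))
          (modelDeriv EB EP s (α y.1) (paramDeriv EB α y.1 V.1))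
        + modelDeriv EF EM (fun x => AssociatedBundle.mk G (s (α y.1)) x) (β y.2)
          (paramDeriv EF β y.2 V.2) := by
  have h1 : MDifferentiableAt 𝓘(ℝ, EB × EF) 𝓘(ℝ, EP) (fun y : EB × EF => s (α y.1)) y :=
    (h.contMDiffOn_left.contMDiffAt (h.isOpen_prod.mem_nhds hy)).mdifferentiableAt (by simp)
  have h2 : MDifferentiableAt 𝓘(ℝ, EB × EF) 𝓘(ℝ, EF) (fun y : EB × EF => β y.2) y :=
    (h.contMDiffOn_right.contMDiffAt (h.isOpen_prod.mem_nhds hy)).mdifferentiableAt (by simp)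
  have h3 := mfderiv_comp_apply (I := 𝓘(ℝ, EB × EF)) (I' := 𝓘(ℝ, EP).prod 𝓘(ℝ, EF))
    (I'' := 𝓘(ℝ, EM)) (g := fun z : P × F => AssociatedBundle.mk G z.1 z.2)
    (f := fun y : EB × EF => (s (α y.1), β y.2)) y
    (hM.smooth_quotient.1.mdifferentiableAt (by simp)) (h1.prodMk h2) V
  rw [h1.mfderiv_prod h2] at h3
  rw [← h.modelDeriv_left hy, ← h.modelDeriv_right hy]
  exact Eq.trans h3 (mfderiv_mk_apply hM.smooth_quotient.1 (s (α y.1)) (β y.2) _ _)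

variable [FiniteDimensional ℝ EB] [FiniteDimensional ℝ EF]

/-- The derivative of the section sends base vectors into `H`, and `pr` sends them back to
themselves. So the defining property of the warped metric applies and yields exactly the product
formula. -/
theorem pull_eq (hM : IsWarpedFlatBundle EG pr H gB gF f g)
    (h : IsBundleParam EB EF EP pr H s U α WB β WF) (hy : y ∈ WB ×ˢ WF) :
    g.pull (bundleParam G s α β) y = warpedMetric (gB.pull α) (gF.pull β) (f ∘ α) y := by
  refine ContinuousLinearMap.ext fun V => ContinuousLinearMap.ext fun W => ?_
  have hb := h.mapsTo hy.1
  have hV := h.flatSection.modelDeriv_mem hb (paramDeriv EB α y.1 V.1)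
  have hW := h.flatSection.modelDeriv_mem hb (paramDeriv EB α y.1 W.1)
  have key := hM.warped (s (α y.1)) (β y.2) _ hV _ hW (paramDeriv EF β y.2 V.2)
    (paramDeriv EF β y.2 W.2)
  have e := fun v => h.flatSection.modelDeriv_proj hM.principal.contMDiff hb v
  have e1 := h.flatSection.section_eq _ hb
  rw [SmoothMetric.pull_apply, hM.paramDeriv_bundleParam h hy, hM.paramDeriv_bundleParam h hy,
    warpedMetric_apply, SmoothMetric.pull_apply, SmoothMetric.pull_apply]
  have key' : g.form (bundleParam G s α β y) _ _ = gB.form (pr (s (α y.1)))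
      (modelDeriv EP EB pr (s (α y.1)) (modelDeriv EB EP s (α y.1) (paramDeriv EB α y.1 V.1)))
      (modelDeriv EP EB pr (s (α y.1)) (modelDeriv EB EP s (α y.1) (paramDeriv EB α y.1 W.1)))
      + f (pr (s (α y.1))) ^ 2 * gF.form (β y.2) (paramDeriv EF β y.2 V.2)
          (paramDeriv EF β y.2 W.2) := key
  rw [e, e, e1] at key'
  exact key'

theorem isCoordWarping (hM : IsWarpedFlatBundle EG pr H gB gF f g)
    (h : IsBundleParam EB EF EP pr H s U α WB β WF) :
    IsCoordWarping (gB.pull α) WB (gF.pull β) WF (f ∘ α) where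
  base := h.base.isCoordMetric gB
  fiber := h.fiber.isCoordMetric gF
  contDiffOn := by
    rw [← contMDiffOn_iff_contDiffOn]
    exact hM.smooth_warping.comp_contMDiffOn h.base.contMDiffOn
  pos := fun y _ => hM.warping_pos (α y)

variable [FiniteDimensional ℝ EM] [LieGroup 𝓘(ℝ, EG) ∞ G] [ContMDiffSMul 𝓘(ℝ, EG) 𝓘(ℝ, EF) ∞ G F]

/-- The derivative is injective because the pulled back form is positive definite. It is surjective
because the quotient map is a submersion and the vertical part of a vector of `P` can be absorbed
into the fiber direction. -/
theorem isParam (hM : IsWarpedFlatBundle EG pr H gB gF f g)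
    (h : IsBundleParam EB EF EP pr H s U α WB β WF) :
    IsParam EM (bundleParam G s α β) (WB ×ˢ WF) := by
  refine ⟨h.isOpen_prod, hM.contMDiffOn_bundleParam h, fun y hy => ?_⟩
  have hinj : Function.Injective (paramDeriv EM (bundleParam G s α β) y) := by
    rw [injective_iff_map_eq_zero]
    intro V hV
    by_contra hne
    have hpos := (hM.isCoordWarping h).metric.pos y hy V hne
    rw [← hM.pull_eq h hy, SmoothMetric.pull_apply, hV, map_zero] at hpos
    exact lt_irrefl _ hpos
  have hsurj : Function.Surjective (paramDeriv EM (bundleParam G s α β) y) := by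
    intro w
    obtain ⟨⟨v, ξ⟩, hv⟩ := hM.smooth_quotient.2 (s (α y.1), β y.2) w
    have hv' := (mfderiv_mk_apply hM.smooth_quotient.1 (s (α y.1)) (β y.2) v ξ).symm.trans hv
    have hsup := (hM.flat.isCompl (s (α y.1))).sup_eq_top
    obtain ⟨v₁, h₁, v₂, h₂, rfl⟩ := Submodule.mem_sup.1
      (hsup.ge (Submodule.mem_top (x := (v : TangentSpace 𝓘(ℝ, EP) (s (α y.1))))))
    obtain ⟨ξ', hξ'⟩ := exists_fiber_of_vertical hM.principal hM.smooth_quotient.1 (s (α y.1))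
      (β y.2) v₂ h₂
    obtain ⟨u, hu⟩ := h.flatSection.exists_of_mem (h.mapsTo hy.1) h₁
    obtain ⟨u₀, hu₀⟩ := (h.base.invertible y.1 hy.1).surjective u
    obtain ⟨ξ₀, hξ₀⟩ := (h.fiber.invertible y.2 hy.2).surjective (ξ' + ξ)
    refine ⟨(u₀, ξ₀), ?_⟩
    rw [hM.paramDeriv_bundleParam h hy, hu₀, hξ₀, hu, map_add, ← hξ', ← add_assoc]
    exact (congrArg (· + modelDeriv EF EM (fun x => AssociatedBundle.mk G (s (α y.1)) x) (β y.2) ξ)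
      (map_add (modelDeriv EP EM (fun p => AssociatedBundle.mk G p (β y.2)) (s (α y.1)))
        v₁ v₂).symm).trans hv'
  exact ⟨(LinearEquiv.ofBijective (paramDeriv EM (bundleParam G s α β) y).toLinearMap
    ⟨hinj, hsurj⟩).toContinuousLinearEquiv, rfl⟩

theorem eventuallyEq_pull (hM : IsWarpedFlatBundle EG pr H gB gF f g)
    (h : IsBundleParam EB EF EP pr H s U α WB β WF) (hy : y ∈ WB ×ˢ WF) :
    g.pull (bundleParam G s α β) =ᶠ[𝓝 y] warpedMetric (gB.pull α) (gF.pull β) (f ∘ α) := by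
  filter_upwards [h.isOpen_prod.mem_nhds hy] with z hz using hM.pull_eq h hz

/-- The Ricci tensor of a warped flat bundle. -/
theorem ricci_eq (hM : IsWarpedFlatBundle EG pr H gB gF f g)
    (h : IsBundleParam EB EF EP pr H s U α WB β WF) (hy : y ∈ WB ×ˢ WF) (V W : EB × EF) :
    g.ricci (bundleParam G s α β y) (paramDeriv EM (bundleParam G s α β) y V)
        (paramDeriv EM (bundleParam G s α β) y W)
      = gB.ricci (α y.1) (paramDeriv EB α y.1 V.1) (paramDeriv EB α y.1 W.1)
        - Module.finrank ℝ EF / f (α y.1)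
          * gB.hessian f (α y.1) (paramDeriv EB α y.1 V.1) (paramDeriv EB α y.1 W.1)
        + (gF.ricci (β y.2) (paramDeriv EF β y.2 V.2) (paramDeriv EF β y.2 W.2)
          - (f (α y.1) * gB.laplacian f (α y.1)
              + ((Module.finrank ℝ EF : ℝ) - 1) * gB.gradInner f f (α y.1))
            * gF.form (β y.2) (paramDeriv EF β y.2 V.2) (paramDeriv EF β y.2 W.2)) := by
  have hf := hM.smooth_warping.contMDiffAt (x := α y.1)
  rw [(hM.isParam h).ricci_eq g hy, coordRicci_congr_metric (hM.eventuallyEq_pull h hy),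
    (hM.isCoordWarping h).ricci_eq hy, h.base.ricci_eq gB hy.1, h.fiber.ricci_eq gF hy.2,
    h.base.hessian_eq gB hy.1 hf, h.base.laplacian_eq gB hy.1 hf,
    h.base.gradInner_eq gB hy.1 hf hf, ← SmoothMetric.pull_apply]
  rfl

/-- The Hessian of a function on a warped flat bundle. -/
theorem hessian_eq (hM : IsWarpedFlatBundle EG pr H gB gF f g)
    (h : IsBundleParam EB EF EP pr H s U α WB β WF) (hy : y ∈ WB ×ˢ WF)
    {ψ : AssociatedBundle G P F → ℝ} (hψ : ContMDiff 𝓘(ℝ, EM) 𝓘(ℝ, ℝ) ∞ ψ) (V W : EB × EF) :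
    g.hessian ψ (bundleParam G s α β y) (paramDeriv EM (bundleParam G s α β) y V)
        (paramDeriv EM (bundleParam G s α β) y W)
      = gB.hessian (fun b => ψ (.mk G (s b) (β y.2))) (α y.1) (paramDeriv EB α y.1 V.1)
          (paramDeriv EB α y.1 W.1)
        + (gF.hessian (fun x => ψ (.mk G (s (α y.1)) x)) (β y.2) (paramDeriv EF β y.2 V.2)
            (paramDeriv EF β y.2 W.2)
          + f (α y.1) * gB.gradInner (fun b => ψ (.mk G (s b) (β y.2))) f (α y.1)
            * gF.form (β y.2) (paramDeriv EF β y.2 V.2) (paramDeriv EF β y.2 W.2))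
        + mixedHessian (f ∘ α) (ψ ∘ bundleParam G s α β) y V.1 W.2
        + mixedHessian (f ∘ α) (ψ ∘ bundleParam G s α β) y W.1 V.2 := by
  have hf := hM.smooth_warping.contMDiffAt (x := α y.1)
  have hs := h.flatSection.contMDiffOn.contMDiffAt
    (h.flatSection.isOpen.mem_nhds (h.mapsTo hy.1))
  have hψb : ContMDiffAt 𝓘(ℝ, EB) 𝓘(ℝ, ℝ) ∞ (fun b => ψ (.mk G (s b) (β y.2))) (α y.1) :=
    (hψ.comp (contMDiff_mk_left hM.smooth_quotient.1 (β y.2))).contMDiffAt.comp (α y.1) hs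
  have hψf : ContMDiffAt 𝓘(ℝ, EF) 𝓘(ℝ, ℝ) ∞ (fun x => ψ (.mk G (s (α y.1)) x)) (β y.2) :=
    (hψ.comp (contMDiff_mk_right hM.smooth_quotient.1 (s (α y.1)))).contMDiffAt
  have hψ2 : ContDiffAt ℝ 2 (ψ ∘ bundleParam G s α β) y := by
    have h1 : ContMDiffAt 𝓘(ℝ, EB × EF) 𝓘(ℝ, ℝ) ∞ (ψ ∘ bundleParam G s α β) y :=
      (hψ.comp_contMDiffOn (hM.contMDiffOn_bundleParam h)).contMDiffAt (h.isOpen_prod.mem_nhds hy)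
    exact (contMDiffAt_iff_contDiffAt.1 h1).of_le ENat.LEInfty.out
  rw [(hM.isParam h).hessian_eq g hy hψ.contMDiffAt,
    coordHessian_congr_metric (hM.eventuallyEq_pull h hy),
    (hM.isCoordWarping h).hessian_eq hy hψ2, h.base.hessian_eq gB hy.1 hψb,
    h.fiber.hessian_eq gF hy.2 hψf, h.base.gradInner_eq gB hy.1 hψb hf,
    ← SmoothMetric.pull_apply]
  rfl

end IsWarpedFlatBundle

end Warped

/-! ### Locality, linearity and constancy criteria on manifolds -/

section CoordLemmas

variable {E : Type*} [NormedAddCommGroup E] [NormedSpace ℝ E] [FiniteDimensional ℝ E]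
  {G : E → E →L[ℝ] E →L[ℝ] ℝ} {U : Set E} {y : E}

namespace IsCoordMetric

theorem coordRicci_zero_left (hG : IsCoordMetric G U) (hy : y ∈ U) (w : E) :
    coordRicci G y 0 w = 0 := by
  rw [hG.coordRicci_eq_trace hy]
  simp [coordCurvatureCLM]

theorem coordRicci_zero_right (hG : IsCoordMetric G U) (hy : y ∈ U) (v : E) :
    coordRicci G y v 0 = 0 := by
  rw [hG.coordRicci_eq_trace hy]
  simp [coordCurvatureCLM]

/-- Metric compatibility and the fact that the covariant derivative of the gradient is the Hessian;
it shows that `|∇φ|²` is constant when `∇²φ = 0`. -/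
theorem fderiv_coordGradInner (hG : IsCoordMetric G U) (hy : y ∈ U) {φ : E → ℝ}
    (hφ : ContDiffAt ℝ ∞ φ y) (u : E) :
    fderiv ℝ (coordGradInner G φ φ) y u = 2 * coordHessian G φ y u (coordGrad G φ y) := by
  have dG := hG.differentiableAt hy
  have dgr := (hG.contDiffAt_coordGrad hy hφ).differentiableAt (by simp)
  have h1 := congrArg (fun v => G y v (coordGrad G φ y)) (hG.fderiv_coordGrad hy hφ u)
  simp only [hG.inverse_spec hy, coordHessianCLM_apply, map_add, add_apply] at h1
  change fderiv ℝ (fun z => G z (coordGrad G φ z) (coordGrad G φ z)) y u = _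
  rw [fderiv_clm_apply_apply (dG.clm_apply dgr) dgr, fderiv_clm_apply_apply dG dgr, add_apply,
    hG.fderiv_eq hy, hG.symm y hy _ (fderiv ℝ (coordGrad G φ) y u), ← h1,
    hG.symm y hy _ (christoffelCLM G y u (coordGrad G φ y))]
  ring

theorem contDiffAt_coordGradInner (hG : IsCoordMetric G U) (hy : y ∈ U) {φ f : E → ℝ}
    (hφ : ContDiffAt ℝ ∞ φ y) (hf : ContDiffAt ℝ ∞ f y) :
    ContDiffAt ℝ ∞ (coordGradInner G φ f) y :=
  ((hG.contDiffAt hy).clm_apply (hG.contDiffAt_coordGrad hy hφ)).clm_apply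
    (hG.contDiffAt_coordGrad hy hf)

theorem contDiffAt_coordLaplacian (hG : IsCoordMetric G U) (hy : y ∈ U) {φ : E → ℝ}
    (hφ : ContDiffAt ℝ ∞ φ y) : ContDiffAt ℝ ∞ (coordLaplacian G φ) y := by
  let T : (E →L[ℝ] E) →L[ℝ] ℝ := LinearMap.toContinuousLinearMap
    (LinearMap.trace ℝ E ∘ₗ ContinuousLinearMap.coeLM ℝ)
  exact T.contDiff.contDiffAt.comp y
    ((hG.contDiffAt_inverse hy).clm_comp (hG.contDiffAt_coordHessianCLM hy hφ))

theorem contDiffAt_coordHamilton (hG : IsCoordMetric G U) (hy : y ∈ U) {φ : E → ℝ}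
    (hφ : ContDiffAt ℝ ∞ φ y) (lam : ℝ) : ContDiffAt ℝ ∞ (coordHamilton G φ lam) y :=
  ((hG.contDiffAt_coordLaplacian hy hφ).sub (hG.contDiffAt_coordGradInner hy hφ hφ)).add
    (contDiffAt_const.mul hφ)

end IsCoordMetric

theorem coordHessian_zero_left (G : E → E →L[ℝ] E →L[ℝ] ℝ) (φ : E → ℝ) (y w : E) :
    coordHessian G φ y 0 w = 0 := by
  rw [← coordHessianCLM_apply]; simp

theorem coordHessian_zero_right (G : E → E →L[ℝ] E →L[ℝ] ℝ) (φ : E → ℝ) (y v : E) :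
    coordHessian G φ y v 0 = 0 := by
  rw [← coordHessianCLM_apply]; simp

variable {M : Type*} [TopologicalSpace M] [ChartedSpace E M] [IsManifold 𝓘(ℝ, E) ∞ M]

namespace SmoothMetric

theorem ricci_zero_left (g : SmoothMetric E M) (x : M) (w : E) : g.ricci x (0 : E) w = 0 :=
  (isCoordMetric_inChart g x).coordRicci_zero_left (mem_extChartAt_target x) w

theorem ricci_zero_right (g : SmoothMetric E M) (x : M) (v : E) : g.ricci x v (0 : E) = 0 :=
  (isCoordMetric_inChart g x).coordRicci_zero_right (mem_extChartAt_target x) v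

theorem hessian_zero_left (g : SmoothMetric E M) (φ : M → ℝ) (x : M) (w : E) :
    g.hessian φ x (0 : E) w = 0 := coordHessian_zero_left _ _ _ _

theorem hessian_zero_right (g : SmoothMetric E M) (φ : M → ℝ) (x : M) (v : E) :
    g.hessian φ x v (0 : E) = 0 := coordHessian_zero_right _ _ _ _

theorem comp_extChartAt_symm_congr {φ φ' : M → ℝ} {x : M} (h : φ =ᶠ[𝓝 x] φ') :
    φ ∘ (extChartAt 𝓘(ℝ, E) x).symm =ᶠ[𝓝 (extChartAt 𝓘(ℝ, E) x x)]
      φ' ∘ (extChartAt 𝓘(ℝ, E) x).symm := by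
  have hc := continuousAt_extChartAt_symm (I := 𝓘(ℝ, E)) x
  rw [ContinuousAt, extChartAt_to_inv] at hc
  exact h.comp_tendsto hc

theorem hessian_congr (g : SmoothMetric E M) {φ φ' : M → ℝ} {x : M} (h : φ =ᶠ[𝓝 x] φ')
    (v w : E) : g.hessian φ x v w = g.hessian φ' x v w :=
  coordHessian_congr _ (comp_extChartAt_symm_congr h) v w

theorem hessian_const (g : SmoothMetric E M) (c : ℝ) (x : M) (v w : E) :
    g.hessian (fun _ => c) x v w = 0 := by
  change coordHessian (g.inChart x) (fun _ => c) _ v w = 0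
  simp [coordHessian]

theorem gradInner_congr (g : SmoothMetric E M) {φ φ' : M → ℝ} {x : M} (h : φ =ᶠ[𝓝 x] φ')
    (f : M → ℝ) : g.gradInner φ f x = g.gradInner φ' f x := by
  have : g.gradient φ x = g.gradient φ' x := by rw [gradient, gradient, h.mfderiv_eq]
  rw [gradInner, gradInner, this]

/-- The Hessian of a combination `φ = φ' + k f`. -/
theorem hessian_add_const_mul (g : SmoothMetric E M) {φ f : M → ℝ} {x : M}
    (hφ : ContMDiffAt 𝓘(ℝ, E) 𝓘(ℝ, ℝ) ∞ φ x) (hf : ContMDiffAt 𝓘(ℝ, E) 𝓘(ℝ, ℝ) ∞ f x) (k : ℝ)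
    (v w : E) : g.hessian (fun z => φ z + k * f z) x v w
      = g.hessian φ x v w + k * g.hessian f x v w := by
  have h1 := contDiffAt_comp_extChartAt_symm hφ
  have h2 := contDiffAt_comp_extChartAt_symm hf
  have key : ∀ {a b : E → ℝ} {y : E}, ContDiffAt ℝ ∞ a y → ContDiffAt ℝ ∞ b y →
      coordHessian (g.inChart x) (fun z => a z + k * b z) y v w
      = coordHessian (g.inChart x) a y v w + k * coordHessian (g.inChart x) b y v w := by
    intro a b y ha hb
    have e : ∀ z, ContDiffAt ℝ 1 a z → ContDiffAt ℝ 1 b z →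
        fderiv ℝ (fun z => a z + k * b z) z = fderiv ℝ a z + k • fderiv ℝ b z := by
      intro z haz hbz
      have db := hbz.differentiableAt (by simp)
      rw [fderiv_fun_add (haz.differentiableAt (by simp)) (db.const_mul k),
        fderiv_const_mul db]
    have ev : fderiv ℝ (fun z => a z + k * b z) =ᶠ[𝓝 y] fun z => fderiv ℝ a z + k • fderiv ℝ b z := by
      filter_upwards [(ha.of_le (m := 1) (by simp)).eventually (by simp),
        (hb.of_le (m := 1) (by simp)).eventually (by simp)]
        with z hz hz' using e z hz hz'
    have da : DifferentiableAt ℝ (fderiv ℝ a) y :=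
      (ha.fderiv_right (m := ∞) (by simp)).differentiableAt (by simp)
    have db : DifferentiableAt ℝ (fderiv ℝ b) y :=
      (hb.fderiv_right (m := ∞) (by simp)).differentiableAt (by simp)
    rw [coordHessian, ev.fderiv_eq, ev.eq_of_nhds, fderiv_fun_add da (db.fun_const_smul k),
      fderiv_fun_const_smul db, coordHessian, coordHessian]
    simp only [add_apply, smul_apply, smul_eq_mul]
    ring
  exact key h1 h2

end SmoothMetric

/-- A function with zero derivative in all charts of a connected manifold is constant. -/
theorem eq_of_fderiv_comp_extChartAt_symm_eq_zero [ConnectedSpace M] {h : M → ℝ}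
    (hh : ∀ b : M, ∀ y ∈ (extChartAt 𝓘(ℝ, E) b).target,
      DifferentiableAt ℝ (h ∘ (extChartAt 𝓘(ℝ, E) b).symm) y ∧
        fderiv ℝ (h ∘ (extChartAt 𝓘(ℝ, E) b).symm) y = 0) (b b' : M) : h b = h b' := by
  refine IsLocallyConstant.apply_eq_of_preconnectedSpace
    ((IsLocallyConstant.iff_eventually_eq h).2 fun b => ?_) b b'
  obtain ⟨r, hr, hball⟩ := Metric.mem_nhds_iff.1 (extChartAt_target_mem_nhds (I := 𝓘(ℝ, E)) b)
  have hc : ∀ᶠ z in 𝓝 b, extChartAt 𝓘(ℝ, E) b z ∈ Metric.ball (extChartAt 𝓘(ℝ, E) b b) r :=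
    (continuousAt_extChartAt b).eventually (Metric.ball_mem_nhds _ hr)
  filter_upwards [hc, extChartAt_source_mem_nhds (I := 𝓘(ℝ, E)) b] with z hz hzs
  have := Metric.isOpen_ball.is_const_of_fderiv_eq_zero (𝕜 := ℝ)
    (f := h ∘ (extChartAt 𝓘(ℝ, E) b).symm) (convex_ball _ _).isPreconnected
    (fun y hy => (hh b y (hball hy)).1.differentiableWithinAt) (fun y hy => (hh b y (hball hy)).2)
    hz (Metric.mem_ball_self hr)
  simpa only [Function.comp_apply, (extChartAt 𝓘(ℝ, E) b).left_inv hzs, extChartAt_to_inv]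
    using this

end CoordLemmas

/-! ### Separation of variables -/

section Rectangle

variable {EB EF : Type*} [NormedAddCommGroup EB] [NormedSpace ℝ EB]
  [NormedAddCommGroup EF] [NormedSpace ℝ EF]

/-- The hypothesis says that `∂_η ψ / f` has zero derivative along the base. Integrating first over
`A` and then over `C` shows that `ψ / f` is a sum of functions of the separate variables; the
conclusion is the form of this without a choice of summands. -/
theorem rectangle_of_mixedHessian_eq_zero {f : EB → ℝ} {ψ : EB × EF → ℝ} {A : Set EB} {C : Set EF}
    (hA : IsOpen A) (hC : IsOpen C) (hA' : IsPreconnected A) (hC' : IsPreconnected C)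
    (hf : ContDiffOn ℝ ∞ f A) (hf0 : ∀ a ∈ A, f a ≠ 0) (hψ : ContDiffOn ℝ ∞ ψ (A ×ˢ C))
    (hmix : ∀ y ∈ A ×ˢ C, ∀ u η, mixedHessian f ψ y u η = 0)
    {a a' : EB} (ha : a ∈ A) (ha' : a' ∈ A) {c c' : EF} (hc : c ∈ C) (hc' : c' ∈ C) :
    (f a)⁻¹ * ψ (a, c) - (f a')⁻¹ * ψ (a', c) = (f a)⁻¹ * ψ (a, c') - (f a')⁻¹ * ψ (a', c') := by
  have hψ' : ∀ y ∈ A ×ˢ C, ContDiffAt ℝ ∞ ψ y := fun y hy =>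
    hψ.contDiffAt ((hA.prod hC).mem_nhds hy)
  have hdψ : ∀ y ∈ A ×ˢ C, DifferentiableAt ℝ ψ y := fun y hy =>
    (hψ' y hy).differentiableAt (by simp)
  -- the fiber derivative of the quotient does not depend on the base point
  have h1 : ∀ c ∈ C, ∀ η : EF, (f a)⁻¹ * fderiv ℝ ψ (a, c) (0, η)
      = (f a')⁻¹ * fderiv ℝ ψ (a', c) (0, η) := by
    intro c hc η
    have hd : ∀ z ∈ A, HasFDerivAt (fun z => (f z)⁻¹ * fderiv ℝ ψ (z, c) (0, η))
        (0 : EB →L[ℝ] ℝ) z := by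
      intro z hz
      have k1 : HasFDerivAt f (fderiv ℝ f z) z :=
        ((hf.contDiffAt (hA.mem_nhds hz)).differentiableAt (by simp)).hasFDerivAt
      have k2 : DifferentiableAt ℝ (fderiv ℝ ψ) (z, c) :=
        ((hψ' (z, c) ⟨hz, hc⟩).fderiv_right (m := ∞) (by simp)).differentiableAt (by simp)
      have k3 : HasFDerivAt (fun z => fderiv ℝ ψ (z, c))
          ((fderiv ℝ (fderiv ℝ ψ) (z, c)).comp (.inl ℝ EB EF)) z :=
        HasFDerivAt.comp (g := fderiv ℝ ψ) z k2.hasFDerivAt (hasFDerivAt_prodMk_left z c)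
      have k4 := k3.clm_apply (hasFDerivAt_const ((0 : EB), η) z)
      have k5 := ((hasDerivAt_inv (hf0 z hz)).comp_hasFDerivAt z k1).fun_mul k4
      refine k5.congr_fderiv ?_
      ext u
      have := hmix (z, c) ⟨hz, hc⟩ u η
      rw [mixedHessian] at this
      have hz0 := hf0 z hz
      simp only [add_apply, smul_apply, smul_eq_mul, zero_apply, Function.comp_apply,
        ContinuousLinearMap.comp_apply, ContinuousLinearMap.flip_apply,
        ContinuousLinearMap.inl_apply, map_zero, sub_eq_zero] at this ⊢
      rw [this]
      field_simp
      ring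
    exact hA.is_const_of_fderiv_eq_zero (𝕜 := ℝ) hA'
      (fun z hz => (hd z hz).differentiableAt.differentiableWithinAt)
      (fun z hz => (hd z hz).fderiv) ha ha'
  have hd : ∀ z ∈ C, HasFDerivAt (fun z => (f a)⁻¹ * ψ (a, z) - (f a')⁻¹ * ψ (a', z))
      (0 : EF →L[ℝ] ℝ) z := by
    intro z hz
    have k : ∀ a ∈ A, HasFDerivAt (fun z => ψ (a, z))
        ((fderiv ℝ ψ (a, z)).comp (.inr ℝ EB EF)) z := fun a ha =>
      HasFDerivAt.comp (g := ψ) z (hdψ (a, z) ⟨ha, hz⟩).hasFDerivAt (hasFDerivAt_prodMk_right a z)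
    refine (((k a ha).const_mul (f a)⁻¹).fun_sub ((k a' ha').const_mul (f a')⁻¹)).congr_fderiv ?_
    ext η
    simpa [sub_eq_zero] using h1 z hz η
  exact hC.is_const_of_fderiv_eq_zero (𝕜 := ℝ) hC'
    (fun z hz => (hd z hz).differentiableAt.differentiableWithinAt)
    (fun z hz => (hd z hz).fderiv) hc hc'

end Rectangle

/-! ### The horizontal, mixed and vertical parts of the soliton equation -/

section Soliton

variable {EB EF EG EP EM : Type*} [NormedAddCommGroup EB] [NormedSpace ℝ EB]
  [NormedAddCommGroup EF] [NormedSpace ℝ EF] [NormedAddCommGroup EG] [NormedSpace ℝ EG]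
  [NormedAddCommGroup EP] [NormedSpace ℝ EP] [NormedAddCommGroup EM] [NormedSpace ℝ EM]
  {B : Type*} [TopologicalSpace B] [ChartedSpace EB B] [IsManifold 𝓘(ℝ, EB) ∞ B]
  {F : Type*} [TopologicalSpace F] [ChartedSpace EF F] [IsManifold 𝓘(ℝ, EF) ∞ F]
  {G : Type*} [TopologicalSpace G] [ChartedSpace EG G] [Group G]
  {P : Type*} [TopologicalSpace P] [ChartedSpace EP P] [MulAction G P] [MulAction G F]
  [ChartedSpace EM (AssociatedBundle G P F)] [IsManifold 𝓘(ℝ, EM) ∞ (AssociatedBundle G P F)]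
  {pr : P → B} {H : ∀ p : P, Submodule ℝ (TangentSpace 𝓘(ℝ, EP) p)}
  {gB : SmoothMetric EB B} {gF : SmoothMetric EF F} {f : B → ℝ}
  {g : SmoothMetric EM (AssociatedBundle G P F)} {s : B → P} {U : Set B}
  {α : EB → B} {β : EF → F} {WB : Set EB} {WF : Set EF} {y : EB × EF}

theorem IsParam.mono {E E' M : Type*} [NormedAddCommGroup E] [NormedSpace ℝ E]
    [TopologicalSpace M] [ChartedSpace E M] [NormedAddCommGroup E'] [NormedSpace ℝ E']
    {Ψ : E' → M} {W W' : Set E'} (h : IsParam E Ψ W) (hW : IsOpen W') (hs : W' ⊆ W) :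
    IsParam E Ψ W' :=
  ⟨hW, h.contMDiffOn.mono hs, fun y hy => h.invertible y (hs hy)⟩

theorem IsFlatSection.mono (h : IsFlatSection EB EP pr H s U) {V : Set B} (hV : IsOpen V)
    (hs : V ⊆ U) : IsFlatSection EB EP pr H s V :=
  ⟨hV, h.contMDiffOn.mono hs, fun b hb => h.section_eq b (hs hb),
    fun b hb => h.range_eq b (hs hb)⟩

/-- The parametrization given by a flat section and the preferred charts at `b` and `x`. -/
theorem IsFlatSection.isBundleParam (h : IsFlatSection EB EP pr H s U) (b : B) (x : F) :
    IsBundleParam EB EF EP pr H s U (extChartAt 𝓘(ℝ, EB) b).symm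
      ((extChartAt 𝓘(ℝ, EB) b).target ∩ (extChartAt 𝓘(ℝ, EB) b).symm ⁻¹' U)
      (extChartAt 𝓘(ℝ, EF) x).symm (extChartAt 𝓘(ℝ, EF) x).target where
  flatSection := h
  base := (isParam_extChartAt_symm b).mono
    ((contMDiffOn_extChartAt_symm (n := ∞) b).continuousOn.isOpen_inter_preimage
      (isOpen_extChartAt_target b) h.isOpen) inter_subset_left
  fiber := isParam_extChartAt_symm x
  mapsTo := fun _ hy => hy.2

theorem IsFlatSection.mem_isBundleParam {b : B} (hb : b ∈ U) (x : F) :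
    (extChartAt 𝓘(ℝ, EB) b b, extChartAt 𝓘(ℝ, EF) x x)
      ∈ ((extChartAt 𝓘(ℝ, EB) b).target ∩ (extChartAt 𝓘(ℝ, EB) b).symm ⁻¹' U) ×ˢ
        (extChartAt 𝓘(ℝ, EF) x).target :=
  ⟨⟨mem_extChartAt_target b, by rw [mem_preimage, extChartAt_to_inv]; exact hb⟩,
    mem_extChartAt_target x⟩

theorem IsPrincipalBundle.surjective (h : IsPrincipalBundle EB EG EP G pr) :
    Function.Surjective pr := by
  intro b
  obtain ⟨U, Φ, hU, hb, hsrc, htgt, -, -, hΦ⟩ := h.exists_trivialization b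
  have hm : (b, (1 : G)) ∈ Φ.target := by rw [htgt]; exact ⟨hb, trivial⟩
  refine ⟨Φ.symm (b, 1), ?_⟩
  rw [← (hΦ _ (Φ.map_target hm)).1, Φ.right_inv hm]

theorem IsPrincipalBundle.exists_smul_eq (h : IsPrincipalBundle EB EG EP G pr) {p q : P}
    (hpq : pr p = pr q) : ∃ a : G, a • p = q := by
  obtain ⟨U, Φ, hU, hb, hsrc, htgt, -, -, hΦ⟩ := h.exists_trivialization (pr p)
  have hp : p ∈ Φ.source := by rw [hsrc]; exact hb
  have hq : q ∈ Φ.source := by rw [hsrc, mem_preimage, ← hpq]; exact hb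
  refine ⟨(Φ q).2 * (Φ p).2⁻¹, ?_⟩
  have hap : ((Φ q).2 * (Φ p).2⁻¹) • p ∈ Φ.source := by
    rw [hsrc, mem_preimage, h.map_smul]; exact hb
  refine Φ.injOn hap hq ?_
  rw [(hΦ p hp).2]
  refine Prod.ext ?_ ?_
  · rw [(hΦ q hq).1, hpq]
  · simp

namespace IsWarpedFlatBundle

variable [FiniteDimensional ℝ EB] [FiniteDimensional ℝ EF] [FiniteDimensional ℝ EM]
  [LieGroup 𝓘(ℝ, EG) ∞ G] [ContMDiffSMul 𝓘(ℝ, EG) 𝓘(ℝ, EF) ∞ G F]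
  {ψ : AssociatedBundle G P F → ℝ} {lam : ℝ}

theorem form_bundleParam (hM : IsWarpedFlatBundle EG pr H gB gF f g)
    (h : IsBundleParam EB EF EP pr H s U α WB β WF) (hy : y ∈ WB ×ˢ WF) (V W : EB × EF) :
    g.form (bundleParam G s α β y) (paramDeriv EM (bundleParam G s α β) y V)
        (paramDeriv EM (bundleParam G s α β) y W)
      = gB.form (α y.1) (paramDeriv EB α y.1 V.1) (paramDeriv EB α y.1 W.1)
        + f (α y.1) ^ 2 * gF.form (β y.2) (paramDeriv EF β y.2 V.2) (paramDeriv EF β y.2 W.2) := by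
  rw [← SmoothMetric.pull_apply, hM.pull_eq h hy, warpedMetric_apply]
  rfl

/-- All terms are expressed on `B` and `F`. Taking `V` and `W` horizontal or vertical isolates the
three parts of the equation. -/
theorem soliton_eq (hM : IsWarpedFlatBundle EG pr H gB gF f g)
    (hsol : g.IsGradientRicciSoliton ψ lam)
    (h : IsBundleParam EB EF EP pr H s U α WB β WF) (hy : y ∈ WB ×ˢ WF) (V W : EB × EF) :
    gB.ricci (α y.1) (paramDeriv EB α y.1 V.1) (paramDeriv EB α y.1 W.1)
        - Module.finrank ℝ EF / f (α y.1)
          * gB.hessian f (α y.1) (paramDeriv EB α y.1 V.1) (paramDeriv EB α y.1 W.1)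
        + (gF.ricci (β y.2) (paramDeriv EF β y.2 V.2) (paramDeriv EF β y.2 W.2)
          - (f (α y.1) * gB.laplacian f (α y.1)
              + ((Module.finrank ℝ EF : ℝ) - 1) * gB.gradInner f f (α y.1))
            * gF.form (β y.2) (paramDeriv EF β y.2 V.2) (paramDeriv EF β y.2 W.2))
      + (gB.hessian (fun b => ψ (.mk G (s b) (β y.2))) (α y.1) (paramDeriv EB α y.1 V.1)
          (paramDeriv EB α y.1 W.1)
        + (gF.hessian (fun x => ψ (.mk G (s (α y.1)) x)) (β y.2) (paramDeriv EF β y.2 V.2)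
            (paramDeriv EF β y.2 W.2)
          + f (α y.1) * gB.gradInner (fun b => ψ (.mk G (s b) (β y.2))) f (α y.1)
            * gF.form (β y.2) (paramDeriv EF β y.2 V.2) (paramDeriv EF β y.2 W.2))
        + mixedHessian (f ∘ α) (ψ ∘ bundleParam G s α β) y V.1 W.2
        + mixedHessian (f ∘ α) (ψ ∘ bundleParam G s α β) y W.1 V.2)
      = lam * (gB.form (α y.1) (paramDeriv EB α y.1 V.1) (paramDeriv EB α y.1 W.1)
        + f (α y.1) ^ 2
          * gF.form (β y.2) (paramDeriv EF β y.2 V.2) (paramDeriv EF β y.2 W.2)) := by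
  rw [← hM.ricci_eq h hy V W, ← hM.hessian_eq h hy hsol.1 V W, ← hM.form_bundleParam h hy V W]
  exact hsol.2 (bundleParam G s α β y) _ _

/-- On a soliton, the mixed part of the Hessian of the potential vanishes. -/
theorem mixedHessian_eq_zero (hM : IsWarpedFlatBundle EG pr H gB gF f g)
    (hsol : g.IsGradientRicciSoliton ψ lam)
    (h : IsBundleParam EB EF EP pr H s U α WB β WF) (hy : y ∈ WB ×ˢ WF) (u : EB) (η : EF) :
    mixedHessian (f ∘ α) (ψ ∘ bundleParam G s α β) y u η = 0 := by
  have := hM.soliton_eq hsol h hy (u, 0) (0, η)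
  have h0 : mixedHessian (f ∘ α) (ψ ∘ bundleParam G s α β) y 0 0 = 0 := by
    have : ((0 : EB), (0 : EF)) = 0 := rfl
    simp [mixedHessian, this]
  simpa only [map_zero, SmoothMetric.ricci_zero_left, SmoothMetric.ricci_zero_right,
    SmoothMetric.hessian_zero_left, SmoothMetric.hessian_zero_right, zero_apply, mul_zero,
    sub_zero, add_zero, zero_add, h0] using this

/-- The horizontal part of the soliton equation. -/
theorem horizontal_eq (hM : IsWarpedFlatBundle EG pr H gB gF f g)
    (hsol : g.IsGradientRicciSoliton ψ lam) (hs : IsFlatSection EB EP pr H s U) {b : B}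
    (hb : b ∈ U) (x : F) (u v : EB) :
    gB.ricci b u v + gB.hessian (fun b => ψ (.mk G (s b) x)) b u v
      = lam * gB.form b u v + Module.finrank ℝ EF / f b * gB.hessian f b u v := by
  have := hM.soliton_eq hsol (hs.isBundleParam b x) (IsFlatSection.mem_isBundleParam hb x)
    (u, 0) (v, 0)
  have h0 : ∀ (k : EB → ℝ) (q : EB × EF → ℝ) y w, mixedHessian k q y w 0 = 0 := by
    intro k q y w
    have : ((0 : EB), (0 : EF)) = 0 := rfl
    simp [mixedHessian, this]
  simp only [map_zero, SmoothMetric.ricci_zero_right, SmoothMetric.hessian_zero_right, mul_zero,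
    sub_zero, add_zero, h0] at this
  -- The point and the vectors are generalized together, since the tangent vectors have types
  -- depending on the point and cannot be rewritten one by one.
  have key : ∀ (b' : B) (x' : F) (u' v' : EB),
      (extChartAt 𝓘(ℝ, EB) b).symm (extChartAt 𝓘(ℝ, EB) b b) = b' →
      (extChartAt 𝓘(ℝ, EF) x).symm (extChartAt 𝓘(ℝ, EF) x x) = x' →
      paramDeriv EB (extChartAt 𝓘(ℝ, EB) b).symm (extChartAt 𝓘(ℝ, EB) b b) u = u' →
      paramDeriv EB (extChartAt 𝓘(ℝ, EB) b).symm (extChartAt 𝓘(ℝ, EB) b b) v = v' →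
      gB.ricci b' u' v' + gB.hessian (fun b => ψ (.mk G (s b) x')) b' u' v'
        = lam * gB.form b' u' v' + Module.finrank ℝ EF / f b' * gB.hessian f b' u' v' := by
    rintro _ _ _ _ rfl rfl rfl rfl
    linarith
  exact key b x u v (extChartAt_to_inv b) (extChartAt_to_inv x)
    (by rw [paramDeriv_extChartAt_symm_self]; rfl) (by rw [paramDeriv_extChartAt_symm_self]; rfl)

/-- The vertical part of the soliton equation. -/
theorem vertical_eq (hM : IsWarpedFlatBundle EG pr H gB gF f g)
    (hsol : g.IsGradientRicciSoliton ψ lam) (hs : IsFlatSection EB EP pr H s U) {b : B}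
    (hb : b ∈ U) (x : F) (ξ η : EF) :
    gF.ricci x ξ η + gF.hessian (fun x => ψ (.mk G (s b) x)) x ξ η
      = (lam * f b ^ 2 + f b * gB.laplacian f b
          + ((Module.finrank ℝ EF : ℝ) - 1) * gB.gradInner f f b
          - f b * gB.gradInner (fun b => ψ (.mk G (s b) x)) f b) * gF.form x ξ η := by
  have := hM.soliton_eq hsol (hs.isBundleParam b x) (IsFlatSection.mem_isBundleParam hb x)
    (0, ξ) (0, η)
  have h0 : ∀ (k : EB → ℝ) (q : EB × EF → ℝ) y w, mixedHessian k q y 0 w = 0 := by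
    intro k q y w
    have : ((0 : EB), (0 : EF)) = 0 := rfl
    simp [mixedHessian, this]
  simp only [map_zero, SmoothMetric.ricci_zero_right, SmoothMetric.hessian_zero_right, mul_zero,
    sub_zero, add_zero, zero_add, h0] at this
  have key : ∀ (b' : B) (x' : F) (ξ' η' : EF),
      (extChartAt 𝓘(ℝ, EB) b).symm (extChartAt 𝓘(ℝ, EB) b b) = b' →
      (extChartAt 𝓘(ℝ, EF) x).symm (extChartAt 𝓘(ℝ, EF) x x) = x' →
      paramDeriv EF (extChartAt 𝓘(ℝ, EF) x).symm (extChartAt 𝓘(ℝ, EF) x x) ξ = ξ' →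
      paramDeriv EF (extChartAt 𝓘(ℝ, EF) x).symm (extChartAt 𝓘(ℝ, EF) x x) η = η' →
      gF.ricci x' ξ' η' + gF.hessian (fun x => ψ (.mk G (s b') x)) x' ξ' η'
        = (lam * f b' ^ 2 + f b' * gB.laplacian f b'
          + ((Module.finrank ℝ EF : ℝ) - 1) * gB.gradInner f f b'
          - f b' * gB.gradInner (fun b => ψ (.mk G (s b) x')) f b') * gF.form x' ξ' η' := by
    rintro _ _ _ _ rfl rfl rfl rfl
    linarith
  exact key b x ξ η (extChartAt_to_inv b) (extChartAt_to_inv x)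
    (by rw [paramDeriv_extChartAt_symm_self]; rfl) (by rw [paramDeriv_extChartAt_symm_self]; rfl)

/-- Near every point of the base, the potential divided by the warping function is the sum of a
function on the base and a function on the fiber. -/
theorem exists_rectangle [ConnectedSpace F] (hM : IsWarpedFlatBundle EG pr H gB gF f g)
    (hsol : g.IsGradientRicciSoliton ψ lam) (b₀ : B) :
    ∃ (s : B → P) (V : Set B), IsFlatSection EB EP pr H s V ∧ b₀ ∈ V ∧
      ∀ b ∈ V, ∀ b' ∈ V, ∀ x x' : F,
        (f b)⁻¹ * ψ (.mk G (s b) x) - (f b')⁻¹ * ψ (.mk G (s b') x)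
          = (f b)⁻¹ * ψ (.mk G (s b) x') - (f b')⁻¹ * ψ (.mk G (s b') x') := by
  obtain ⟨p₀, rfl⟩ := hM.principal.surjective b₀
  obtain ⟨s, U, hs, hb₀, -⟩ := hM.flat.exists_section p₀
  set b₀ := pr p₀
  set χ := extChartAt 𝓘(ℝ, EB) b₀
  have hopen : IsOpen (χ.target ∩ χ.symm ⁻¹' U) :=
    (contMDiffOn_extChartAt_symm (n := ∞) b₀).continuousOn.isOpen_inter_preimage
      (isOpen_extChartAt_target b₀) hs.isOpen
  have hmem : χ b₀ ∈ χ.target ∩ χ.symm ⁻¹' U :=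
    ⟨mem_extChartAt_target b₀, by rw [mem_preimage, extChartAt_to_inv]; exact hb₀⟩
  -- A coordinate ball is convex, hence connected. It is fixed before any point of the fiber is
  -- considered, so that the same `V` serves for all of `F`.
  obtain ⟨r, hr, hball⟩ := Metric.isOpen_iff.1 hopen _ hmem
  have hVopen : IsOpen (χ.source ∩ χ ⁻¹' Metric.ball (χ b₀) r) :=
    (continuousOn_extChartAt b₀).isOpen_inter_preimage (isOpen_extChartAt_source b₀)
      Metric.isOpen_ball
  have hVU : χ.source ∩ χ ⁻¹' Metric.ball (χ b₀) r ⊆ U := by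
    rintro b ⟨h1, h2⟩
    have := (hball h2).2
    rwa [mem_preimage, χ.left_inv h1] at this
  refine ⟨s, _, hs.mono hVopen hVU,
    ⟨mem_extChartAt_source b₀, Metric.mem_ball_self hr⟩, fun b hb b' hb' x x' => ?_⟩
  -- The rectangle lemma compares nearby points of the fiber; connectedness of `F` extends the
  -- comparison to any two.
  refine IsLocallyConstant.apply_eq_of_preconnectedSpace
    (f := fun x => (f b)⁻¹ * ψ (.mk G (s b) x) - (f b')⁻¹ * ψ (.mk G (s b') x))
    ((IsLocallyConstant.iff_eventually_eq _).2 fun x₀ => ?_) x x'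
  set ζ := extChartAt 𝓘(ℝ, EF) x₀
  have h := hs.isBundleParam (EF := EF) b₀ x₀
  obtain ⟨ρ, hρ, hball'⟩ := Metric.isOpen_iff.1 (isOpen_extChartAt_target (I := 𝓘(ℝ, EF)) x₀) _
    (mem_extChartAt_target x₀)
  have hsub : Metric.ball (χ b₀) r ×ˢ Metric.ball (ζ x₀) ρ
      ⊆ (χ.target ∩ χ.symm ⁻¹' U) ×ˢ ζ.target := prod_mono hball hball'
  have hψ : ContDiffOn ℝ ∞ (ψ ∘ bundleParam G s χ.symm ζ.symm)
      (Metric.ball (χ b₀) r ×ˢ Metric.ball (ζ x₀) ρ) := by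
    rw [← contMDiffOn_iff_contDiffOn]
    exact (hsol.1.comp_contMDiffOn (hM.contMDiffOn_bundleParam h)).mono hsub
  have hc : ∀ᶠ z in 𝓝 x₀, ζ z ∈ Metric.ball (ζ x₀) ρ :=
    (continuousAt_extChartAt x₀).eventually (Metric.ball_mem_nhds _ hρ)
  filter_upwards [hc, extChartAt_source_mem_nhds (I := 𝓘(ℝ, EF)) x₀] with z hz hzs
  have key := rectangle_of_mixedHessian_eq_zero Metric.isOpen_ball Metric.isOpen_ball
    (convex_ball _ _).isPreconnected (convex_ball _ _).isPreconnected
    ((hM.isCoordWarping h).contDiffOn.mono hball) (fun a _ => (hM.warping_pos _).ne') hψ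
    (fun y hy u η => hM.mixedHessian_eq_zero hsol h (hsub hy) u η) hb.2 hb'.2 hz
    (Metric.mem_ball_self hρ)
  have e1 : χ.symm (χ b) = b := χ.left_inv hb.1
  have e2 : χ.symm (χ b') = b' := χ.left_inv hb'.1
  have e3 : ζ.symm (ζ z) = z := ζ.left_inv hzs
  have e4 : ζ.symm (ζ x₀) = x₀ := extChartAt_to_inv x₀
  have e1' : f ((extChartAt 𝓘(ℝ, EB) b₀).symm (χ b)) = f b := congrArg f e1
  have e2' : f ((extChartAt 𝓘(ℝ, EB) b₀).symm (χ b')) = f b' := congrArg f e2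
  simpa only [Function.comp_apply, bundleParam, e1, e2, e3, e4, e1', e2'] using key

end IsWarpedFlatBundle

end Soliton

/-! ### Functions with parallel gradient -/

section ParallelGradient

variable {E : Type*} [NormedAddCommGroup E] [NormedSpace ℝ E] [FiniteDimensional ℝ E]
  {M : Type*} [TopologicalSpace M] [ChartedSpace E M] [IsManifold 𝓘(ℝ, E) ∞ M]

theorem contDiffAt_comp_chart_symm {φ : M → ℝ} (hφ : ContMDiff 𝓘(ℝ, E) 𝓘(ℝ, ℝ) ∞ φ) (b : M) {y : E}
    (hy : y ∈ (extChartAt 𝓘(ℝ, E) b).target) :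
    ContDiffAt ℝ ∞ (φ ∘ (extChartAt 𝓘(ℝ, E) b).symm) y := by
  rw [← contMDiffAt_iff_contDiffAt]
  exact hφ.contMDiffAt.comp y ((isParam_extChartAt_symm b).contMDiffOn.contMDiffAt
    ((isOpen_extChartAt_target b).mem_nhds hy))

namespace SmoothMetric

/-- A function with zero Hessian has a gradient of constant length. -/
theorem gradInner_self_eq_of_hessian_eq_zero [ConnectedSpace M] (g : SmoothMetric E M) {φ : M → ℝ}
    (hφ : ContMDiff 𝓘(ℝ, E) 𝓘(ℝ, ℝ) ∞ φ) (hess : ∀ (b : M) (u v : E), g.hessian φ b u v = 0)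
    (b b' : M) : g.gradInner φ φ b = g.gradInner φ φ b' := by
  refine eq_of_fderiv_comp_extChartAt_symm_eq_zero (E := E) (fun b y hy => ?_) b b'
  have h := isParam_extChartAt_symm (E := E) b
  have hd := contDiffAt_comp_chart_symm hφ b hy
  have e : g.gradInner φ φ ∘ (extChartAt 𝓘(ℝ, E) b).symm =ᶠ[𝓝 y]
      coordGradInner (g.inChart b) (φ ∘ (extChartAt 𝓘(ℝ, E) b).symm)
        (φ ∘ (extChartAt 𝓘(ℝ, E) b).symm) := by
    filter_upwards [h.isOpen.mem_nhds hy] with z hz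
      using h.gradInner_eq g hz hφ.contMDiffAt hφ.contMDiffAt
  have hG := isCoordMetric_inChart g b
  have hsm := hG.contDiffAt_coordGradInner hy hd hd
  refine ⟨e.differentiableAt_iff.2 (hsm.differentiableAt (by simp)), ?_⟩
  rw [e.fderiv_eq]
  ext u
  rw [hG.fderiv_coordGradInner hy hd, inChart_eq_pull, ← h.hessian_eq g hy hφ.contMDiffAt, hess]
  simp

theorem eq_of_gradInner_self_eq_zero [ConnectedSpace M] (g : SmoothMetric E M) {φ : M → ℝ}
    (hφ : ContMDiff 𝓘(ℝ, E) 𝓘(ℝ, ℝ) ∞ φ) (h0 : ∀ b : M, g.gradInner φ φ b = 0)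
    (b b' : M) : φ b = φ b' := by
  refine eq_of_fderiv_comp_extChartAt_symm_eq_zero (E := E) (fun b y hy => ?_) b b'
  have h := isParam_extChartAt_symm (E := E) b
  have hd := contDiffAt_comp_chart_symm hφ b hy
  have hG := isCoordMetric_inChart g b
  refine ⟨hd.differentiableAt (by simp), ?_⟩
  have h1 : coordGradInner (g.inChart b) (φ ∘ (extChartAt 𝓘(ℝ, E) b).symm)
      (φ ∘ (extChartAt 𝓘(ℝ, E) b).symm) y = 0 :=
    (h.gradInner_eq g hy hφ.contMDiffAt hφ.contMDiffAt).symm.trans (h0 _)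
  have h2 : coordGrad (g.inChart b) (φ ∘ (extChartAt 𝓘(ℝ, E) b).symm) y = 0 := by
    by_contra hne
    exact (hG.pos y hy _ hne).ne' h1
  ext u
  rw [← hG.coordGrad_spec hy, h2]
  simp

end SmoothMetric

end ParallelGradient

/-! ### Descent of the potential to the base -/

section Soliton

variable {EB EF EG EP EM : Type*} [NormedAddCommGroup EB] [NormedSpace ℝ EB]
  [NormedAddCommGroup EF] [NormedSpace ℝ EF] [NormedAddCommGroup EG] [NormedSpace ℝ EG]
  [NormedAddCommGroup EP] [NormedSpace ℝ EP] [NormedAddCommGroup EM] [NormedSpace ℝ EM]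
  {B : Type*} [TopologicalSpace B] [ChartedSpace EB B] [IsManifold 𝓘(ℝ, EB) ∞ B]
  {F : Type*} [TopologicalSpace F] [ChartedSpace EF F] [IsManifold 𝓘(ℝ, EF) ∞ F]
  {G : Type*} [TopologicalSpace G] [ChartedSpace EG G] [Group G]
  {P : Type*} [TopologicalSpace P] [ChartedSpace EP P] [MulAction G P] [MulAction G F]
  [ChartedSpace EM (AssociatedBundle G P F)] [IsManifold 𝓘(ℝ, EM) ∞ (AssociatedBundle G P F)]
  {pr : P → B} {H : ∀ p : P, Submodule ℝ (TangentSpace 𝓘(ℝ, EP) p)}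
  {gB : SmoothMetric EB B} {gF : SmoothMetric EF F} {f : B → ℝ}
  {g : SmoothMetric EM (AssociatedBundle G P F)} {s : B → P} {U : Set B}
  {ψ : AssociatedBundle G P F → ℝ} {lam : ℝ}

theorem IsFlatSection.contMDiffAt_comp_mk (hs : IsFlatSection EB EP pr H s U)
    (hq : IsQuotientSmoothStructure EF EP EM F G P) (hψ : ContMDiff 𝓘(ℝ, EM) 𝓘(ℝ, ℝ) ∞ ψ) {b : B}
    (hb : b ∈ U) (x : F) :
    ContMDiffAt 𝓘(ℝ, EB) 𝓘(ℝ, ℝ) ∞ (fun b => ψ (.mk G (s b) x)) b :=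
  (hψ.comp (contMDiff_mk_left hq.1 x)).contMDiffAt.comp b
    (hs.contMDiffOn.contMDiffAt (hs.isOpen.mem_nhds hb))

namespace IsWarpedFlatBundle

/-- The function `ψ` is constant on the fiber over `b`. -/
def IsConstOnFiber (pr : P → B) (ψ : AssociatedBundle G P F → ℝ) (b : B) : Prop :=
  ∀ p, pr p = b → ∀ x x' : F, ψ (.mk G p x) = ψ (.mk G p x')

/-- The group is transitive on the points of `P` over `b`, and a change of this point only permutes
`F`. -/
theorem isConstOnFiber_iff (h : IsPrincipalBundle EB EG EP G pr) {p : P} {b : B} (hp : pr p = b) :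
    IsConstOnFiber pr ψ b ↔ ∀ x x' : F, ψ (.mk G p x) = ψ (.mk G p x') := by
  refine ⟨fun H => H p hp, fun H q hq x x' => ?_⟩
  obtain ⟨a, rfl⟩ := h.exists_smul_eq (hp.trans hq.symm)
  rw [AssociatedBundle.mk_smul_left, AssociatedBundle.mk_smul_left]
  exact H _ _

variable [FiniteDimensional ℝ EB] [FiniteDimensional ℝ EF] [FiniteDimensional ℝ EM]
  [LieGroup 𝓘(ℝ, EG) ∞ G] [ContMDiffSMul 𝓘(ℝ, EG) 𝓘(ℝ, EF) ∞ G F]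

/-- Either the potential is constant on all fibers or the warping function has zero Hessian. -/
theorem isConstOnFiber_or_hessian_eq_zero [ConnectedSpace B] [ConnectedSpace F]
    (hM : IsWarpedFlatBundle EG pr H gB gF f g) (hsol : g.IsGradientRicciSoliton ψ lam) :
    (∀ b, IsConstOnFiber pr ψ b) ∨ ∀ (b : B) (u v : EB), gB.hessian f b u v = 0 := by
  have hf0 : ∀ b, f b ≠ 0 := fun b => (hM.warping_pos b).ne'
  have hloc : IsLocallyConstant (IsConstOnFiber pr ψ) := by
    refine (IsLocallyConstant.iff_eventually_eq _).2 fun b₀ => ?_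
    obtain ⟨s, V, hs, hb₀, hrect⟩ := hM.exists_rectangle hsol b₀
    filter_upwards [hs.isOpen.mem_nhds hb₀] with b hb
    rw [eq_iff_iff, isConstOnFiber_iff hM.principal (hs.section_eq b hb),
      isConstOnFiber_iff hM.principal (hs.section_eq b₀ hb₀)]
    -- If `ψ` takes equal values at `x` and `x'` over `b`, the rectangle identity cancels to the
    -- same equality over `b'`.
    have key : ∀ b ∈ V, ∀ b' ∈ V, (∀ x x', ψ (.mk G (s b) x) = ψ (.mk G (s b) x')) →
        ∀ x x', ψ (.mk G (s b') x) = ψ (.mk G (s b') x') := by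
      intro b hb b' hb' h x x'
      have := hrect b hb b' hb' x x'
      rw [h x x'] at this
      exact mul_left_cancel₀ (inv_ne_zero (hf0 b')) (sub_right_injective this)
    exact ⟨key b hb b₀ hb₀, key b₀ hb₀ b hb⟩
  by_cases hex : ∀ b, IsConstOnFiber pr ψ b
  · exact Or.inl hex
  · right
    intro b₀ u v
    obtain ⟨b₁, hb₁⟩ := not_forall.1 hex
    have hn : ¬ IsConstOnFiber pr ψ b₀ := fun h =>
      hb₁ ((hloc.apply_eq_of_preconnectedSpace b₀ b₁).mp h)
    obtain ⟨s, V, hs, hb₀, hrect⟩ := hM.exists_rectangle hsol b₀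
    rw [isConstOnFiber_iff hM.principal (hs.section_eq b₀ hb₀)] at hn
    push Not at hn
    obtain ⟨x, x', hne⟩ := hn
    -- By the rectangle identity the value of `k` is the same at all `b` in `V`, so the potentials
    -- along `x` and `x'` differ by `k f`.
    set k := (f b₀)⁻¹ * (ψ (.mk G (s b₀) x) - ψ (.mk G (s b₀) x')) with hk
    have hk0 : k ≠ 0 := mul_ne_zero (inv_ne_zero (hf0 b₀)) (sub_ne_zero.2 hne)
    have e : (fun b => ψ (.mk G (s b) x)) =ᶠ[𝓝 b₀] fun b => ψ (.mk G (s b) x') + k * f b := by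
      filter_upwards [hs.isOpen.mem_nhds hb₀] with b hb
      have h1 := hrect b hb b₀ hb₀ x x'
      have h2 : (f b)⁻¹ * (ψ (.mk G (s b) x) - ψ (.mk G (s b) x')) = k := by
        rw [hk]; linear_combination h1
      rw [← h2]
      have := hf0 b
      field_simp
      ring
    -- The horizontal equations along `x` and `x'` have the same right-hand side; their difference
    -- is `k ∇²f = 0`.
    have h1 := hM.horizontal_eq hsol hs hb₀ x u v
    have h2 := hM.horizontal_eq hsol hs hb₀ x' u v
    rw [gB.hessian_congr e, gB.hessian_add_const_mul
      (hs.contMDiffAt_comp_mk hM.smooth_quotient hsol.1 hb₀ x') hM.smooth_warping.contMDiffAt] at h1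
    exact (mul_eq_zero.1 (by linarith : k * gB.hessian f b₀ u v = 0)).resolve_left hk0

/-- If the potential is constant on the fibers, then it comes from the base, and the soliton
equation reduces to equations on the base and on the fiber. -/
theorem exists_base_potential [ConnectedSpace B] [ConnectedSpace F]
    (hm : 0 < Module.finrank ℝ EF)
    (hM : IsWarpedFlatBundle EG pr H gB gF f g) (hsol : g.IsGradientRicciSoliton ψ lam)
    (hconst : ∀ b, IsConstOnFiber pr ψ b) :
    ∃ φ : B → ℝ, ContMDiff 𝓘(ℝ, EB) 𝓘(ℝ, ℝ) ∞ φ ∧ (∀ p x, ψ (.mk G p x) = φ (pr p)) ∧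
      gB.BaseTensorEq f φ lam (Module.finrank ℝ EF) ∧
      (∃ c : ℝ, gB.BaseScalarEq f φ lam (Module.finrank ℝ EF) c) ∧
      ∃ μ : ℝ, gB.FiberConstantEq f φ lam (Module.finrank ℝ EF) μ ∧ gF.IsEinstein μ := by
  obtain ⟨x₀⟩ := (inferInstance : Nonempty F)
  -- `q` is a section of `pr` without any regularity. Constancy on fibers makes the function it
  -- defines agree locally with the one given by a smooth flat section, whence smoothness.
  choose q hq using hM.principal.surjective
  have hφψ : ∀ p x, ψ (.mk G p x) = ψ (.mk G (q (pr p)) x₀) := by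
    intro p x
    obtain ⟨a, ha⟩ := hM.principal.exists_smul_eq (hq (pr p))
    have h1 : AssociatedBundle.mk G p x = .mk G (q (pr p)) (a⁻¹ • x) := by
      rw [← AssociatedBundle.mk_smul_left, ha]
    rw [h1]
    exact hconst (pr p) _ (hq _) _ _
  set φ : B → ℝ := fun b => ψ (.mk G (q b) x₀) with hφdef
  have hsec : ∀ {s : B → P} {U : Set B} (hs : IsFlatSection EB EP pr H s U) {b : B} (hb : b ∈ U)
      (x : F), (fun b => ψ (.mk G (s b) x)) =ᶠ[𝓝 b] φ := by
    intro s U hs b hb x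
    filter_upwards [hs.isOpen.mem_nhds hb] with z hz
    rw [hφψ, hs.section_eq z hz]
  have hφ : ContMDiff 𝓘(ℝ, EB) 𝓘(ℝ, ℝ) ∞ φ := by
    intro b
    obtain ⟨s, U, hs, hb, -⟩ := hM.flat.exists_section (q b)
    rw [hq] at hb
    exact (hs.contMDiffAt_comp_mk hM.smooth_quotient hsol.1 hb x₀).congr_of_eventuallyEq
      (hsec hs hb x₀).symm
  have hvert : ∀ (b : B) (x : F) (ξ η : EF), gF.ricci x ξ η
      = (lam * f b ^ 2 + f b * gB.laplacian f b
          + ((Module.finrank ℝ EF : ℝ) - 1) * gB.gradInner f f b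
          - f b * gB.gradInner φ f b) * gF.form x ξ η := by
    intro b x ξ η
    obtain ⟨s, U, hs, hb, -⟩ := hM.flat.exists_section (q b)
    rw [hq] at hb
    have := hM.vertical_eq hsol hs hb x ξ η
    have hc : (fun x => ψ (.mk G (s b) x)) = fun _ => φ b := by
      ext x; rw [hφψ, hs.section_eq b hb]
    rwa [hc, gF.hessian_const, add_zero, gB.gradInner_congr (hsec hs hb x)] at this
  refine ⟨φ, hφ, hφψ, ?_, ?_, ?_⟩
  · intro b u v
    obtain ⟨s, U, hs, hb, -⟩ := hM.flat.exists_section (q b)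
    rw [hq] at hb
    have := hM.horizontal_eq hsol hs hb x₀ u v
    exact (congrArg (gB.ricci b u v + ·) (gB.hessian_congr (hsec hs hb x₀) u v).symm).trans this
  · obtain ⟨b₀⟩ := (inferInstance : Nonempty B)
    refine ⟨_, fun b => eq_of_fderiv_comp_extChartAt_symm_eq_zero (E := EB)
      (h := fun x => 2 * lam * φ x - gB.gradInner φ φ x + gB.laplacian φ x
        + (Module.finrank ℝ EF : ℝ) / f x * gB.gradInner φ f x) (fun b y hy => ?_) b b₀⟩
    set χ := extChartAt 𝓘(ℝ, EB) b
    -- A flat section around the point under consideration exhibits the scalar expression on `B` as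
    -- Hamilton's quantity of `M`, restricted to the slice through `c₀`; its derivative therefore
    -- vanishes.
    obtain ⟨s, U, hs, hb, -⟩ := hM.flat.exists_section (q (χ.symm y))
    rw [hq] at hb
    have h := hs.isBundleParam (EF := EF) b x₀
    set Ψ := bundleParam G s χ.symm (extChartAt 𝓘(ℝ, EF) x₀).symm
    set c₀ := extChartAt 𝓘(ℝ, EF) x₀ x₀
    have hW : (y, c₀) ∈ (χ.target ∩ χ.symm ⁻¹' U) ×ˢ (extChartAt 𝓘(ℝ, EF) x₀).target :=
      ⟨⟨hy, hb⟩, mem_extChartAt_target x₀⟩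
    have hpar := hM.isParam h
    have hmet := hpar.isCoordMetric g
    have hψs : ContDiffOn ℝ ∞ (ψ ∘ Ψ)
        ((χ.target ∩ χ.symm ⁻¹' U) ×ˢ (extChartAt 𝓘(ℝ, EF) x₀).target) := by
      rw [← contMDiffOn_iff_contDiffOn]
      exact hsol.1.comp_contMDiffOn (hM.contMDiffOn_bundleParam h)
    have hham : fderiv ℝ (coordHamilton (g.pull Ψ) (ψ ∘ Ψ) lam) (y, c₀) = 0 :=
      hmet.fderiv_coordHamilton hW hψs fun z hz v w => by
        rw [← hpar.ricci_eq g hz, ← hpar.hessian_eq g hz hsol.1.contMDiffAt]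
        exact hsol.2 (Ψ z) _ _
    have hdiff : DifferentiableAt ℝ (coordHamilton (g.pull Ψ) (ψ ∘ Ψ) lam) (y, c₀) :=
      (hmet.contDiffAt_coordHamilton hW (hψs.contDiffAt (h.isOpen_prod.mem_nhds hW)) lam
        ).differentiableAt (by simp)
    have e : (fun x => 2 * lam * φ x - gB.gradInner φ φ x + gB.laplacian φ x
        + (Module.finrank ℝ EF : ℝ) / f x * gB.gradInner φ f x) ∘ χ.symm =ᶠ[𝓝 y]
        fun z => coordHamilton (g.pull Ψ) (ψ ∘ Ψ) lam (z, c₀) := by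
      filter_upwards [h.base.isOpen.mem_nhds hW.1] with z hz
      have hzW : (z, c₀) ∈ (χ.target ∩ χ.symm ⁻¹' U) ×ˢ (extChartAt 𝓘(ℝ, EF) x₀).target :=
        ⟨hz, hW.2⟩
      have hwarp := hM.isCoordWarping h
      have e1 : ψ ∘ Ψ =ᶠ[𝓝 (z, c₀)] fun w => (φ ∘ χ.symm) w.1 := by
        filter_upwards [h.isOpen_prod.mem_nhds hzW] with w hw
        change ψ (.mk G _ _) = _
        rw [hφψ, hs.section_eq _ hw.1.2]
        rfl
      have hd := contDiffAt_comp_chart_symm hφ b hz.1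
      have hfd := contDiffAt_comp_chart_symm hM.smooth_warping b hz.1
      have e2 := hM.eventuallyEq_pull h hzW
      have e3 : coordHamilton (g.pull Ψ) (ψ ∘ Ψ) lam (z, c₀)
          = coordHamilton (warpedMetric (gB.pull χ.symm)
            (gF.pull (extChartAt 𝓘(ℝ, EF) x₀).symm) (f ∘ χ.symm))
            (fun w => (φ ∘ χ.symm) w.1) lam (z, c₀) := by
        rw [coordHamilton, coordHamilton, coordLaplacian_congr_metric e2,
          coordGradInner_congr_metric e2, coordLaplacian_congr _ e1, coordGradInner_congr _ e1 e1,
          e1.eq_of_nhds]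
      rw [e3, coordHamilton, hwarp.laplacian_fst hzW (hd.of_le ENat.LEInfty.out),
        hwarp.gradInner_fst hzW (hd.differentiableAt (by simp)) (hd.differentiableAt (by simp))]
      simp only [Function.comp_apply]
      rw [h.base.gradInner_eq gB hz hφ.contMDiffAt hφ.contMDiffAt,
        h.base.laplacian_eq gB hz hφ.contMDiffAt,
        h.base.gradInner_eq gB hz hφ.contMDiffAt hM.smooth_warping.contMDiffAt]
      simp only [Function.comp_def]
      ring
    have hcomp : HasFDerivAt (fun z => coordHamilton (g.pull Ψ) (ψ ∘ Ψ) lam (z, c₀))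
        (0 : EB →L[ℝ] ℝ) y := by
      have h1 := hdiff.hasFDerivAt
      rw [hham] at h1
      have h2 := HasFDerivAt.comp (g := coordHamilton (g.pull Ψ) (ψ ∘ Ψ) lam)
        (f := fun z : EB => (z, c₀)) y h1 (hasFDerivAt_prodMk_left y c₀)
      rwa [ContinuousLinearMap.zero_comp] at h2
    have hcomp' := hcomp.congr_of_eventuallyEq e
    exact ⟨hcomp'.differentiableAt, hcomp'.fderiv⟩
  · obtain ⟨b₀⟩ := (inferInstance : Nonempty B)
    refine ⟨_, fun b => ?_, fun x ξ η => hvert b₀ x ξ η⟩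
    -- With `m ≥ 1` there is a vector with `g_F(ξ, ξ) > 0`. It can be cancelled from the vertical
    -- equations over `b` and `b₀`, which have the same left-hand side.
    have : Nontrivial EF := Module.finrank_pos_iff.1 hm
    obtain ⟨ξ, hξ⟩ := exists_ne (0 : EF)
    have hpos : 0 < gF.form x₀ ξ ξ := gF.pos x₀ ξ hξ
    exact mul_right_cancel₀ hpos.ne' ((hvert b x₀ ξ ξ).symm.trans (hvert b₀ x₀ ξ ξ))

end IsWarpedFlatBundle

end Soliton

open MeasureTheory

/-! ### Lengths of curves and the Riemannian distance -/

section Distance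

variable {E : Type*} [NormedAddCommGroup E] [NormedSpace ℝ E]
  {M : Type*} [TopologicalSpace M] [ChartedSpace E M] [IsManifold 𝓘(ℝ, E) ∞ M]

namespace SmoothMetric

/-- The speed of a curve. -/
def speed (g : SmoothMetric E M) (γ : ℝ → M) (t : ℝ) : ℝ :=
  √(g.form (γ t) (modelDeriv ℝ E γ t 1) (modelDeriv ℝ E γ t 1))

/-- The length of a curve. -/
def length (g : SmoothMetric E M) (γ : ℝ → M) (a b : ℝ) : ℝ≥0∞ :=
  ∫⁻ t in Icc a b, ENNReal.ofReal (g.speed γ t)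

theorem length_eq_pathELength (g : SmoothMetric E M) (γ : ℝ → M) (a b : ℝ) :
    g.length γ a b =
      letI : RiemannianBundle (fun x : M => TangentSpace 𝓘(ℝ, E) x) := ⟨g.toRiemannianMetric⟩
      pathELength 𝓘(ℝ, E) γ a b := by
  let _ : RiemannianBundle (fun x : M => TangentSpace 𝓘(ℝ, E) x) := ⟨g.toRiemannianMetric⟩
  rw [pathELength_eq_lintegral_mfderiv_Icc, length]
  refine lintegral_congr fun t => ?_
  rw [← ofReal_norm, norm_eq_sqrt_real_inner]
  rfl

theorem edist_le_length (g : SmoothMetric E M) {γ : ℝ → M} {a b : ℝ} (hab : a ≤ b)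
    (hγ : ContMDiffOn 𝓘(ℝ, ℝ) 𝓘(ℝ, E) 1 γ (Icc a b)) : g.edist (γ a) (γ b) ≤ g.length γ a b := by
  let _ : RiemannianBundle (fun x : M => TangentSpace 𝓘(ℝ, E) x) := ⟨g.toRiemannianMetric⟩
  rw [length_eq_pathELength]
  exact riemannianEDist_le_pathELength hγ rfl rfl hab

theorem exists_length_lt (g : SmoothMetric E M) {x y : M} {r : ℝ≥0∞} (h : g.edist x y < r) :
    ∃ γ : ℝ → M, γ 0 = x ∧ γ 1 = y ∧ ContMDiff 𝓘(ℝ, ℝ) 𝓘(ℝ, E) 1 γ ∧ g.length γ 0 1 < r := by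
  let _ : RiemannianBundle (fun x : M => TangentSpace 𝓘(ℝ, E) x) := ⟨g.toRiemannianMetric⟩
  obtain ⟨γ, h0, h1, hγ, hl, -⟩ := exists_lt_locally_constant_of_riemannianEDist_lt
    (I := 𝓘(ℝ, E)) h zero_lt_one
  exact ⟨γ, h0, h1, hγ, by rwa [length_eq_pathELength]⟩

theorem edist_comm (g : SmoothMetric E M) (x y : M) : g.edist x y = g.edist y x := by
  let _ : RiemannianBundle (fun x : M => TangentSpace 𝓘(ℝ, E) x) := ⟨g.toRiemannianMetric⟩
  exact riemannianEDist_comm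

theorem edist_triangle (g : SmoothMetric E M) (x y z : M) :
    g.edist x z ≤ g.edist x y + g.edist y z := by
  let _ : RiemannianBundle (fun x : M => TangentSpace 𝓘(ℝ, E) x) := ⟨g.toRiemannianMetric⟩
  exact riemannianEDist_triangle

theorem eventually_edist_lt (g : SmoothMetric E M) (x : M) {c : ℝ≥0∞} (hc : 0 < c) :
    ∀ᶠ y in 𝓝 x, g.edist x y < c := by
  let _ : RiemannianBundle (fun x : M => TangentSpace 𝓘(ℝ, E) x) := ⟨g.toRiemannianMetric⟩
  have : IsContinuousRiemannianBundle E (fun x : M => TangentSpace 𝓘(ℝ, E) x) :=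
    ⟨g.inner, g.contMDiff.continuous, fun _ _ _ => rfl⟩
  exact eventually_riemannianEDist_lt 𝓘(ℝ, E) x hc

/-- Small distance balls lie in given neighborhoods. Finite dimension provides the local compactness
that, with the Hausdorff property, this requires. -/
theorem exists_edist_lt_subset [FiniteDimensional ℝ E] [T2Space M] (g : SmoothMetric E M) {x : M}
    {s : Set M} (hs : s ∈ 𝓝 x) : ∃ c : ℝ≥0∞, 0 < c ∧ ∀ y, g.edist x y < c → y ∈ s := by
  let _ : RiemannianBundle (fun x : M => TangentSpace 𝓘(ℝ, E) x) := ⟨g.toRiemannianMetric⟩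
  have : IsContinuousRiemannianBundle E (fun x : M => TangentSpace 𝓘(ℝ, E) x) :=
    ⟨g.inner, g.contMDiff.continuous, fun _ _ _ => rfl⟩
  have : LocallyCompactSpace M := Manifold.locallyCompact_of_finiteDimensional 𝓘(ℝ, E)
  obtain ⟨c, hc, h⟩ := setOfPred_riemannianEDist_lt_subset_nhds' 𝓘(ℝ, E) hs
  exact ⟨c, hc, fun y hy => h hy⟩

theorem length_mono (g : SmoothMetric E M) (γ : ℝ → M) {a b a' b' : ℝ} (ha : a' ≤ a)
    (hb : b ≤ b') : g.length γ a b ≤ g.length γ a' b' :=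
  lintegral_mono_set (Icc_subset_Icc ha hb)

theorem length_le_of_speed_le (g : SmoothMetric E M) {γ : ℝ → M} {a b C : ℝ} (hC : 0 ≤ C)
    (h : ∀ t ∈ Icc a b, g.speed γ t ≤ C) : g.length γ a b ≤ ENNReal.ofReal (C * (b - a)) := by
  calc g.length γ a b ≤ ∫⁻ _ in Icc a b, ENNReal.ofReal C :=
        setLIntegral_mono' measurableSet_Icc fun t ht => ENNReal.ofReal_le_ofReal (h t ht)
    _ = ENNReal.ofReal (C * (b - a)) := by
        rw [setLIntegral_const, Real.volume_Icc, ENNReal.ofReal_mul hC]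

end SmoothMetric

end Distance

/-! ### A Caristi-Ekeland principle -/

section Caristi

/-- A version of the Caristi-Ekeland principle: if every point can be moved so that `h` decreases
by at least the distance covered, and Cauchy sequences converge, then `h` is unbounded below. -/
theorem exists_forall_le_of_caristi {X : Type*} [TopologicalSpace X] [Nonempty X]
    (d : X → X → ℝ≥0∞)
    (hcomm : ∀ x y, d x y = d y x) (htri : ∀ x y z, d x z ≤ d x y + d y z)
    (hlim : ∀ x, ∀ c : ℝ≥0∞, 0 < c → ∀ᶠ y in 𝓝 x, d x y < c)
    (hcomplete : ∀ u : ℕ → X, (∀ ε : ℝ≥0∞, 0 < ε → ∃ N, ∀ m ≥ N, ∀ n ≥ N, d (u m) (u n) < ε) →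
      ∃ x, Tendsto u atTop (𝓝 x))
    {h : X → ℝ} (hcont : Continuous h) (hpos : ∀ x, 0 ≤ h x) :
    ∃ x, ∀ y, d x y ≤ ENNReal.ofReal (h x - h y) → h x ≤ h y := by
  have hself : ∀ x, d x x = 0 := fun x => by
    by_contra hne
    exact lt_irrefl _ (hlim x (d x x) (pos_iff_ne_zero.2 hne)).self_of_nhds
  -- Ekeland's order: `y` follows `x` if `h` drops by at least the distance covered. The triangle
  -- inequality makes it transitive.
  let R : X → X → Prop := fun x y => d x y ≤ ENNReal.ofReal (h x - h y) ∧ h y ≤ h x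
  have Rtrans : ∀ {x y z}, R x y → R y z → R x z := by
    rintro x y z ⟨h1, h1'⟩ ⟨h2, h2'⟩
    refine ⟨(htri x y z).trans ((add_le_add h1 h2).trans ?_), h2'.trans h1'⟩
    rw [← ENNReal.ofReal_add (by linarith) (by linarith)]
    exact ENNReal.ofReal_le_ofReal (by linarith)
  have Rself : ∀ x, R x x := fun x => ⟨by simp [hself], le_rfl⟩
  -- A greedy step: `y` realizes at least half of the decrease of `h` available after `x`.
  have hstep : ∀ x, ∃ y, R x y ∧ ∀ z, R x z → h y ≤ (h x + h z) / 2 := by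
    intro x
    set S := h '' {z | R x z}
    have hne : S.Nonempty := ⟨h x, x, Rself x, rfl⟩
    have hbdd : BddBelow S := ⟨0, by rintro _ ⟨z, -, rfl⟩; exact hpos z⟩
    by_cases hlt : sInf S < h x
    · obtain ⟨_, ⟨y, hy, rfl⟩, hlt'⟩ := exists_lt_of_csInf_lt hne
        (show sInf S < (h x + sInf S) / 2 by linarith)
      refine ⟨y, hy, fun z hz => ?_⟩
      have := csInf_le hbdd ⟨z, hz, rfl⟩
      linarith
    · refine ⟨x, Rself x, fun z hz => ?_⟩
      have := csInf_le hbdd ⟨z, hz, rfl⟩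
      linarith
  choose T hT hT' using hstep
  obtain ⟨x₀⟩ := (inferInstance : Nonempty X)
  let u : ℕ → X := fun n => T^[n] x₀
  have hu : ∀ n, u (n + 1) = T (u n) := fun n => Function.iterate_succ_apply' T n x₀
  have hR : ∀ {m n}, m ≤ n → R (u m) (u n) := by
    intro m n hmn
    induction n, hmn using Nat.le_induction with
    | base => exact Rself _
    | succ n _ ih => rw [hu]; exact Rtrans ih (hT _)
  have hanti : Antitone (h ∘ u) := fun m n hmn => (hR hmn).2
  have hbdd : BddBelow (range (h ∘ u)) := ⟨0, by rintro _ ⟨n, rfl⟩; exact hpos _⟩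
  have htend := tendsto_atTop_ciInf hanti hbdd
  set L := ⨅ n, (h ∘ u) n
  have hL : ∀ n, L ≤ h (u n) := fun n => ciInf_le hbdd n
  -- Along the orbit distances are bounded by differences of `h`, which decreases to `L`.
  have hcauchy : ∀ ε : ℝ≥0∞, 0 < ε → ∃ N, ∀ m ≥ N, ∀ n ≥ N, d (u m) (u n) < ε := by
    intro ε hε
    obtain ⟨δ, hδ0, hδ⟩ : ∃ δ : ℝ, 0 < δ ∧ ENNReal.ofReal δ < ε := by
      obtain ⟨q, hq0, hq⟩ := ENNReal.lt_iff_exists_real_btwn.1 hε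
      exact ⟨q, by simpa using hq.1, hq.2⟩
    obtain ⟨N, hN⟩ := (htend.eventually (gt_mem_nhds (show L < L + δ by linarith))).exists
    have key : ∀ m ≥ N, ∀ n ≥ m, d (u m) (u n) < ε := by
      intro m hm n hn
      refine lt_of_le_of_lt ((hR hn).1.trans (ENNReal.ofReal_le_ofReal ?_)) hδ
      have h1 : h (u m) ≤ h (u N) := (hR hm).2
      have h2 := hL n
      have h3 : h (u N) < L + δ := hN
      linarith
    refine ⟨N, fun m hm n hn => ?_⟩
    rcases le_total m n with h | h
    · exact key m hm n h
    · rw [hcomm]; exact key n hn m h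
  obtain ⟨x, hx⟩ := hcomplete u hcauchy
  have hhx : h x = L := tendsto_nhds_unique ((hcont.tendsto x).comp hx) htend
  have hRx : ∀ n, R (u n) x := by
    intro n
    refine ⟨le_of_forall_pos_le_add ?_, hhx ▸ hL n⟩
    intro c hc
    obtain ⟨m, hm, hnm⟩ := ((hx.eventually (hlim x c hc)).and (eventually_ge_atTop n)).exists
    refine (htri _ (u m) _).trans (add_le_add ((hR hnm).1.trans (ENNReal.ofReal_le_ofReal ?_)) ?_)
    · have := hL m
      linarith
    · rw [hcomm]; exact hm.le
  refine ⟨x, fun y hy => ?_⟩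
  by_contra hlt
  push Not at hlt
  have hRy : ∀ n, R (u n) y := fun n => Rtrans (hRx n) ⟨hy, hlt.le⟩
  -- A point `y` after the limit with `h y < h x = L` follows every `u n`; in the limit the greedy
  -- choice gives `L ≤ (L + h y) / 2`, a contradiction.
  have h1 : ∀ n, h (u (n + 1)) ≤ (h (u n) + h y) / 2 := fun n => by
    rw [hu]; exact hT' _ _ (hRy n)
  have h2 : L ≤ (L + h y) / 2 :=
    le_of_tendsto_of_tendsto' ((tendsto_add_atTop_iff_nat 1).2 htend)
      ((htend.add_const (h y)).div_const 2) h1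
  linarith

end Caristi

/-! ### Functions with gradient of constant length on a complete manifold -/

section Complete

variable {E : Type*} [NormedAddCommGroup E] [NormedSpace ℝ E]
  {M : Type*} [TopologicalSpace M] [ChartedSpace E M] [IsManifold 𝓘(ℝ, E) ∞ M]
  {E' : Type*} [NormedAddCommGroup E'] [NormedSpace ℝ E']

theorem IsParam.speed_line (g : SmoothMetric E M) {Ψ : E' → M} {W : Set E'} (h : IsParam E Ψ W)
    {y v : E'} {t : ℝ} (ht : y + t • v ∈ W) :
    g.speed (fun t => Ψ (y + t • v)) t = √(g.pull Ψ (y + t • v) v v) := by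
  have hd : HasDerivAt (fun t : ℝ => y + t • v) v t := by
    simpa using ((hasDerivAt_id t).smul_const v).const_add y
  have h1 : modelDeriv ℝ E' (fun t : ℝ => y + t • v) t 1 = v := by
    rw [modelDeriv_eq_fderiv, hd.hasFDerivAt.fderiv]; simp
  have h2 := modelDeriv_comp (E₁ := ℝ) (g := Ψ) (f := fun t : ℝ => y + t • v) (x := t)
    (h.mdifferentiableAt ht) hd.differentiableAt.mdifferentiableAt 1
  rw [h1] at h2
  have h3 : modelDeriv ℝ E (fun t : ℝ => Ψ (y + t • v)) t 1 = paramDeriv E Ψ (y + t • v) v := h2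
  rw [SmoothMetric.speed, h3]
  rfl

theorem IsParam.contMDiffOn_line {Ψ : E' → M} {W : Set E'} (h : IsParam E Ψ W)
    {y v : E'} {s : Set ℝ} (hs : ∀ t ∈ s, y + t • v ∈ W) :
    ContMDiffOn 𝓘(ℝ, ℝ) 𝓘(ℝ, E) 1 (fun t : ℝ => Ψ (y + t • v)) s := by
  have h1 : ContMDiffOn 𝓘(ℝ, ℝ) 𝓘(ℝ, E') 1 (fun t : ℝ => y + t • v) s := by
    rw [contMDiffOn_iff_contDiffOn]
    fun_prop
  exact (h.contMDiffOn.of_le (by simp)).comp h1 hs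

/-- On a complete manifold, a function that is bounded below cannot have a gradient of constant
positive length. -/
theorem SmoothMetric.IsComplete.false_of_gradInner_eq [FiniteDimensional ℝ E'] [Nonempty M]
    {g : SmoothMetric E M} (hg : g.IsComplete) {h : M → ℝ} (hcont : Continuous h)
    (hpos : ∀ z, 0 ≤ h z) {k : ℝ} (hk : 0 < k)
    (hgrad : ∀ z, ∃ (Ψ : E' → M) (W : Set E') (y : E'), IsParam E Ψ W ∧ y ∈ W ∧ Ψ y = z ∧
      DifferentiableAt ℝ (h ∘ Ψ) y ∧ coordGradInner (g.pull Ψ) (h ∘ Ψ) (h ∘ Ψ) y = k) : False := by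
  -- Moving against the gradient for a short time `t` covers distance at most `2 √k t` and lowers
  -- `h` by at least `(k / 2) t`. The constant satisfies `C (k / 2) = 2 √k`, so `C h` drops by at
  -- least the distance covered.
  set C := 4 / √k with hC
  have hsk : 0 < √k := Real.sqrt_pos.2 hk
  have hsk2 : √k * √k = k := Real.mul_self_sqrt hk.le
  have hC0 : 0 < C := by positivity
  obtain ⟨z, hz⟩ := exists_forall_le_of_caristi g.edist g.edist_comm g.edist_triangle
    (fun x _ hc => g.eventually_edist_lt x hc) hg (h := fun z => C * h z)
    (continuous_const.mul hcont) fun z => mul_nonneg hC0.le (hpos z)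
  obtain ⟨Ψ, W, y, hΨ, hy, rfl, hd, hgr⟩ := hgrad z
  have hG := hΨ.isCoordMetric g
  set v := coordGrad (g.pull Ψ) (h ∘ Ψ) y with hv
  have hline : ContinuousAt (fun t : ℝ => y + t • (-v)) 0 := by fun_prop
  have hline0 : y + (0 : ℝ) • (-v) = y := by simp
  have hmetric : ContinuousAt (fun z => g.pull Ψ z (-v) (-v)) y :=
    (((hG.contDiffAt hy).continuousAt).clm_apply continuousAt_const).clm_apply continuousAt_const
  have hval : g.pull Ψ y (-v) (-v) = k := by
    rw [← hgr, coordGradInner, ← hv]; simp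
  -- The squared speed is `k` at the start, so by continuity it stays below `4 k` on the straight
  -- coordinate line.
  have e1 : ∀ᶠ t in 𝓝 (0 : ℝ), y + t • (-v) ∈ W ∧ g.pull Ψ (y + t • (-v)) (-v) (-v) < 4 * k := by
    have h1 : ∀ᶠ z in 𝓝 y, z ∈ W ∧ g.pull Ψ z (-v) (-v) < 4 * k :=
      (show ∀ᶠ z in 𝓝 y, z ∈ W from hG.isOpen.mem_nhds hy).and (hmetric.eventually (gt_mem_nhds (by simp only [hval]; linarith)))
    rw [ContinuousAt, hline0] at hline
    exact hline.eventually h1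
  have hder : HasDerivAt (fun t : ℝ => h (Ψ (y + t • (-v)))) (-k) 0 := by
    have h1 : HasDerivAt (fun t : ℝ => y + t • (-v)) (-v) 0 := by
      simpa using ((hasDerivAt_id (0 : ℝ)).smul_const (-v)).const_add y
    have h2 := HasFDerivAt.comp_hasDerivAt_of_eq (f := fun t : ℝ => y + t • (-v)) 0
      hd.hasFDerivAt h1 hline0.symm
    rw [map_neg, ← hG.coordGradInner_eq hy, hgr] at h2
    exact h2
  -- The derivative along the line at time zero is `-k`, so difference quotients are soon below `-k
  -- / 2`.
  have e2 : ∀ᶠ t in 𝓝[>] (0 : ℝ), h (Ψ (y + t • (-v))) ≤ h (Ψ y) - k / 2 * t := by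
    have hs := (hasDerivAt_iff_tendsto_slope.1 hder).eventually
      (gt_mem_nhds (show -k < -(k / 2) by linarith))
    have hs' := nhdsWithin_mono (0 : ℝ) (fun t (ht : (0 : ℝ) < t) => ht.ne') hs
    filter_upwards [hs', self_mem_nhdsWithin] with t ht ht0
    have ht0' : (0 : ℝ) < t := ht0
    rw [slope_def_field, hline0, sub_zero, div_lt_iff₀ ht0'] at ht
    linarith
  obtain ⟨ε, hε, hball⟩ := Metric.eventually_nhds_iff.1 e1
  have e3 : ∀ᶠ t in 𝓝[>] (0 : ℝ), t < ε := nhdsWithin_le_nhds (gt_mem_nhds hε)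
  obtain ⟨t, ⟨ht, htε⟩, ht0⟩ := ((e2.and e3).and self_mem_nhdsWithin).exists
  have ht0' : (0 : ℝ) < t := ht0
  have hin : ∀ r ∈ Icc 0 t, y + r • (-v) ∈ W ∧ g.pull Ψ (y + r • (-v)) (-v) (-v) < 4 * k := by
    intro r hr
    refine hball ?_
    rw [Real.dist_eq, sub_zero, abs_of_nonneg hr.1]
    exact hr.2.trans_lt htε
  have hlen : g.edist (Ψ y) (Ψ (y + t • (-v))) ≤ ENNReal.ofReal (2 * √k * t) := by
    have h1 := g.edist_le_length (γ := fun t : ℝ => Ψ (y + t • (-v))) ht0'.le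
      (hΨ.contMDiffOn_line fun r hr => (hin r hr).1)
    have h2 := g.length_le_of_speed_le (γ := fun t : ℝ => Ψ (y + t • (-v))) (a := 0) (b := t)
      (C := 2 * √k) (by positivity) fun r hr => by
        rw [hΨ.speed_line g (hin r hr).1]
        refine Real.sqrt_le_iff.2 ⟨by positivity, ?_⟩
        have := (hin r hr).2
        nlinarith
    simp only [hline0, sub_zero] at h1 h2
    exact h1.trans h2
  -- The point supplied by the Caristi-Ekeland principle admits no such descent.
  have := hz (Ψ (y + t • (-v))) (hlen.trans (ENNReal.ofReal_le_ofReal ?_))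
  · have h1 := le_of_mul_le_mul_left this hC0
    nlinarith
  · have h1 : C * (k / 2 * t) = 2 * √k * t := by
      have h2 : C * k = 4 * √k := by
        rw [hC, div_mul_eq_mul_div, div_eq_iff hsk.ne']
        linear_combination (-4) * hsk2
      linear_combination t / 2 * h2
    nlinarith

end Complete

/-! ### The necessary conditions -/

section Necessary

variable {EB EF EG EP EM : Type*} [NormedAddCommGroup EB] [NormedSpace ℝ EB]
  [NormedAddCommGroup EF] [NormedSpace ℝ EF] [NormedAddCommGroup EG] [NormedSpace ℝ EG]
  [NormedAddCommGroup EP] [NormedSpace ℝ EP] [NormedAddCommGroup EM] [NormedSpace ℝ EM]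
  {B : Type*} [TopologicalSpace B] [ChartedSpace EB B] [IsManifold 𝓘(ℝ, EB) ∞ B]
  {F : Type*} [TopologicalSpace F] [ChartedSpace EF F] [IsManifold 𝓘(ℝ, EF) ∞ F]
  {G : Type*} [TopologicalSpace G] [ChartedSpace EG G] [Group G]
  {P : Type*} [TopologicalSpace P] [ChartedSpace EP P] [MulAction G P] [MulAction G F]
  [ChartedSpace EM (AssociatedBundle G P F)] [IsManifold 𝓘(ℝ, EM) ∞ (AssociatedBundle G P F)]
  {pr : P → B} {H : ∀ p : P, Submodule ℝ (TangentSpace 𝓘(ℝ, EP) p)}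
  {gB : SmoothMetric EB B} {gF : SmoothMetric EF F} {f : B → ℝ}
  {g : SmoothMetric EM (AssociatedBundle G P F)}
  {ψ : AssociatedBundle G P F → ℝ} {lam : ℝ}

theorem AssociatedBundle.continuous_proj (hpr : Continuous pr)
    (h : ∀ (a : G) (p : P), pr (a • p) = pr p) :
    Continuous (proj pr h : AssociatedBundle G P F → B) :=
  Continuous.quotient_lift (hpr.comp continuous_fst) _

variable [FiniteDimensional ℝ EB] [FiniteDimensional ℝ EF] [FiniteDimensional ℝ EM]
  [LieGroup 𝓘(ℝ, EG) ∞ G] [ContMDiffSMul 𝓘(ℝ, EG) 𝓘(ℝ, EF) ∞ G F]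

/-- On a complete warped flat bundle, a warping function with zero Hessian is constant. -/
theorem IsWarpedFlatBundle.eq_of_hessian_eq_zero [ConnectedSpace B] [Nonempty F]
    (hM : IsWarpedFlatBundle EG pr H gB gF f g) (hg : g.IsComplete)
    (hess : ∀ (b : B) (u v : EB), gB.hessian f b u v = 0) (b b' : B) : f b = f b' := by
  have hconst := gB.gradInner_self_eq_of_hessian_eq_zero hM.smooth_warping hess
  have hnonneg : 0 ≤ gB.gradInner f f b := by
    by_cases h0 : gB.gradient f b = 0
    · rw [SmoothMetric.gradInner, h0]; simp
    · exact (gB.pos b _ h0).le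
  rcases hnonneg.eq_or_lt with h0 | hpos
  · exact gB.eq_of_gradInner_self_eq_zero hM.smooth_warping
      (fun b'' => (hconst b'' b).trans h0.symm) b b'
  · exfalso
    obtain ⟨p₀, -⟩ := hM.principal.surjective b
    obtain ⟨x₀⟩ := (inferInstance : Nonempty F)
    have : Nonempty (AssociatedBundle G P F) := ⟨.mk G p₀ x₀⟩
    -- The obstruction applies to `f ∘ π`, which is positive and whose gradient has the length of
    -- `∇f`, as it is horizontal. Thus completeness of the total space suffices.
    refine hg.false_of_gradInner_eq (E' := EB × EF)
      (h := f ∘ AssociatedBundle.proj pr hM.principal.map_smul)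
      (hM.smooth_warping.continuous.comp
        (AssociatedBundle.continuous_proj hM.principal.contMDiff.continuous _))
      (fun z => (hM.warping_pos _).le) hpos fun z => ?_
    obtain ⟨p, x, rfl⟩ := AssociatedBundle.exists_rep z
    obtain ⟨s, U, hs, hb, hsp⟩ := hM.flat.exists_section p
    have h := hs.isBundleParam (EF := EF) (pr p) x
    have hW := IsFlatSection.mem_isBundleParam (EB := EB) (EF := EF) hb x
    set χ := extChartAt 𝓘(ℝ, EB) (pr p)
    have hχ : χ.symm (χ (pr p)) = pr p := extChartAt_to_inv _
    have hζ : (extChartAt 𝓘(ℝ, EF) x).symm (extChartAt 𝓘(ℝ, EF) x x) = x := extChartAt_to_inv _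
    refine ⟨_, _, _, hM.isParam h, hW, ?_, ?_⟩
    · simp only [bundleParam, hχ, hζ, hsp]
    · have e : (f ∘ AssociatedBundle.proj pr hM.principal.map_smul)
          ∘ bundleParam G s χ.symm (extChartAt 𝓘(ℝ, EF) x).symm
          =ᶠ[𝓝 (χ (pr p), extChartAt 𝓘(ℝ, EF) x x)] fun y => (f ∘ χ.symm) y.1 := by
        filter_upwards [h.isOpen_prod.mem_nhds hW] with y hy
        simp only [Function.comp_apply, bundleParam, AssociatedBundle.proj_mk]
        rw [hs.section_eq _ hy.1.2]
      have hd : DifferentiableAt ℝ (f ∘ χ.symm) (χ (pr p)) :=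
        (contDiffAt_comp_chart_symm hM.smooth_warping (pr p) hW.1.1).differentiableAt (by simp)
      refine ⟨e.differentiableAt_iff.2 (hd.comp_prod_fst (y := (χ (pr p), _))), ?_⟩
      have hsm := hM.smooth_warping.contMDiffAt (x := χ.symm (χ (pr p)))
      rw [coordGradInner_congr_metric (hM.eventuallyEq_pull h hW), coordGradInner_congr _ e e,
        (hM.isCoordWarping h).gradInner_fst hW hd hd, ← h.base.gradInner_eq gB hW.1 hsm hsm]
      exact hconst _ b

theorem IsSolitonWarpedFlatBundle.isWarpedFlatBundle (hpr : IsPrincipalBundle EB EG EP G pr)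
    (h : IsSolitonWarpedFlatBundle pr H gB gF f g ψ lam) :
    IsWarpedFlatBundle EG pr H gB gF f g :=
  ⟨hpr, h.flat, h.smooth_quotient, h.smooth_warping, h.warping_pos, h.warped⟩

/-- The potential of a complete gradient Ricci soliton warped flat bundle with nonconstant warping
function comes from the base. -/
theorem IsSolitonWarpedFlatBundle.exists_base_potential [ConnectedSpace B] [ConnectedSpace F]
    (hm : 0 < Module.finrank ℝ EF) (hpr : IsPrincipalBundle EB EG EP G pr)
    (h : IsSolitonWarpedFlatBundle pr H gB gF f g ψ lam) (hg : g.IsComplete)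
    (hf : ∃ b b' : B, f b ≠ f b') :
    ∃ φ : B → ℝ, ContMDiff 𝓘(ℝ, EB) 𝓘(ℝ, ℝ) ∞ φ ∧
      ψ = φ ∘ AssociatedBundle.proj pr hpr.map_smul ∧
      gB.BaseTensorEq f φ lam (Module.finrank ℝ EF) ∧
      (∃ c : ℝ, gB.BaseScalarEq f φ lam (Module.finrank ℝ EF) c) ∧
      ∃ μ : ℝ, gB.FiberConstantEq f φ lam (Module.finrank ℝ EF) μ ∧ gF.IsEinstein μ := by
  have hM := h.isWarpedFlatBundle hpr
  rcases hM.isConstOnFiber_or_hessian_eq_zero h.soliton with hc | hess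
  · obtain ⟨φ, hφ, hφψ, h1, h2, h3⟩ := hM.exists_base_potential hm h.soliton hc
    refine ⟨φ, hφ, funext fun z => ?_, h1, h2, h3⟩
    obtain ⟨p, x, rfl⟩ := AssociatedBundle.exists_rep z
    exact hφψ p x
  · obtain ⟨b, b', hne⟩ := hf
    exact absurd (hM.eq_of_hessian_eq_zero hg hess b b') hne

end Necessary

/-! ### Constructing metrics and manifolds -/

section ConstructMetric

variable {E : Type*} [NormedAddCommGroup E] [NormedSpace ℝ E] [FiniteDimensional ℝ E]

/-- On the compact unit sphere `Q v v` has a positive minimum `c`, so the unit ball of `Q` lies in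
the ball of radius `√(1 / c)`. This boundedness is part of the data of a Riemannian metric on a
bundle. -/
theorem isVonNBounded_of_pos_def (Q : E →L[ℝ] E →L[ℝ] ℝ) (hpos : ∀ v, v ≠ 0 → 0 < Q v v) :
    Bornology.IsVonNBounded ℝ {v : E | Q v v < 1} := by
  have hc : Continuous fun v : E => Q v v := by fun_prop
  obtain ⟨c, hc0, hc1⟩ : ∃ c > 0, ∀ v : E, ‖v‖ = 1 → c ≤ Q v v := by
    -- The unit sphere is empty if `E` is trivial.
    rcases (Metric.sphere (0 : E) 1).eq_empty_or_nonempty with h | h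
    · refine ⟨1, one_pos, fun v hv => ?_⟩
      have : v ∈ Metric.sphere (0 : E) 1 := by simpa using hv
      rw [h] at this
      exact this.elim
    · obtain ⟨v, hv, hmin⟩ := (isCompact_sphere (0 : E) 1).exists_isMinOn h hc.continuousOn
      refine ⟨Q v v, hpos v ?_, fun w hw => hmin (by simpa using hw)⟩
      rintro rfl
      simp at hv
  rw [NormedSpace.isVonNBounded_iff, isBounded_iff_forall_norm_le]
  refine ⟨√(1 / c), fun v hv => ?_⟩
  rcases eq_or_ne v 0 with rfl | hv0
  · simp
  have hn : 0 < ‖v‖ := norm_pos_iff.2 hv0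
  have h1 := hc1 (‖v‖⁻¹ • v) (by rw [norm_smul, norm_inv, norm_norm, inv_mul_cancel₀ hn.ne'])
  simp only [map_smul, smul_apply, smul_eq_mul] at h1
  have h2 : c * ‖v‖ ^ 2 ≤ Q v v := by
    calc c * ‖v‖ ^ 2 ≤ ‖v‖⁻¹ * (‖v‖⁻¹ * Q v v) * ‖v‖ ^ 2 := by gcongr
      _ = Q v v := by field_simp
  refine Real.le_sqrt_of_sq_le ?_
  rw [le_div_iff₀ hc0, mul_comm]
  exact h2.trans (le_of_lt hv)

theorem contDiffAt_of_apply {E' F' : Type*} [NormedAddCommGroup E'] [NormedSpace ℝ E']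
    [NormedAddCommGroup F'] [NormedSpace ℝ F'] {f : E' → E →L[ℝ] F'} {x : E'}
    (h : ∀ v, ContDiffAt ℝ ∞ (fun y => f y v) x) : ContDiffAt ℝ ∞ f x := by
  let b := Module.finBasis ℝ E
  have h2 : f = fun y => ∑ i, ((b.coord i).toContinuousLinearMap).smulRight (f y (b i)) := by
    ext y v
    simp only [sum_apply, ContinuousLinearMap.smulRight_apply, LinearMap.coe_toContinuousLinearMap',
      Module.Basis.coord_apply]
    conv_lhs => rw [← b.sum_repr v, map_sum]
    simp only [map_smul]
  rw [h2]
  exact ContDiffAt.sum fun i _ =>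
    (ContinuousLinearMap.smulRightL ℝ E F' _).contDiff.contDiffAt.comp x (h (b i))

variable {M : Type*} [TopologicalSpace M] [ChartedSpace E M] [IsManifold 𝓘(ℝ, E) ∞ M]

/-- A family of inner products that is smooth in the preferred charts is a smooth metric. -/
theorem exists_smoothMetric (Q : M → E →L[ℝ] E →L[ℝ] ℝ) (hsymm : ∀ x v w, Q x v w = Q x w v)
    (hpos : ∀ x v, v ≠ 0 → 0 < Q x v v)
    (hQ : ∀ (x : M) (u v : E), ContDiffAt ℝ ∞
      (fun y => Q ((extChartAt 𝓘(ℝ, E) x).symm y) (paramDeriv E (extChartAt 𝓘(ℝ, E) x).symm y u)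
        (paramDeriv E (extChartAt 𝓘(ℝ, E) x).symm y v)) (extChartAt 𝓘(ℝ, E) x x)) :
    ∃ g : SmoothMetric E M, ∀ x, g.form x = Q x := by
  refine ⟨⟨Q, hsymm, hpos, fun x => isVonNBounded_of_pos_def (Q x) (hpos x), fun x => ?_⟩,
    fun x => rfl⟩
  rw [contMDiffAt_hom_bundle]
  refine ⟨contMDiffAt_id, ?_⟩
  let D : E → E →L[ℝ] E := fun y => paramDeriv E (extChartAt 𝓘(ℝ, E) x).symm y
  have h1 : ContDiffAt ℝ ∞ (fun y => (Q ((extChartAt 𝓘(ℝ, E) x).symm y)).bilinearComp (D y) (D y))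
      (extChartAt 𝓘(ℝ, E) x x) :=
    contDiffAt_of_apply fun u => contDiffAt_of_apply fun v => hQ x u v
  have h2 := (contMDiffAt_iff_contDiffAt.2 h1).comp x (contMDiffAt_extChartAt (I := 𝓘(ℝ, E)))
  refine h2.congr_of_eventuallyEq ?_
  filter_upwards [chart_source_mem_nhds E x] with z hz
  -- The inverse of the tangent bundle trivialization is the derivative of the inverse chart, so
  -- smoothness in the bundle sense is the coordinate condition `hQ`.
  have hs : (trivializationAt E (TangentSpace 𝓘(ℝ, E)) x).symmL ℝ z
      = D (extChartAt 𝓘(ℝ, E) x z) := by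
    have h3 := TangentBundle.symmL_trivializationAt (I := 𝓘(ℝ, E)) hz
    rw [modelWithCornersSelf_coe, range_id, mfderivWithin_univ] at h3
    exact h3
  have hz' : (extChartAt 𝓘(ℝ, E) x).symm (extChartAt 𝓘(ℝ, E) x z) = z :=
    (extChartAt 𝓘(ℝ, E) x).left_inv (by rwa [extChartAt_source])
  ext u v
  have h4 := inCoordinates_apply_eq₂ (𝕜 := ℝ) (F₁ := E) (F₂ := E) (F₃ := ℝ)
    (E₁ := fun x : M => TangentSpace 𝓘(ℝ, E) x) (E₂ := fun x : M => TangentSpace 𝓘(ℝ, E) x)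
    (E₃ := Bundle.Trivial M ℝ) (x₀ := x) (x := z) (ϕ := Q z) (v := u) (w := v) (by simpa using hz)
    (by simpa using hz) (by simp)
  have h5 : ∀ u : E, (trivializationAt E (TangentSpace 𝓘(ℝ, E)) x).symm z u
      = D (extChartAt 𝓘(ℝ, E) x z) u := fun u =>
    (Trivialization.symmL_apply (R := ℝ) _ (by simpa using hz) _).symm.trans (congrArg (fun L : E →L[ℝ] E => L u) hs)
  refine h4.trans (Eq.trans ?_ ((congrArg₂ (fun a b : E => Q z a b) (h5 u) (h5 v)).trans ?_))
  · simp
    rfl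
  · change Q z _ _ = Q ((extChartAt 𝓘(ℝ, E) x).symm (extChartAt 𝓘(ℝ, E) x z)) _ _
    rw [hz']
    rfl

end ConstructMetric

/-! ### Manifold structures from local homeomorphisms -/

section Gluing

variable {E : Type*} [NormedAddCommGroup E] [NormedSpace ℝ E]
  {N : Type*} [TopologicalSpace N] [ChartedSpace E N] [IsManifold 𝓘(ℝ, E) ∞ N]
  {M : Type*} [TopologicalSpace M] {ι : Type*}

/-- A space that is locally homeomorphic to a manifold, with smooth changes of coordinates, is a
manifold. -/
theorem exists_isManifold_of_openPartialHomeomorph (T : ι → OpenPartialHomeomorph M N) (i : M → ι)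
    (hi : ∀ z, z ∈ (T (i z)).source)
    (hT : ∀ j k, ContMDiffOn 𝓘(ℝ, E) 𝓘(ℝ, E) ∞ (T k ∘ (T j).symm) ((T j).symm ≫ₕ T k).source) :
    ∃ (_ : ChartedSpace E M) (_ : IsManifold 𝓘(ℝ, E) ∞ M),
      ∀ j, ContMDiffOn 𝓘(ℝ, E) 𝓘(ℝ, E) ∞ (T j) (T j).source ∧
        ContMDiffOn 𝓘(ℝ, E) 𝓘(ℝ, E) ∞ (T j).symm (T j).target := by
  -- The chart at `z` is one chosen local homeomorphism followed by the preferred chart of `N` at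
  -- the image of `z`.
  let χ : M → OpenPartialHomeomorph M E := fun z => T (i z) ≫ₕ chartAt E (T (i z) z)
  let CM : ChartedSpace E M :=
    { atlas := range χ
      chartAt := χ
      mem_chart_source := fun z => by simp [χ, hi]
      chart_mem_atlas := fun z => ⟨z, rfl⟩ }
  have IM : IsManifold 𝓘(ℝ, E) ∞ M := by
    refine isManifold_of_contDiffOn _ _ _ ?_
    rintro _ _ ⟨z, rfl⟩ ⟨w, rfl⟩
    simp only [modelWithCornersSelf_coe, modelWithCornersSelf_coe_symm, range_id, inter_univ,
      preimage_id, Function.comp_id, Function.id_comp]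
    rw [← contMDiffOn_iff_contDiffOn]
    have hs : ∀ y ∈ ((χ z).symm ≫ₕ χ w).source, y ∈ (chartAt E (T (i z) z)).target ∧
        (chartAt E (T (i z) z)).symm y ∈ ((T (i z)).symm ≫ₕ T (i w)).source ∧
        T (i w) ((T (i z)).symm ((chartAt E (T (i z) z)).symm y))
          ∈ (chartAt E (T (i w) w)).source := by
      intro y hy
      simp [χ] at hy ⊢
      tauto
    exact ((contMDiffOn_chart (x := T (i w) w)).comp ((hT (i z) (i w)).comp
      ((contMDiffOn_chart_symm (x := T (i z) z)).mono fun y hy => (hs y hy).1)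
      fun y hy => (hs y hy).2.1) fun y hy => (hs y hy).2.2)
  refine ⟨CM, IM, fun j => ⟨fun z hz => ?_, fun n hn => ?_⟩⟩
  · have h1 : ContMDiffAt 𝓘(ℝ, E) 𝓘(ℝ, E) ∞ (χ z) z :=
      (contMDiffOn_chart (x := z)).contMDiffAt (chart_source_mem_nhds E z)
    have hz1 : T (i z) z ∈ (chartAt E (T (i z) z)).source := mem_chart_source _ _
    have h2 : ContMDiffAt 𝓘(ℝ, E) 𝓘(ℝ, E) ∞ (chartAt E (T (i z) z)).symm (χ z z) :=
      (contMDiffOn_chart_symm (x := T (i z) z)).contMDiffAt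
        ((chartAt E (T (i z) z)).open_target.mem_nhds ((chartAt E (T (i z) z)).map_source hz1))
    have e : (chartAt E (T (i z) z)).symm (χ z z) = T (i z) z :=
      (chartAt E (T (i z) z)).left_inv hz1
    have hz2 : T (i z) z ∈ ((T (i z)).symm ≫ₕ T j).source := by
      simp [(T (i z)).map_source (hi z), (T (i z)).left_inv (hi z), hz]
    have h3 := (hT (i z) j).contMDiffAt (((T (i z)).symm ≫ₕ T j).open_source.mem_nhds hz2)
    have h4 := ContMDiffAt.comp_of_eq h3 (ContMDiffAt.comp z h2 h1) e
    -- Near `z` the map `T j` is the chart at `z`, followed by an inverse chart of `N` and the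
    -- transition map to `T j`.
    refine (h4.congr_of_eventuallyEq ?_).contMDiffWithinAt
    have : ∀ᶠ w in 𝓝 z, w ∈ (χ z).source := (χ z).open_source.mem_nhds (by simp [χ, hi])
    filter_upwards [this] with w hw
    have hw' : w ∈ (T (i z)).source ∧ T (i z) w ∈ (chartAt E (T (i z) z)).source := by
      simpa [χ] using hw
    change T j w = T j ((T (i z)).symm ((chartAt E (T (i z) z)).symm
      (chartAt E (T (i z) z) (T (i z) w))))
    rw [(chartAt E (T (i z) z)).left_inv hw'.2, (T (i z)).left_inv hw'.1]
  · set z := (T j).symm n with hz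
    have hzj : z ∈ (T j).source := (T j).map_target hn
    have hz1 : T (i z) z ∈ (chartAt E (T (i z) z)).source := mem_chart_source _ _
    have h1 : ContMDiffAt 𝓘(ℝ, E) 𝓘(ℝ, E) ∞ (χ z).symm (χ z z) :=
      (contMDiffOn_chart_symm (x := z)).contMDiffAt ((χ z).open_target.mem_nhds
        ((χ z).map_source (by simp [χ, hi])))
    have h2 : ContMDiffAt 𝓘(ℝ, E) 𝓘(ℝ, E) ∞ (chartAt E (T (i z) z)) (T (i z) z) :=
      (contMDiffOn_chart (x := T (i z) z)).contMDiffAt (chart_source_mem_nhds E _)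
    have hz2 : n ∈ ((T j).symm ≫ₕ T (i z)).source := by
      simp [hn, ← hz, hi]
    have h3 := (hT j (i z)).contMDiffAt (((T j).symm ≫ₕ T (i z)).open_source.mem_nhds hz2)
    have h4 := ContMDiffAt.comp n h1 (ContMDiffAt.comp n h2 h3)
    refine (h4.congr_of_eventuallyEq ?_).contMDiffWithinAt
    have hmem : ∀ᶠ w in 𝓝 n, w ∈ ((T j).symm ≫ₕ T (i z)).source :=
      ((T j).symm ≫ₕ T (i z)).open_source.mem_nhds hz2
    have hmem' : ∀ᶠ w in 𝓝 n, (T (i z) ∘ (T j).symm) w ∈ (chartAt E (T (i z) z)).source :=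
      h3.continuousAt.eventually ((chartAt E (T (i z) z)).open_source.mem_nhds hz1)
    filter_upwards [hmem, hmem'] with w hw hw'
    have hw2 : w ∈ (T j).target ∧ (T j).symm w ∈ (T (i z)).source := by simpa using hw
    change (T j).symm w = (T (i z)).symm ((chartAt E (T (i z) z)).symm
      (chartAt E (T (i z) z) (T (i z) ((T j).symm w))))
    rw [(chartAt E (T (i z) z)).left_inv (show T (i z) ((T j).symm w) ∈ _ from hw'), (T (i z)).left_inv hw2.2]

end Gluing

/-! ### Products modelled on the product vector space -/

section ProductModel

variable {E₁ E₂ E' : Type*} [NormedAddCommGroup E₁] [NormedSpace ℝ E₁]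
  [NormedAddCommGroup E₂] [NormedSpace ℝ E₂] [NormedAddCommGroup E'] [NormedSpace ℝ E']
  {M₁ : Type*} [TopologicalSpace M₁] [ChartedSpace E₁ M₁] [IsManifold 𝓘(ℝ, E₁) ∞ M₁]
  {M₂ : Type*} [TopologicalSpace M₂] [ChartedSpace E₂ M₂] [IsManifold 𝓘(ℝ, E₂) ∞ M₂]
  {M' : Type*} [TopologicalSpace M'] [ChartedSpace E' M']

/-- The product of two manifolds, modelled on the product of the model vector spaces. -/
@[reducible] def prodSelfChartedSpace (E₁ E₂ M₁ M₂ : Type*) [NormedAddCommGroup E₁]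
    [NormedAddCommGroup E₂] [TopologicalSpace M₁] [ChartedSpace E₁ M₁] [TopologicalSpace M₂]
    [ChartedSpace E₂ M₂] : ChartedSpace (E₁ × E₂) (M₁ × M₂) :=
  prodChartedSpace E₁ M₁ E₂ M₂

attribute [local instance] prodSelfChartedSpace

instance isManifold_prodSelf : IsManifold 𝓘(ℝ, E₁ × E₂) ∞ (M₁ × M₂) := by
  rw [modelWithCornersSelf_prod]
  exact IsManifold.prod M₁ M₂

theorem contMDiff_fst_self : ContMDiff 𝓘(ℝ, E₁ × E₂) 𝓘(ℝ, E₁) ∞ (Prod.fst : M₁ × M₂ → M₁) := by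
  rw [modelWithCornersSelf_prod]
  exact contMDiff_fst

theorem contMDiff_snd_self : ContMDiff 𝓘(ℝ, E₁ × E₂) 𝓘(ℝ, E₂) ∞ (Prod.snd : M₁ × M₂ → M₂) := by
  rw [modelWithCornersSelf_prod]
  exact contMDiff_snd

theorem ContMDiffAt.prodMk_self {E : Type*} [NormedAddCommGroup E] [NormedSpace ℝ E]
    {H : Type*} [TopologicalSpace H] {I : ModelWithCorners ℝ E H} {M : Type*} [TopologicalSpace M]
    [ChartedSpace H M] {f₁ : M → M₁} {f₂ : M → M₂} {x : M} (h₁ : ContMDiffAt I 𝓘(ℝ, E₁) ∞ f₁ x)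
    (h₂ : ContMDiffAt I 𝓘(ℝ, E₂) ∞ f₂ x) :
    ContMDiffAt I 𝓘(ℝ, E₁ × E₂) ∞ (fun z => (f₁ z, f₂ z)) x := by
  rw [modelWithCornersSelf_prod]
  exact h₁.prodMk h₂

end ProductModel

/-! ### Flat bundles with discrete structure group -/

section Discrete

/-- A local trivialization over `U` of a principal bundle: a local section `s`, together with the
map `γ` to the structure group that compares points of the bundle with the section. -/
structure IsLocalTriv (EB EP : Type*) [NormedAddCommGroup EB] [NormedSpace ℝ EB]
    [NormedAddCommGroup EP] [NormedSpace ℝ EP]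
    {B : Type*} [TopologicalSpace B] [ChartedSpace EB B]
    {G : Type*} [TopologicalSpace G] [Group G]
    {P : Type*} [TopologicalSpace P] [ChartedSpace EP P] [MulAction G P]
    (pr : P → B) (U : Set B) (s : B → P) (γ : P → G) : Prop where
  isOpen : IsOpen U
  contMDiffOn : ContMDiffOn 𝓘(ℝ, EB) 𝓘(ℝ, EP) ∞ s U
  section_eq : ∀ b ∈ U, pr (s b) = b
  continuousOn : ContinuousOn γ (pr ⁻¹' U)
  smul_section : ∀ p ∈ pr ⁻¹' U, γ p • s (pr p) = p
  map_smul : ∀ (a : G), ∀ p ∈ pr ⁻¹' U, γ (a • p) = a * γ p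
  map_section : ∀ b ∈ U, γ (s b) = 1

variable {EB EF EG EP EM : Type*} [NormedAddCommGroup EB] [NormedSpace ℝ EB]
  [NormedAddCommGroup EF] [NormedSpace ℝ EF] [NormedAddCommGroup EG] [NormedSpace ℝ EG]
  [NormedAddCommGroup EP] [NormedSpace ℝ EP] [NormedAddCommGroup EM] [NormedSpace ℝ EM]
  {B : Type*} [TopologicalSpace B] [ChartedSpace EB B] [IsManifold 𝓘(ℝ, EB) ∞ B]
  {F : Type*} [TopologicalSpace F] [ChartedSpace EF F] [IsManifold 𝓘(ℝ, EF) ∞ F]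
  {G : Type*} [TopologicalSpace G] [ChartedSpace EG G] [Group G]
  {P : Type*} [TopologicalSpace P] [ChartedSpace EP P] [MulAction G P] [MulAction G F]
  {pr : P → B}

/-- The section is the preimage of the unit of `G`, and `γ` is the group component of the
trivialization. -/
theorem IsPrincipalBundle.exists_isLocalTriv (hpr : IsPrincipalBundle EB EG EP G pr) (b : B) :
    ∃ (U : Set B) (s : B → P) (γ : P → G), IsLocalTriv EB EP pr U s γ ∧ b ∈ U := by
  obtain ⟨U, Φ, hU, hb, hsrc, htgt, hΦ, hΦs, hΦ'⟩ := hpr.exists_trivialization b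
  have hmem : ∀ b ∈ U, ∀ a : G, (b, a) ∈ Φ.target := fun b hb a => by rw [htgt]; exact ⟨hb, trivial⟩
  have hsec : ∀ b ∈ U, pr (Φ.symm (b, 1)) = b := fun b hb => by
    rw [← (hΦ' _ (Φ.map_target (hmem b hb 1))).1, Φ.right_inv (hmem b hb 1)]
  refine ⟨U, fun b => Φ.symm (b, 1), fun p => (Φ p).2, ⟨hU, ?_, hsec, ?_, ?_, ?_, ?_⟩, hb⟩
  · exact hΦs.comp (contMDiffOn_id.prodMk contMDiffOn_const) fun b hb => hmem b hb 1
  · rw [← hsrc]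
    exact continuous_snd.comp_continuousOn Φ.continuousOn
  · intro p hp
    have hp' : p ∈ Φ.source := by rwa [hsrc]
    have h1 : Φ.symm (pr p, 1) ∈ Φ.source := Φ.map_target (hmem _ hp 1)
    have h2 : (Φ p).2 • Φ.symm (pr p, 1) ∈ Φ.source := by
      rw [hsrc, mem_preimage, hpr.map_smul, hsec _ hp]; exact hp
    refine Φ.injOn h2 hp' ?_
    rw [(hΦ' _ h1).2, Φ.right_inv (hmem _ hp 1), hsec _ hp, mul_one]
    exact Prod.ext (hΦ' p hp').1.symm rfl
  · intro a p hp
    have hp' : p ∈ Φ.source := by rwa [hsrc]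
    simp only [(hΦ' p hp').2 a]
  · intro b hb
    simp only [Φ.right_inv (hmem b hb 1)]

namespace IsLocalTriv

variable {U : Set B} {s : B → P} {γ : P → G}

/-- This is where discreteness enters: a locally constant `γ` makes `pr` a local diffeomorphism, and
changes of trivialization involve only fixed elements of `G`. -/
theorem eventually_eq [DiscreteTopology G] (h : IsLocalTriv EB EP pr U s γ) (hpr : Continuous pr)
    {p : P} (hp : pr p ∈ U) : ∀ᶠ p' in 𝓝 p, γ p' = γ p := by
  have h1 : ContinuousAt γ p := h.continuousOn.continuousAt
    ((h.isOpen.preimage hpr).mem_nhds hp)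
  exact h1.eventually (IsOpen.mem_nhds (isOpen_discrete {γ p}) rfl)

theorem exists_rep (h : IsLocalTriv EB EP pr U s γ) {hmap : ∀ (a : G) (p : P), pr (a • p) = pr p}
    {z : AssociatedBundle G P F} (hz : z.proj pr hmap ∈ U) :
    ∃ x : F, z = AssociatedBundle.mk G (s (z.proj pr hmap)) x := by
  obtain ⟨p, x, rfl⟩ := z.exists_rep
  rw [AssociatedBundle.proj_mk] at hz ⊢
  refine ⟨(γ p)⁻¹ • x, ?_⟩
  rw [← AssociatedBundle.mk_smul_left, h.smul_section p hz]

/-- The fiber coordinate of a point of the associated bundle. -/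
def _root_.AssociatedBundle.fiberCoord (γ : P → G) (z : AssociatedBundle G P F) : F :=
  (γ (Quotient.out z).1)⁻¹ • (Quotient.out z).2

/-- Another representative is `(a • p, a • x)`, and `γ (a • p) = a γ p`, so the factor `a` cancels.
-/
theorem fiberCoord_mk (h : IsLocalTriv EB EP pr U s γ) {p : P} (hp : pr p ∈ U) (x : F) :
    AssociatedBundle.fiberCoord γ (AssociatedBundle.mk G p x) = (γ p)⁻¹ • x := by
  have hz := Quotient.mk_out (s := MulAction.orbitRel G (P × F)) (p, x)
  obtain ⟨a, ha⟩ := hz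
  have ha' : (a • p, a • x) = Quotient.out (AssociatedBundle.mk G p x) := ha
  rw [AssociatedBundle.fiberCoord, ← ha']
  simp [h.map_smul a p hp, mul_smul]

theorem fiberCoord_mk_section (h : IsLocalTriv EB EP pr U s γ) {b : B} (hb : b ∈ U) (x : F) :
    AssociatedBundle.fiberCoord γ (AssociatedBundle.mk G (s b) x) = x := by
  rw [h.fiberCoord_mk (by rwa [h.section_eq b hb]), h.map_section b hb]
  simp

theorem mk_fiberCoord (h : IsLocalTriv EB EP pr U s γ)
    {hmap : ∀ (a : G) (p : P), pr (a • p) = pr p} {z : AssociatedBundle G P F}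
    (hz : z.proj pr hmap ∈ U) :
    AssociatedBundle.mk G (s (z.proj pr hmap)) (AssociatedBundle.fiberCoord γ z) = z := by
  obtain ⟨x, hx⟩ := h.exists_rep hz
  have : AssociatedBundle.fiberCoord γ z = x := by
    rw [hx, h.fiberCoord_mk_section hz]
  rw [this, ← hx]

variable [ContinuousConstSMul G (P × F)] [ContinuousSMul G F] [ContinuousInv G]

theorem _root_.AssociatedBundle.continuous_mk :
    Continuous fun z : P × F => AssociatedBundle.mk G z.1 z.2 :=
  continuous_quotient_mk'

/-- The quotient map by a group action is open, so continuity may be tested on `P × F`, where the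
fiber coordinate has an explicit formula. -/
theorem continuousOn_fiberCoord (h : IsLocalTriv EB EP pr U s γ) (hc : Continuous pr)
    (hmap : ∀ (a : G) (p : P), pr (a • p) = pr p) :
    ContinuousOn (AssociatedBundle.fiberCoord (F := F) γ)
      (AssociatedBundle.proj pr hmap ⁻¹' U) := by
  intro z hz
  obtain ⟨p, x, rfl⟩ := z.exists_rep
  refine ContinuousAt.continuousWithinAt ?_
  have hq : IsOpenQuotientMap (Quotient.mk (MulAction.orbitRel G (P × F))) :=
    MulAction.isOpenQuotientMap_quotientMk
  refine (hq.continuousAt_comp_iff (x := (p, x))).1 ?_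
  have hmem : pr ⁻¹' U ∈ 𝓝 p := (h.isOpen.preimage hc).mem_nhds hz
  have h1 : ContinuousAt (fun w : P × F => (γ w.1)⁻¹ • w.2) (p, x) :=
    ((ContinuousAt.comp (x := (p, x)) (h.continuousOn.continuousAt hmem)
      continuousAt_fst).inv).smul continuousAt_snd
  refine h1.congr_of_eventuallyEq ?_
  filter_upwards [continuousAt_fst.preimage_mem_nhds hmem] with w hw
  exact h.fiberCoord_mk hw w.2

/-- The local trivialization of the associated bundle. -/
def toOpenPartialHomeomorph (h : IsLocalTriv EB EP pr U s γ) (hc : Continuous pr)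
    (hmap : ∀ (a : G) (p : P), pr (a • p) = pr p) :
    OpenPartialHomeomorph (AssociatedBundle G P F) (B × F) where
  toFun z := (z.proj pr hmap, AssociatedBundle.fiberCoord γ z)
  invFun y := AssociatedBundle.mk G (s y.1) y.2
  source := AssociatedBundle.proj pr hmap ⁻¹' U
  target := U ×ˢ univ
  map_source' z hz := ⟨hz, trivial⟩
  map_target' y hy := by
    rw [mem_preimage, AssociatedBundle.proj_mk, h.section_eq _ hy.1]
    exact hy.1
  left_inv' z hz := h.mk_fiberCoord hz
  right_inv' y hy := Prod.ext (h.section_eq _ hy.1) (h.fiberCoord_mk_section hy.1 y.2)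
  open_source := h.isOpen.preimage (AssociatedBundle.continuous_proj hc hmap)
  open_target := h.isOpen.prod isOpen_univ
  continuousOn_toFun := (AssociatedBundle.continuous_proj hc hmap).continuousOn.prodMk
    (h.continuousOn_fiberCoord hc hmap)
  continuousOn_invFun := AssociatedBundle.continuous_mk.comp_continuousOn
    ((h.contMDiffOn.continuousOn.comp continuousOn_fst fun _ hy => hy.1).prodMk continuousOn_snd)

end IsLocalTriv

end Discrete

/-! ### The smooth structure of the associated bundle -/

section Discrete

variable {EB EF EG EP EM : Type*} [NormedAddCommGroup EB] [NormedSpace ℝ EB]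
  [NormedAddCommGroup EF] [NormedSpace ℝ EF] [NormedAddCommGroup EG] [NormedSpace ℝ EG]
  [NormedAddCommGroup EP] [NormedSpace ℝ EP] [NormedAddCommGroup EM] [NormedSpace ℝ EM]
  {B : Type*} [TopologicalSpace B] [ChartedSpace EB B] [IsManifold 𝓘(ℝ, EB) ∞ B]
  {F : Type*} [TopologicalSpace F] [ChartedSpace EF F] [IsManifold 𝓘(ℝ, EF) ∞ F]
  {G : Type*} [TopologicalSpace G] [DiscreteTopology G] [ChartedSpace EG G] [Group G]
  {P : Type*} [TopologicalSpace P] [ChartedSpace EP P] [MulAction G P] [MulAction G F]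
  [ContMDiffSMul 𝓘(ℝ, EG) 𝓘(ℝ, EP) ∞ G P] [ContMDiffSMul 𝓘(ℝ, EG) 𝓘(ℝ, EF) ∞ G F]
  {pr : P → B} {hmap : ∀ (a : G) (p : P), pr (a • p) = pr p} {U : Set B} {s : B → P} {γ : P → G}

namespace IsLocalTriv

/-- Near `a • s b` the map `γ` has the constant value `a`, so the translated section is a local
inverse of the projection on both sides. -/
theorem section_comp_proj_eventuallyEq (h : IsLocalTriv EB EP pr U s γ) (hc : Continuous pr)
    (hmap : ∀ (a : G) (p : P), pr (a • p) = pr p) (a : G) {b : B} (hb : b ∈ U) :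
    (fun b => a • s b) ∘ pr =ᶠ[𝓝 (a • s b)] id := by
  have hsb : s b ∈ pr ⁻¹' U := by rwa [mem_preimage, h.section_eq b hb]
  have hasb : pr (a • s b) ∈ U := by rwa [hmap, h.section_eq b hb]
  filter_upwards [h.eventually_eq hc hasb, (h.isOpen.preimage hc).mem_nhds hasb] with p' h1 h2
  rw [h.map_smul a _ hsb, h.map_section b hb, mul_one] at h1
  change a • s (pr p') = p'
  rw [← h1, h.smul_section p' h2]

omit [DiscreteTopology G] [ContMDiffSMul 𝓘(ℝ, EG) 𝓘(ℝ, EF) ∞ G F] in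
theorem contMDiffOn_smul_section (EG : Type*) [NormedAddCommGroup EG] [NormedSpace ℝ EG]
    [ChartedSpace EG G] [ContMDiffSMul 𝓘(ℝ, EG) 𝓘(ℝ, EP) ∞ G P]
    (h : IsLocalTriv EB EP pr U s γ) (a : G) :
    ContMDiffOn 𝓘(ℝ, EB) 𝓘(ℝ, EP) ∞ (fun b => a • s b) U :=
  (ContMDiffSMul.contMDiff_const_smul (I := 𝓘(ℝ, EG)) (I' := 𝓘(ℝ, EP)) (n := ∞)
    (M := P) a).comp_contMDiffOn h.contMDiffOn

/-- As the section is a local inverse of `pr`, its derivative is onto, so its range is the whole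
tangent space, the only candidate for a horizontal distribution. -/
theorem isFlatSection (EG : Type*) [NormedAddCommGroup EG] [NormedSpace ℝ EG]
    [ChartedSpace EG G] [ContMDiffSMul 𝓘(ℝ, EG) 𝓘(ℝ, EP) ∞ G P]
    (h : IsLocalTriv EB EP pr U s γ) (hpr : ContMDiff 𝓘(ℝ, EP) 𝓘(ℝ, EB) ∞ pr)
    (hmap : ∀ (a : G) (p : P), pr (a • p) = pr p) (a : G) :
    IsFlatSection EB EP pr (fun _ => ⊤) (fun b => a • s b) U := by
  refine ⟨h.isOpen, h.contMDiffOn_smul_section EG a, fun b hb => ?_, fun b hb => ?_⟩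
  · rw [hmap, h.section_eq b hb]
  · refine LinearMap.range_eq_top.2 fun (w : EP) => ⟨modelDeriv EP EB pr (a • s b) w, ?_⟩
    have hb' : pr (a • s b) = b := by rw [hmap, h.section_eq b hb]
    have h1 : MDifferentiableAt 𝓘(ℝ, EB) 𝓘(ℝ, EP) (fun b => a • s b) (pr (a • s b)) :=
      ((h.contMDiffOn_smul_section EG a).contMDiffAt
        (h.isOpen.mem_nhds (hb'.symm ▸ hb))).mdifferentiableAt (by simp)
    have h2 := modelDeriv_comp (E₁ := EP) (E₃ := EP) h1 (hpr.mdifferentiableAt (by simp)) w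
    rw [modelDeriv_congr (h.section_comp_proj_eventuallyEq hpr.continuous hmap a hb),
      modelDeriv_id, hb'] at h2
    exact h2.symm

theorem isCompl (EG : Type*) [NormedAddCommGroup EG] [NormedSpace ℝ EG]
    [ChartedSpace EG G] [ContMDiffSMul 𝓘(ℝ, EG) 𝓘(ℝ, EP) ∞ G P]
    (h : IsLocalTriv EB EP pr U s γ) (hpr : ContMDiff 𝓘(ℝ, EP) 𝓘(ℝ, EB) ∞ pr)
    (hmap : ∀ (a : G) (p : P), pr (a • p) = pr p) {p : P} (hp : pr p ∈ U) :
    LinearMap.ker (mfderiv 𝓘(ℝ, EP) 𝓘(ℝ, EB) pr p).toLinearMap = ⊥ := by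
  refine LinearMap.ker_eq_bot'.2 fun (w : EP) hw => ?_
  have hw' : modelDeriv EP EB pr p w = 0 := hw
  have h1 : MDifferentiableAt 𝓘(ℝ, EB) 𝓘(ℝ, EP) (fun b => γ p • s b) (pr p) :=
    ((h.contMDiffOn_smul_section EG _).contMDiffAt
      (h.isOpen.mem_nhds hp)).mdifferentiableAt (by simp)
  have h2 := modelDeriv_comp (E₁ := EP) (E₃ := EP) h1 (hpr.mdifferentiableAt (by simp)) w
  have h3 := h.section_comp_proj_eventuallyEq hpr.continuous hmap (γ p) hp
  rw [h.smul_section p hp] at h3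
  rw [modelDeriv_congr h3, modelDeriv_id, hw', map_zero] at h2
  exact h2

end IsLocalTriv

/-- A principal bundle with discrete structure group is flat. -/
theorem IsPrincipalBundle.isFlatConnection_top (hpr : IsPrincipalBundle EB EG EP G pr) :
    IsFlatConnection EB EP G pr (fun _ => ⊤) := by
  refine ⟨fun p => ?_, fun a p => ?_, fun p => ?_⟩
  · obtain ⟨U, s, γ, h, hp⟩ := hpr.exists_isLocalTriv (pr p)
    rw [h.isCompl EG hpr.contMDiff hpr.map_smul hp]
    exact isCompl_top_bot
  · rw [Submodule.map_top]
    refine LinearMap.range_eq_top.2 fun (w : EP) => ?_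
    have hs := fun a : G => (ContMDiffSMul.contMDiff_const_smul (I := 𝓘(ℝ, EG)) (I' := 𝓘(ℝ, EP))
      (n := ∞) (M := P) a)
    refine ⟨modelDeriv EP EP (fun p : P => a⁻¹ • p) (a • p) w, ?_⟩
    have h1 : ∀ q, a⁻¹ • a • p = q → MDifferentiableAt 𝓘(ℝ, EP) 𝓘(ℝ, EP) (fun p : P => a • p) q →
      modelDeriv EP EP (fun p : P => a • p) q (modelDeriv EP EP (fun p : P => a⁻¹ • p) (a • p) w)
        = w := by
      rintro _ rfl hd
      have e : (fun p : P => a • p) ∘ (fun p : P => a⁻¹ • p) = id := by ext; simp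
      rw [← modelDeriv_comp (E₂ := EP) (g := fun p : P => a • p) (f := fun p : P => a⁻¹ • p) hd
        ((hs a⁻¹).mdifferentiableAt (by simp)), e, modelDeriv_id]
    exact h1 p (inv_smul_smul a p) ((hs a).mdifferentiableAt (by simp))
  · obtain ⟨U, s, γ, h, hp⟩ := hpr.exists_isLocalTriv (pr p)
    have h' := h.isFlatSection EG hpr.contMDiff hpr.map_smul (γ p)
    exact ⟨U, fun b => γ p • s b, h.isOpen, hp, h.smul_section p hp, h'.contMDiffOn,
      fun b hb => ⟨h'.section_eq b hb, h'.range_eq b hb⟩⟩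

/-- A local trivialization inducing smooth coordinates on the associated bundle. -/
structure IsSmoothLocalTriv (EB EF EP EM : Type*) [NormedAddCommGroup EB] [NormedSpace ℝ EB]
    [NormedAddCommGroup EF] [NormedSpace ℝ EF]
    [NormedAddCommGroup EP] [NormedSpace ℝ EP] [NormedAddCommGroup EM] [NormedSpace ℝ EM]
    {B : Type*} [TopologicalSpace B] [ChartedSpace EB B]
    {F : Type*} [TopologicalSpace F] [ChartedSpace EF F]
    {G : Type*} [TopologicalSpace G] [Group G] [MulAction G F]
    {P : Type*} [TopologicalSpace P] [ChartedSpace EP P] [MulAction G P]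
    [ChartedSpace EM (AssociatedBundle G P F)]
    (pr : P → B) (hmap : ∀ (a : G) (p : P), pr (a • p) = pr p) (U : Set B) (s : B → P)
    (γ : P → G) : Prop extends IsLocalTriv EB EP pr U s γ where
  contMDiffOn_proj : ContMDiffOn 𝓘(ℝ, EM) 𝓘(ℝ, EB) ∞
    (AssociatedBundle.proj (F := F) pr hmap) (AssociatedBundle.proj pr hmap ⁻¹' U)
  contMDiffOn_fiberCoord : ContMDiffOn 𝓘(ℝ, EM) 𝓘(ℝ, EF) ∞
    (AssociatedBundle.fiberCoord (F := F) γ) (AssociatedBundle.proj pr hmap ⁻¹' U)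
  contMDiffOn_mk : ContMDiffOn (𝓘(ℝ, EB).prod 𝓘(ℝ, EF)) 𝓘(ℝ, EM) ∞
    (fun y : B × F => AssociatedBundle.mk G (s y.1) y.2) (U ×ˢ univ)

theorem continuousSMul_of_contMDiffSMul (E E' : Type*) [NormedAddCommGroup E] [NormedSpace ℝ E]
    [NormedAddCommGroup E'] [NormedSpace ℝ E']
    {G : Type*} [TopologicalSpace G] [ChartedSpace E G]
    {P : Type*} [TopologicalSpace P] [ChartedSpace E' P] [SMul G P]
    [ContMDiffSMul 𝓘(ℝ, E) 𝓘(ℝ, E') ∞ G P] : ContinuousSMul G P :=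
  ContMDiffSMul.continuousSMul (I := 𝓘(ℝ, E)) (I' := 𝓘(ℝ, E')) ∞

attribute [local instance] prodSelfChartedSpace

/-- The associated bundle of a principal bundle with discrete structure group is a manifold. -/
theorem exists_isManifold_associatedBundle (hpr : IsPrincipalBundle EB EG EP G pr)
    {U : B → Set B} {s : B → B → P} {γ : B → P → G}
    (h : ∀ b, IsLocalTriv EB EP pr (U b) (s b) (γ b)) (hU : ∀ b, b ∈ U b) :
    ∃ (_ : ChartedSpace (EB × EF) (AssociatedBundle G P F))
      (_ : IsManifold 𝓘(ℝ, EB × EF) ∞ (AssociatedBundle G P F)),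
      ∀ b, IsSmoothLocalTriv EB EF EP (EB × EF) (F := F) pr hpr.map_smul (U b) (s b) (γ b) := by
  have _ : ContinuousSMul G P := continuousSMul_of_contMDiffSMul EG EP
  have _ : ContinuousSMul G F := continuousSMul_of_contMDiffSMul EG EF
  let T : B → OpenPartialHomeomorph (AssociatedBundle G P F) (B × F) := fun b =>
    (h b).toOpenPartialHomeomorph hpr.contMDiff.continuous hpr.map_smul
  obtain ⟨C, I, hT⟩ := exists_isManifold_of_openPartialHomeomorph (E := EB × EF) T
    (AssociatedBundle.proj pr hpr.map_smul) (fun z => hU _) (by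
      intro j k y hy
      have hy' : y.1 ∈ U j ∧ y.1 ∈ U k := by
        have h0 : y ∈ (T j).target ∧ (T j).symm y ∈ (T k).source := by simpa using hy
        have h1 : pr (s j y.1) ∈ U k := h0.2
        rw [(h j).section_eq _ h0.1.1] at h1
        exact ⟨h0.1.1, h1⟩
      have hsj : ContinuousAt (s j) y.1 :=
        (h j).contMDiffOn.continuousOn.continuousAt ((h j).isOpen.mem_nhds hy'.1)
      have h2 : ∀ᶠ b in 𝓝 y.1, γ k (s j b) = γ k (s j y.1) :=
        hsj.eventually ((h k).eventually_eq hpr.contMDiff.continuous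
          (by rw [(h j).section_eq _ hy'.1]; exact hy'.2))
      -- On the overlap the change of trivialization is `(b, x) ↦ (b, a⁻¹ • x)` with `a` locally
      -- constant in `b`.
      have h3 : ContMDiffAt 𝓘(ℝ, EB × EF) 𝓘(ℝ, EB × EF) ∞
          (fun w : B × F => (w.1, (γ k (s j y.1))⁻¹ • w.2)) y :=
        ContMDiffAt.prodMk_self contMDiff_fst_self.contMDiffAt
          (ContMDiffAt.comp y (ContMDiffSMul.contMDiff_const_smul (I := 𝓘(ℝ, EG))
            (I' := 𝓘(ℝ, EF)) (n := ∞) (M := F) (γ k (s j y.1))⁻¹).contMDiffAt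
            contMDiff_snd_self.contMDiffAt)
      refine (h3.congr_of_eventuallyEq ?_).contMDiffWithinAt
      filter_upwards [continuousAt_fst.eventually h2, continuousAt_fst.eventually
        (((h j).isOpen.inter (h k).isOpen).mem_nhds hy')] with w hw1 hw2
      refine Prod.ext ((h j).section_eq _ hw2.1) ?_
      change AssociatedBundle.fiberCoord (γ k) (AssociatedBundle.mk G (s j w.1) w.2) = _
      rw [(h k).fiberCoord_mk (by rw [(h j).section_eq _ hw2.1]; exact hw2.2), hw1])
  refine ⟨C, I, fun b => { h b with
    contMDiffOn_proj := contMDiff_fst_self.comp_contMDiffOn (hT b).1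
    contMDiffOn_fiberCoord := contMDiff_snd_self.comp_contMDiffOn (hT b).1
    contMDiffOn_mk := ?_ }⟩
  rw [← modelWithCornersSelf_prod]
  exact (hT b).2

/-- Points over different base points are separated in `B`; points over the same base point lie in a
common trivialization and are separated there. -/
theorem IsPrincipalBundle.t2Space_associatedBundle (EF : Type*) [NormedAddCommGroup EF]
    [NormedSpace ℝ EF] [ChartedSpace EF F] [ContMDiffSMul 𝓘(ℝ, EG) 𝓘(ℝ, EF) ∞ G F]
    [T2Space B] [T2Space F]
    (hpr : IsPrincipalBundle EB EG EP G pr) : T2Space (AssociatedBundle G P F) := by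
  have _ : ContinuousSMul G P := continuousSMul_of_contMDiffSMul EG EP
  have _ : ContinuousSMul G F := continuousSMul_of_contMDiffSMul EG EF
  have hc := AssociatedBundle.continuous_proj (F := F) hpr.contMDiff.continuous hpr.map_smul
  refine ⟨fun z w hzw => ?_⟩
  by_cases hb : z.proj pr hpr.map_smul = w.proj pr hpr.map_smul
  · obtain ⟨U, s, γ, h, hz⟩ := hpr.exists_isLocalTriv (z.proj pr hpr.map_smul)
    let T := h.toOpenPartialHomeomorph (F := F) hpr.contMDiff.continuous hpr.map_smul
    have hz' : z ∈ T.source := hz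
    have hw' : w ∈ T.source := by
      change w.proj pr hpr.map_smul ∈ U
      rwa [← hb]
    obtain ⟨A, C, hA, hC, hzA, hwC, hAC⟩ := t2_separation fun e => hzw (T.injOn hz' hw' e)
    refine ⟨T.source ∩ T ⁻¹' A, T.source ∩ T ⁻¹' C, T.isOpen_inter_preimage hA,
      T.isOpen_inter_preimage hC, ⟨hz', hzA⟩, ⟨hw', hwC⟩, ?_⟩
    exact (hAC.preimage T).mono inter_subset_right inter_subset_right
  · obtain ⟨A, C, hA, hC, hzA, hwC, hAC⟩ := t2_separation hb
    exact ⟨_, _, hA.preimage hc, hC.preimage hc, hzA, hwC, hAC.preimage _⟩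

/-- Countably many trivializing sets cover `B`, and each trivialized part is homeomorphic to an open
set of `B × F`. -/
theorem IsPrincipalBundle.secondCountableTopology_associatedBundle (EF : Type*) [NormedAddCommGroup EF]
    [NormedSpace ℝ EF] [ChartedSpace EF F] [ContMDiffSMul 𝓘(ℝ, EG) 𝓘(ℝ, EF) ∞ G F]
    [SecondCountableTopology B]
    [SecondCountableTopology F] (hpr : IsPrincipalBundle EB EG EP G pr) :
    SecondCountableTopology (AssociatedBundle G P F) := by
  have _ : ContinuousSMul G P := continuousSMul_of_contMDiffSMul EG EP
  have _ : ContinuousSMul G F := continuousSMul_of_contMDiffSMul EG EF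
  have hc := AssociatedBundle.continuous_proj (F := F) hpr.contMDiff.continuous hpr.map_smul
  choose U s γ h hU using hpr.exists_isLocalTriv
  obtain ⟨S, hS, hSU⟩ := TopologicalSpace.countable_cover_nhds fun b =>
    (h b).isOpen.mem_nhds (hU b)
  have _ : Countable S := hS
  have _ : ∀ b : S, SecondCountableTopology (AssociatedBundle.proj (F := F) pr hpr.map_smul ⁻¹' U b) :=
    fun b => ((h b).toOpenPartialHomeomorph (F := F) hpr.contMDiff.continuous
      hpr.map_smul).secondCountableTopology_source
  refine TopologicalSpace.secondCountableTopology_of_countable_cover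
    (U := fun b : S => AssociatedBundle.proj (F := F) pr hpr.map_smul ⁻¹' U b)
    (fun b => (h b).isOpen.preimage hc) (eq_univ_of_forall fun z => ?_)
  have hz : z.proj pr hpr.map_smul ∈ ⋃ b ∈ S, U b := by rw [hSU]; trivial
  obtain ⟨b, hb, hzb⟩ := mem_iUnion₂.1 hz
  exact mem_iUnion.2 ⟨⟨b, hb⟩, hzb⟩

variable [ChartedSpace EM (AssociatedBundle G P F)]

theorem IsSmoothLocalTriv.contMDiffAt_mk (EG : Type*) [NormedAddCommGroup EG] [NormedSpace ℝ EG]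
    [ChartedSpace EG G] [ContMDiffSMul 𝓘(ℝ, EG) 𝓘(ℝ, EF) ∞ G F]
    (h : IsSmoothLocalTriv EB EF EP EM (F := F) pr hmap U s γ)
    (hpr : ContMDiff 𝓘(ℝ, EP) 𝓘(ℝ, EB) ∞ pr) {p : P} (hp : pr p ∈ U) (x : F) :
    ContMDiffAt (𝓘(ℝ, EP).prod 𝓘(ℝ, EF)) 𝓘(ℝ, EM) ∞
      (fun z : P × F => AssociatedBundle.mk G z.1 z.2) (p, x) := by
  have h1 : ContMDiffAt (𝓘(ℝ, EP).prod 𝓘(ℝ, EF)) (𝓘(ℝ, EB).prod 𝓘(ℝ, EF)) ∞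
      (fun z : P × F => (pr z.1, (γ p)⁻¹ • z.2)) (p, x) :=
    ((hpr.comp contMDiff_fst).prodMk ((ContMDiffSMul.contMDiff_const_smul (I := 𝓘(ℝ, EG))
      (I' := 𝓘(ℝ, EF)) (n := ∞) (M := F) (γ p)⁻¹).comp contMDiff_snd)).contMDiffAt
  have h2 := (h.contMDiffOn_mk.contMDiffAt ((h.isOpen.prod isOpen_univ).mem_nhds
    (show (pr p, (γ p)⁻¹ • x) ∈ U ×ˢ univ from ⟨hp, trivial⟩)))
  refine (ContMDiffAt.comp (p, x) h2 h1).congr_of_eventuallyEq ?_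
  filter_upwards [continuousAt_fst.eventually (h.eventually_eq hpr.continuous hp),
    continuousAt_fst.eventually ((h.isOpen.preimage hpr.continuous).mem_nhds hp)] with w h3 h4
  change _ = AssociatedBundle.mk G (s (pr w.1)) ((γ p)⁻¹ • w.2)
  rw [← h3, ← AssociatedBundle.mk_smul_left, h.smul_section w.1 h4]

/-- Through every `(p, x)` passes a smooth local section `σ` of the quotient map, obtained by
translating the trivialization by `γ p`; hence the derivative of the quotient map is onto. -/
theorem isQuotientSmoothStructure_of_isSmoothLocalTriv (EG : Type*) [NormedAddCommGroup EG]
    [NormedSpace ℝ EG] [ChartedSpace EG G] [ContMDiffSMul 𝓘(ℝ, EG) 𝓘(ℝ, EP) ∞ G P]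
    [ContMDiffSMul 𝓘(ℝ, EG) 𝓘(ℝ, EF) ∞ G F] (hpr : ContMDiff 𝓘(ℝ, EP) 𝓘(ℝ, EB) ∞ pr)
    {U : B → Set B} {s : B → B → P} {γ : B → P → G}
    (h : ∀ b, IsSmoothLocalTriv EB EF EP EM (F := F) pr hmap (U b) (s b) (γ b))
    (hU : ∀ b, b ∈ U b) : IsQuotientSmoothStructure EF EP EM F G P := by
  have hmk : ContMDiff (𝓘(ℝ, EP).prod 𝓘(ℝ, EF)) 𝓘(ℝ, EM) ∞
      (fun z : P × F => AssociatedBundle.mk G z.1 z.2) :=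
    fun z => (h (pr z.1)).contMDiffAt_mk EG hpr (hU _) z.2
  refine ⟨hmk, fun ⟨p, x⟩ w => ?_⟩
  have h := h (pr p)
  have hp := hU (pr p)
  set U := U (pr p)
  set s := s (pr p)
  set γ := γ (pr p)
  let z₀ : AssociatedBundle G P F := .mk G p x
  have hz₀ : z₀ ∈ AssociatedBundle.proj pr hmap ⁻¹' U := hp
  have hopen : IsOpen (AssociatedBundle.proj (F := F) pr hmap ⁻¹' U) :=
    h.isOpen.preimage (AssociatedBundle.continuous_proj hpr.continuous hmap)
  let σ : AssociatedBundle G P F → P × F := fun z =>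
    (γ p • s (z.proj pr hmap), γ p • AssociatedBundle.fiberCoord γ z)
  have hσ : ContMDiffAt 𝓘(ℝ, EM) (𝓘(ℝ, EP).prod 𝓘(ℝ, EF)) ∞ σ z₀ := by
    have h1 := (h.contMDiffOn_smul_section EG (γ p)).comp h.contMDiffOn_proj fun z hz => hz
    have h2 := (ContMDiffSMul.contMDiff_const_smul (I := 𝓘(ℝ, EG))
      (I' := 𝓘(ℝ, EF)) (n := ∞) (M := F) (γ p)).comp_contMDiffOn h.contMDiffOn_fiberCoord
    exact (h1.prodMk h2).contMDiffAt (hopen.mem_nhds hz₀)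
  have hσ₀ : σ z₀ = (p, x) := by
    refine Prod.ext (h.smul_section p hp) ?_
    change γ p • AssociatedBundle.fiberCoord γ (AssociatedBundle.mk G p x) = x
    rw [h.fiberCoord_mk hp, smul_inv_smul]
  have e : (fun z : P × F => AssociatedBundle.mk G z.1 z.2) ∘ σ =ᶠ[𝓝 z₀] id := by
    filter_upwards [hopen.mem_nhds hz₀] with z hz
    change AssociatedBundle.mk G (γ p • s (z.proj pr hmap))
      (γ p • AssociatedBundle.fiberCoord γ z) = z
    rw [AssociatedBundle.mk_smul_left, inv_smul_smul, h.mk_fiberCoord hz]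
  have key : ∀ q, σ z₀ = q → ∃ v, mfderiv (𝓘(ℝ, EP).prod 𝓘(ℝ, EF)) 𝓘(ℝ, EM)
      (fun z : P × F => AssociatedBundle.mk G z.1 z.2) q v = w := by
    rintro _ rfl
    have h1 := mfderiv_comp_apply (I := 𝓘(ℝ, EM)) (I' := 𝓘(ℝ, EP).prod 𝓘(ℝ, EF))
      (I'' := 𝓘(ℝ, EM)) (g := fun z : P × F => AssociatedBundle.mk G z.1 z.2) (f := σ) z₀
      (hmk.mdifferentiableAt (by simp)) (hσ.mdifferentiableAt (by simp)) w
    rw [e.mfderiv_eq, mfderiv_id] at h1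
    exact ⟨_, h1.symm⟩
  exact key _ hσ₀

end Discrete

/-! ### The warped metric and the soliton equation for discrete structure group -/

section Sufficient

variable {EB EF EG EP EM : Type*} [NormedAddCommGroup EB] [NormedSpace ℝ EB]
  [NormedAddCommGroup EF] [NormedSpace ℝ EF] [NormedAddCommGroup EG] [NormedSpace ℝ EG]
  [NormedAddCommGroup EP] [NormedSpace ℝ EP] [NormedAddCommGroup EM] [NormedSpace ℝ EM]
  {B : Type*} [TopologicalSpace B] [ChartedSpace EB B] [IsManifold 𝓘(ℝ, EB) ∞ B]
  {F : Type*} [TopologicalSpace F] [ChartedSpace EF F] [IsManifold 𝓘(ℝ, EF) ∞ F]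
  {G : Type*} [TopologicalSpace G] [ChartedSpace EG G] [Group G]
  {P : Type*} [TopologicalSpace P] [ChartedSpace EP P] [MulAction G P] [MulAction G F]
  [ChartedSpace EM (AssociatedBundle G P F)] [IsManifold 𝓘(ℝ, EM) ∞ (AssociatedBundle G P F)]
  {pr : P → B} {hmap : ∀ (a : G) (p : P), pr (a • p) = pr p}
  {gB : SmoothMetric EB B} {gF : SmoothMetric EF F} {f : B → ℝ}

section Soliton

variable {H : ∀ p : P, Submodule ℝ (TangentSpace 𝓘(ℝ, EP) p)}
  {g : SmoothMetric EM (AssociatedBundle G P F)}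
  [FiniteDimensional ℝ EB] [FiniteDimensional ℝ EF] [FiniteDimensional ℝ EM]
  [LieGroup 𝓘(ℝ, EG) ∞ G] [ContMDiffSMul 𝓘(ℝ, EG) 𝓘(ℝ, EF) ∞ G F]

/-- The Hessian of a function coming from the base. -/
theorem IsWarpedFlatBundle.hessian_comp_proj (hM : IsWarpedFlatBundle EG pr H gB gF f g)
    {s : B → P} {U : Set B} {α : EB → B} {β : EF → F} {WB : Set EB} {WF : Set EF} {y : EB × EF}
    (h : IsBundleParam EB EF EP pr H s U α WB β WF) (hy : y ∈ WB ×ˢ WF) {φ : B → ℝ}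
    (hφ : ContMDiff 𝓘(ℝ, EB) 𝓘(ℝ, ℝ) ∞ φ)
    (hψ : ContMDiff 𝓘(ℝ, EM) 𝓘(ℝ, ℝ) ∞ (φ ∘ AssociatedBundle.proj (F := F) pr hmap))
    (V W : EB × EF) :
    g.hessian (φ ∘ AssociatedBundle.proj pr hmap) (bundleParam G s α β y)
        (paramDeriv EM (bundleParam G s α β) y V) (paramDeriv EM (bundleParam G s α β) y W)
      = gB.hessian φ (α y.1) (paramDeriv EB α y.1 V.1) (paramDeriv EB α y.1 W.1)
        + f (α y.1) * gB.gradInner φ f (α y.1)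
          * gF.form (β y.2) (paramDeriv EF β y.2 V.2) (paramDeriv EF β y.2 W.2) := by
  have e : (φ ∘ AssociatedBundle.proj pr hmap) ∘ bundleParam G s α β
      =ᶠ[𝓝 y] fun y => (φ ∘ α) y.1 := by
    filter_upwards [h.isOpen_prod.mem_nhds hy] with z hz
    simp only [Function.comp_apply, bundleParam, AssociatedBundle.proj_mk]
    rw [h.flatSection.section_eq _ (h.mapsTo hz.1)]
  have hd : ContDiffAt ℝ 2 (φ ∘ α) y.1 := by
    have h1 : ContMDiffAt 𝓘(ℝ, EB) 𝓘(ℝ, ℝ) ∞ (φ ∘ α) y.1 :=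
      (hφ.comp_contMDiffOn h.base.contMDiffOn).contMDiffAt (h.base.isOpen.mem_nhds hy.1)
    exact (contMDiffAt_iff_contDiffAt.1 h1).of_le ENat.LEInfty.out
  rw [(hM.isParam h).hessian_eq g hy hψ.contMDiffAt,
    coordHessian_congr_metric (hM.eventuallyEq_pull h hy), coordHessian_congr _ e,
    (hM.isCoordWarping h).hessian_fst hy hd, h.base.hessian_eq gB hy.1 hφ.contMDiffAt,
    h.base.gradInner_eq gB hy.1 hφ.contMDiffAt hM.smooth_warping.contMDiffAt,
    ← SmoothMetric.pull_apply]
  rfl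

/-- Solutions of the equations on the base give gradient Ricci solitons. -/
theorem IsWarpedFlatBundle.isGradientRicciSoliton (hM : IsWarpedFlatBundle EG pr H gB gF f g)
    {φ : B → ℝ} {lam μ : ℝ} (hφ : ContMDiff 𝓘(ℝ, EB) 𝓘(ℝ, ℝ) ∞ φ)
    (hψ : ContMDiff 𝓘(ℝ, EM) 𝓘(ℝ, ℝ) ∞ (φ ∘ AssociatedBundle.proj (F := F) pr hmap))
    (h1 : gB.BaseTensorEq f φ lam (Module.finrank ℝ EF))
    (h3 : gB.FiberConstantEq f φ lam (Module.finrank ℝ EF) μ) (hF : gF.IsEinstein μ) :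
    g.IsGradientRicciSoliton (φ ∘ AssociatedBundle.proj pr hmap) lam := by
  refine ⟨hψ, fun z => ?_⟩
  obtain ⟨p, x, rfl⟩ := z.exists_rep
  obtain ⟨s, U, hs, hb, hsp⟩ := hM.flat.exists_section p
  have h := hs.isBundleParam (EF := EF) (pr p) x
  have hy := IsFlatSection.mem_isBundleParam (EB := EB) (EF := EF) hb x
  set y : EB × EF := (extChartAt 𝓘(ℝ, EB) (pr p) (pr p), extChartAt 𝓘(ℝ, EF) x x)
  have key : ∀ z, bundleParam G s (extChartAt 𝓘(ℝ, EB) (pr p)).symm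
      (extChartAt 𝓘(ℝ, EF) x).symm y = z → ∀ v w : EM, g.ricci z v w
        + g.hessian (φ ∘ AssociatedBundle.proj pr hmap) z v w = lam * g.form z v w := by
    rintro _ rfl v w
    obtain ⟨V, rfl⟩ := ((hM.isParam h).invertible y hy).surjective v
    obtain ⟨W, rfl⟩ := ((hM.isParam h).invertible y hy).surjective w
    rw [hM.ricci_eq h hy, hM.hessian_comp_proj h hy hφ hψ, hM.form_bundleParam h hy]
    have e1 := h1 ((extChartAt 𝓘(ℝ, EB) (pr p)).symm y.1)
      (paramDeriv EB (extChartAt 𝓘(ℝ, EB) (pr p)).symm y.1 V.1)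
      (paramDeriv EB (extChartAt 𝓘(ℝ, EB) (pr p)).symm y.1 W.1)
    have e2 := hF ((extChartAt 𝓘(ℝ, EF) x).symm y.2)
      (paramDeriv EF (extChartAt 𝓘(ℝ, EF) x).symm y.2 V.2)
      (paramDeriv EF (extChartAt 𝓘(ℝ, EF) x).symm y.2 W.2)
    have e3 := h3 ((extChartAt 𝓘(ℝ, EB) (pr p)).symm y.1)
    change _ = lam * gB.form _ _ _ + _ at e1
    change _ = μ * gF.form _ _ _ at e2
    -- After replacing `Ric_F` by `μ g_F` and `μ` by its expression on the base, all fiber terms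
    -- cancel and the base equation remains.
    rw [e2, ← e3]
    linear_combination e1
  refine key _ ?_
  rw [bundleParam, extChartAt_to_inv, extChartAt_to_inv, hsp]

end Soliton

section Metric

/-- The warped inner product at a point of the associated bundle, in a local trivialization. -/
def warpedForm (EM : Type*) [NormedAddCommGroup EM] [NormedSpace ℝ EM]
    [ChartedSpace EM (AssociatedBundle G P F)] (pr : P → B)
    (hmap : ∀ (a : G) (p : P), pr (a • p) = pr p) (gB : SmoothMetric EB B)
    (gF : SmoothMetric EF F) (f : B → ℝ) (γ : P → G) (z : AssociatedBundle G P F) :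
    EM →L[ℝ] EM →L[ℝ] ℝ :=
  (gB.form (z.proj pr hmap)).bilinearComp (modelDeriv EM EB (AssociatedBundle.proj pr hmap) z)
      (modelDeriv EM EB (AssociatedBundle.proj pr hmap) z)
    + f (z.proj pr hmap) ^ 2 • (gF.form (AssociatedBundle.fiberCoord γ z)).bilinearComp
      (modelDeriv EM EF (AssociatedBundle.fiberCoord γ) z)
      (modelDeriv EM EF (AssociatedBundle.fiberCoord γ) z)

theorem warpedForm_apply (γ : P → G) (z : AssociatedBundle G P F) (v w : EM) :
    warpedForm EM pr hmap gB gF f γ z v w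
      = gB.form (z.proj pr hmap) (modelDeriv EM EB (AssociatedBundle.proj pr hmap) z v)
          (modelDeriv EM EB (AssociatedBundle.proj pr hmap) z w)
        + f (z.proj pr hmap) ^ 2 * gF.form (AssociatedBundle.fiberCoord γ z)
          (modelDeriv EM EF (AssociatedBundle.fiberCoord γ) z v)
          (modelDeriv EM EF (AssociatedBundle.fiberCoord γ) z w) := rfl

variable {U U' : Set B} {s s' : B → P} {γ γ' : P → G}

theorem SmoothMetric.form_self_nonneg {E M : Type*} [NormedAddCommGroup E] [NormedSpace ℝ E]
    [TopologicalSpace M] [ChartedSpace E M] [IsManifold 𝓘(ℝ, E) ∞ M] (g : SmoothMetric E M)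
    (x : M) (v : E) : 0 ≤ g.form x v v := by
  by_cases h : v = 0
  · simp [h]
  · exact (g.pos x v h).le

theorem ActsIsometrically.form_modelDeriv (hiso : ActsIsometrically G gF) (a : G) (x : F)
    (v w : EF) : gF.form (a • x) (modelDeriv EF EF (fun x : F => a • x) x v)
      (modelDeriv EF EF (fun x : F => a • x) x w) = gF.form x v w :=
  hiso a x v w

theorem IsSmoothLocalTriv.isOpen_preimage (h : IsSmoothLocalTriv EB EF EP EM (F := F) pr hmap U s γ)
    (hc : Continuous pr) : IsOpen (AssociatedBundle.proj (F := F) pr hmap ⁻¹' U) :=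
  h.isOpen.preimage (AssociatedBundle.continuous_proj hc hmap)

theorem IsSmoothLocalTriv.mdifferentiableAt_proj
    (h : IsSmoothLocalTriv EB EF EP EM (F := F) pr hmap U s γ) (hc : Continuous pr)
    {z : AssociatedBundle G P F} (hz : z.proj pr hmap ∈ U) :
    MDifferentiableAt 𝓘(ℝ, EM) 𝓘(ℝ, EB) (AssociatedBundle.proj (F := F) pr hmap) z :=
  (h.contMDiffOn_proj.contMDiffAt ((h.isOpen_preimage hc).mem_nhds hz)).mdifferentiableAt (by simp)

theorem IsSmoothLocalTriv.mdifferentiableAt_fiberCoord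
    (h : IsSmoothLocalTriv EB EF EP EM (F := F) pr hmap U s γ) (hc : Continuous pr)
    {z : AssociatedBundle G P F} (hz : z.proj pr hmap ∈ U) :
    MDifferentiableAt 𝓘(ℝ, EM) 𝓘(ℝ, EF) (AssociatedBundle.fiberCoord (F := F) γ) z :=
  (h.contMDiffOn_fiberCoord.contMDiffAt
    ((h.isOpen_preimage hc).mem_nhds hz)).mdifferentiableAt (by simp)

/-- Projection and fiber coordinate together have the smooth left inverse `(b, x) ↦ [s b, x]`, so
their derivatives have no common kernel. Positivity of the warped form depends on this. -/
theorem IsSmoothLocalTriv.eq_zero (h : IsSmoothLocalTriv EB EF EP EM (F := F) pr hmap U s γ)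
    (hc : Continuous pr) {z : AssociatedBundle G P F} (hz : z.proj pr hmap ∈ U) {v : EM}
    (h1 : modelDeriv EM EB (AssociatedBundle.proj pr hmap) z v = 0)
    (h2 : modelDeriv EM EF (AssociatedBundle.fiberCoord γ) z v = 0) : v = 0 := by
  have d1 := h.mdifferentiableAt_proj hc hz
  have d2 := h.mdifferentiableAt_fiberCoord hc hz
  have d3 : MDifferentiableAt (𝓘(ℝ, EB).prod 𝓘(ℝ, EF)) 𝓘(ℝ, EM)
      (fun y : B × F => AssociatedBundle.mk G (s y.1) y.2)
      (z.proj pr hmap, AssociatedBundle.fiberCoord γ z) :=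
    (h.contMDiffOn_mk.contMDiffAt ((h.isOpen.prod isOpen_univ).mem_nhds
      (show (z.proj pr hmap, AssociatedBundle.fiberCoord γ z) ∈ U ×ˢ univ from
        ⟨hz, trivial⟩))).mdifferentiableAt (by simp)
  have e : (fun y : B × F => AssociatedBundle.mk G (s y.1) y.2)
      ∘ (fun z => (z.proj pr hmap, AssociatedBundle.fiberCoord γ z)) =ᶠ[𝓝 z] id := by
    filter_upwards [(h.isOpen_preimage hc).mem_nhds hz] with w hw using h.mk_fiberCoord hw
  have h3 := mfderiv_comp_apply (I := 𝓘(ℝ, EM)) (I' := 𝓘(ℝ, EB).prod 𝓘(ℝ, EF))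
    (I'' := 𝓘(ℝ, EM)) (g := fun y : B × F => AssociatedBundle.mk G (s y.1) y.2)
    (f := fun z => (z.proj pr hmap, AssociatedBundle.fiberCoord γ z)) z d3 (d1.prodMk d2) v
  rw [e.mfderiv_eq, mfderiv_id, d1.mfderiv_prod d2] at h3
  let L : EB × EF →L[ℝ] EM := mfderiv (𝓘(ℝ, EB).prod 𝓘(ℝ, EF)) 𝓘(ℝ, EM)
    (fun y : B × F => AssociatedBundle.mk G (s y.1) y.2)
    (z.proj pr hmap, AssociatedBundle.fiberCoord γ z)
  have h4 : v = L (modelDeriv EM EB (AssociatedBundle.proj pr hmap) z v,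
    modelDeriv EM EF (AssociatedBundle.fiberCoord γ) z v) := h3
  rw [h4, h1, h2]
  exact map_zero L

variable [ContMDiffSMul 𝓘(ℝ, EG) 𝓘(ℝ, EF) ∞ G F] [DiscreteTopology G]

/-- By invariance, the warped inner product does not depend on the local trivialization. -/
theorem IsSmoothLocalTriv.warpedForm_eq (EG : Type*) [NormedAddCommGroup EG] [NormedSpace ℝ EG]
    [ChartedSpace EG G] [ContMDiffSMul 𝓘(ℝ, EG) 𝓘(ℝ, EF) ∞ G F]
    (hiso : ActsIsometrically G gF)
    (h : IsSmoothLocalTriv EB EF EP EM (F := F) pr hmap U s γ)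
    (h' : IsSmoothLocalTriv EB EF EP EM (F := F) pr hmap U' s' γ') (hc : Continuous pr)
    {z : AssociatedBundle G P F} (hz : z.proj pr hmap ∈ U) (hz' : z.proj pr hmap ∈ U') :
    warpedForm EM pr hmap gB gF f γ' z = warpedForm EM pr hmap gB gF f γ z := by
  -- The two fiber coordinates differ by the action of this element, locally fixed along the base;
  -- it is an isometry of the fiber.
  set a := (γ' (s (z.proj pr hmap)))⁻¹
  have hπ := AssociatedBundle.continuous_proj (F := F) hc hmap
  have hs : ContinuousAt (s ∘ AssociatedBundle.proj (F := F) pr hmap) z :=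
    ContinuousAt.comp (h.contMDiffOn.continuousOn.continuousAt (h.isOpen.mem_nhds hz))
      hπ.continuousAt
  have hev := hs.eventually (h'.eventually_eq hc (p := s (z.proj pr hmap))
    (by rwa [h.section_eq _ hz]))
  have e : AssociatedBundle.fiberCoord γ' =ᶠ[𝓝 z]
      (fun x : F => a • x) ∘ AssociatedBundle.fiberCoord γ := by
    filter_upwards [hev, (h.isOpen_preimage hc).mem_nhds hz,
      (h'.isOpen_preimage hc).mem_nhds hz'] with w h1 h2 h3
    have h4 : AssociatedBundle.fiberCoord γ' w = AssociatedBundle.fiberCoord γ'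
      (AssociatedBundle.mk G (s (w.proj pr hmap)) (AssociatedBundle.fiberCoord γ w)) := by
      rw [h.mk_fiberCoord h2]
    rw [h4, h'.fiberCoord_mk (by rw [h.section_eq _ h2]; exact h3)]
    have h1' : γ' (s (w.proj pr hmap)) = γ' (s (z.proj pr hmap)) := h1
    rw [h1']
    rfl
  have hd : ∀ v, modelDeriv EM EF (AssociatedBundle.fiberCoord γ') z v
      = modelDeriv EF EF (fun x : F => a • x) (AssociatedBundle.fiberCoord γ z)
        (modelDeriv EM EF (AssociatedBundle.fiberCoord γ) z v) := by
    intro v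
    rw [modelDeriv_congr e]
    exact modelDeriv_comp ((ContMDiffSMul.contMDiff_const_smul (I := 𝓘(ℝ, EG))
      (I' := 𝓘(ℝ, EF)) (n := ∞) (M := F) a).mdifferentiableAt (by simp))
      (h.mdifferentiableAt_fiberCoord hc hz) v
  ext v w
  rw [warpedForm_apply, warpedForm_apply, hd, hd, e.eq_of_nhds]
  rw [Function.comp_apply, hiso.form_modelDeriv]

/-- In coordinates the form is the pullback of `g_B` by the projection plus `f²` times the pullback
of `g_F` by the fiber coordinate, and both maps are smooth. -/
theorem IsSmoothLocalTriv.contDiffAt_warpedForm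
    (h : IsSmoothLocalTriv EB EF EP EM (F := F) pr hmap U s γ) (hc : Continuous pr)
    (hf : ContMDiff 𝓘(ℝ, EB) 𝓘(ℝ, ℝ) ∞ f)
    {z : AssociatedBundle G P F} (hz : z.proj pr hmap ∈ U) (u v : EM) :
    ContDiffAt ℝ ∞ (fun y => warpedForm EM pr hmap gB gF f γ ((extChartAt 𝓘(ℝ, EM) z).symm y)
      (paramDeriv EM (extChartAt 𝓘(ℝ, EM) z).symm y u)
      (paramDeriv EM (extChartAt 𝓘(ℝ, EM) z).symm y v)) (extChartAt 𝓘(ℝ, EM) z z) := by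
  set χ := extChartAt 𝓘(ℝ, EM) z
  set W := χ.target ∩ χ.symm ⁻¹' (AssociatedBundle.proj pr hmap ⁻¹' U)
  have hχ := contMDiffOn_extChartAt_symm (I := 𝓘(ℝ, EM)) (n := ∞) z
  have hW : IsOpen W := hχ.continuousOn.isOpen_inter_preimage (isOpen_extChartAt_target z)
    (h.isOpen_preimage hc)
  have hzW : χ z ∈ W := ⟨mem_extChartAt_target z, by
    rw [mem_preimage, extChartAt_to_inv]; exact hz⟩
  have hp : ContMDiffOn 𝓘(ℝ, EM) 𝓘(ℝ, EB) ∞ (AssociatedBundle.proj (F := F) pr hmap ∘ χ.symm) W :=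
    h.contMDiffOn_proj.comp (hχ.mono inter_subset_left) fun y hy => hy.2
  have hq : ContMDiffOn 𝓘(ℝ, EM) 𝓘(ℝ, EF) ∞
      (AssociatedBundle.fiberCoord (F := F) γ ∘ χ.symm) W :=
    h.contMDiffOn_fiberCoord.comp (hχ.mono inter_subset_left) fun y hy => hy.2
  have h1 := contDiffOn_pull_apply gB hW hp u v
  have h2 := contDiffOn_pull_apply gF hW hq u v
  have h3 : ContDiffOn ℝ ∞ (f ∘ AssociatedBundle.proj pr hmap ∘ χ.symm) W := by
    rw [← contMDiffOn_iff_contDiffOn]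
    exact hf.comp_contMDiffOn hp
  refine ((h1.add ((h3.pow 2).mul h2)).contDiffAt (hW.mem_nhds hzW)).congr_of_eventuallyEq ?_
  filter_upwards [hW.mem_nhds hzW] with y hy
  have dχ := (isParam_extChartAt_symm z).mdifferentiableAt hy.1
  have e1 : ∀ u, paramDeriv EB (AssociatedBundle.proj (F := F) pr hmap ∘ χ.symm) y u
      = modelDeriv EM EB (AssociatedBundle.proj pr hmap) (χ.symm y)
        (paramDeriv EM χ.symm y u) := fun u =>
    modelDeriv_comp (h.mdifferentiableAt_proj hc hy.2) dχ u
  have e2 : ∀ u, paramDeriv EF (AssociatedBundle.fiberCoord (F := F) γ ∘ χ.symm) y u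
      = modelDeriv EM EF (AssociatedBundle.fiberCoord γ) (χ.symm y)
        (paramDeriv EM χ.symm y u) := fun u =>
    modelDeriv_comp (h.mdifferentiableAt_fiberCoord hc hy.2) dχ u
  rw [warpedForm_apply]
  simp only [SmoothMetric.pull_apply, e1, e2]
  rfl

/-- The warped metric of a flat bundle with discrete structure group. -/
theorem exists_warpedMetric [FiniteDimensional ℝ EM] (EG : Type*) [NormedAddCommGroup EG]
    [NormedSpace ℝ EG] [ChartedSpace EG G] [ContMDiffSMul 𝓘(ℝ, EG) 𝓘(ℝ, EF) ∞ G F]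
    (hiso : ActsIsometrically G gF) (hc : Continuous pr)
    (hf : ContMDiff 𝓘(ℝ, EB) 𝓘(ℝ, ℝ) ∞ f) (hpos : ∀ b, 0 < f b)
    {U : B → Set B} {s : B → B → P} {γ : B → P → G}
    (h : ∀ b, IsSmoothLocalTriv EB EF EP EM (F := F) pr hmap (U b) (s b) (γ b))
    (hU : ∀ b, b ∈ U b) :
    ∃ g : SmoothMetric EM (AssociatedBundle G P F), ∀ b, ∀ z : AssociatedBundle G P F,
      z.proj pr hmap ∈ U b → g.form z = warpedForm EM pr hmap gB gF f (γ b) z := by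
  -- At each point the trivialization attached to its own base point is used. Independence of the
  -- choice allows a fixed trivialization nearby, which smoothness requires.
  let Q : AssociatedBundle G P F → EM →L[ℝ] EM →L[ℝ] ℝ := fun z =>
    warpedForm EM pr hmap gB gF f (γ (z.proj pr hmap)) z
  have hQ : ∀ b, ∀ z : AssociatedBundle G P F, z.proj pr hmap ∈ U b →
      Q z = warpedForm EM pr hmap gB gF f (γ b) z := fun b z hz =>
    (h b).warpedForm_eq EG hiso (h (z.proj pr hmap)) hc hz (hU _)
  suffices ∃ g : SmoothMetric EM (AssociatedBundle G P F), ∀ z, g.form z = Q z by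
    obtain ⟨g, hg⟩ := this
    exact ⟨g, fun b z hz => (hg z).trans (hQ b z hz)⟩
  refine exists_smoothMetric Q ?_ ?_ ?_
  · intro z v w
    simp only [Q, warpedForm_apply]
    exact congrArg₂ _ (gB.symm _ _ _) (congrArg _ (gF.symm _ _ _))
  · intro z v hv
    simp only [Q, warpedForm_apply]
    have hf2 := pow_pos (hpos (z.proj pr hmap)) 2
    have h1 := gB.form_self_nonneg (z.proj pr hmap)
      (modelDeriv EM EB (AssociatedBundle.proj pr hmap) z v)
    have h2 := gF.form_self_nonneg (AssociatedBundle.fiberCoord (γ (z.proj pr hmap)) z)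
      (modelDeriv EM EF (AssociatedBundle.fiberCoord (γ (z.proj pr hmap))) z v)
    by_cases h0 : modelDeriv EM EB (AssociatedBundle.proj pr hmap) z v = 0
    · have h3 : modelDeriv EM EF (AssociatedBundle.fiberCoord (γ (z.proj pr hmap))) z v ≠ 0 :=
        fun h4 => hv ((h (z.proj pr hmap)).eq_zero hc (hU _) h0 h4)
      exact add_pos_of_nonneg_of_pos h1 (mul_pos hf2 (gF.pos _ _ h3))
    · exact add_pos_of_pos_of_nonneg (gB.pos _ _ h0) (mul_nonneg hf2.le h2)
  · intro z u v
    refine ((h (z.proj pr hmap)).contDiffAt_warpedForm (gB := gB) (gF := gF) hc hf (hU _) u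
      v).congr_of_eventuallyEq ?_
    have hcs := continuousAt_extChartAt_symm (I := 𝓘(ℝ, EM)) z
    rw [ContinuousAt, extChartAt_to_inv] at hcs
    filter_upwards [hcs.eventually
      (((h (z.proj pr hmap)).isOpen_preimage hc).mem_nhds (hU _))] with y hy
    rw [hQ _ _ hy]

omit [DiscreteTopology G] in
theorem modelDeriv_comp_apply_add {E₁ E₂ E₃ M₁ M₂ M₃ : Type*} [NormedAddCommGroup E₁]
    [NormedSpace ℝ E₁] [NormedAddCommGroup E₂] [NormedSpace ℝ E₂] [NormedAddCommGroup E₃]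
    [NormedSpace ℝ E₃] [TopologicalSpace M₁] [ChartedSpace E₁ M₁] [TopologicalSpace M₂]
    [ChartedSpace E₂ M₂] [TopologicalSpace M₃] [ChartedSpace E₃ M₃] {E₄ M₄ : Type*}
    [NormedAddCommGroup E₄] [NormedSpace ℝ E₄] [TopologicalSpace M₄] [ChartedSpace E₄ M₄]
    {k : M₃ → M₄} {i : M₁ → M₃} {j : M₂ → M₃} {x : M₁} {y : M₂} (hxy : i x = j y)
    (hk : MDifferentiableAt 𝓘(ℝ, E₃) 𝓘(ℝ, E₄) k (i x))
    (hi : MDifferentiableAt 𝓘(ℝ, E₁) 𝓘(ℝ, E₃) i x) (hj : MDifferentiableAt 𝓘(ℝ, E₂) 𝓘(ℝ, E₃) j y)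
    (u : E₁) (v : E₂) :
    modelDeriv E₃ E₄ k (i x) (modelDeriv E₁ E₃ i x u + modelDeriv E₂ E₃ j y v)
      = modelDeriv E₁ E₄ (k ∘ i) x u + modelDeriv E₂ E₄ (k ∘ j) y v := by
  rw [map_add, modelDeriv_comp hk hi, modelDeriv_comp (hxy ▸ hk) hj, hxy]

/-- The derivative of the projection kills fiber directions. That of the fiber coordinate kills
directions of `P`, because `γ` is locally constant, and on fiber directions it is the isometry `(γ
p)⁻¹`. -/
theorem isWarpedBundleMetric_of_form_eq (EG : Type*) [NormedAddCommGroup EG] [NormedSpace ℝ EG]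
    [ChartedSpace EG G] [ContMDiffSMul 𝓘(ℝ, EG) 𝓘(ℝ, EF) ∞ G F]
    (hiso : ActsIsometrically G gF) (hpr : ContMDiff 𝓘(ℝ, EP) 𝓘(ℝ, EB) ∞ pr)
    (hq : ContMDiff (𝓘(ℝ, EP).prod 𝓘(ℝ, EF)) 𝓘(ℝ, EM) ∞
      (fun z : P × F => AssociatedBundle.mk G z.1 z.2))
    {g : SmoothMetric EM (AssociatedBundle G P F)}
    {U : B → Set B} {s : B → B → P} {γ : B → P → G}
    (h : ∀ b, IsSmoothLocalTriv EB EF EP EM (F := F) pr hmap (U b) (s b) (γ b))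
    (hU : ∀ b, b ∈ U b)
    (hg : ∀ b, ∀ z : AssociatedBundle G P F,
      z.proj pr hmap ∈ U b → g.form z = warpedForm EM pr hmap gB gF f (γ b) z)
    (H : ∀ p : P, Submodule ℝ (TangentSpace 𝓘(ℝ, EP) p)) :
    IsWarpedBundleMetric pr H gB gF f g := by
  intro p x u _ v _ ξ η
  have h := h (pr p)
  have hp := hU (pr p)
  set γ := γ (pr p)
  set z : AssociatedBundle G P F := .mk G p x
  have hz : z.proj pr hmap = pr p := rfl
  have dl := (contMDiff_mk_left hq x).mdifferentiableAt (x := p) (by simp)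
  have dr := (contMDiff_mk_right hq p).mdifferentiableAt (x := x) (by simp)
  let mv : EP → EF → EM := fun u ξ =>
    modelDeriv EP EM (fun p' => AssociatedBundle.mk G p' x) p u
      + modelDeriv EF EM (fun x' => AssociatedBundle.mk G p x') x ξ
  have eπ : ∀ u ξ, modelDeriv EM EB (AssociatedBundle.proj pr hmap) z (mv u ξ)
      = modelDeriv EP EB pr p u := by
    intro u ξ
    have h1 := modelDeriv_comp_apply_add (E₄ := EB) (k := AssociatedBundle.proj (F := F) pr hmap)
      (i := fun p' => AssociatedBundle.mk G p' x) (j := fun x' => AssociatedBundle.mk G p x')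
      (x := p) (y := x) rfl (h.mdifferentiableAt_proj hpr.continuous hp) dl dr u ξ
    have h2 : modelDeriv EF EB (AssociatedBundle.proj (F := F) pr hmap
        ∘ fun x' => AssociatedBundle.mk G p x') x = 0 := modelDeriv_const (pr p) x
    rw [h2, zero_apply, add_zero] at h1
    exact h1
  have eρ : ∀ u ξ, modelDeriv EM EF (AssociatedBundle.fiberCoord γ) z (mv u ξ)
      = modelDeriv EF EF (fun x : F => (γ p)⁻¹ • x) x ξ := by
    intro u ξ
    have h1 := modelDeriv_comp_apply_add (E₄ := EF) (k := AssociatedBundle.fiberCoord (F := F) γ)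
      (i := fun p' => AssociatedBundle.mk G p' x) (j := fun x' => AssociatedBundle.mk G p x')
      (x := p) (y := x) rfl (h.mdifferentiableAt_fiberCoord hpr.continuous hp) dl dr u ξ
    have h2 : AssociatedBundle.fiberCoord (F := F) γ ∘ (fun p' => AssociatedBundle.mk G p' x)
        =ᶠ[𝓝 p] fun _ => (γ p)⁻¹ • x := by
      filter_upwards [h.eventually_eq hpr.continuous hp,
        (h.isOpen.preimage hpr.continuous).mem_nhds hp] with p' h3 h4
      rw [Function.comp_apply, h.fiberCoord_mk h4, h3]
    have h5 : AssociatedBundle.fiberCoord (F := F) γ ∘ (fun x' => AssociatedBundle.mk G p x')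
        = fun x => (γ p)⁻¹ • x := funext fun x' => h.fiberCoord_mk hp x'
    rw [modelDeriv_congr h2, modelDeriv_const, zero_apply, zero_add, h5] at h1
    exact h1
  have hgz : g.form z = warpedForm EM pr hmap gB gF f γ z := hg (pr p) z hp
  have key : ∀ (u v : EP) (ξ η : EF), g.form z (mv u ξ) (mv v η) = gB.form (pr p) (modelDeriv EP EB pr p u)
      (modelDeriv EP EB pr p v) + f (pr p) ^ 2 * gF.form x ξ η := by
    intro u v ξ η
    rw [hgz, warpedForm_apply, eπ, eπ, eρ, eρ, hz, h.fiberCoord_mk hp, hiso.form_modelDeriv]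
  exact key u v ξ η

end Metric

end Sufficient

/-! ### Lipschitz maps and lengths -/

section LengthComparison

open MeasureTheory

variable {E : Type*} [NormedAddCommGroup E] [NormedSpace ℝ E]
  {M : Type*} [TopologicalSpace M] [ChartedSpace E M] [IsManifold 𝓘(ℝ, E) ∞ M]
  {E' : Type*} [NormedAddCommGroup E'] [NormedSpace ℝ E']
  {M' : Type*} [TopologicalSpace M'] [ChartedSpace E' M'] [IsManifold 𝓘(ℝ, E') ∞ M']

namespace SmoothMetric

/-- A map expanding tangent vectors along a curve by at most the factor `C` increases the length
of the curve by at most the factor `C`. -/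
theorem length_comp_le (g : SmoothMetric E M) (g' : SmoothMetric E' M') {k : M → M'} {γ : ℝ → M}
    {a b C : ℝ} (hC : 0 ≤ C) (hk : ∀ t ∈ Icc a b, MDifferentiableAt 𝓘(ℝ, E) 𝓘(ℝ, E') k (γ t))
    (hγ : ∀ t ∈ Icc a b, MDifferentiableAt 𝓘(ℝ, ℝ) 𝓘(ℝ, E) γ t)
    (h : ∀ t ∈ Icc a b, ∀ v, g'.form (k (γ t)) (modelDeriv E E' k (γ t) v)
      (modelDeriv E E' k (γ t) v) ≤ C ^ 2 * g.form (γ t) v v) :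
    g'.length (k ∘ γ) a b ≤ ENNReal.ofReal C * g.length γ a b := by
  rw [length, length, ← lintegral_const_mul' _ _ ENNReal.ofReal_ne_top]
  refine setLIntegral_mono' measurableSet_Icc fun t ht => ?_
  rw [← ENNReal.ofReal_mul hC]
  refine ENNReal.ofReal_le_ofReal ?_
  rw [speed, speed, modelDeriv_comp (hk t ht) (hγ t ht), ← Real.sqrt_sq hC,
    ← Real.sqrt_mul (sq_nonneg C)]
  exact Real.sqrt_le_sqrt (h t ht _)

theorem edist_comp_le (g : SmoothMetric E M) (g' : SmoothMetric E' M') {k : M → M'} {γ : ℝ → M}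
    {a b C : ℝ} (hC : 0 ≤ C) (hab : a ≤ b)
    (hk : ∀ t ∈ Icc a b, ContMDiffAt 𝓘(ℝ, E) 𝓘(ℝ, E') ∞ k (γ t))
    (hγ : ContMDiff 𝓘(ℝ, ℝ) 𝓘(ℝ, E) 1 γ)
    (h : ∀ t ∈ Icc a b, ∀ v, g'.form (k (γ t)) (modelDeriv E E' k (γ t) v)
      (modelDeriv E E' k (γ t) v) ≤ C ^ 2 * g.form (γ t) v v) :
    g'.edist (k (γ a)) (k (γ b)) ≤ ENNReal.ofReal C * g.length γ a b := by
  have h1 : ContMDiffOn 𝓘(ℝ, ℝ) 𝓘(ℝ, E') 1 (k ∘ γ) (Icc a b) := fun t ht =>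
    (ContMDiffAt.comp t ((hk t ht).of_le (by simp)) hγ.contMDiffAt).contMDiffWithinAt
  exact (g'.edist_le_length hab h1).trans (g.length_comp_le g' hC
    (fun t ht => (hk t ht).mdifferentiableAt (by simp))
    (fun t _ => hγ.mdifferentiable (by simp) t) h)

end SmoothMetric

end LengthComparison

/-! ### Completeness of the warped metric -/

section Complete

variable {EB EF EP EM : Type*} [NormedAddCommGroup EB] [NormedSpace ℝ EB]
  [NormedAddCommGroup EF] [NormedSpace ℝ EF]
  [NormedAddCommGroup EP] [NormedSpace ℝ EP] [NormedAddCommGroup EM] [NormedSpace ℝ EM]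
  {B : Type*} [TopologicalSpace B] [ChartedSpace EB B] [IsManifold 𝓘(ℝ, EB) ∞ B]
  {F : Type*} [TopologicalSpace F] [ChartedSpace EF F] [IsManifold 𝓘(ℝ, EF) ∞ F]
  {G : Type*} [TopologicalSpace G] [Group G]
  {P : Type*} [TopologicalSpace P] [ChartedSpace EP P] [MulAction G P] [MulAction G F]
  [ChartedSpace EM (AssociatedBundle G P F)] [IsManifold 𝓘(ℝ, EM) ∞ (AssociatedBundle G P F)]
  {pr : P → B} {hmap : ∀ (a : G) (p : P), pr (a • p) = pr p}
  {gB : SmoothMetric EB B} {gF : SmoothMetric EF F} {f : B → ℝ}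
  {g : SmoothMetric EM (AssociatedBundle G P F)}

theorem form_proj_le_warpedForm (γ : P → G) (z : AssociatedBundle G P F) (v : EM) :
    gB.form (z.proj pr hmap) (modelDeriv EM EB (AssociatedBundle.proj pr hmap) z v)
      (modelDeriv EM EB (AssociatedBundle.proj pr hmap) z v)
    ≤ warpedForm EM pr hmap gB gF f γ z v v := by
  rw [warpedForm_apply]
  exact le_add_of_nonneg_right (mul_nonneg (sq_nonneg _) (gF.form_self_nonneg _ _))

theorem form_fiberCoord_le_warpedForm (γ : P → G) (z : AssociatedBundle G P F) (v : EM) :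
    f (z.proj pr hmap) ^ 2 * gF.form (AssociatedBundle.fiberCoord γ z)
      (modelDeriv EM EF (AssociatedBundle.fiberCoord γ) z v)
      (modelDeriv EM EF (AssociatedBundle.fiberCoord γ) z v)
    ≤ warpedForm EM pr hmap gB gF f γ z v v := by
  rw [warpedForm_apply]
  exact le_add_of_nonneg_left (gB.form_self_nonneg _ _)

/-- The warped metric is complete if the metrics of the base and of the fiber are. -/
theorem isComplete_of_form_eq_warpedForm [FiniteDimensional ℝ EB] [T2Space B]
    (hc : Continuous pr) (hf : Continuous f) (hpos : ∀ b, 0 < f b)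
    {U : B → Set B} {s : B → B → P} {γ : B → P → G}
    (h : ∀ b, IsSmoothLocalTriv EB EF EP EM (F := F) pr hmap (U b) (s b) (γ b))
    (hU : ∀ b, b ∈ U b)
    (hg : ∀ b, ∀ z : AssociatedBundle G P F,
      z.proj pr hmap ∈ U b → g.form z = warpedForm EM pr hmap gB gF f (γ b) z)
    (hB : gB.IsComplete) (hF : gF.IsComplete) : g.IsComplete := by
  intro u hu
  set q := AssociatedBundle.proj (F := F) pr hmap
  have hqs : ∀ z, ContMDiffAt 𝓘(ℝ, EM) 𝓘(ℝ, EB) ∞ q z := fun z =>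
    (h (q z)).contMDiffOn_proj.contMDiffAt (((h (q z)).isOpen_preimage hc).mem_nhds (hU (q z)))
  -- The projection does not increase lengths, since the vertical part of the warped form is
  -- nonnegative.
  have hlen : ∀ {σ : ℝ → AssociatedBundle G P F} {t : ℝ}, ContMDiff 𝓘(ℝ, ℝ) 𝓘(ℝ, EM) 1 σ →
      0 ≤ t → gB.edist (q (σ 0)) (q (σ t)) ≤ g.length σ 0 t := by
    intro σ t hσ ht
    have := g.edist_comp_le gB (k := q) zero_le_one ht (fun t _ => hqs (σ t)) hσ fun t _ v => by
      rw [one_pow, one_mul, hg (q (σ t)) (σ t) (hU _)]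
      exact form_proj_le_warpedForm _ _ _
    simpa using this
  obtain ⟨b, hb⟩ := hB (fun n => q (u n)) fun ε hε => by
    obtain ⟨N, hN⟩ := hu ε hε
    refine ⟨N, fun m hm n hn => ?_⟩
    obtain ⟨σ, h0, h1, hσ, hl⟩ := g.exists_length_lt (hN m hm n hn)
    rw [← h0, ← h1]
    exact (hlen hσ zero_le_one).trans_lt hl
  -- Over this neighborhood the fiber coordinate is defined and expands lengths by at most `2 / f
  -- b`.
  have hW : U b ∩ {b' | f b / 2 < f b'} ∈ 𝓝 b :=
    inter_mem ((h b).isOpen.mem_nhds (hU b))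
      (hf.continuousAt.eventually (lt_mem_nhds (half_lt_self (hpos b))))
  obtain ⟨c, hc0, hcW⟩ := gB.exists_edist_lt_subset hW
  have hc2 : 0 < c / 2 := ENNReal.half_pos hc0.ne'
  set K := ENNReal.ofReal (2 / f b) with hK
  have hK0 : K ≠ 0 := by
    rw [hK, Ne, ENNReal.ofReal_eq_zero, not_le]
    exact div_pos two_pos (hpos b)
  have hKt : K ≠ ⊤ := ENNReal.ofReal_ne_top
  obtain ⟨N₀, hN₀⟩ := eventually_atTop.1 (hb.eventually (gB.eventually_edist_lt b hc2))
  obtain ⟨x, hx⟩ := hF (fun n => AssociatedBundle.fiberCoord (γ b) (u n)) fun ε hε => by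
    -- The bound `c / 2` keeps the connecting curves over the neighborhood of `b`; the bound `ε / K`
    -- compensates for the expansion by the fiber coordinate.
    obtain ⟨N, hN⟩ := hu (min (ε / K) (c / 2)) (lt_min (ENNReal.div_pos hε.ne' hKt) hc2)
    refine ⟨max N N₀, fun m hm n hn => ?_⟩
    obtain ⟨σ, h0, h1, hσ, hl⟩ := g.exists_length_lt
      (hN m ((le_max_left _ _).trans hm) n ((le_max_left _ _).trans hn))
    -- The projected curve starts within `c / 2` of `b` and has length less than `c / 2`.
    have hmem : ∀ t ∈ Icc (0 : ℝ) 1, q (σ t) ∈ U b ∩ {b' | f b / 2 < f b'} := by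
      intro t ht
      refine hcW _ ?_
      have e1 : gB.edist b (q (σ 0)) < c / 2 := by
        rw [h0]; exact hN₀ m ((le_max_right _ _).trans hm)
      have e2 : gB.edist (q (σ 0)) (q (σ t)) < c / 2 :=
        ((hlen hσ ht.1).trans (g.length_mono σ le_rfl ht.2)).trans_lt
          (hl.trans_le (min_le_right _ _))
      calc gB.edist b (q (σ t)) ≤ gB.edist b (q (σ 0)) + gB.edist (q (σ 0)) (q (σ t)) :=
            gB.edist_triangle _ _ _
        _ < c / 2 + c / 2 := ENNReal.add_lt_add e1 e2
        _ = c := ENNReal.add_halves c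
    have key := g.edist_comp_le gF (k := AssociatedBundle.fiberCoord (γ b)) (C := 2 / f b)
      (div_pos two_pos (hpos b)).le zero_le_one
      (fun t ht => (h b).contMDiffOn_fiberCoord.contMDiffAt
        (((h b).isOpen_preimage hc).mem_nhds (hmem t ht).1)) hσ fun t ht v => by
      have e1 := form_fiberCoord_le_warpedForm (pr := pr) (hmap := hmap) (gB := gB) (gF := gF)
        (f := f) (γ b) (σ t) v
      rw [← hg b (σ t) (hmem t ht).1] at e1
      have e2 : f b / 2 < f (q (σ t)) := (hmem t ht).2
      have e3 := gF.form_self_nonneg (AssociatedBundle.fiberCoord (γ b) (σ t))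
        (modelDeriv EM EF (AssociatedBundle.fiberCoord (γ b)) (σ t) v)
      have hfb := hpos b
      have e4 : (f b / 2) ^ 2 ≤ f (q (σ t)) ^ 2 := by gcongr
      have e5 := (mul_le_mul_of_nonneg_right e4 e3).trans e1
      calc _ = (2 / f b) ^ 2 * ((f b / 2) ^ 2 * gF.form (AssociatedBundle.fiberCoord (γ b) (σ t))
            (modelDeriv EM EF (AssociatedBundle.fiberCoord (γ b)) (σ t) v)
            (modelDeriv EM EF (AssociatedBundle.fiberCoord (γ b)) (σ t) v)) := by
            field_simp
        _ ≤ _ := mul_le_mul_of_nonneg_left e5 (sq_nonneg _)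
    rw [h0, h1] at key
    refine key.trans_lt ?_
    calc K * g.length σ 0 1 < K * (ε / K) :=
          (ENNReal.mul_lt_mul_iff_right hK0 hKt).2 (hl.trans_le (min_le_left _ _))
      _ = ε := ENNReal.mul_div_cancel hK0 hKt
  refine ⟨AssociatedBundle.mk G (s b b) x, ?_⟩
  have hmk : ContinuousAt (fun y : B × F => AssociatedBundle.mk G (s b y.1) y.2) (b, x) :=
    (h b).contMDiffOn_mk.continuousOn.continuousAt
      (((h b).isOpen.prod isOpen_univ).mem_nhds ⟨hU b, trivial⟩)
  -- Base and fiber coordinates converge, and eventually the sequence is recovered from them through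
  -- the trivialization over `U b`.
  refine (hmk.tendsto.comp (hb.prodMk_nhds hx)).congr' ?_
  filter_upwards [hb.eventually ((h b).isOpen.mem_nhds (hU b))] with n hn
  exact (h b).mk_fiberCoord hn

end Complete

end

theorem theorem1
    {EB EF EG EP : Type*}
    [NormedAddCommGroup EB] [NormedSpace ℝ EB] [FiniteDimensional ℝ EB]
    [NormedAddCommGroup EF] [NormedSpace ℝ EF] [FiniteDimensional ℝ EF]
    [NormedAddCommGroup EG] [NormedSpace ℝ EG] [FiniteDimensional ℝ EG]
    [NormedAddCommGroup EP] [NormedSpace ℝ EP] [FiniteDimensional ℝ EP]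
    -- the base and the fiber
    {B : Type*} [TopologicalSpace B] [T2Space B] [SecondCountableTopology B] [ConnectedSpace B]
    [ChartedSpace EB B] [IsManifold 𝓘(ℝ, EB) ∞ B]
    {F : Type*} [TopologicalSpace F] [T2Space F] [SecondCountableTopology F] [ConnectedSpace F]
    [ChartedSpace EF F] [IsManifold 𝓘(ℝ, EF) ∞ F]
    (gB : SmoothMetric EB B) (gF : SmoothMetric EF F)
    (hm : 0 < Module.finrank ℝ EF)
    -- the principal bundle `G → P → B`
    {G : Type*} [TopologicalSpace G] [T2Space G] [Group G]
    [ChartedSpace EG G] [LieGroup 𝓘(ℝ, EG) ∞ G]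
    {P : Type*} [TopologicalSpace P] [T2Space P] [ChartedSpace EP P] [IsManifold 𝓘(ℝ, EP) ∞ P]
    [MulAction G P] [ContMDiffSMul 𝓘(ℝ, EG) 𝓘(ℝ, EP) ∞ G P]
    (pr : P → B) (hpr : IsPrincipalBundle EB EG EP G pr)
    -- the isometric action of the structure group on the fiber
    [MulAction G F] [ContMDiffSMul 𝓘(ℝ, EG) 𝓘(ℝ, EF) ∞ G F]
    (hiso : ActsIsometrically G gF) :
    -- necessary conditions
    (∀ {EM : Type*} [NormedAddCommGroup EM] [NormedSpace ℝ EM] [FiniteDimensional ℝ EM]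
        [T2Space (AssociatedBundle G P F)] [SecondCountableTopology (AssociatedBundle G P F)]
        [ChartedSpace EM (AssociatedBundle G P F)]
        [IsManifold 𝓘(ℝ, EM) ∞ (AssociatedBundle G P F)]
        (H : ∀ p : P, Submodule ℝ (TangentSpace 𝓘(ℝ, EP) p))
        (f : B → ℝ) (g : SmoothMetric EM (AssociatedBundle G P F))
        (ψ : AssociatedBundle G P F → ℝ) (lam : ℝ),
      IsSolitonWarpedFlatBundle pr H gB gF f g ψ lam → g.IsComplete →
      (∃ b b' : B, f b ≠ f b') →
      ∃ φ : B → ℝ, ContMDiff 𝓘(ℝ, EB) 𝓘(ℝ, ℝ) ∞ φ ∧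
        ψ = φ ∘ AssociatedBundle.proj pr hpr.map_smul ∧
        gB.BaseTensorEq f φ lam (Module.finrank ℝ EF) ∧
        (∃ c : ℝ, gB.BaseScalarEq f φ lam (Module.finrank ℝ EF) c) ∧
        ∃ μ : ℝ, gB.FiberConstantEq f φ lam (Module.finrank ℝ EF) μ ∧ gF.IsEinstein μ) ∧
    -- sufficient conditions, for `P` the universal covering and `G` the fundamental group of `B`
    (∀ [DiscreteTopology G] [SimplyConnectedSpace P] (b₀ : B) (_ : G ≃* FundamentalGroup B b₀)
        (f φ : B → ℝ) (lam c μ : ℝ),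
      ContMDiff 𝓘(ℝ, EB) 𝓘(ℝ, ℝ) ∞ f → (∀ b, 0 < f b) → ContMDiff 𝓘(ℝ, EB) 𝓘(ℝ, ℝ) ∞ φ →
      gB.BaseTensorEq f φ lam (Module.finrank ℝ EF) →
      gB.BaseScalarEq f φ lam (Module.finrank ℝ EF) c →
      gB.FiberConstantEq f φ lam (Module.finrank ℝ EF) μ →
      gF.IsEinstein μ →
      T2Space (AssociatedBundle G P F) ∧ SecondCountableTopology (AssociatedBundle G P F) ∧
      ∃ (_ : ChartedSpace (EB × EF) (AssociatedBundle G P F))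
        (_ : IsManifold 𝓘(ℝ, EB × EF) ∞ (AssociatedBundle G P F))
        (g : SmoothMetric (EB × EF) (AssociatedBundle G P F)),
        IsSolitonWarpedFlatBundle (EP := EP) pr (fun _ => ⊤) gB gF f g
          (φ ∘ AssociatedBundle.proj pr hpr.map_smul) lam ∧
        (gB.IsComplete → gF.IsComplete → g.IsComplete)) := by
  refine ⟨fun H f g ψ lam h hg hf => h.exists_base_potential hm hpr hg hf, ?_⟩
  intro _ _ b₀ _ f φ lam c μ hf hpos hφ h1 _ h3 hF
  refine ⟨hpr.t2Space_associatedBundle EF, hpr.secondCountableTopology_associatedBundle EF, ?_⟩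
  -- One family of local trivializations serves for the smooth structure, the metric and the
  -- completeness argument, so that these refer to the same charts.
  choose U s γ h hU using hpr.exists_isLocalTriv
  obtain ⟨C, I, h'⟩ := exists_isManifold_associatedBundle (EF := EF) (F := F) hpr h hU
  obtain ⟨g, hg⟩ := exists_warpedMetric EG (gB := gB) hiso hpr.contMDiff.continuous hf hpos h' hU
  have hq := isQuotientSmoothStructure_of_isSmoothLocalTriv EG hpr.contMDiff h' hU
  have hw := isWarpedBundleMetric_of_form_eq EG hiso hpr.contMDiff hq.1 h' hU hg fun _ => ⊤
  have hM : IsWarpedFlatBundle EG pr (fun _ => ⊤) gB gF f g :=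
    ⟨hpr, hpr.isFlatConnection_top, hq, hf, hpos, hw⟩
  have hψ : ContMDiff 𝓘(ℝ, EB × EF) 𝓘(ℝ, ℝ) ∞
      (φ ∘ AssociatedBundle.proj (F := F) pr hpr.map_smul) := fun z =>
    hφ.contMDiffAt.comp z ((h' _).contMDiffOn_proj.contMDiffAt
      (((h' _).isOpen_preimage hpr.contMDiff.continuous).mem_nhds (hU (z.proj pr hpr.map_smul))))
  exact ⟨C, I, g, ⟨hM.flat, hq, hf, hpos, hw, hM.isGradientRicciSoliton hφ hψ h1 h3 hF⟩,
    isComplete_of_form_eq_warpedForm hpr.contMDiff.continuous hf.continuous hpos h' hU hg⟩
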